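/- **Setting.** Fix $q=e^{\hbar}$ with $\mathrm{Re}\,\hbar<0$ and put $q^x=e^{x\hbar}$, $[x]=(q^x-q^{-x})/(q-q^{-1})$. Let $k,r\in\mathbb R$ with $r>0$, $r^*=r-k>0$, $k\neq 0,-2$, and let $l\ge 0$ be an integer. Put $p=q^{2r}$, $p^*=q^{2r^*}$, $(z;t)_\infty=\prod_{n\ge0}(1-zt^n)$, $\Theta_t(z)=(z;t)_\infty(t/z;t)_\infty(t;t)_\infty$, $$\theta_\nu(u)=q^{u^2/\nu-u}\,\Theta_{q^{2\nu}}(q^{2u})/(q^{2\nu};q^{2\nu})_\infty^3,\qquad \theta=\theta_r,\quad \theta^*=\theta_{r^*},$$ and write $z=q^{2u}$, $w=q^{2v}$, $\ln z=2u\hbar$. Free bosons: for $n\neq 0$, $[a_n,a_m]=\frac{[(k+2)n][2n]}{n}\delta_{n+m,0}$, $[b_n,b_m]=-\frac{[n]^2}{n}\delta_{n+m,0}$, $[c_n,c_m]=\frac{[n]^2}{n}\delta_{n+m,0}$, with zero modes $[p_a,q_a]=2(k+2)$, $[p_b,q_b]=-1$, $[p_c,q_c]=1$, $[\hat q,\hat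 p]=1$, all other commutators vanishing. They act on the direct sum of the Fock spaces generated by the negative modes over vacua labelled by the (arbitrary complex) eigenvalues of $p_a,p_b,p_c,\hat p$. All exponentials below are normal ordered (negative modes and $q$'s to the left of positive modes and $p$'s). For $x\in\{a,b,c\}$ let $x(z)=-\sum_{n\ne0}\frac{x_n}{[n]}z^{-n}+q_x+p_x\ln z$, $\;x_\pm(z)=\pm\big((q-q^{-1})\sum_{n>0}x_{\pm n}z^{\mp n}+p_x\hbar\big)$, $\;x^*_+(z)=-\sum_{n>0}\frac{x_n}{[rn]}z^{-n}$, $\;x_-^*(z)=\sum_{n>0}\frac{x_{-n}}{[r^*n]}z^n$, and, with $X=A,B,C$ for $x=a,b,c$, $$X_\pm(L_1,\dots;M_1,\dots|z;\alpha)=\sum_{n>0}\frac{\prod_i[L_in]}{\prod_j[M_jn]}\,x_{\pm n}(q^\alpha z)^{\mp n},\qquad X_\pm(\cdots|z)=X_\pm(\cdots|z;0),\qquad X_\pm(M|z;\alpha)=X_\pm(\,;M|z;\alpha).$$ Currents: put $U^+(z)=\exp[a_-^*(q^{r^*+k/2-1}z)+b_-^*(q^{r^*}z)+b_-^*(q^{r^*-2}z)]$,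 $U^-(z)=\exp[a_+^*(q^{-(r-k/2-1)}z)+b_+^*(q^{-(r-k-2)}z)+b_+^*(q^{-(r-k)}z)]$, $\psi_\pm(z)=\,:\!\exp[b_\pm(q^{\pm k/2}z)+a_\pm(q^{\pm1}z)+b_\pm(q^{\pm(k/2+2)}z)]\!:$, $e^+(z)=\frac{-1}{(q-q^{-1})z}:\!\{e^{b_+(z)-(b+c)(qz)}-e^{b_-(z)-(b+c)(q^{-1}z)}\}\!:$, $e^-(z)=\frac{-1}{(q-q^{-1})z}:\!\{e^{(b+c)(q^{-(k+1)}z)+a_-(q^{-(k+2)/2}z)+b_-(q^{-(k+2)}z)}-e^{(b+c)(q^{k+1}z)+a_+(q^{(k+2)/2}z)+b_+(q^{k+2}z)}\}\!:$, and $$H^\pm(u)=U^+(q^{\pm k/2}z)\psi_\pm(z)U^-(q^{\mp k/2}z)\,e^{2\hat q}(q^{\mp k/2}z)^{\frac{2p_b+p_a}{r}}(q^{\pm(r-k/2)}z)^{\frac{\hat p-1}{r}-\frac{\hat p-1}{r^*}},$$ $$E(u)=U^+(z)e^+(z)e^{2\hat q}z^{-\frac{\hat p-1}{r^*}},\qquad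 F(u)=e^-(z)U^-(z)z^{\frac{2p_b+p_a}{r}}z^{\frac{\hat p-1}{r}} .$$ Highest components: put $V^+(w)=\exp\{-A_+(l,r^*;2,k,r|w;\tfrac{k+2}2)-B_+(l,r^*;1,k,r|w;k+1)\}$, $V^-(w)=\exp\{A_-(-l,r;2,k,r^*|w;\tfrac{k-2}2)+B_-(-l,r;1,k,r^*|w;-1)\}$, and $$\begin{aligned}\Phi^t_{l,l}(v)=V^+(w)\exp\{&A_-(l;2,k+2|w;\tfrac{k+2}2)+A_-(k-l+1;1,k+2|w;-\tfrac{k+2}2)+B_-(k-l+1;1,1|w;-1)\\&-A_+(k-l,k+1;1,k,k+2|w;\tfrac{k+2}2)-B_+(k-l,k+1;1,1,k|w;1)+C_-(k-l;1,1|w)-C_+(k-l;1,1|w)\}\\ \times\exp\{&\tfrac{(k-l)q_a}{2(k+2)}+(k-l)(q_b+q_c)+r^*\hat q+(\tfrac{l-r}{r}p_c-\tfrac{l}{2r}\hat p)\ln w\},\end{aligned}$$ $$\begin{aligned}\Psi^{*t}_{l,l}(v)=V^-(w)\exp\{&A_-(-(k-l);k,k+2|w;-\tfrac{k+2}2)+B_-(-(k-l);1,k|w;-1)+A_+(l+2;2,k+2|w;\tfrac{k+2}2)+B_+(1|w;l+1)\}\\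 \times\exp\{&\tfrac{(k-l)q_a}{2(k+2)}-(l+r^*)\hat q+(-p_b+\tfrac{l}{2r^*}\hat p)\ln w\}.\end{aligned}$$ **Theorem 4.** (i) The following relations hold in the sense of analytic continuation: each matrix element of $X(u)Y(v)$ between basis states is a convergent sum over intermediate states for $|z|\gg|w|$, that of $Y(v)X(u)$ for $|z|\ll|w|$, both continue to meromorphic functions of $u\in\mathbb C$, and these satisfy $$H^\pm(u)\Phi^t_{l,l}(v)=\frac{\theta(u-v+\frac l2\mp\frac k4)}{\theta(u-v-\frac l2\mp\frac k4)}\Phi^t_{l,l}(v)H^\pm(u),\quad E(u)\Phi^t_{l,l}(v)=-\Phi^t_{l,l}(v)E(u),\quad F(u)\Phi^t_{l,l}(v)=-\frac{\theta(u-v+\frac l2)}{\theta(u-v-\frac l2)}\Phi^t_{l,l}(v)F(u),$$ $$H^\pm(u)\Psi^{*t}_{l,l}(v)=\frac{\theta^*(u-v-\frac l2\pm\frac k4)}{\theta^*(u-v+\frac l2\pm\frac k4)}\Psi^{*t}_{l,l}(v)H^\pm(u),\quad F(u)\Psi^{*t}_{l,l}(v)=-\Psi^{*t}_{l,l}(v)F(u),\quad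 E(u)\Psi^{*t}_{l,l}(v)=-\frac{\theta^*(u-v-\frac l2)}{\theta^*(u-v+\frac l2)}\Psi^{*t}_{l,l}(v)E(u).$$ (ii) Let $h=2p_b+p_a$ and define the half currents $$F^+(v)=\varrho\oint_{|pw|<|w'|<|w|}F(v')\frac{\theta(v-v'+\hat p+h-1)\theta(1)}{\theta(v-v')\theta(\hat p+h-1)}\frac{dw'}{2\pi iw'},\quad E^+(v)=\varrho^*\oint_{|p^*q^kw|<|w'|<|q^kw|}E(v')\frac{\theta^*(v-v'+\frac k2-\hat p+1)\theta^*(1)}{\theta^*(v-v'+\frac k2)\theta^*(\hat p-1)}\frac{dw'}{2\pi iw'},$$ where $w'=q^{2v'}$, the contours are circles, and $\varrho,\varrho^*$ are constants with $\varrho\varrho^*\theta^*(1)\lim_{y\to q^{-2}}\xi(y;p^*,q)/\xi(y;p,q)=q-q^{-1}$, where $\xi(z;t,q)=\frac{(q^2z;t,q^4)_\infty(tq^2z;t,q^4)_\infty}{(q^4z;t,q^4)_\infty(tz;t,q^4)_\infty}$ and $(z;t_1,t_2)_\infty=\prod_{m,n\ge0}(1-zt_1^mt_2^n)$. Consider the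 sectors on which $p_b+p_c$ is an integer and no $\theta(\hat p+h+n)$, $\theta^*(\hat p+n)$ $(n\in\mathbb Z)$ vanishes. If $\theta(n)\neq0$ for $1\le n\le l-1$, there are operators $\Phi^t_{l,m}(v)$, $0\le m\le l$, with $\Phi^t_{l,l}(v)$ as above and $$\Phi^t_{l,m-1}(v)=F^+(v-\tfrac l2)\frac{\theta(\hat p+h+l-m)}{\theta(\hat p+h)}\Phi^t_{l,m}(v)\qquad(1\le m\le l),$$ and they are unique on these sectors. If $\theta^*(n)\ne0$ for $1\le n\le l$, there are operators $\Psi^{*t}_{l,m}(v)$, $0\le m\le l$, with $\Psi^{*t}_{l,l}(v)$ as above and $$\Psi^{*t}_{l,m-1}(v)=\Psi^{*t}_{l,m}(v)E^+(v-\tfrac{l+k}2-r^*)\frac{\theta^*(m)\theta^*(\hat p-l+m-2)}{\theta^*(l-m+1)\theta^*(\hat p-2)}\qquad(1\le m\le l),$$ and they are unique on these sectors. The products with $F^+(v_1)$, $E^+(v_1)$ are convergent sums over intermediate states for $|q^{2v_1}|\gg|w|$, respectively $|q^{2v_1}|\ll|w|$; their values at $v_1=v-\frac l2$, respectively $v_1=v-\frac{l+k}2-r^*$,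 are those of the meromorphic continuation in $v_1$, which is regular there. -/

import Mathlib

open Filter Topology

noncomputable section

namespace EllipticVO

/-! ### Parameters and special functions -/

/-- The numerical parameters: a chosen logarithm `logq` of `q`, the level `k` and `r`. -/
structure Params where
  logq : ℂ
  k : ℝ
  r : ℝ

namespace Params

variable (P : Params)

/-- `r* = r - k` (the central element `c` acts as the level `k`). -/
def rs : ℝ := P.r - P.k

/-- Standing assumptions: `0 < |q| < 1`, `r > 0`, `r* > 0`, and the level `k` is generic, so
that no quantum integer `[kn]`, `[(k+2)n]` with `n ≥ 1` vanishes. -/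
structure Admissible : Prop where
  q_lt_one : P.logq.re < 0
  r_pos : 0 < P.r
  rs_pos : 0 < P.rs
  k_ne_zero : P.k ≠ 0
  k_ne_neg_two : P.k ≠ -2

/-- The power `q ^ x`. -/
def qpow (x : ℂ) : ℂ := Complex.exp (x * P.logq)

/-- The multiplicative spectral variable `z = q ^ (2u)`. -/
def z (u : ℂ) : ℂ := P.qpow (2 * u)

/-- `ln z` for `z = q ^ (2u)`. Multiplying `z` by `q ^ α` replaces `u` by `u + α / 2`. -/
def lnz (u : ℂ) : ℂ := 2 * u * P.logq

/-- The symbol `[x] = (q ^ x - q ^ (-x)) / (q - q ^ (-1))`. -/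
def br (x : ℂ) : ℂ := (P.qpow x - P.qpow (-x)) / (P.qpow 1 - P.qpow (-1))

/-- `(z; t)_∞`. -/
def poch (z t : ℂ) : ℂ := ∏' n : ℕ, (1 - z * t ^ n)

/-- `(z; t₁, t₂)_∞`. -/
def poch2 (z t₁ t₂ : ℂ) : ℂ := ∏' n : ℕ × ℕ, (1 - z * t₁ ^ n.1 * t₂ ^ n.2)

/-- `Θ_t(z) = (z; t)_∞ (t / z; t)_∞ (t; t)_∞`. -/
def bigTheta (t z : ℂ) : ℂ := poch z t * poch (t * z⁻¹) t * poch t t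

/-- `θ_ν(u) = q ^ (u² / ν - u) Θ_{q^{2ν}}(q ^ (2u)) / (q^{2ν}; q^{2ν})_∞³`. -/
def thetaNu (ν : ℝ) (u : ℂ) : ℂ :=
  P.qpow (u ^ 2 / ν - u) * bigTheta (P.qpow (2 * ν)) (P.qpow (2 * u)) /
    poch (P.qpow (2 * ν)) (P.qpow (2 * ν)) ^ 3

/-- `θ = θ_r`. -/
def theta (u : ℂ) : ℂ := P.thetaNu P.r u

/-- `θ* = θ_{r*}`. -/
def thetaS (u : ℂ) : ℂ := P.thetaNu P.rs u

/-- `ξ(z; t, q) = (q²z; t, q⁴)_∞ (tq²z; t, q⁴)_∞ / ((q⁴z; t, q⁴)_∞ (tz; t, q⁴)_∞)`. -/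
def xi (t z : ℂ) : ℂ :=
  poch2 (P.qpow 2 * z) t (P.qpow 4) * poch2 (t * P.qpow 2 * z) t (P.qpow 4) /
    (poch2 (P.qpow 4 * z) t (P.qpow 4) * poch2 (t * z) t (P.qpow 4))

end Params

/-! ### Bosons and Fock space -/

/-- The three free bosons. -/
inductive Boson where
  | a
  | b
  | c
  deriving DecidableEq

/-- The four pairs of zero modes `(q_a, p_a)`, `(q_b, p_b)`, `(q_c, p_c)`, `(q̂, p̂)`. -/
inductive ZeroMode where
  | a
  | b
  | c
  | hat
  deriving DecidableEq

/-- The zero mode belonging to a boson. -/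
def Boson.zero : Boson → ZeroMode
  | .a => .a
  | .b => .b
  | .c => .c

/-- `(x, n)` labels the oscillators `x_n` and `x_{-n}`, `n ≥ 1`. -/
abbrev Mode := Boson × ℕ+

/-- Eigenvalues of `p_a, p_b, p_c, p̂`; the sector `F_{l, m₁, m₂} ⊗ F_n` has the eigenvalues
`l, -m₁, m₂, -n`. -/
abbrev Charge := ZeroMode → ℂ

/-- Occupation numbers: `d` stands for the state `∏ x_{-n} ^ d (x, n)` over a highest weight
state. -/
abbrev Occ := Mode →₀ ℕ

/-- Basis states of the total Fock space. -/
abbrev State := Charge × Occ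

/-- Operators from the Fock space to its completion, given by their matrix elements:
`A s t` is the coefficient of the basis state `s` in the image of the basis state `t`. -/
abbrev Op := State → State → ℂ

namespace Params

variable (P : Params)

/-- The commutator `[x_n, x_{-n}]`, `n ≥ 1`. -/
def comm : Mode → ℂ
  | (.a, n) => P.br ((P.k + 2) * n) * P.br (2 * n) / n
  | (.b, n) => -(P.br n ^ 2 / n)
  | (.c, n) => P.br n ^ 2 / n

/-- The commutators `[p_x, q_x]`; for the last pair, `[q̂, p̂] = 1`. -/
def zcomm : ZeroMode → ℂ
  | .a => 2 * (P.k + 2)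
  | .b => -1
  | .c => 1
  | .hat => -1

/-- The oscillator `x_{-n}` on one sector, realized as a polynomial ring. -/
def creation (i : Mode) (f : MvPolynomial Mode ℂ) : MvPolynomial Mode ℂ :=
  MvPolynomial.X i * f

/-- The oscillator `x_n` on one sector. -/
def annihilation (i : Mode) (f : MvPolynomial Mode ℂ) : MvPolynomial Mode ℂ :=
  P.comm i • MvPolynomial.pderiv i f

theorem annihilation_creation (i j : Mode) (f : MvPolynomial Mode ℂ) :
    P.annihilation i (creation j f) - creation j (P.annihilation i f) =
      if i = j then P.comm i • f else 0 := by
  by_cases h : i = j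
  · subst h
    simp [annihilation, creation, Derivation.leibniz]
  · simp [annihilation, creation, Derivation.leibniz, MvPolynomial.pderiv_X_of_ne (Ne.symm h), h]

/-- `∑ y_i x_i` over the annihilation operators `x_i = comm i • ∂/∂X_i`; on each polynomial only
finitely many terms contribute. -/
def annSum (y : Mode → ℂ) : Derivation ℂ (MvPolynomial Mode ℂ) (MvPolynomial Mode ℂ) :=
  MvPolynomial.mkDerivation ℂ fun i => MvPolynomial.C (P.comm i * y i)

theorem annSum_single (i : Mode) (f : MvPolynomial Mode ℂ) :
    P.annSum (Pi.single i 1) f = P.annihilation i f := by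
  have h : P.annSum (Pi.single i 1) = P.comm i • MvPolynomial.pderiv i := by
    apply MvPolynomial.derivation_ext
    intro j
    by_cases hj : j = i
    · subst hj
      simp [annSum, MvPolynomial.mkDerivation_X, MvPolynomial.smul_eq_C_mul]
    · simp [annSum, MvPolynomial.mkDerivation_X, MvPolynomial.pderiv_X_of_ne hj, hj]
  rw [h]
  rfl

/-- `exp (∑ y_i x_i)` over the annihilation operators, which is a Taylor shift. -/
def expAnn (y : Mode → ℂ) : MvPolynomial Mode ℂ →ₐ[ℂ] MvPolynomial Mode ℂ :=
  MvPolynomial.aeval fun i => MvPolynomial.X i + MvPolynomial.C (P.comm i * y i)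

/-- The Taylor shift is the exponential series of `annSum`, which terminates. -/
theorem expAnn_eq (y : Mode → ℂ) (f : MvPolynomial Mode ℂ) :
    ∃ N₀ : ℕ, ∀ N ≥ N₀, P.expAnn y f =
      ∑ j ∈ Finset.range N, ((j.factorial : ℂ)⁻¹) • (P.annSum y)^[j] f := by
  induction f using MvPolynomial.induction_on with
  | C c =>
    refine ⟨1, fun N hN => ?_⟩
    obtain ⟨M, rfl⟩ : ∃ M, N = M + 1 := ⟨N - 1, by omega⟩
    have h : ∀ j : ℕ, (P.annSum y)^[j + 1] (MvPolynomial.C c) = 0 := by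
      intro j
      rw [Function.iterate_succ_apply, ← MvPolynomial.algebraMap_eq, Derivation.map_algebraMap]
      exact Function.iterate_fixed (map_zero _) j
    rw [Finset.sum_range_succ', Finset.sum_eq_zero (fun j _ => by rw [h, smul_zero])]
    simp [expAnn]
  | add f g hf hg =>
    obtain ⟨N₁, h₁⟩ := hf
    obtain ⟨N₂, h₂⟩ := hg
    refine ⟨max N₁ N₂, fun N hN => ?_⟩
    rw [map_add, h₁ N (le_trans (le_max_left _ _) hN), h₂ N (le_trans (le_max_right _ _) hN),
      ← Finset.sum_add_distrib]
    refine Finset.sum_congr rfl fun j _ => ?_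
    rw [iterate_map_add, smul_add]
  | mul_X f i hf =>
    obtain ⟨N₀, h₀⟩ := hf
    refine ⟨N₀ + 1, fun N hN => ?_⟩
    obtain ⟨M, rfl⟩ : ∃ M, N = M + 1 := ⟨N - 1, by omega⟩
    have hX : P.annSum y (MvPolynomial.X i) = MvPolynomial.C (P.comm i * y i) :=
      MvPolynomial.mkDerivation_X _ _ _
    have hC : P.annSum y (MvPolynomial.C (P.comm i * y i)) = 0 := by
      rw [← MvPolynomial.algebraMap_eq, Derivation.map_algebraMap]
    have h : ∀ j : ℕ, (P.annSum y)^[j + 1] (f * MvPolynomial.X i) =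
        (P.annSum y)^[j + 1] f * MvPolynomial.X i +
          ((j + 1 : ℕ) : MvPolynomial Mode ℂ) *
            ((P.annSum y)^[j] f * MvPolynomial.C (P.comm i * y i)) := by
      intro j
      induction j with
      | zero =>
        simp only [zero_add, Function.iterate_one, Function.iterate_zero, id_eq, Nat.cast_one,
          Derivation.leibniz, hX, smul_eq_mul]
        ring
      | succ j ih =>
        rw [Function.iterate_succ_apply', ih, map_add, Derivation.leibniz, Derivation.leibniz,
          Derivation.leibniz, hX, hC, Derivation.map_natCast]
        simp only [Function.iterate_succ_apply', smul_eq_mul, Nat.cast_add, Nat.cast_one]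
        ring
    have hs : P.expAnn y (f * MvPolynomial.X i) =
        P.expAnn y f * (MvPolynomial.X i + MvPolynomial.C (P.comm i * y i)) := by
      rw [map_mul]
      simp [expAnn]
    rw [hs, mul_add]
    nth_rewrite 1 [h₀ (M + 1) (by omega)]
    rw [h₀ M (by omega), Finset.sum_range_succ', Finset.sum_range_succ', add_mul, Finset.sum_mul,
      Finset.sum_mul, add_right_comm, ← Finset.sum_add_distrib]
    congr 1
    · refine Finset.sum_congr rfl fun j _ => ?_
      rw [h, smul_add, smul_mul_assoc]
      congr 1
      rw [smul_mul_assoc, ← nsmul_eq_mul, ← Nat.cast_smul_eq_nsmul ℂ, smul_smul]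
      congr 1
      rw [Nat.factorial_succ]
      push_cast
      have h1 : ((j : ℂ) + 1) ≠ 0 := by exact_mod_cast Nat.succ_ne_zero j
      have h2 : (j.factorial : ℂ) ≠ 0 := by exact_mod_cast Nat.factorial_ne_zero j
      field_simp
    · simp

/-- `exp (∑ x_i X_i)` over the creation operators, as a formal power series. -/
def expCre (x : Mode → ℂ) : MvPowerSeries Mode ℂ :=
  fun d => d.prod fun i n => x i ^ n / (n.factorial : ℂ)

end Params

/-- A linear combination of oscillators and zero modes plus a constant: `cre (x, n)` and
`ann (x, n)` are the coefficients of `x_{-n}` and `x_n`; `Q` and `P` those of the `q`'s and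
`p`'s. -/
structure Expo where
  cre : Mode → ℂ
  ann : Mode → ℂ
  Q : ZeroMode → ℂ
  P : ZeroMode → ℂ
  K : ℂ

namespace Expo

instance : Add Expo := ⟨fun X Y => ⟨X.cre + Y.cre, X.ann + Y.ann, X.Q + Y.Q, X.P + Y.P, X.K + Y.K⟩⟩

instance : Neg Expo := ⟨fun X => ⟨-X.cre, -X.ann, -X.Q, -X.P, -X.K⟩⟩

instance : Sub Expo := ⟨fun X Y => ⟨X.cre - Y.cre, X.ann - Y.ann, X.Q - Y.Q, X.P - Y.P, X.K - Y.K⟩⟩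

/-- `∑_{n > 0} f n · x_{-n}`. -/
def creSum (x : Boson) (f : ℕ+ → ℂ) : Expo :=
  ⟨fun i => if i.1 = x then f i.2 else 0, 0, 0, 0, 0⟩

/-- `∑_{n > 0} f n · x_n`. -/
def annSum (x : Boson) (f : ℕ+ → ℂ) : Expo :=
  ⟨0, fun i => if i.1 = x then f i.2 else 0, 0, 0, 0⟩

/-- `κ · q_x`. -/
def q (x : ZeroMode) (κ : ℂ) : Expo := ⟨0, 0, Pi.single x κ, 0, 0⟩

/-- `κ · p_x`. -/
def p (x : ZeroMode) (κ : ℂ) : Expo := ⟨0, 0, 0, Pi.single x κ, 0⟩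

/-- A constant. -/
def const (κ : ℂ) : Expo := ⟨0, 0, 0, 0, κ⟩

end Expo

namespace Params

variable (P : Params)

open Classical in
/-- The normal ordered exponential `:exp X:`, that is
`exp (creation part) · exp (q part) · exp (p part + constant) · exp (annihilation part)`. -/
def vop (X : Expo) : Op := fun s t =>
  if s.1 = t.1 + (fun i => P.zcomm i * X.Q i) then
    Complex.exp (X.P .a * t.1 .a + X.P .b * t.1 .b + X.P .c * t.1 .c + X.P .hat * t.1 .hat + X.K) *
      MvPowerSeries.coeff s.2
        (expCre X.cre * (P.expAnn X.ann (MvPolynomial.monomial t.2 1) : MvPowerSeries Mode ℂ))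
  else 0

/-! ### Boson fields, as functions of `u` where `z = q ^ (2u)` -/

/-- `x(z) = -∑_{n ≠ 0} x_n z^{-n} / [n] + q_x + p_x ln z`. -/
def field (x : Boson) (u : ℂ) : Expo :=
  Expo.creSum x (fun n => P.z u ^ (n : ℕ) / P.br n) -
    Expo.annSum x (fun n => (P.z u ^ (n : ℕ))⁻¹ / P.br n) +
    Expo.q x.zero 1 + Expo.p x.zero (P.lnz u)

/-- `x_+(z) = (q - q⁻¹) ∑_{n > 0} x_n z^{-n} + p_x ln q`. -/
def fieldP (x : Boson) (u : ℂ) : Expo :=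
  Expo.annSum x (fun n => (P.qpow 1 - P.qpow (-1)) * (P.z u ^ (n : ℕ))⁻¹) +
    Expo.p x.zero P.logq

/-- `x_-(z) = -((q - q⁻¹) ∑_{n > 0} x_{-n} z^n + p_x ln q)`. -/
def fieldM (x : Boson) (u : ℂ) : Expo :=
  -(Expo.creSum x (fun n => (P.qpow 1 - P.qpow (-1)) * P.z u ^ (n : ℕ)) +
    Expo.p x.zero P.logq)

/-- `x_+^*(z) = -∑_{n > 0} x_n z^{-n} / [rn]`. -/
def starP (x : Boson) (u : ℂ) : Expo :=
  -Expo.annSum x (fun n => (P.z u ^ (n : ℕ))⁻¹ / P.br (P.r * n))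

/-- `x_-^*(z) = ∑_{n > 0} x_{-n} z^n / [r*n]`. -/
def starM (x : Boson) (u : ℂ) : Expo :=
  Expo.creSum x (fun n => P.z u ^ (n : ℕ) / P.br (P.rs * n))

/-- `∏ [L_i n] / ∏ [M_j n]`. -/
def brRatio (L M : List ℂ) (n : ℕ+) : ℂ :=
  (L.map fun x => P.br (x * n)).prod / (M.map fun x => P.br (x * n)).prod

/-- `X_+(L; M | z; α) = ∑_{n > 0} (∏ [L_i n] / ∏ [M_j n]) x_n (q^α z)^{-n}`. -/
def bigP (x : Boson) (L M : List ℂ) (u α : ℂ) : Expo :=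
  Expo.annSum x (fun n => P.brRatio L M n * (P.z (u + α / 2) ^ (n : ℕ))⁻¹)

/-- `X_-(L; M | z; α) = ∑_{n > 0} (∏ [L_i n] / ∏ [M_j n]) x_{-n} (q^α z)^n`. -/
def bigM (x : Boson) (L M : List ℂ) (u α : ℂ) : Expo :=
  Expo.creSum x (fun n => P.brRatio L M n * P.z (u + α / 2) ^ (n : ℕ))

/-! ### The currents `H^±`, `E`, `F` -/

/-- Exponent of the twisting current `U^+(z)`; here `b_-^*(q^{r*-1}(q+q⁻¹)z)` stands for
`b_-^*(q^{r*}z) + b_-^*(q^{r*-2}z)`. -/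
def expoUp (u : ℂ) : Expo :=
  P.starM .a (u + (P.rs + P.k / 2 - 1) / 2) +
    (P.starM .b (u + P.rs / 2) + P.starM .b (u + (P.rs - 2) / 2))

/-- Exponent of the twisting current `U^-(z)`; here `b_+^*(q^{-(r-k-1)}(q+q⁻¹)z)` stands for
`b_+^*(q^{-(r-k-2)}z) + b_+^*(q^{-(r-k)}z)`. -/
def expoUm (u : ℂ) : Expo :=
  P.starP .a (u - (P.r - P.k / 2 - 1) / 2) +
    (P.starP .b (u - (P.r - P.k - 2) / 2) + P.starP .b (u - (P.r - P.k) / 2))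

/-- Exponent of `ψ_+(z)`. -/
def expoPsiP (u : ℂ) : Expo :=
  P.fieldP .b (u + P.k / 4) + P.fieldP .a (u + 1 / 2) + P.fieldP .b (u + (P.k / 2 + 2) / 2)

/-- Exponent of `ψ_-(z)`. -/
def expoPsiM (u : ℂ) : Expo :=
  P.fieldM .b (u - P.k / 4) + P.fieldM .a (u - 1 / 2) + P.fieldM .b (u - (P.k / 2 + 2) / 2)

/-- First exponent in `e^+(z)`: `b_+(z) - (b+c)(qz)`. -/
def expoE1 (u : ℂ) : Expo :=
  P.fieldP .b u - (P.field .b (u + 1 / 2) + P.field .c (u + 1 / 2))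

/-- Second exponent in `e^+(z)`: `b_-(z) - (b+c)(q⁻¹z)`. -/
def expoE2 (u : ℂ) : Expo :=
  P.fieldM .b u - (P.field .b (u - 1 / 2) + P.field .c (u - 1 / 2))

/-- First exponent in `e^-(z)`. -/
def expoF1 (u : ℂ) : Expo :=
  P.field .b (u - (P.k + 1) / 2) + P.field .c (u - (P.k + 1) / 2) +
    P.fieldM .a (u - (P.k + 2) / 4) + P.fieldM .b (u - (P.k + 2) / 2)

/-- Second exponent in `e^-(z)`. -/
def expoF2 (u : ℂ) : Expo :=
  P.field .b (u + (P.k + 1) / 2) + P.field .c (u + (P.k + 1) / 2) +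
    P.fieldP .a (u + (P.k + 2) / 4) + P.fieldP .b (u + (P.k + 2) / 2)

/-- `κ · (p̂ - 1)`. -/
def phat1 (κ : ℂ) : Expo := Expo.p .hat κ - Expo.const κ

/-- `κ · (2p_b + p_a)`. -/
def ph (κ : ℂ) : Expo := Expo.p .b (2 * κ) + Expo.p .a κ

/-- `H^+(u) = Ψ^+(z) e^{2q̂} (q^{-k/2}z)^{(2p_b+p_a)/r} (q^{r-k/2}z)^{(p̂-1)/r - (p̂-1)/r*}`,
with `Ψ^+(z) = U^+(q^{k/2}z) ψ_+(z) U^-(q^{-k/2}z)`. -/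
def Hplus (u : ℂ) : Op :=
  P.vop (P.expoUp (u + P.k / 4) + P.expoPsiP u + P.expoUm (u - P.k / 4) + Expo.q .hat 2 +
    ph (P.lnz (u - P.k / 4) / P.r) +
    (phat1 (P.lnz (u + (P.r - P.k / 2) / 2) / P.r) -
      phat1 (P.lnz (u + (P.r - P.k / 2) / 2) / P.rs)))

/-- `H^-(u) = Ψ^-(z) e^{2q̂} (q^{k/2}z)^{(2p_b+p_a)/r} (q^{-(r-k/2)}z)^{(p̂-1)/r - (p̂-1)/r*}`,
with `Ψ^-(z) = U^+(q^{-k/2}z) ψ_-(z) U^-(q^{k/2}z)`. -/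
def Hminus (u : ℂ) : Op :=
  P.vop (P.expoUp (u - P.k / 4) + P.expoPsiM u + P.expoUm (u + P.k / 4) + Expo.q .hat 2 +
    ph (P.lnz (u + P.k / 4) / P.r) +
    (phat1 (P.lnz (u - (P.r - P.k / 2) / 2) / P.r) -
      phat1 (P.lnz (u - (P.r - P.k / 2) / 2) / P.rs)))

/-- `E(u) = U^+(z) e^+(z) e^{2q̂} z^{-(p̂-1)/r*}`. -/
def E (u : ℂ) : Op := fun s t =>
  -1 / ((P.qpow 1 - P.qpow (-1)) * P.z u) *
    (P.vop (P.expoUp u + P.expoE1 u + Expo.q .hat 2 + phat1 (-(P.lnz u / P.rs))) s t -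
      P.vop (P.expoUp u + P.expoE2 u + Expo.q .hat 2 + phat1 (-(P.lnz u / P.rs))) s t)

/-- `F(u) = e^-(z) U^-(z) z^{(2p_b+p_a)/r} z^{(p̂-1)/r}`. -/
def F (u : ℂ) : Op := fun s t =>
  -1 / ((P.qpow 1 - P.qpow (-1)) * P.z u) *
    (P.vop (P.expoF1 u + P.expoUm u + ph (P.lnz u / P.r) + phat1 (P.lnz u / P.r)) s t -
      P.vop (P.expoF2 u + P.expoUm u + ph (P.lnz u / P.r) + phat1 (P.lnz u / P.r)) s t)

/-! ### The highest components of the twisted vertex operators -/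

/-- Exponent of `V^+(w; r, r*)`. -/
def expoVp (l : ℕ) (v : ℂ) : Expo :=
  -P.bigP .a [l, P.rs] [2, P.k, P.r] v ((P.k + 2) / 2) -
    P.bigP .b [l, P.rs] [1, P.k, P.r] v (P.k + 1)

/-- Exponent of `V^-(w; r, r*)`. -/
def expoVm (l : ℕ) (v : ℂ) : Expo :=
  P.bigM .a [-l, P.r] [2, P.k, P.rs] v ((P.k - 2) / 2) +
    P.bigM .b [-l, P.r] [1, P.k, P.rs] v (-1)

/-- The highest component `Φ^t_{l,l}(v)`, `w = q ^ (2v)`. -/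
def PhiTop (l : ℕ) (v : ℂ) : Op :=
  P.vop (P.expoVp l v +
    (P.bigM .a [l] [2, P.k + 2] v ((P.k + 2) / 2) +
      P.bigM .a [P.k - l + 1] [1, P.k + 2] v (-((P.k + 2) / 2)) +
      P.bigM .b [P.k - l + 1] [1, 1] v (-1) -
      P.bigP .a [P.k - l, P.k + 1] [1, P.k, P.k + 2] v ((P.k + 2) / 2) -
      P.bigP .b [P.k - l, P.k + 1] [1, 1, P.k] v 1 +
      P.bigM .c [P.k - l] [1, 1] v 0 -
      P.bigP .c [P.k - l] [1, 1] v 0) +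
    (Expo.q .a ((P.k - l) / (2 * (P.k + 2))) + Expo.q .b (P.k - l) + Expo.q .c (P.k - l) +
      Expo.q .hat P.rs + Expo.p .c ((l - P.r) / P.r * P.lnz v) -
      Expo.p .hat (l / (2 * P.r) * P.lnz v)))

/-- The highest component `Ψ^{*t}_{l,l}(v)`, `w = q ^ (2v)`. -/
def PsiTop (l : ℕ) (v : ℂ) : Op :=
  P.vop (P.expoVm l v +
    (P.bigM .a [-(P.k - l)] [P.k, P.k + 2] v (-((P.k + 2) / 2)) +
      P.bigM .b [-(P.k - l)] [1, P.k] v (-1) +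
      P.bigP .a [l + 2] [2, P.k + 2] v ((P.k + 2) / 2) +
      P.bigP .b [] [1] v (l + 1)) +
    (Expo.q .a ((P.k - l) / (2 * (P.k + 2))) - Expo.q .hat (l + P.rs) -
      Expo.p .b (P.lnz v) + Expo.p .hat (l / (2 * P.rs) * P.lnz v)))

/-! ### Relations between operators, in the sense of analytic continuation -/

/-- The relation `A(u) B(v) = ρ(u - v) B(v) A(u)`: every matrix element of `A(u) B(v)` is a
convergent sum over intermediate states for `|z| ≫ |w|`, every matrix element of `B(v) A(u)`
one for `|z| ≪ |w|`, both continue to meromorphic functions of `u ∈ ℂ`, and these are related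
by the factor `ρ(u - v)`. -/
def Exchange (A B : ℂ → Op) (ρ : ℂ → ℂ) : Prop :=
  ∃ R : ℝ, 0 < R ∧ ∀ (s t : State) (v : ℂ), ∃ G G' : ℂ → ℂ,
    MeromorphicOn G Set.univ ∧ MeromorphicOn G' Set.univ ∧
    (∀ u : ℂ, R * ‖P.z v‖ < ‖P.z u‖ → HasSum (fun x : State => A u s x * B v x t) (G u)) ∧
    (∀ u : ℂ, R * ‖P.z u‖ < ‖P.z v‖ → HasSum (fun x : State => B v s x * A u x t) (G' u)) ∧
    ∀ᶠ u in codiscrete ℂ, G u = ρ (u - v) * G' u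

/-! ### Half currents and lower components -/

/-- Eigenvalue of `h = 2p_b + p_a`. -/
def hval (c : Charge) : ℂ := 2 * c .b + c .a

/-- The half current `F^+(v)`, with `ϱ` its normalization. The contour is the circle
`w' = q^{2v'}`, `|w'| = |p|^σ |w|`, `0 < σ < 1`, on which `dw' / (2πi w') = dx` for
`v' = v + rσ + x πi / ln q`, `0 ≤ x ≤ 1`. -/
def Fplus (ϱ : ℂ) (σ : ℝ) (v : ℂ) : Op := fun s t =>
  ϱ * ∫ x in (0 : ℝ)..1,
    (fun v' : ℂ => P.F v' s t *
      (P.theta (v - v' + t.1 .hat + hval t.1 - 1) * P.theta 1 /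
        (P.theta (v - v') * P.theta (t.1 .hat + hval t.1 - 1))))
    (v + P.r * σ + x * (Real.pi * Complex.I / P.logq))

/-- The half current `E^+(v)`, with `ϱ*` its normalization. The contour is the circle
`w' = q^{2v'}`, `|w'| = |p*|^σ |q^k w|`, `0 < σ < 1`. -/
def Eplus (ϱs : ℂ) (σ : ℝ) (v : ℂ) : Op := fun s t =>
  ϱs * ∫ x in (0 : ℝ)..1,
    (fun v' : ℂ => P.E v' s t *
      (P.thetaS (v - v' + P.k / 2 - t.1 .hat + 1) * P.thetaS 1 /
        (P.thetaS (v - v' + P.k / 2) * P.thetaS (t.1 .hat - 1))))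
    (v + P.k / 2 + P.rs * σ + x * (Real.pi * Complex.I / P.logq))

/-- The normalization `ϱ ϱ* θ*(1) ξ(q⁻²; p*, q) / ξ(q⁻²; p, q) = q - q⁻¹`. The quotient of the two
`ξ`'s is a limit, since both of them vanish at `q⁻²`. -/
def Normalized (ϱ ϱs : ℂ) : Prop :=
  Tendsto (fun y => ϱ * ϱs * P.thetaS 1 * (P.xi (P.qpow (2 * P.rs)) y / P.xi (P.qpow (2 * P.r)) y))
    (𝓝[≠] P.qpow (-2)) (𝓝 (P.qpow 1 - P.qpow (-1)))

/-- The sectors on which the recursions make sense: the currents have integral powers of the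
`(b+c)`-zero mode, so that the contour integrals are over closed contours, and no denominator
`θ(p̂ + h + n)`, `θ*(p̂ + n)` vanishes. -/
def Generic (c : Charge) : Prop :=
  (∃ n : ℤ, c .b + c .c = n) ∧ (∀ n : ℤ, P.theta (c .hat + hval c + n) ≠ 0) ∧
    ∀ n : ℤ, P.thetaS (c .hat + n) ≠ 0

/-- `Φ_{l,m}`, `0 ≤ m ≤ l`, has the highest component `Φ^t_{l,l}` and obeys
`Φ_{l,m-1}(v) = F^+(v - l/2) θ(p̂+h+l-m)/θ(p̂+h) Φ_{l,m}(v)` for `1 ≤ m ≤ l`. The operator product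
on the right is the value at `v₁ = v - l/2` of the analytic continuation in `v₁` of
`F^+(v₁) θ(p̂+h+l-m)/θ(p̂+h) Φ_{l,m}(v)`, which is a convergent sum over intermediate states for
`|w₁| ≫ |w|`. -/
def LowerPhi (ϱ : ℂ) (l : ℕ) (Φ : ℕ → ℂ → Op) : Prop :=
  Φ l = P.PhiTop l ∧
  ∀ m : ℕ, 1 ≤ m → m ≤ l → ∀ σ : ℝ, 0 < σ → σ < 1 → ∀ (v : ℂ) (s t : State), P.Generic t.1 →
    ∃ G : ℂ → ℂ, MeromorphicOn G Set.univ ∧ AnalyticAt ℂ G (v - l / 2) ∧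
      (∃ R : ℝ, ∀ v₁ : ℂ, R * ‖P.z v‖ < ‖P.z v₁‖ →
        HasSum (fun x : State => P.Fplus ϱ σ v₁ s x *
          (P.theta (x.1 .hat + hval x.1 + l - m) / P.theta (x.1 .hat + hval x.1)) * Φ m v x t)
          (G v₁)) ∧
      Φ (m - 1) v s t = G (v - l / 2)

/-- `Ψ*_{l,m}`, `0 ≤ m ≤ l`, has the highest component `Ψ^{*t}_{l,l}` and obeys
`Ψ*_{l,m-1}(v) = Ψ*_{l,m}(v) E^+(v - (l+k)/2 - r*) θ*(m) θ*(p̂-l+m-2) / (θ*(l-m+1) θ*(p̂-2))` for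
`1 ≤ m ≤ l`. The operator product on the right is the value at `v₁ = v - (l+k)/2 - r*` of the
analytic continuation in `v₁` of the product with `E^+(v₁)`, which is a convergent sum over
intermediate states for `|w₁| ≪ |w|`. -/
def LowerPsi (ϱs : ℂ) (l : ℕ) (Ψ : ℕ → ℂ → Op) : Prop :=
  Ψ l = P.PsiTop l ∧
  ∀ m : ℕ, 1 ≤ m → m ≤ l → ∀ σ : ℝ, 0 < σ → σ < 1 → ∀ (v : ℂ) (s t : State), P.Generic t.1 →
    ∃ G : ℂ → ℂ, MeromorphicOn G Set.univ ∧ AnalyticAt ℂ G (v - (l + P.k) / 2 - P.rs) ∧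
      (∃ R : ℝ, ∀ v₁ : ℂ, R * ‖P.z v₁‖ < ‖P.z v‖ →
        HasSum (fun x : State => Ψ m v s x * P.Eplus ϱs σ v₁ x t *
          (P.thetaS m * P.thetaS (t.1 .hat - l + m - 2) /
            (P.thetaS (l - m + 1) * P.thetaS (t.1 .hat - 2)))) (G v₁)) ∧
      Ψ (m - 1) v s t = G (v - (l + P.k) / 2 - P.rs)

end Params

end EllipticVO

end

/-! Every operator in part (i) is a normal ordered exponential or, for `E` and `F`, a combination of
two with scalar factors. By Wick's theorem (`hasSum_vop_mul`) the product of two normal ordered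
exponentials is a scalar, their contraction, times the normal ordered exponential of the sum of the
exponents, and the latter does not see the order of the factors. An exchange relation is therefore a
relation between two contractions. If `ζ` is the quotient of the spectral variables, the oscillators
contribute `exp (∑ b_i c_i ζ^n)`. Summed over the three bosons the coefficient of `ζ^n` is always
`(y'^n - y^n) / (n (1 - p^n)) - e^n / n`, a rational identity in `q^n`, `q^{kn/2}`, `q^{rn}`,
`q^{ln}`. Hence the contraction is `(yζ; p)_∞ (1 - eζ) / (y'ζ; p)_∞` (`contr_of_eq`), which is
meromorphic everywhere and so provides the analytic continuation. Together with the powers of `z`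
and `w` from the zero modes, the quotient of the contractions in the two orders is the stated
quotient of theta functions (`exchange_of_contr`, `thetaNu_div_mul`), the same for both terms of a
current.

For part (ii) a lower component is an iterated contour integral of currents times the highest
component. By Wick's theorem the integrands are periodic holomorphic numerators over infinite
products. An integral along a circle that separates an inner from an outer family of poles continues
in its parameters until an inner pole meets an outer one, and it becomes entire after multiplication
by the product `Poles.res` over all pairs of poles. The reason is algebraic: `∏∏ (1 - A_m B_n)` lies
in the ideal generated by `∏ (1 - A_m)` and `∏ (1 - B_n)` (`bezout_prod`). So, up to tails of poles
that lie far away, the integrand times `res` splits into a summand with outer poles only and one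
with inner poles only, and the contour of each can be moved to a fixed circle.

To iterate, one carries along not only a component but its products with any number of further
currents (`Fam`). Integrating out the innermost current and setting the kernel parameter to `v + τ`
gives such a family again, with more zeros in the denominators (`fam_step`). These zeros are tracked
by `PoleSet`. For `Φ` the next evaluation is regular if `q^{2(l-j)} p^n ≠ 1` and `q^{-2j} p^{n+1} ≠
1`; the former holds because of the size of the left side, the latter because `θ(j) ≠ 0`. For `Ψ*`
the current acts from the right; transposed matrix elements and the reflection `u ↦ -u` reduce this
to the same situation with opposite signs, so that now the former condition needs `θ*(l - j) ≠ 0`.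

Uniqueness follows by induction downwards in `m`: the recursion determines the continued function
where the sum converges, hence by the identity theorem also at the point of evaluation. -/

open Filter Topology
noncomputable section
namespace EllipticVO

/-! ### Infinite products -/

/-- `∏ (1 - a_k x)`. -/
def Pr (a : ℕ → ℂ) (x : ℂ) : ℂ := ∏' k : ℕ, (1 - a k * x)

/-- The pairwise products of two sequences. -/
def conv (a b : ℕ → ℂ) (k : ℕ) : ℂ := a k.unpair.1 * b k.unpair.2

theorem multipliable_Pr {a : ℕ → ℂ} (ha : Summable fun k => ‖a k‖) (x : ℂ) :
    Multipliable fun k => 1 - a k * x := by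
  have := multipliable_one_add_of_summable (R := ℂ) (f := fun k => -(a k * x))
    (by simpa using ha.mul_right ‖x‖)
  simpa [sub_eq_add_neg] using this

theorem Pr_ne_zero {a : ℕ → ℂ} (ha : Summable fun k => ‖a k‖) {x : ℂ} (h : ∀ k, a k * x ≠ 1) :
    Pr a x ≠ 0 := by
  have := tprod_one_add_ne_zero_of_summable (R := ℂ) (f := fun k => -(a k * x))
    (fun k => by rw [← sub_eq_add_neg, sub_ne_zero]; exact (h k).symm)
    (by simpa using ha.mul_right ‖x‖)
  simpa [Pr, sub_eq_add_neg] using this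

theorem Pr_ne_zero_of_norm {a : ℕ → ℂ} (ha : Summable fun k => ‖a k‖) {x : ℂ} {A : ℝ}
    (hA : ∀ k, ‖a k‖ ≤ A) (h : A * ‖x‖ < 1) : Pr a x ≠ 0 := by
  refine Pr_ne_zero ha fun k hk => ?_
  have h1 : ‖a k * x‖ = 1 := by rw [hk, norm_one]
  rw [norm_mul] at h1
  nlinarith [hA k, norm_nonneg x]

theorem Pr_eq_zero {a : ℕ → ℂ} {x : ℂ} (k : ℕ) (h : a k * x = 1) : Pr a x = 0 :=
  tprod_of_exists_eq_zero ⟨k, by rw [h, sub_self]⟩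

/-- On a ball of radius `R` the deviations of the factors from 1 are bounded by `‖a k‖ * R`, so the
product converges locally uniformly. -/
theorem differentiable_Pr {a : ℕ → ℂ} (ha : Summable fun k => ‖a k‖) : Differentiable ℂ (Pr a) := by
  have key : ∀ R : ℝ, DifferentiableOn ℂ (Pr a) (Metric.ball 0 R) := by
    intro R
    have h := Summable.hasProdLocallyUniformlyOn_nat_one_add (R := ℂ) (K := Metric.ball (0:ℂ) R)
      (f := fun k x => -(a k * x)) (u := fun k => ‖a k‖ * R) Metric.isOpen_ball (ha.mul_right R)
      (Eventually.of_forall fun n x hx => by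
        rw [norm_neg, norm_mul]
        have : ‖x‖ < R := by simpa using hx
        gcongr)
      (fun n => by fun_prop)
    have h2 := h.differentiableOn (Eventually.of_forall fun s => by fun_prop) Metric.isOpen_ball
    refine h2.congr fun x hx => ?_
    simp [Pr, sub_eq_add_neg]
  intro x
  exact (key (‖x‖ + 1)).differentiableAt (Metric.isOpen_ball.mem_nhds (by simp))

theorem contDiff_Pr {a : ℕ → ℂ} (ha : Summable fun k => ‖a k‖) {n : WithTop ℕ∞} :
    ContDiff ℂ n (Pr a) := (differentiable_Pr ha).contDiff

/-- The sequence with the entries in a finite set replaced by zero. -/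
def dropSet (T : Finset ℕ) (a : ℕ → ℂ) (k : ℕ) : ℂ := if k ∈ T then 0 else a k

theorem norm_dropSet_le (T : Finset ℕ) (a : ℕ → ℂ) (k : ℕ) : ‖dropSet T a k‖ ≤ ‖a k‖ := by
  unfold dropSet; split_ifs <;> simp

theorem summable_dropSet {a : ℕ → ℂ} (ha : Summable fun k => ‖a k‖) (T : Finset ℕ) :
    Summable fun k => ‖dropSet T a k‖ :=
  ha.of_nonneg_of_le (fun _ => norm_nonneg _) (norm_dropSet_le T a)

/-- Finitely many factors form a polynomial in `x`, and the entries that remain can be made as small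
as desired. In this way infinite families of poles are reduced to finite ones. -/
theorem Pr_split {a : ℕ → ℂ} (ha : Summable fun k => ‖a k‖) (T : Finset ℕ) (x : ℂ) :
    Pr a x = (∏ k ∈ T, (1 - a k * x)) * Pr (dropSet T a) x := by
  have h1 : HasProd (fun k => if k ∈ T then 1 - a k * x else 1) (∏ k ∈ T, (1 - a k * x)) := by
    have : HasProd (fun k => if k ∈ T then 1 - a k * x else 1)
        (∏ k ∈ T, if k ∈ T then 1 - a k * x else 1) :=
      hasProd_prod_of_ne_finset_one (fun b hb => by simp [hb])
    rwa [Finset.prod_congr rfl (fun k hk => if_pos hk)] at this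
  have h2 := (multipliable_Pr (summable_dropSet ha T) x).hasProd
  have h3 := h1.mul h2
  rw [Pr, Pr, ← h3.tprod_eq]
  congr 1
  ext k
  by_cases hk : k ∈ T <;> simp [dropSet, hk]

theorem summable_conv {a b : ℕ → ℂ} (ha : Summable fun k => ‖a k‖) (hb : Summable fun k => ‖b k‖) :
    Summable fun k => ‖conv a b k‖ := by
  have h := (ha.mul_of_nonneg hb (fun _ => norm_nonneg _) (fun _ => norm_nonneg _))
  have := (Nat.pairEquiv.symm.summable_iff).2 h
  refine this.congr fun k => ?_
  simp only [conv, norm_mul]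
  rfl

theorem norm_conv_le {a b : ℕ → ℂ} {A B : ℝ} (hA : ∀ k, ‖a k‖ ≤ A) (hB : ∀ k, ‖b k‖ ≤ B) (k : ℕ) :
    ‖conv a b k‖ ≤ A * B := by
  rw [conv, norm_mul]
  exact mul_le_mul (hA _) (hB _) (norm_nonneg _) ((norm_nonneg _).trans (hA 0))

/-- Two sequences joined into one. -/
def merge (a b : ℕ → ℂ) (k : ℕ) : ℂ := Sum.elim a b (Equiv.natSumNatEquivNat.symm k)

theorem summable_merge {a b : ℕ → ℂ} (ha : Summable fun k => ‖a k‖) (hb : Summable fun k => ‖b k‖) :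
    Summable fun k => ‖merge a b k‖ := by
  have : Summable (fun k : ℕ ⊕ ℕ => ‖Sum.elim a b k‖) :=
    Summable.sum _ (by simpa [Function.comp_def] using ha) (by simpa [Function.comp_def] using hb)
  exact (Equiv.natSumNatEquivNat.symm.summable_iff (f := fun k => ‖Sum.elim a b k‖)).2 this

theorem Pr_merge {a b : ℕ → ℂ} (ha : Summable fun k => ‖a k‖) (hb : Summable fun k => ‖b k‖) (x : ℂ) :
    Pr (merge a b) x = Pr a x * Pr b x := by
  have h := HasProd.sum (f := fun k : ℕ ⊕ ℕ => 1 - Sum.elim a b k * x)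
    (by simpa [Function.comp_def] using (multipliable_Pr ha x).hasProd)
    (by simpa [Function.comp_def] using (multipliable_Pr hb x).hasProd)
  have h2 := (Equiv.natSumNatEquivNat.symm.hasProd_iff).2 h
  exact h2.tprod_eq

theorem Pr_smul (a : ℕ → ℂ) (c x : ℂ) : Pr (fun k => c * a k) x = Pr a (c * x) := by
  unfold Pr; congr 1; ext k; ring

/-- The geometric sequence `c t^k`. -/
def geo (c t : ℂ) (k : ℕ) : ℂ := c * t ^ k

theorem summable_geo (c : ℂ) {t : ℂ} (ht : ‖t‖ < 1) : Summable fun k => ‖geo c t k‖ := by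
  simp only [geo, norm_mul, norm_pow]
  exact (summable_geometric_of_lt_one (norm_nonneg _) ht).mul_left _

theorem norm_geo_le (c : ℂ) {t : ℂ} (ht : ‖t‖ < 1) (k : ℕ) : ‖geo c t k‖ ≤ ‖c‖ := by
  rw [geo, norm_mul, norm_pow]
  exact mul_le_of_le_one_right (norm_nonneg _) (pow_le_one₀ (norm_nonneg _) ht.le)

theorem Pr_geo (c t x : ℂ) : Pr (geo c t) x = Params.poch (c * x) t := by
  unfold Pr Params.poch geo; congr 1; ext k; ring

theorem poch_eq_Pr (x t : ℂ) : Params.poch x t = Pr (geo 1 t) x := by rw [Pr_geo, one_mul]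

theorem poch_ne_zero {x t : ℂ} (ht : ‖t‖ < 1) (hx : ‖x‖ < 1) : Params.poch x t ≠ 0 := by
  rw [poch_eq_Pr]
  exact Pr_ne_zero_of_norm (summable_geo 1 ht) (norm_geo_le 1 ht) (by simpa using hx)

theorem poch_succ {t : ℂ} (ht : ‖t‖ < 1) (x : ℂ) :
    Params.poch x t = (1 - x) * Params.poch (t * x) t := by
  have hm := multipliable_Pr (summable_geo 1 ht) (t * x)
  have hm' : Multipliable fun n : ℕ => 1 - x * t ^ (n + 1) :=
    hm.congr fun k => by rw [geo]; ring
  have h := tprod_eq_zero_mul' (f := fun n : ℕ => 1 - x * t ^ n) hm'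
  have h1 : ∏' n : ℕ, (1 - x * t ^ (n + 1)) = Params.poch (t * x) t :=
    tprod_congr fun k => by ring
  calc Params.poch x t = (1 - x * t ^ 0) * ∏' n : ℕ, (1 - x * t ^ (n + 1)) := h
    _ = _ := by rw [h1, pow_zero, mul_one]

/-- `(y; p)_∞ = exp (-∑ yⁿ / (n (1 - pⁿ)))`. -/
theorem hasSum_log_poch {y t : ℂ} (ht : ‖t‖ < 1) (hy : ‖y‖ < 1) :
    ∃ S : ℂ, HasSum (fun n : ℕ+ => y ^ (n : ℕ) / ((n : ℕ) * (1 - t ^ (n : ℕ)))) S ∧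
      Complex.exp (-S) = Params.poch y t := by
  have hterm : ∀ m : ℕ, ‖y * t ^ m‖ < 1 := fun m => by
    rw [norm_mul, norm_pow]
    exact mul_lt_one_of_nonneg_of_lt_one_left (norm_nonneg _) hy (pow_le_one₀ (norm_nonneg _) ht.le)
  -- the double series
  have hs : Summable (fun x : ℕ+ × ℕ => y ^ (x.1 : ℕ) * t ^ (x.2 * x.1) / ((x.1 : ℕ) : ℂ)) := by
    refine Summable.of_norm_bounded (g := fun x : ℕ+ × ℕ => ‖y‖ ^ (x.1 : ℕ) * ‖t‖ ^ x.2) ?_ ?_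
    · refine Summable.mul_of_nonneg (f := fun n : ℕ+ => ‖y‖ ^ (n : ℕ)) (g := fun m : ℕ => ‖t‖ ^ m)
        ?_ (summable_geometric_of_lt_one (norm_nonneg _) ht) (fun _ => by positivity)
        (fun _ => by positivity)
      exact (summable_geometric_of_lt_one (norm_nonneg _) hy).comp_injective PNat.coe_injective
    · rintro ⟨n, m⟩
      simp only [norm_div, norm_mul, norm_pow, Complex.norm_natCast]
      have hn : (1 : ℝ) ≤ (n : ℕ) := by exact_mod_cast n.pos
      rw [div_le_iff₀ (by linarith)]
      have h1 : ‖t‖ ^ (m * (n : ℕ)) ≤ ‖t‖ ^ m :=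
        pow_le_pow_of_le_one (norm_nonneg _) ht.le (Nat.le_mul_of_pos_right _ n.pos)
      calc ‖y‖ ^ (n : ℕ) * ‖t‖ ^ (m * (n : ℕ)) ≤ ‖y‖ ^ (n : ℕ) * ‖t‖ ^ m := by gcongr
        _ ≤ ‖y‖ ^ (n : ℕ) * ‖t‖ ^ m * (n : ℕ) := le_mul_of_one_le_right (by positivity) hn
  have h1 : ∀ n : ℕ+, HasSum (fun m : ℕ => y ^ (n : ℕ) * t ^ (m * (n : ℕ)) / ((n : ℕ) : ℂ))
      (y ^ (n : ℕ) / ((n : ℕ) * (1 - t ^ (n : ℕ)))) := by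
    intro n
    have hg := hasSum_geometric_of_norm_lt_one (ξ := t ^ (n : ℕ))
      (by rw [norm_pow]; exact pow_lt_one₀ (norm_nonneg _) ht n.ne_zero)
    have := hg.mul_left (y ^ (n : ℕ) / ((n : ℕ) : ℂ))
    rw [show y ^ (n : ℕ) / ((n : ℕ) * (1 - t ^ (n : ℕ))) =
      y ^ (n : ℕ) / ((n : ℕ) : ℂ) * (1 - t ^ (n : ℕ))⁻¹ by rw [div_mul_eq_div_div, div_eq_mul_inv]]
    refine this.congr_fun fun m => ?_
    rw [mul_comm m, pow_mul]; ring
  have h2 : ∀ m : ℕ, HasSum (fun n : ℕ+ => y ^ (n : ℕ) * t ^ (m * (n : ℕ)) / ((n : ℕ) : ℂ))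
      (-Complex.log (1 - y * t ^ m)) := by
    intro m
    have h3 := (PNat.coe_injective.hasSum_iff (f := fun n : ℕ => (y * t ^ m) ^ n / (n : ℂ)) (by
      intro n hn
      have : n = 0 := by
        by_contra h
        exact hn ⟨⟨n, Nat.pos_of_ne_zero h⟩, rfl⟩
      simp [this])).2 (Complex.hasSum_taylorSeries_neg_log (hterm m))
    refine h3.congr_fun fun n => ?_
    simp only [Function.comp_apply]
    rw [mul_pow, ← pow_mul]
  have hS := hs.hasSum
  -- The sum over the powers of `t` first yields the series of the statement, the sum over `n` first
  -- yields the logarithms of the factors. Only exponentials are compared, so no branch matters.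
  have hS1 := hS.prod_fiberwise h1
  have hS2 := ((Equiv.prodComm ℕ ℕ+).hasSum_iff.2 hS).prod_fiberwise h2
  refine ⟨_, hS1, ?_⟩
  have hne : ∀ m : ℕ, 1 - y * t ^ m ≠ 0 := fun m h => by
    have := hterm m
    rw [← sub_eq_zero.1 h, norm_one] at this
    exact lt_irrefl _ this
  have := Complex.hasProd_of_hasSum_log hne (by simpa using hS2.neg)
  rw [← this.tprod_eq, Params.poch]

end EllipticVO
end

open Filter Topology
noncomputable section
namespace EllipticVO

/-! ### Holomorphic functions of several variables and contour integrals -/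

/-- The integral over the segment from `c` to `c + δ`. -/
def perInt (δ c : ℂ) (g : ℂ → ℂ) : ℂ := ∫ x in (0 : ℝ)..1, g (c + x * δ)

/-- Differentiation under the integral sign. Compactness of the segment bounds the derivative of the
integrand uniformly for all nearby parameters. -/
theorem contDiffOn_perInt {E : Type*} [NormedAddCommGroup E] [NormedSpace ℂ E] {F : ℂ × E → ℂ}
    {δ c : ℂ} {U : Set E} (hU : IsOpen U)
    (hF : ∀ x ∈ Set.Icc (0 : ℝ) 1, ∀ Y ∈ U, ContDiffAt ℂ 1 F (c + x * δ, Y)) :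
    ContDiffOn ℂ 1 (fun Y => perInt δ c fun u => F (u, Y)) U := by
  let : NormedSpace ℝ E := NormedSpace.restrictScalars ℝ ℂ E
  set D : E → ℝ → E →L[ℂ] ℂ :=
    fun Y x => (fderiv ℂ F (c + x * δ, Y)).comp (ContinuousLinearMap.inr ℂ ℂ E) with hD
  have hγ : Continuous fun q : E × ℝ => ((c + q.2 * δ, q.1) : ℂ × E) := by fun_prop
  have hDc : ∀ x ∈ Set.Icc (0 : ℝ) 1, ∀ Y ∈ U, ContinuousAt (fun q : E × ℝ => D q.1 q.2) (Y, x) := by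
    intro x hx Y hY
    have h1 : ContinuousAt (fderiv ℂ F) (c + x * δ, Y) :=
      ((hF x hx Y hY).fderiv_right (m := 0) (by norm_num)).continuousAt
    have h2 : ContinuousAt (fun q : E × ℝ => fderiv ℂ F (c + q.2 * δ, q.1)) (Y, x) :=
      ContinuousAt.comp (f := fun q : E × ℝ => ((c + q.2 * δ, q.1) : ℂ × E)) h1 hγ.continuousAt
    exact h2.clm_comp continuousAt_const
  have hFc : ∀ x ∈ Set.Icc (0 : ℝ) 1, ∀ Y ∈ U,
      ContinuousAt (fun q : E × ℝ => F (c + q.2 * δ, q.1)) (Y, x) := fun x hx Y hY =>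
    ContinuousAt.comp (f := fun q : E × ℝ => ((c + q.2 * δ, q.1) : ℂ × E))
      (hF x hx Y hY).continuousAt hγ.continuousAt
  have hd : ∀ x ∈ Set.Icc (0 : ℝ) 1, ∀ Y ∈ U,
      HasFDerivAt (fun Y => F (c + x * δ, Y)) (D Y x) Y := by
    intro x hx Y hY
    have h1 := ((hF x hx Y hY).differentiableAt (by norm_num)).hasFDerivAt
    exact h1.comp Y (hasFDerivAt_prodMk_right (c + x * δ) Y)
  have hFint : ∀ Y ∈ U, ContinuousOn (fun x : ℝ => F (c + x * δ, Y)) (Set.Icc 0 1) :=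
    fun Y hY x hx => (ContinuousAt.comp (f := fun x : ℝ => ((Y, x) : E × ℝ)) (hFc x hx Y hY)
      (by fun_prop)).continuousWithinAt
  have hDint : ∀ Y ∈ U, ContinuousOn (fun x : ℝ => D Y x) (Set.Icc 0 1) :=
    fun Y hY x hx => (ContinuousAt.comp (f := fun x : ℝ => ((Y, x) : E × ℝ)) (hDc x hx Y hY)
      (by fun_prop)).continuousWithinAt
  have hI : Set.uIoc (0 : ℝ) 1 ⊆ Set.Icc 0 1 := by
    rw [Set.uIoc_of_le zero_le_one]; exact Set.Ioc_subset_Icc_self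
  have hder : ∀ Y ∈ U, HasFDerivAt (fun Y => perInt δ c fun u => F (u, Y))
      (∫ x in (0 : ℝ)..1, D Y x) Y := by
    intro Y hY
    obtain ⟨C, hC⟩ := isCompact_Icc.exists_bound_of_continuousOn (hDint Y hY)
    have hev : ∀ᶠ Y' in 𝓝 Y, ∀ x ∈ Set.Icc (0 : ℝ) 1, ‖D Y' x‖ < C + 1 ∧ Y' ∈ U := by
      refine isCompact_Icc.eventually_forall_of_forall_eventually fun x hx => ?_
      have h1 := (hDc x hx Y hY).norm.eventually_lt (continuousAt_const (y := C + 1))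
        (by have := hC x hx; simp only; linarith)
      filter_upwards [h1, (continuous_fst (X := E) (Y := ℝ)).continuousAt.eventually_mem
        (hU.mem_nhds hY)] with q h1 h2 using ⟨h1, h2⟩
    refine intervalIntegral.hasFDerivAt_integral_of_dominated_of_fderiv_le (𝕜 := ℂ)
      (bound := fun _ => C + 1) (F := fun Y x => F (c + x * δ, Y)) (F' := D) hev ?_ ?_ ?_ ?_ ?_ ?_
    · filter_upwards [hU.mem_nhds hY] with Y' hY'
      exact ((hFint Y' hY').mono hI).aestronglyMeasurable measurableSet_uIoc
    · exact ContinuousOn.intervalIntegrable (by rw [Set.uIcc_of_le zero_le_one]; exact hFint Y hY)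
    · exact ((hDint Y hY).mono hI).aestronglyMeasurable measurableSet_uIoc
    · exact Eventually.of_forall fun x hx Y' hY' => (hY' x (hI hx)).1.le
    · simp
    · exact Eventually.of_forall fun x hx Y' hY' => hd x (hI hx) Y' (hY' x (hI hx)).2
  have hcont : ContinuousOn (fun Y => ∫ x in (0 : ℝ)..1, D Y x) U := by
    rw [continuousOn_iff_continuous_domRestrict]
    -- The theorem on parametric integrals asks for joint continuity on the whole line, so the
    -- integrand is extended beyond the segment by its values at the ends.
    have h1 : Continuous (Function.uncurry fun (Y : U) (x : ℝ) =>
        D Y (Set.projIcc (0 : ℝ) 1 zero_le_one x)) := by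
      rw [continuous_iff_continuousAt]
      rintro ⟨Y, x⟩
      have hp : Continuous fun q : U × ℝ =>
          (((q.1 : E), (Set.projIcc (0 : ℝ) 1 zero_le_one q.2 : ℝ)) : E × ℝ) :=
        (continuous_subtype_val.comp continuous_fst).prodMk
          (continuous_subtype_val.comp (continuous_projIcc.comp continuous_snd))
      exact ContinuousAt.comp (x := (Y, x))
        (f := fun q : U × ℝ => (((q.1 : E), (Set.projIcc (0 : ℝ) 1 zero_le_one q.2 : ℝ)) : E × ℝ))
        (g := fun q : E × ℝ => D q.1 q.2)
        (hDc _ (Set.projIcc (0 : ℝ) 1 zero_le_one x).2 Y Y.2) hp.continuousAt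
    have h2 := intervalIntegral.continuous_parametric_intervalIntegral_of_continuous'
      (μ := MeasureTheory.volume) h1 0 1
    refine h2.congr fun Y => ?_
    refine intervalIntegral.integral_congr fun x hx => ?_
    rw [Set.uIcc_of_le zero_le_one] at hx
    simp only [Set.projIcc_of_mem zero_le_one hx]; rfl
  have := (contDiffOn_succ_iff_hasFDerivWithinAt_of_uniqueDiffOn (n := 0) (𝕜 := ℂ)
    (f := fun Y => perInt δ c fun u => F (u, Y)) hU.uniqueDiffOn).2
    ⟨by simp, fun Y => ∫ x in (0 : ℝ)..1, D Y x, contDiffOn_zero.2 hcont,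
      fun Y hY => (hder Y hY).hasFDerivWithinAt⟩
  simpa using this

/-- Restriction to the complex line through `X` and `Y` reduces the identity theorem to one
variable: the zero near `t = 0` spreads to `t = 1`. -/
theorem eqOn_zero_of_eventuallyEq {E : Type*} [NormedAddCommGroup E] [NormedSpace ℂ E] {f : E → ℂ}
    {U : Set E} (hU : IsOpen U) (hc : ∀ X ∈ U, ∀ Y ∈ U, IsPreconnected {t : ℂ | X + t • (Y - X) ∈ U})
    (hf : ∀ X ∈ U, ∀ Y ∈ U, DifferentiableOn ℂ (fun t : ℂ => f (X + t • (Y - X)))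
      {t : ℂ | X + t • (Y - X) ∈ U})
    {X : E} (hX : X ∈ U) (h : ∀ᶠ Y in 𝓝 X, f Y = 0) {Y : E} (hY : Y ∈ U) : f Y = 0 := by
  have hl : Continuous fun t : ℂ => X + t • (Y - X) := by fun_prop
  have ho : IsOpen {t : ℂ | X + t • (Y - X) ∈ U} := hU.preimage hl
  have ha := (hf X hX Y hY).analyticOnNhd ho
  have h0 : (fun t : ℂ => f (X + t • (Y - X))) =ᶠ[𝓝 0] 0 := by
    have : Tendsto (fun t : ℂ => X + t • (Y - X)) (𝓝 0) (𝓝 X) := by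
      have := hl.tendsto 0; simpa using this
    exact this.eventually h
  have := ha.eqOn_zero_of_preconnected_of_eventuallyEq_zero (hc X hX Y hY) (by simpa using hX) h0
    (show (1 : ℂ) ∈ _ by simpa using hY)
  simpa using this

theorem isPreconnected_line_ball {E : Type*} [NormedAddCommGroup E] [NormedSpace ℂ E] (M : ℝ)
    (X Y : E) : IsPreconnected {t : ℂ | X + t • Y ∈ Metric.ball (0 : E) M} := by
  let : NormedSpace ℝ E := NormedSpace.restrictScalars ℝ ℂ E
  have : IsScalarTower ℝ ℂ E := ⟨fun x y z => by
    change ((x • y : ℂ)) • z = (x : ℂ) • (y • z)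
    rw [smul_smul, Complex.real_smul]⟩
  refine Convex.isPreconnected ?_
  intro s hs t ht a b ha hb hab
  have := (convex_ball (0 : E) M) hs ht ha hb hab
  simp only [Set.mem_ofPred_eq] at *
  convert this using 1
  rw [smul_add, smul_add, add_smul, smul_assoc, smul_assoc, add_add_add_comm, ← add_smul, hab,
    one_smul]

/-- The identity theorem on a ball. -/
theorem eq_on_ball {E : Type*} [NormedAddCommGroup E] [NormedSpace ℂ E] {f g : E → ℂ} {M : ℝ}
    (hf : DifferentiableOn ℂ f (Metric.ball 0 M)) (hg : DifferentiableOn ℂ g (Metric.ball 0 M))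
    {X : E} (hX : X ∈ Metric.ball (0 : E) M) (h : ∀ᶠ Y in 𝓝 X, f Y = g Y) {Y : E}
    (hY : Y ∈ Metric.ball (0 : E) M) : f Y = g Y := by
  rw [← sub_eq_zero]
  refine eqOn_zero_of_eventuallyEq (f := fun Y => f Y - g Y) Metric.isOpen_ball
    (fun X _ Y _ => isPreconnected_line_ball M X (Y - X)) (fun X _ Y _ => ?_) hX
    (by filter_upwards [h] with Y hY using sub_eq_zero.2 hY) hY
  refine DifferentiableOn.sub ?_ ?_
  · exact hf.comp (by fun_prop) fun t ht => ht
  · exact hg.comp (by fun_prop) fun t ht => ht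

/-- For one `A`, `1 - A B_n = (1 - B_n) + B_n (1 - A)`, so the product over `n` is congruent to `∏
(1 - B_n)` modulo `1 - A`. In the product over `m` of such expressions all terms but one contain `∏
(1 - B_n)`, and the exception contains `∏ (1 - A_m)`. -/
theorem bezout_prod {R M N : Type*} [CommRing R] (s : Finset M) (t : Finset N) (A : M → R)
    (B : N → R) : ∃ X Y : R, ∏ m ∈ s, ∏ n ∈ t, (1 - A m * B n) =
      X * ∏ m ∈ s, (1 - A m) + Y * ∏ n ∈ t, (1 - B n) := by
  have inner : ∀ m, ∃ X : R, ∏ n ∈ t, (1 - A m * B n) = X * (1 - A m) + ∏ n ∈ t, (1 - B n) := by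
    intro m
    induction t using Finset.cons_induction with
    | empty => exact ⟨0, by simp⟩
    | cons n t hn ih =>
      obtain ⟨X, hX⟩ := ih
      rw [Finset.prod_cons, Finset.prod_cons, hX]
      exact ⟨(1 - A m * B n) * X + B n * ∏ n ∈ t, (1 - B n), by ring⟩
  choose X hX using inner
  induction s using Finset.cons_induction with
  | empty => exact ⟨1, 0, by simp⟩
  | cons m s hm ih =>
    obtain ⟨X', Y', h⟩ := ih
    rw [Finset.prod_cons, Finset.prod_cons, h, hX]
    exact ⟨X m * X', X m * (1 - A m) * Y' + X' * ∏ m ∈ s, (1 - A m) + Y' * ∏ n ∈ t, (1 - B n),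
      by ring⟩

namespace Params

variable (P : Params)

/-- The period of `z` as a function of `u`. -/
def per : ℂ := Real.pi * Complex.I / P.logq

/-- `log ‖z‖`. -/
def lev (u : ℂ) : ℝ := (2 * u * P.logq).re

theorem norm_z (u : ℂ) : ‖P.z u‖ = Real.exp (P.lev u) := by
  rw [z, qpow, Complex.norm_exp, lev]

theorem z_add (u v : ℂ) : P.z (u + v) = P.z u * P.z v := by
  rw [z, z, z, qpow, qpow, qpow, ← Complex.exp_add]; congr 1; ring

theorem z_sub (u v : ℂ) : P.z (u - v) = P.z u / P.z v := by
  rw [z, z, z, qpow, qpow, qpow, ← Complex.exp_sub]; congr 1; ring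

theorem z_neg (u : ℂ) : P.z (-u) = (P.z u)⁻¹ := by
  rw [z, z, qpow, qpow, ← Complex.exp_neg]; congr 1; ring

@[simp] theorem z_zero : P.z 0 = 1 := by simp [z, qpow]

theorem z_ne_zero (u : ℂ) : P.z u ≠ 0 := Complex.exp_ne_zero _

theorem contDiff_z {n : WithTop ℕ∞} : ContDiff ℂ n P.z := by
  unfold z qpow; fun_prop

theorem logq_ne_zero {P : Params} (hq : P.logq.re < 0) : P.logq ≠ 0 := fun h => by simp [h] at hq

theorem z_per {P : Params} (hq : P.logq.re < 0) : P.z P.per = 1 := by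
  have := logq_ne_zero hq
  rw [z, qpow, per, show (2 * (Real.pi * Complex.I / P.logq)) * P.logq = 2 * Real.pi * Complex.I by
    field_simp]
  exact Complex.exp_two_pi_mul_I

theorem z_add_per {P : Params} (hq : P.logq.re < 0) (u : ℂ) : P.z (u + P.per) = P.z u := by
  rw [z_add, z_per hq, mul_one]

theorem lev_add (u v : ℂ) : P.lev (u + v) = P.lev u + P.lev v := by
  simp only [lev, ← Complex.add_re]; congr 1; ring

theorem lev_sub (u v : ℂ) : P.lev (u - v) = P.lev u - P.lev v := by
  simp only [lev, ← Complex.sub_re]; congr 1; ring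

theorem lev_mul_per {P : Params} (hq : P.logq.re < 0) (x : ℝ) : P.lev (x * P.per) = 0 := by
  have := logq_ne_zero hq
  rw [lev, per, show 2 * ((x : ℂ) * (Real.pi * Complex.I / P.logq)) * P.logq =
    ((2 * x * Real.pi : ℝ) : ℂ) * Complex.I by push_cast; field_simp]
  simp

theorem lev_real (x : ℝ) : P.lev x = 2 * x * P.logq.re := by
  simp [lev, Complex.mul_re]

theorem continuous_lev : Continuous P.lev := by unfold lev; fun_prop

theorem lev_convex (s : Set ℝ) (hs : Convex ℝ s) : Convex ℝ (P.lev ⁻¹' s) := by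
  intro u hu v hv a b ha hb hab
  have := hs hu hv ha hb hab
  simp only [Set.mem_preimage] at *
  convert this using 1
  simp only [lev, smul_eq_mul, Complex.real_smul]
  rw [← Complex.re_ofReal_mul, ← Complex.re_ofReal_mul, ← Complex.add_re]
  congr 1; ring

/-- Integrals of periodic holomorphic functions over a period do not depend on the level. -/
theorem perInt_eq_of_differentiableOn {P : Params} (hq : P.logq.re < 0) {g : ℂ → ℂ} {s : Set ℝ}
    (hs : IsOpen s) (hsc : Convex ℝ s) (hg : DifferentiableOn ℂ g (P.lev ⁻¹' s))
    (hper : ∀ u ∈ P.lev ⁻¹' s, g (u + P.per) = g u) {c₁ c₂ : ℂ} (h₁ : P.lev c₁ ∈ s)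
    (h₂ : P.lev c₂ ∈ s) : perInt P.per c₁ g = perInt P.per c₂ g := by
  set V := P.lev ⁻¹' s with hV
  have hVo : IsOpen V := hs.preimage P.continuous_lev
  have hVc : Convex ℝ V := P.lev_convex s hsc
  have hshift : ∀ c ∈ V, ∀ x : ℝ, c + x * P.per ∈ V := fun c hc x => by
    simpa [hV, lev_add, lev_mul_per hq] using hc
  have hgc : ContDiffOn ℂ 1 g V := hg.contDiffOn hVo
  have hder : ∀ c ∈ V, HasDerivAt (fun c => perInt P.per c g) 0 c := by
    intro c hc
    have hcd : ContinuousOn (deriv g) V := hgc.continuousOn_deriv_of_isOpen hVo (by norm_num)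
    have hline : ∀ c ∈ V, ContinuousOn (fun x : ℝ => c + x * P.per) (Set.Icc 0 1) := fun c _ => by
      fun_prop
    obtain ⟨C, hC⟩ := isCompact_Icc.exists_bound_of_continuousOn
      (hcd.comp (hline c hc) fun x _ => hshift c hc x)
    have hev : ∀ᶠ c' in 𝓝 c, ∀ x ∈ Set.Icc (0 : ℝ) 1, ‖deriv g (c' + x * P.per)‖ < C + 1 := by
      refine isCompact_Icc.eventually_forall_of_forall_eventually fun x hx => ?_
      have h1 : ContinuousAt (fun q : ℂ × ℝ => deriv g (q.1 + q.2 * P.per)) (c, x) :=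
        ContinuousAt.comp (f := fun q : ℂ × ℝ => q.1 + q.2 * P.per)
          (hcd.continuousAt (hVo.mem_nhds (hshift c hc x))) (by fun_prop)
      exact h1.norm.eventually_lt (continuousAt_const (y := C + 1))
        (by have := hC x hx; simp only [Function.comp_apply] at this ⊢; linarith)
    have hI : Set.uIoc (0 : ℝ) 1 ⊆ Set.Icc 0 1 := by
      rw [Set.uIoc_of_le zero_le_one]; exact Set.Ioc_subset_Icc_self
    have hmain := (intervalIntegral.hasDerivAt_integral_of_dominated_loc_of_deriv_le (𝕜 := ℂ)
      (μ := MeasureTheory.volume) (a := 0) (b := 1)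
      (F := fun c (x : ℝ) => g (c + x * P.per)) (F' := fun c (x : ℝ) => deriv g (c + x * P.per))
      (bound := fun _ => C + 1) (x₀ := c) (Filter.inter_mem hev (hVo.mem_nhds hc)) ?_ ?_ ?_ ?_ ?_ ?_).2
    -- The derivative with respect to the base point is the integral of `g'` over the segment.
    -- Multiplied by the period it equals `g (c + per) - g c = 0`.
    · have hfun : ∀ x ∈ Set.uIcc (0 : ℝ) 1, HasDerivAt (fun x : ℝ => g (c + x * P.per))
          (deriv g (c + x * P.per) * P.per) x := by
        intro x _
        have h1 := (hg.differentiableAt (hVo.mem_nhds (hshift c hc x))).hasDerivAt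
        have h2 : HasDerivAt (fun x : ℝ => c + x * P.per) P.per x := by
          simpa using ((Complex.ofRealCLM.hasDerivAt (x := x)).mul_const P.per).const_add c
        exact h1.comp x h2
      have hFTC := intervalIntegral.integral_eq_sub_of_hasDerivAt hfun (by
        refine ContinuousOn.intervalIntegrable ?_
        refine (hcd.comp ?_ fun x _ => hshift c hc x).mul continuousOn_const
        fun_prop)
      rw [intervalIntegral.integral_mul_const] at hFTC
      have hp : P.per ≠ 0 := by
        have := logq_ne_zero hq
        simp [per, this, Real.pi_ne_zero]
      have h0 : g (c + ((1 : ℝ) : ℂ) * P.per) - g (c + ((0 : ℝ) : ℂ) * P.per) = 0 := by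
        simp [hper c hc]
      rw [h0] at hFTC
      rw [(mul_eq_zero.1 hFTC).resolve_right hp] at hmain
      exact hmain
    · filter_upwards [hVo.mem_nhds hc] with c' hc'
      exact ((hg.continuousOn.comp (by fun_prop) fun x _ => hshift c' hc' x :
        ContinuousOn (fun x : ℝ => g (c' + x * P.per)) _)).aestronglyMeasurable measurableSet_uIoc
    · exact ContinuousOn.intervalIntegrable
        (hg.continuousOn.comp (by fun_prop) fun x _ => hshift c hc x)
    · exact ((hcd.comp (by fun_prop) fun x _ => hshift c hc x :
        ContinuousOn (fun x : ℝ => deriv g (c + x * P.per)) _)).aestronglyMeasurable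
        measurableSet_uIoc
    · exact Eventually.of_forall fun x hx c' hc' => (hc'.1 x (hI hx)).le
    · simp
    · exact Eventually.of_forall fun x hx c' hc' =>
        ((hg.differentiableAt (hVo.mem_nhds (hshift c' hc'.2 x))).hasDerivAt).comp_add_const c' _
  exact hVo.is_const_of_deriv_eq_zero hVc.isPreconnected
    (fun c hc => (hder c hc).differentiableAt.differentiableWithinAt)
    (fun c hc => (hder c hc).deriv) h₁ h₂

end Params
end EllipticVO
end

/-! ### Contour integrals between two families of poles -/

open Filter Topology
noncomputable section
namespace EllipticVO

/-- Two families of pole divisors for a contour integral in `u` depending on parameters `Y`: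
`a_j z(β_j(Y) - u) = 1`, to stay inside of the contour, and `b_i z(u - α_i(Y)) = 1`, to stay
outside. -/
structure Poles (E : Type) [NormedAddCommGroup E] [NormedSpace ℂ E] where
  J : Type
  I : Type
  [finJ : Fintype J]
  [finI : Fintype I]
  β : J → E → ℂ
  α : I → E → ℂ
  a : J → ℕ → ℂ
  b : I → ℕ → ℂ
  A : J → ℝ
  B : I → ℝ
  hβ : ∀ j, ContDiff ℂ 1 (β j)
  hα : ∀ i, ContDiff ℂ 1 (α i)
  ha : ∀ j, Summable fun k => ‖a j k‖
  hb : ∀ i, Summable fun k => ‖b i k‖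
  hA : ∀ j k, ‖a j k‖ ≤ A j
  hB : ∀ i k, ‖b i k‖ ≤ B i

namespace Poles

attribute [instance] Poles.finJ Poles.finI

variable {E : Type} [NormedAddCommGroup E] [NormedSpace ℂ E] (D : Poles E) (P : Params)

/-- The denominator with zeros inside of the contour. -/
def din (X : ℂ × E) : ℂ := ∏ j, Pr (D.a j) (P.z (D.β j X.2 - X.1))

/-- The denominator with zeros outside of the contour. -/
def dout (X : ℂ × E) : ℂ := ∏ i, Pr (D.b i) (P.z (X.1 - D.α i X.2))

/-- The denominator of the integral, with zeros where the contour is pinched. -/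
def res (Y : E) : ℂ := ∏ j, ∏ i, Pr (conv (D.a j) (D.b i)) (P.z (D.β j Y - D.α i Y))

/-- The level `t` is outside of the poles of the first family. -/
def Above (Y : E) (t : ℝ) : Prop := ∀ j, D.A j * Real.exp (P.lev (D.β j Y) - t) < 1

/-- The level `t` is inside of the poles of the second family. -/
def Below (Y : E) (t : ℝ) : Prop := ∀ i, D.B i * Real.exp (t - P.lev (D.α i Y)) < 1

/-- The numerators: holomorphic functions, periodic in the first variable. -/
def Good (P : Params) (N : ℂ × E → ℂ) : Prop :=
  ContDiff ℂ 1 N ∧ ∀ u Y, N (u + P.per, Y) = N (u, Y)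

theorem A_nonneg (j : D.J) : 0 ≤ D.A j := (norm_nonneg _).trans (D.hA j 0)

theorem B_nonneg (i : D.I) : 0 ≤ D.B i := (norm_nonneg _).trans (D.hB i 0)

variable {D P}

theorem Above.mono {Y : E} {s t : ℝ} (h : D.Above P Y s) (hst : s ≤ t) : D.Above P Y t := fun j =>
  lt_of_le_of_lt (mul_le_mul_of_nonneg_left (Real.exp_le_exp.2 (by linarith)) (D.A_nonneg j)) (h j)

theorem Below.mono {Y : E} {s t : ℝ} (h : D.Below P Y t) (hst : s ≤ t) : D.Below P Y s := fun i =>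
  lt_of_le_of_lt (mul_le_mul_of_nonneg_left (Real.exp_le_exp.2 (by linarith)) (D.B_nonneg i)) (h i)

variable (D P)

theorem isOpen_above (Y : E) : IsOpen {t | D.Above P Y t} := by
  simp only [Above, Set.ofPred_forall]
  exact isOpen_iInter_of_finite fun j => isOpen_lt (by fun_prop) continuous_const

theorem isOpen_below (Y : E) : IsOpen {t | D.Below P Y t} := by
  simp only [Below, Set.ofPred_forall]
  exact isOpen_iInter_of_finite fun j => isOpen_lt (by fun_prop) continuous_const

theorem eventually_above {Y : E} {t : ℝ} (h : D.Above P Y t) : ∀ᶠ Y' in 𝓝 Y, D.Above P Y' t := by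
  refine Filter.eventually_all.2 fun j => ?_
  have : ContinuousAt (fun Y => D.A j * Real.exp (P.lev (D.β j Y) - t)) Y :=
    continuousAt_const.mul (Real.continuous_exp.continuousAt.comp
      ((P.continuous_lev.continuousAt.comp (D.hβ j).continuous.continuousAt).sub continuousAt_const))
  exact this.eventually_lt continuousAt_const (h j)

theorem eventually_below {Y : E} {t : ℝ} (h : D.Below P Y t) : ∀ᶠ Y' in 𝓝 Y, D.Below P Y' t := by
  refine Filter.eventually_all.2 fun j => ?_
  have : ContinuousAt (fun Y => D.B j * Real.exp (t - P.lev (D.α j Y))) Y :=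
    continuousAt_const.mul (Real.continuous_exp.continuousAt.comp
      (continuousAt_const.sub
        (P.continuous_lev.continuousAt.comp (D.hα j).continuous.continuousAt)))
  exact this.eventually_lt continuousAt_const (h j)

/-- The numerators form a ring. -/
def goodRing (P : Params) (E : Type) [NormedAddCommGroup E] [NormedSpace ℂ E] :
    Subring (ℂ × E → ℂ) where
  carrier := {N | Good P N}
  mul_mem' hf hg := ⟨hf.1.mul hg.1, fun u Y => by simp [hf.2, hg.2]⟩
  one_mem' := ⟨contDiff_const, fun _ _ => rfl⟩
  add_mem' hf hg := ⟨hf.1.add hg.1, fun u Y => by simp [hf.2, hg.2]⟩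
  zero_mem' := ⟨contDiff_const, fun _ _ => rfl⟩
  neg_mem' hf := ⟨hf.1.neg, fun u Y => by simp [hf.2]⟩

theorem good_in (hq : P.logq.re < 0) (j : D.J) (c : ℂ) :
    Good P fun X : ℂ × E => c * P.z (D.β j X.2 - X.1) := by
  refine ⟨contDiff_const.mul (P.contDiff_z.comp
    (((D.hβ j).comp contDiff_snd).sub contDiff_fst)), fun u Y => ?_⟩
  simp only [P.z_sub, Params.z_add_per hq]

theorem good_out (hq : P.logq.re < 0) (i : D.I) (c : ℂ) :
    Good P fun X : ℂ × E => c * P.z (X.1 - D.α i X.2) := by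
  refine ⟨contDiff_const.mul (P.contDiff_z.comp
    (contDiff_fst.sub ((D.hα i).comp contDiff_snd))), fun u Y => ?_⟩
  simp only [P.z_sub, Params.z_add_per hq]

/-- The data with finitely many factors dropped. -/
def drop (T : Finset ℕ) : Poles E where
  J := D.J
  I := D.I
  β := D.β
  α := D.α
  a := fun j => dropSet T (D.a j)
  b := fun i => dropSet T (D.b i)
  A := D.A
  B := D.B
  hβ := D.hβ
  hα := D.hα
  ha := fun j => summable_dropSet (D.ha j) T
  hb := fun i => summable_dropSet (D.hb i) T
  hA := fun j k => (norm_dropSet_le T _ k).trans (D.hA j k)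
  hB := fun i k => (norm_dropSet_le T _ k).trans (D.hB i k)

theorem contDiff_din : ContDiff ℂ 1 (D.din P) :=
  contDiff_prod fun j _ => (contDiff_Pr (D.ha j)).comp
    (P.contDiff_z.comp (((D.hβ j).comp contDiff_snd).sub contDiff_fst))

theorem contDiff_dout : ContDiff ℂ 1 (D.dout P) :=
  contDiff_prod fun i _ => (contDiff_Pr (D.hb i)).comp
    (P.contDiff_z.comp (contDiff_fst.sub ((D.hα i).comp contDiff_snd)))

theorem contDiff_res : ContDiff ℂ 1 (D.res P) :=
  contDiff_prod fun j _ => contDiff_prod fun i _ =>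
    (contDiff_Pr (summable_conv (D.ha j) (D.hb i))).comp
      (P.contDiff_z.comp ((D.hβ j).sub (D.hα i)))

theorem din_per (hq : P.logq.re < 0) (u : ℂ) (Y : E) : D.din P (u + P.per, Y) = D.din P (u, Y) := by
  simp only [din, P.z_sub, Params.z_add_per hq]

theorem dout_per (hq : P.logq.re < 0) (u : ℂ) (Y : E) :
    D.dout P (u + P.per, Y) = D.dout P (u, Y) := by
  simp only [dout, P.z_sub, Params.z_add_per hq]

variable {D P}

theorem din_ne_zero {u : ℂ} {Y : E} (h : D.Above P Y (P.lev u)) : D.din P (u, Y) ≠ 0 :=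
  Finset.prod_ne_zero_iff.2 fun j _ => Pr_ne_zero_of_norm (D.ha j) (D.hA j) (by
    rw [P.norm_z, P.lev_sub]; exact h j)

theorem dout_ne_zero {u : ℂ} {Y : E} (h : D.Below P Y (P.lev u)) : D.dout P (u, Y) ≠ 0 :=
  Finset.prod_ne_zero_iff.2 fun i _ => Pr_ne_zero_of_norm (D.hb i) (D.hB i) (by
    rw [P.norm_z, P.lev_sub]; exact h i)

variable (D P)

theorem din_split (T : Finset ℕ) (X : ℂ × E) : D.din P X =
    (∏ m ∈ Finset.univ ×ˢ T, (1 - D.a m.1 m.2 * P.z (D.β m.1 X.2 - X.1))) *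
      (D.drop T).din P X := by
  rw [Finset.prod_product, din, din]
  change _ = _ * ∏ j : D.J, _
  rw [← Finset.prod_mul_distrib]
  exact Finset.prod_congr rfl fun j _ => Pr_split (D.ha j) T _

theorem dout_split (T : Finset ℕ) (X : ℂ × E) : D.dout P X =
    (∏ m ∈ Finset.univ ×ˢ T, (1 - D.b m.1 m.2 * P.z (X.1 - D.α m.1 X.2))) *
      (D.drop T).dout P X := by
  rw [Finset.prod_product, dout, dout]
  change _ = _ * ∏ j : D.I, _
  rw [← Finset.prod_mul_distrib]
  exact Finset.prod_congr rfl fun j _ => Pr_split (D.hb j) T _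

/-- The factors of `res` that belong to large indices. -/
def resTail (T : Finset ℕ) (Y : E) : ℂ :=
  ∏ j, ∏ i, Pr (dropSet ((T ×ˢ T).map Nat.pairEquiv.toEmbedding) (conv (D.a j) (D.b i)))
    (P.z (D.β j Y - D.α i Y))

theorem contDiff_resTail (T : Finset ℕ) : ContDiff ℂ 1 (D.resTail P T) :=
  contDiff_prod fun j _ => contDiff_prod fun i _ =>
    (contDiff_Pr (summable_dropSet (summable_conv (D.ha j) (D.hb i)) _)).comp
      (P.contDiff_z.comp ((D.hβ j).sub (D.hα i)))

/-- The product of `z (β - u)` and `z (u - α)` no longer contains `u`, so every factor of `res` is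
`1 - A B` with `A` from `din` and `B` from `dout`. The finite part has the form required by
`bezout_prod`. -/
theorem res_split (T : Finset ℕ) (X : ℂ × E) : D.res P X.2 =
    (∏ m ∈ Finset.univ ×ˢ T, ∏ n ∈ Finset.univ ×ˢ T,
      (1 - D.a m.1 m.2 * P.z (D.β m.1 X.2 - X.1) * (D.b n.1 n.2 * P.z (X.1 - D.α n.1 X.2)))) *
      D.resTail P T X.2 := by
  rw [Finset.prod_product, res, resTail, ← Finset.prod_mul_distrib]
  refine Finset.prod_congr rfl fun j _ => ?_
  simp only [Finset.prod_product]
  rw [Finset.prod_comm, ← Finset.prod_mul_distrib]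
  refine Finset.prod_congr rfl fun i _ => ?_
  rw [Pr_split (summable_conv (D.ha j) (D.hb i)) ((T ×ˢ T).map Nat.pairEquiv.toEmbedding)]
  congr 1
  rw [Finset.prod_map, Finset.prod_product]
  refine Finset.prod_congr rfl fun k _ => Finset.prod_congr rfl fun k' _ => ?_
  have e : conv (D.a j) (D.b i) (Nat.pairEquiv.toEmbedding (k, k')) = D.a j k * D.b i k' := by
    simp only [conv, Equiv.coe_toEmbedding]
    rw [show Nat.pairEquiv (k, k') = Nat.pair k k' from rfl, Nat.unpair_pair]
  have e2 : P.z (D.β j X.2 - D.α i X.2) = P.z (D.β j X.2 - X.1) * P.z (X.1 - D.α i X.2) := by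
    rw [← P.z_add]; congr 1; ring
  rw [e, e2]
  ring

/-- For all parameters in a ball, one fixed circle lies outside of the inner poles and another one
inside of the outer poles. -/
theorem exists_level_bound [ProperSpace E] (M : ℝ) : ∃ s : ℝ, 0 ≤ s ∧
    ∀ Y ∈ Metric.closedBall (0 : E) M, D.Above P Y s ∧ D.Below P Y (-s) ∧
      (∀ j, |P.lev (D.β j Y)| ≤ s) ∧ ∀ i, |P.lev (D.α i Y)| ≤ s := by
  have hc := isCompact_closedBall (0 : E) M
  choose L hL using fun j => hc.exists_bound_of_continuousOn
    (P.continuous_lev.comp (D.hβ j).continuous).continuousOn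
  choose L' hL' using fun i => hc.exists_bound_of_continuousOn
    (P.continuous_lev.comp (D.hα i).continuous).continuousOn
  set S : ℝ := ∑ j, (|L j| + D.A j) + ∑ i, (|L' i| + D.B i) with hS
  have h1 : ∀ j, |L j| + D.A j ≤ S := fun j => by
    have := Finset.single_le_sum (f := fun j => |L j| + D.A j)
      (fun j _ => add_nonneg (abs_nonneg _) (D.A_nonneg j)) (Finset.mem_univ j)
    have h2 : 0 ≤ ∑ i, (|L' i| + D.B i) :=
      Finset.sum_nonneg fun i _ => add_nonneg (abs_nonneg _) (D.B_nonneg i)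
    linarith
  have h2 : ∀ i, |L' i| + D.B i ≤ S := fun i => by
    have := Finset.single_le_sum (f := fun i => |L' i| + D.B i)
      (fun j _ => add_nonneg (abs_nonneg _) (D.B_nonneg j)) (Finset.mem_univ i)
    have h2 : 0 ≤ ∑ j, (|L j| + D.A j) :=
      Finset.sum_nonneg fun i _ => add_nonneg (abs_nonneg _) (D.A_nonneg i)
    linarith
  have h0 : 0 ≤ S := add_nonneg
    (Finset.sum_nonneg fun i _ => add_nonneg (abs_nonneg _) (D.A_nonneg i))
    (Finset.sum_nonneg fun i _ => add_nonneg (abs_nonneg _) (D.B_nonneg i))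
  -- A coefficient of size `A` is compensated by raising the level by `A`, since `A * exp (-A) < 1`.
  have key : ∀ A L x : ℝ, 0 ≤ A → |L| + A ≤ S → x ≤ |L| → A * Real.exp (x - S) < 1 := by
    intro A L x hA hAL hx
    have e1 : Real.exp (x - S) ≤ Real.exp (-A) := Real.exp_le_exp.2 (by linarith)
    have e2 : A < Real.exp A := by linarith [Real.add_one_le_exp A]
    calc A * Real.exp (x - S) ≤ A * Real.exp (-A) := by gcongr
      _ < Real.exp A * Real.exp (-A) := by gcongr
      _ = 1 := by rw [← Real.exp_add]; simp
  refine ⟨S, h0, fun Y hY => ⟨fun j => ?_, fun i => ?_, fun j => ?_, fun i => ?_⟩⟩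
  · have := hL j Y hY
    simp only [Function.comp_apply, Real.norm_eq_abs] at this
    exact key _ (L j) _ (D.A_nonneg j) (h1 j)
      ((le_abs_self _).trans (this.trans (le_abs_self _)))
  · have := hL' i Y hY
    simp only [Function.comp_apply, Real.norm_eq_abs] at this
    rw [show -S - P.lev (D.α i Y) = -P.lev (D.α i Y) - S by ring]
    exact key _ (L' i) _ (D.B_nonneg i) (h2 i)
      ((neg_le_abs _).trans (this.trans (le_abs_self _)))
  · have := hL j Y hY
    simp only [Function.comp_apply, Real.norm_eq_abs] at this
    linarith [h1 j, D.A_nonneg j, le_abs_self (L j)]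
  · have := hL' i Y hY
    simp only [Function.comp_apply, Real.norm_eq_abs] at this
    linarith [h2 i, D.B_nonneg i, le_abs_self (L' i)]

theorem exists_tail {ι : Type*} [Fintype ι] {a : ι → ℕ → ℂ} (ha : ∀ j, Summable fun k => ‖a j k‖)
    {ε : ℝ} (hε : 0 < ε) : ∃ K, ∀ K' ≥ K, ∀ j k, ‖dropSet (Finset.range K') (a j) k‖ ≤ ε := by
  have : ∀ j, ∃ K, ∀ k ≥ K, ‖a j k‖ ≤ ε := fun j => by
    have := (ha j).tendsto_atTop_zero.eventually_le_const hε
    simpa using this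
  choose K hK using this
  refine ⟨∑ j, K j, fun K' hK' j k => ?_⟩
  rw [dropSet]
  split_ifs with h
  · simpa using hε.le
  · refine hK j k ?_
    have := Finset.single_le_sum (f := K) (fun _ _ => Nat.zero_le _) (Finset.mem_univ j)
    simp at h
    omega

theorem lev_ofReal_div (hq : P.logq.re < 0) (s : ℝ) :
    P.lev ((s / (2 * P.logq.re) : ℝ) : ℂ) = s := by
  rw [P.lev_real]; have := hq.ne; field_simp

/-- The integral over a contour separating the two families of poles, times `res`, continues to
a ball. -/
theorem exists_local [ProperSpace E] (hq : P.logq.re < 0) (M : ℝ) :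
    ∃ (H : (ℂ × E → ℂ) → E → ℂ) (M' C : ℝ), 0 ≤ C ∧
      (∀ N, Good P N → ContDiffOn ℂ 1 (H N) (Metric.ball 0 (M + 1))) ∧
      (∀ N, Good P N → ∀ Y ∈ Metric.ball (0 : E) (M + 1), ∀ c : ℂ, D.Above P Y (P.lev c) →
        D.Below P Y (P.lev c) → H N Y = D.res P Y *
          perInt P.per c fun u => N (u, Y) / (D.din P (u, Y) * D.dout P (u, Y))) ∧
      ∀ N, Good P N → ∀ b : ℝ, (∀ X : ℂ × E, ‖X‖ ≤ M' → ‖N X‖ ≤ b) →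
        ∀ Y : E, ‖Y‖ ≤ M → ‖H N Y‖ ≤ C * b := by
  obtain ⟨s, hs0, hs⟩ := D.exists_level_bound P (M + 1)
  -- The centres have levels between `-s` and `s`. With coefficients below this `ε` the inner tail
  -- has no zero at levels above `-s - 1` and the outer tail none at levels below `s + 1`.
  set ε : ℝ := Real.exp (-(2 * s + 1)) / 2 with hε
  have hε0 : 0 < ε := by positivity
  obtain ⟨K₁, hK₁⟩ := exists_tail D.ha hε0
  obtain ⟨K₂, hK₂⟩ := exists_tail D.hb hε0
  set T := Finset.range (max K₁ K₂) with hT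
  have htail_in : ∀ Y ∈ Metric.closedBall (0 : E) (M + 1), ∀ u : ℂ, -s - 1 < P.lev u →
      (D.drop T).din P (u, Y) ≠ 0 := by
    intro Y hY u hu
    refine Finset.prod_ne_zero_iff.2 fun j _ => Pr_ne_zero_of_norm ((D.drop T).ha j)
      (A := ε) (hK₁ _ (le_max_left _ _) j) ?_
    change ε * ‖P.z (D.β j Y - u)‖ < 1
    rw [P.norm_z, P.lev_sub]
    have h1 := (abs_le.1 ((hs Y hY).2.2.1 j)).2
    have h2 : Real.exp (P.lev (D.β j Y) - P.lev u) ≤ Real.exp (2 * s + 1) :=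
      Real.exp_le_exp.2 (by linarith)
    calc ε * Real.exp (P.lev (D.β j Y) - P.lev u) ≤ ε * Real.exp (2 * s + 1) := by gcongr
      _ = 1 / 2 := by rw [hε, div_mul_eq_mul_div, ← Real.exp_add]; simp
      _ < 1 := by norm_num
  have htail_out : ∀ Y ∈ Metric.closedBall (0 : E) (M + 1), ∀ u : ℂ, P.lev u < s + 1 →
      (D.drop T).dout P (u, Y) ≠ 0 := by
    intro Y hY u hu
    refine Finset.prod_ne_zero_iff.2 fun i _ => Pr_ne_zero_of_norm ((D.drop T).hb i)
      (A := ε) (hK₂ _ (le_max_right _ _) i) ?_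
    change ε * ‖P.z (u - D.α i Y)‖ < 1
    rw [P.norm_z, P.lev_sub]
    have h1 := (abs_le.1 ((hs Y hY).2.2.2 i)).1
    have h2 : Real.exp (P.lev u - P.lev (D.α i Y)) ≤ Real.exp (2 * s + 1) :=
      Real.exp_le_exp.2 (by linarith)
    calc ε * Real.exp (P.lev u - P.lev (D.α i Y)) ≤ ε * Real.exp (2 * s + 1) := by gcongr
      _ = 1 / 2 := by rw [hε, div_mul_eq_mul_div, ← Real.exp_add]; simp
      _ < 1 := by norm_num
  -- The identity is used inside `goodRing`, so that its coefficients are again holomorphic and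
  -- periodic in `u` and may stand under a contour integral.
  obtain ⟨X₀, Y₀, hXY⟩ := bezout_prod (R := goodRing P E) (Finset.univ ×ˢ T) (Finset.univ ×ˢ T)
    (fun m : D.J × ℕ => ⟨_, D.good_in P hq m.1 (D.a m.1 m.2)⟩)
    (fun n : D.I × ℕ => ⟨_, D.good_out P hq n.1 (D.b n.1 n.2)⟩)
  have hX₀ : Good P X₀.1 := X₀.2
  have hY₀ : Good P Y₀.1 := Y₀.2
  have hbez : ∀ X : ℂ × E, D.res P X.2 * ((D.drop T).din P X * (D.drop T).dout P X) =
      D.resTail P T X.2 * (X₀.1 X * D.din P X * (D.drop T).dout P X +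
        Y₀.1 X * D.dout P X * (D.drop T).din P X) := by
    intro X
    have h := congrFun (congrArg Subtype.val hXY) X
    simp only [Subring.coe_add, Subring.coe_mul, SubmonoidClass.coe_finsetProd,
      AddSubgroupClass.coe_sub, Finset.prod_apply, Pi.add_apply, Pi.mul_apply, Pi.sub_apply,
      OneMemClass.coe_one, Pi.one_apply] at h
    rw [D.res_split P T X, h, D.din_split P T X, D.dout_split P T X]
    ring
  set c₁ : ℂ := ((-s / (2 * P.logq.re) : ℝ) : ℂ) with hc₁
  set c₂ : ℂ := ((s / (2 * P.logq.re) : ℝ) : ℂ) with hc₂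
  have lc₁ : P.lev c₁ = -s := lev_ofReal_div P hq _
  have lc₂ : P.lev c₂ = s := lev_ofReal_div P hq _
  -- Now `res / (din * dout) = resTail * (w₁ + w₂)`. Apart from the dropped tails, `w₁` has only
  -- outer poles and `w₂` only inner ones. Their contours may be placed at the levels `-s` and `s`
  -- for every parameter in the ball.
  set w₁ : ℂ × E → ℂ := fun X => X₀.1 X / (D.dout P X * (D.drop T).din P X) with hw₁
  set w₂ : ℂ × E → ℂ := fun X => Y₀.1 X / (D.din P X * (D.drop T).dout P X) with hw₂
  have sm₁ : ∀ X : ℂ × E, D.dout P X * (D.drop T).din P X ≠ 0 → ContDiffAt ℂ 1 w₁ X := fun X hX =>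
    hX₀.1.contDiffAt.div ((D.contDiff_dout P).mul ((D.drop T).contDiff_din P)).contDiffAt hX
  have sm₂ : ∀ X : ℂ × E, D.din P X * (D.drop T).dout P X ≠ 0 → ContDiffAt ℂ 1 w₂ X := fun X hX =>
    hY₀.1.contDiffAt.div ((D.contDiff_din P).mul ((D.drop T).contDiff_dout P)).contDiffAt hX
  have lev_line : ∀ (c : ℂ) (x : ℝ), P.lev (c + x * P.per) = P.lev c := fun c x => by
    rw [P.lev_add, Params.lev_mul_per hq, add_zero]
  have nz₁ : ∀ Y ∈ Metric.closedBall (0 : E) (M + 1), ∀ x : ℝ,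
      D.dout P (c₁ + x * P.per, Y) * (D.drop T).din P (c₁ + x * P.per, Y) ≠ 0 := fun Y hY x =>
    mul_ne_zero (dout_ne_zero (by rw [lev_line, lc₁]; exact (hs Y hY).2.1))
      (htail_in Y hY _ (by rw [lev_line, lc₁]; linarith))
  have nz₂ : ∀ Y ∈ Metric.closedBall (0 : E) (M + 1), ∀ x : ℝ,
      D.din P (c₂ + x * P.per, Y) * (D.drop T).dout P (c₂ + x * P.per, Y) ≠ 0 := fun Y hY x =>
    mul_ne_zero (din_ne_zero (by rw [lev_line, lc₂]; exact (hs Y hY).1))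
      (htail_out Y hY _ (by rw [lev_line, lc₂]; linarith))
  set H : (ℂ × E → ℂ) → E → ℂ := fun N Y => D.resTail P T Y *
    ((perInt P.per c₁ fun u => N (u, Y) * w₁ (u, Y)) +
      perInt P.per c₂ fun u => N (u, Y) * w₂ (u, Y)) with hH
  -- bounds
  have hbd : ∀ (c : ℂ) (w : ℂ × E → ℂ), (∀ Y ∈ Metric.closedBall (0 : E) (M + 1), ∀ x : ℝ,
      ContDiffAt ℂ 1 w (c + x * P.per, Y)) → ∃ B : ℝ, 0 ≤ B ∧
      ∀ Y ∈ Metric.closedBall (0 : E) (M + 1), ∀ x ∈ Set.Icc (0 : ℝ) 1,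
        ‖w (c + x * P.per, Y)‖ ≤ B := by
    intro c w hw
    have hcomp := (isCompact_closedBall (0 : E) (M + 1)).prod (isCompact_Icc (a := (0 : ℝ)) (b := 1))
    obtain ⟨B, hB⟩ := hcomp.exists_bound_of_continuousOn
      (f := fun q : E × ℝ => w (c + q.2 * P.per, q.1)) (by
        intro q hq'
        exact (ContinuousAt.comp (f := fun q : E × ℝ => ((c + q.2 * P.per, q.1) : ℂ × E))
          (hw q.1 hq'.1 q.2).continuousAt (by fun_prop)).continuousWithinAt)
    exact ⟨|B|, abs_nonneg _, fun Y hY x hx => (hB (Y, x) ⟨hY, hx⟩).trans (le_abs_self _)⟩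
  obtain ⟨B₁, hB₁0, hB₁⟩ := hbd c₁ w₁ fun Y hY x => sm₁ _ (nz₁ Y hY x)
  obtain ⟨B₂, hB₂0, hB₂⟩ := hbd c₂ w₂ fun Y hY x => sm₂ _ (nz₂ Y hY x)
  obtain ⟨B₃, hB₃⟩ := (isCompact_closedBall (0 : E) (M + 1)).exists_bound_of_continuousOn
    (D.contDiff_resTail P T).continuous.continuousOn
  refine ⟨H, max |M| (max (‖c₁‖ + ‖P.per‖) (‖c₂‖ + ‖P.per‖)), |B₃| * (B₁ + B₂), by positivity,
    ?_, ?_, ?_⟩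
  · intro N hN
    refine (D.contDiff_resTail P T).contDiffOn.mul (ContDiffOn.add ?_ ?_)
    · exact contDiffOn_perInt (F := fun X => N X * w₁ X) Metric.isOpen_ball fun x _ Y hY =>
        hN.1.contDiffAt.mul (sm₁ _ (nz₁ Y (Metric.ball_subset_closedBall hY) x))
    · exact contDiffOn_perInt (F := fun X => N X * w₂ X) Metric.isOpen_ball fun x _ Y hY =>
        hN.1.contDiffAt.mul (sm₂ _ (nz₂ Y (Metric.ball_subset_closedBall hY) x))
  · intro N hN Y hY c hca hcb
    have hY' := Metric.ball_subset_closedBall hY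
    have line : ContDiff ℂ 1 fun u : ℂ => ((u, Y) : ℂ × E) :=
      contDiff_id.prodMk contDiff_const
    have dAbove : ∀ {u : ℂ}, D.Above P Y (P.lev u) → (D.drop T).din P (u, Y) ≠ 0 := fun h =>
      din_ne_zero (D := D.drop T) h
    have dBelow : ∀ {u : ℂ}, D.Below P Y (P.lev u) → (D.drop T).dout P (u, Y) ≠ 0 := fun h =>
      dout_ne_zero (D := D.drop T) h
    have sh₁ : perInt P.per c₁ (fun u => N (u, Y) * w₁ (u, Y)) =
        perInt P.per c (fun u => N (u, Y) * w₁ (u, Y)) := by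
      -- A convex set of levels without poles of `w₁`: inside of the outer poles, and outside of the
      -- dropped inner ones either by the choice of `ε` or because the level is above all inner
      -- poles. It contains both the level `-s` and that of `c`.
      set S : Set ℝ := {t | -s - 1 < t ∨ D.Above P Y t} ∩ {t | D.Below P Y t} with hS
      have hSo : IsOpen S := (isOpen_Ioi.union (D.isOpen_above P Y)).inter (D.isOpen_below P Y)
      have hSc : Convex ℝ S := by
        refine Set.OrdConnected.convex (Set.OrdConnected.inter ?_ ?_)
        · refine IsUpperSet.ordConnected fun t t' htt' ht => ?_
          rcases ht with h | h
          · exact Or.inl (lt_of_lt_of_le h htt')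
          · exact Or.inr (h.mono htt')
        · exact IsLowerSet.ordConnected fun t t' htt' ht => Below.mono ht htt'
      have hnz : ∀ u ∈ P.lev ⁻¹' S, D.dout P (u, Y) * (D.drop T).din P (u, Y) ≠ 0 := by
        rintro u ⟨h1, h2⟩
        refine mul_ne_zero (dout_ne_zero h2) ?_
        rcases h1 with h1 | h1
        · exact htail_in Y hY' u h1
        · exact dAbove h1
      refine Params.perInt_eq_of_differentiableOn hq hSo hSc (fun u hu => ?_) (fun u hu => ?_)
        ⟨Or.inl (by rw [lc₁]; linarith), by rw [lc₁]; exact (hs Y hY').2.1⟩ ⟨Or.inr hca, hcb⟩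
      · have := (hN.1.contDiffAt.mul (sm₁ _ (hnz u hu))).comp u line.contDiffAt
        exact (this.differentiableAt (by norm_num)).differentiableWithinAt
      · simp only [hw₁, hN.2, hX₀.2, D.dout_per P hq, (D.drop T).din_per P hq]
    have sh₂ : perInt P.per c₂ (fun u => N (u, Y) * w₂ (u, Y)) =
        perInt P.per c (fun u => N (u, Y) * w₂ (u, Y)) := by
      set S : Set ℝ := {t | t < s + 1 ∨ D.Below P Y t} ∩ {t | D.Above P Y t} with hS
      have hSo : IsOpen S := (isOpen_Iio.union (D.isOpen_below P Y)).inter (D.isOpen_above P Y)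
      have hSc : Convex ℝ S := by
        refine Set.OrdConnected.convex (Set.OrdConnected.inter ?_ ?_)
        · refine IsLowerSet.ordConnected fun t t' htt' ht => ?_
          rcases ht with h | h
          · exact Or.inl (lt_of_le_of_lt htt' h)
          · exact Or.inr (h.mono htt')
        · exact IsUpperSet.ordConnected fun t t' htt' ht => Above.mono ht htt'
      have hnz : ∀ u ∈ P.lev ⁻¹' S, D.din P (u, Y) * (D.drop T).dout P (u, Y) ≠ 0 := by
        rintro u ⟨h1, h2⟩
        refine mul_ne_zero (din_ne_zero h2) ?_
        rcases h1 with h1 | h1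
        · exact htail_out Y hY' u h1
        · exact dBelow h1
      refine Params.perInt_eq_of_differentiableOn hq hSo hSc (fun u hu => ?_) (fun u hu => ?_)
        ⟨Or.inl (by rw [lc₂]; linarith), by rw [lc₂]; exact (hs Y hY').1⟩ ⟨Or.inr hcb, hca⟩
      · have := (hN.1.contDiffAt.mul (sm₂ _ (hnz u hu))).comp u line.contDiffAt
        exact (this.differentiableAt (by norm_num)).differentiableWithinAt
      · simp only [hw₂, hN.2, hY₀.2, D.din_per P hq, (D.drop T).dout_per P hq]
    have hnzc : ∀ x : ℝ, D.din P (c + x * P.per, Y) ≠ 0 ∧ D.dout P (c + x * P.per, Y) ≠ 0 ∧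
        (D.drop T).din P (c + x * P.per, Y) ≠ 0 ∧ (D.drop T).dout P (c + x * P.per, Y) ≠ 0 := by
      intro x
      have l := lev_line c x
      exact ⟨din_ne_zero (by rwa [l]), dout_ne_zero (by rwa [l]), dAbove (by rwa [l]),
        dBelow (by rwa [l])⟩
    simp only [hH]
    rw [sh₁, sh₂, perInt, perInt, perInt, ← intervalIntegral.integral_add,
      ← intervalIntegral.integral_const_mul, ← intervalIntegral.integral_const_mul]
    · refine intervalIntegral.integral_congr fun x _ => ?_
      obtain ⟨h1, h2, h3, h4⟩ := hnzc x
      have hb := hbez (c + x * P.per, Y)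
      simp only [hw₁, hw₂] at *
      have hb' : D.res P Y = D.resTail P T Y *
          (X₀.1 (c + x * P.per, Y) * D.din P (c + x * P.per, Y) *
              (D.drop T).dout P (c + x * P.per, Y) +
            Y₀.1 (c + x * P.per, Y) * D.dout P (c + x * P.per, Y) *
              (D.drop T).din P (c + x * P.per, Y)) /
            ((D.drop T).din P (c + x * P.per, Y) * (D.drop T).dout P (c + x * P.per, Y)) := by
        rw [← hb]; field_simp
      rw [hb']
      field_simp
    · refine Continuous.intervalIntegrable ?_ _ _
      refine continuous_iff_continuousAt.2 fun x => ?_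
      obtain ⟨h1, h2, h3, h4⟩ := hnzc x
      exact ContinuousAt.comp (f := fun x : ℝ => ((c + x * P.per, Y) : ℂ × E))
        (hN.1.contDiffAt.mul (sm₁ _ (mul_ne_zero h2 h3))).continuousAt (by fun_prop)
    · refine Continuous.intervalIntegrable ?_ _ _
      refine continuous_iff_continuousAt.2 fun x => ?_
      obtain ⟨h1, h2, h3, h4⟩ := hnzc x
      exact ContinuousAt.comp (f := fun x : ℝ => ((c + x * P.per, Y) : ℂ × E))
        (hN.1.contDiffAt.mul (sm₂ _ (mul_ne_zero h1 h4))).continuousAt (by fun_prop)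
  · intro N hN b hb Y hY
    have hYc : Y ∈ Metric.closedBall (0 : E) (M + 1) := by simp; linarith
    have hb0 : 0 ≤ b := (norm_nonneg _).trans (hb 0 (by simp))
    have hint : ∀ (c : ℂ) (w : ℂ × E → ℂ) (B : ℝ), 0 ≤ B →
        ‖c‖ + ‖P.per‖ ≤ max |M| (max (‖c₁‖ + ‖P.per‖) (‖c₂‖ + ‖P.per‖)) →
        (∀ x ∈ Set.Icc (0 : ℝ) 1, ‖w (c + x * P.per, Y)‖ ≤ B) →
        ‖perInt P.per c fun u => N (u, Y) * w (u, Y)‖ ≤ b * B := by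
      intro c w B hB0 hc hw
      have := intervalIntegral.norm_integral_le_of_norm_le_const (a := (0 : ℝ)) (b := 1)
        (f := fun x : ℝ => N (c + x * P.per, Y) * w (c + x * P.per, Y)) (C := b * B) (by
          intro x hx
          rw [Set.uIoc_of_le zero_le_one] at hx
          have hx' : x ∈ Set.Icc (0 : ℝ) 1 := Set.Ioc_subset_Icc_self hx
          rw [norm_mul]
          refine mul_le_mul (hb _ ?_) (hw x hx') (norm_nonneg _) hb0
          rw [Prod.norm_def]
          refine max_le (le_trans ?_ hc) (le_trans (hY.trans (le_abs_self M)) (le_max_left _ _))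
          refine (norm_add_le _ _).trans (add_le_add le_rfl ?_)
          rw [norm_mul, Complex.norm_real, Real.norm_eq_abs, abs_of_nonneg hx'.1]
          exact mul_le_of_le_one_left (norm_nonneg _) hx'.2)
      simpa [perInt] using this
    have e1 := hint c₁ w₁ B₁ hB₁0 (le_trans (le_max_left _ _) (le_max_right _ _)) (hB₁ Y hYc)
    have e2 := hint c₂ w₂ B₂ hB₂0 (le_trans (le_max_right _ _) (le_max_right _ _)) (hB₂ Y hYc)
    simp only [hH]
    rw [norm_mul]
    calc _ ≤ |B₃| * (b * B₁ + b * B₂) := by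
          refine mul_le_mul ((hB₃ Y hYc).trans (le_abs_self _)) ?_ (norm_nonneg _) (abs_nonneg _)
          exact (norm_add_le _ _).trans (add_le_add e1 e2)
      _ = _ := by ring

end Poles
end EllipticVO
end

open Filter Topology
noncomputable section
namespace EllipticVO
namespace Poles

variable {E : Type} [NormedAddCommGroup E] [NormedSpace ℂ E] (D : Poles E) (P : Params)

/-- The integral over a contour separating the two families of poles, times `res`, continues to
an entire function. -/
theorem exists_continuation [ProperSpace E] (hq : P.logq.re < 0) :
    ∃ H : (ℂ × E → ℂ) → E → ℂ, (∀ N, Good P N → ContDiff ℂ 1 (H N)) ∧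
      (∀ N, Good P N → ∀ (Y : E) (c : ℂ), D.Above P Y (P.lev c) →
        D.Below P Y (P.lev c) → H N Y = D.res P Y *
          perInt P.per c fun u => N (u, Y) / (D.din P (u, Y) * D.dout P (u, Y))) ∧
      ∀ M : ℝ, ∃ M' C : ℝ, 0 ≤ C ∧ ∀ N, Good P N → ∀ b : ℝ,
        (∀ X : ℂ × E, ‖X‖ ≤ M' → ‖N X‖ ≤ b) → ∀ Y : E, ‖Y‖ ≤ M → ‖H N Y‖ ≤ C * b := by
  -- If the contour is pinched in every configuration there is nothing to continue, and zero will
  -- do. Otherwise an unpinched configuration is the base point near which the functions on all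
  -- balls agree.
  by_cases hbase : ∃ (Y : E) (c : ℂ), D.Above P Y (P.lev c) ∧ D.Below P Y (P.lev c)
  swap
  · refine ⟨fun _ _ => 0, fun _ _ => contDiff_const, fun N _ Y c h1 h2 =>
      absurd ⟨Y, c, h1, h2⟩ hbase, fun M => ⟨0, 0, le_rfl, fun N _ b _ Y _ => by simp⟩⟩
  obtain ⟨Y₀, c₀, ha₀, hb₀⟩ := hbase
  choose H M' C hC0 hsm hfo hbo using fun n : ℕ => D.exists_local P hq (‖Y₀‖ + n)
  have hball : ∀ (n : ℕ) (Y : E), ‖Y‖ ≤ n → Y ∈ Metric.ball (0 : E) (‖Y₀‖ + n + 1) := by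
    intro n Y hY
    rw [mem_ball_zero_iff]
    linarith [norm_nonneg Y₀]
  have hY₀ : ∀ n : ℕ, Y₀ ∈ Metric.ball (0 : E) (‖Y₀‖ + n + 1) := fun n => by
    rw [mem_ball_zero_iff]
    have : (0 : ℝ) ≤ n := Nat.cast_nonneg n
    linarith
  have hle : ∀ N, Good P N → ∀ n m : ℕ, n ≤ m → ∀ Y ∈ Metric.ball (0 : E) (‖Y₀‖ + n + 1),
      H n N Y = H m N Y := by
    intro N hN n m hnm Y hY
    have hsub : Metric.ball (0 : E) (‖Y₀‖ + n + 1) ⊆ Metric.ball (0 : E) (‖Y₀‖ + m + 1) := by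
      have : (n : ℝ) ≤ m := by exact_mod_cast hnm
      exact Metric.ball_subset_ball (by linarith)
    refine eq_on_ball ((hsm n N hN).differentiableOn (by norm_num))
      (((hsm m N hN).differentiableOn (by norm_num)).mono hsub) (hY₀ n) ?_ hY
    filter_upwards [D.eventually_above P ha₀, D.eventually_below P hb₀,
      Metric.isOpen_ball.mem_nhds (hY₀ n)] with Y h1 h2 h3
    rw [hfo n N hN Y h3 c₀ h1 h2, hfo m N hN Y (hsub h3) c₀ h1 h2]
  have hglob : ∀ N, Good P N → ∀ (n : ℕ), ∀ Y ∈ Metric.ball (0 : E) (‖Y₀‖ + n + 1),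
      H ⌈‖Y‖⌉₊ N Y = H n N Y := by
    intro N hN n Y hY
    rcases le_total ⌈‖Y‖⌉₊ n with h | h
    · exact hle N hN _ _ h Y (hball _ _ (Nat.le_ceil _))
    · exact (hle N hN _ _ h Y hY).symm
  refine ⟨fun N Y => H ⌈‖Y‖⌉₊ N Y, fun N hN => ?_, fun N hN Y c h1 h2 => ?_, fun M => ?_⟩
  · refine contDiff_iff_contDiffAt.2 fun Y => ?_
    have hY := hball _ _ (Nat.le_ceil ‖Y‖)
    refine ((hsm ⌈‖Y‖⌉₊ N hN).contDiffAt (Metric.isOpen_ball.mem_nhds hY)).congr_of_eventuallyEq ?_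
    filter_upwards [Metric.isOpen_ball.mem_nhds hY] with Z hZ using hglob N hN _ Z hZ
  · exact hfo _ N hN Y (hball _ _ (Nat.le_ceil _)) c h1 h2
  · refine ⟨M' ⌈M⌉₊, C ⌈M⌉₊, hC0 _, fun N hN b hb Y hY => ?_⟩
    have hY' : ‖Y‖ ≤ ⌈M⌉₊ := hY.trans (Nat.le_ceil M)
    simp only [hglob N hN _ Y (hball _ _ hY')]
    exact hbo _ N hN b hb Y (by linarith [norm_nonneg Y₀])

/-- The entire function that continues `res` times the contour integral. -/
def cont [ProperSpace E] (hq : P.logq.re < 0) : (ℂ × E → ℂ) → E → ℂ :=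
  (D.exists_continuation P hq).choose

variable [ProperSpace E] {D P}

theorem contDiff_cont (hq : P.logq.re < 0) {N : ℂ × E → ℂ} (hN : Good P N) :
    ContDiff ℂ 1 (D.cont P hq N) := (D.exists_continuation P hq).choose_spec.1 N hN

theorem cont_eq (hq : P.logq.re < 0) {N : ℂ × E → ℂ} (hN : Good P N) {Y : E} {c : ℂ}
    (h₁ : D.Above P Y (P.lev c)) (h₂ : D.Below P Y (P.lev c)) :
    D.cont P hq N Y = D.res P Y *
      perInt P.per c fun u => N (u, Y) / (D.din P (u, Y) * D.dout P (u, Y)) :=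
  (D.exists_continuation P hq).choose_spec.2.1 N hN Y c h₁ h₂

theorem cont_bound (D : Poles E) (hq : P.logq.re < 0) (M : ℝ) : ∃ M' C : ℝ, 0 ≤ C ∧
    ∀ N, Good P N → ∀ b : ℝ, (∀ X : ℂ × E, ‖X‖ ≤ M' → ‖N X‖ ≤ b) → ∀ Y : E, ‖Y‖ ≤ M →
      ‖D.cont P hq N Y‖ ≤ C * b := (D.exists_continuation P hq).choose_spec.2.2 M

end Poles
end EllipticVO
end

/-! ### Families of products with currents, and integration over the innermost current -/

open Filter Topology
noncomputable section
namespace EllipticVO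

theorem merge_mem (a b : ℕ → ℂ) (k : ℕ) : (∃ m, merge a b k = a m) ∨ ∃ m, merge a b k = b m := by
  unfold merge
  rcases Equiv.natSumNatEquivNat.symm k with m | m
  · exact Or.inl ⟨m, rfl⟩
  · exact Or.inr ⟨m, rfl⟩

theorem continuousOn_hasSum_perInt {S : Type*} [Countable S] {δ c : ℂ} {f : S → ℂ → ℂ} {g : ℂ → ℂ}
    {b : S → ℝ} (hb : Summable b)
    (hf : ∀ x, ContinuousOn (fun t : ℝ => f x (c + t * δ)) (Set.Icc 0 1))
    (hfb : ∀ x, ∀ t ∈ Set.Icc (0 : ℝ) 1, ‖f x (c + t * δ)‖ ≤ b x)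
    (hs : ∀ t ∈ Set.Icc (0 : ℝ) 1, HasSum (fun x => f x (c + t * δ)) (g (c + t * δ))) :
    HasSum (fun x => perInt δ c (f x)) (perInt δ c g) := by
  have hI : Set.uIoc (0 : ℝ) 1 ⊆ Set.Icc 0 1 := by
    rw [Set.uIoc_of_le zero_le_one]; exact Set.Ioc_subset_Icc_self
  refine intervalIntegral.hasSum_integral_of_dominated_convergence (fun x _ => b x) ?_ ?_ ?_ ?_ ?_
  · exact fun x => ((hf x).mono hI).aestronglyMeasurable measurableSet_uIoc
  · exact fun x => Eventually.of_forall fun t ht => hfb x t (hI ht)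
  · exact Eventually.of_forall fun t _ => hb
  · simp
  · exact Eventually.of_forall fun t ht => hs t (hI ht)

namespace Params

variable (P : Params)

theorem abs_lev_le (u : ℂ) : |P.lev u| ≤ 2 * ‖P.logq‖ * ‖u‖ := by
  refine (Complex.abs_re_le_norm _).trans ?_
  simp only [norm_mul, Complex.norm_ofNat]
  linarith [mul_comm ‖u‖ ‖P.logq‖]

theorem lev_line {P : Params} (hq : P.logq.re < 0) (c : ℂ) (x : ℝ) :
    P.lev (c + x * P.per) = P.lev c := by
  rw [P.lev_add, lev_mul_per hq, add_zero]

theorem norm_z_lt_one {P : Params} (hq : P.logq.re < 0) {ν : ℝ} (hν : 0 < ν) : ‖P.z ν‖ < 1 := by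
  rw [P.norm_z, P.lev_real, Real.exp_lt_one_iff]
  nlinarith

end Params

/-- Products over the zeros of a fixed sequence do not vanish far out. -/
theorem exists_far (P : Params) {a : ℕ → ℂ} (ha : Summable fun k => ‖a k‖) (ρ : ℝ) :
    ∃ R : ℝ, ∀ u : ℂ, R ≤ P.lev u → ∀ w : ℂ, ‖w‖ ≤ ρ →
      (∑' k, ‖a k‖) * Real.exp (P.lev w - P.lev u) < 1 ∧ Pr a (P.z (w - u)) ≠ 0 := by
  set A := ∑' k, ‖a k‖ with hA
  have hA0 : 0 ≤ A := tsum_nonneg fun _ => norm_nonneg _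
  refine ⟨2 * ‖P.logq‖ * ρ + A, fun u hu w hw => ?_⟩
  have h1 : A * Real.exp (P.lev w - P.lev u) < 1 := by
    have h2 : P.lev w ≤ 2 * ‖P.logq‖ * ρ :=
      (le_abs_self _).trans ((P.abs_lev_le w).trans (by gcongr))
    have e1 : Real.exp (P.lev w - P.lev u) ≤ Real.exp (-A) := Real.exp_le_exp.2 (by linarith)
    have e2 : A < Real.exp A := by linarith [Real.add_one_le_exp A]
    calc A * Real.exp (P.lev w - P.lev u) ≤ A * Real.exp (-A) := by gcongr
      _ < Real.exp A * Real.exp (-A) := by gcongr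
      _ = 1 := by rw [← Real.exp_add]; simp
  exact ⟨h1, Pr_ne_zero_of_norm ha (fun k => ha.le_tsum k fun _ _ => norm_nonneg _)
    (by rw [P.norm_z, P.lev_sub]; exact h1)⟩

theorem hasSum_of_eq {S : Type*} {f f' : S → ℂ} {a a' : ℂ} (h : HasSum f a) (hf : ∀ x, f' x = f x)
    (ha : a' = a) : HasSum f' a' := by
  rw [ha, funext hf]
  exact h

/-- A normally convergent sum of holomorphic functions that is known near a point. -/
theorem hasSum_of_eventually {S E : Type*} [NormedAddCommGroup E] [NormedSpace ℂ E]
    {f : S → E → ℂ} {g : E → ℂ} {M : ℝ} {b : S → ℝ} (hb : Summable b)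
    (hf : ∀ x, DifferentiableOn ℂ (f x) (Metric.ball 0 M))
    (hg : DifferentiableOn ℂ g (Metric.ball 0 M))
    (hfb : ∀ x, ∀ Y ∈ Metric.ball (0 : E) M, ‖f x Y‖ ≤ b x)
    {X : E} (hX : X ∈ Metric.ball (0 : E) M) (h : ∀ᶠ Y in 𝓝 X, HasSum (fun x => f x Y) (g Y))
    {Y : E} (hY : Y ∈ Metric.ball (0 : E) M) : HasSum (fun x => f x Y) (g Y) := by
  have hs : Summable fun x => f x Y := Summable.of_norm_bounded hb fun x => hfb x Y hY
  have : ∑' x, f x Y = g Y := by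
    rw [← sub_eq_zero]
    refine eqOn_zero_of_eventuallyEq (f := fun Y => ∑' x, f x Y - g Y) Metric.isOpen_ball
      (fun X _ Y _ => isPreconnected_line_ball M X (Y - X)) (fun X _ Y _ => ?_) hX
      (by filter_upwards [h] with Y hY using sub_eq_zero.2 hY.tsum_eq) hY
    have hl : Continuous fun t : ℂ => X + t • (Y - X) := by fun_prop
    refine DifferentiableOn.sub ?_ ?_
    · exact Complex.differentiableOn_tsum_of_summable_norm hb
        (fun x => (hf x).comp (by fun_prop) fun t ht => ht) (Metric.isOpen_ball.preimage hl)
        fun x t ht => hfb x _ ht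
    · exact hg.comp (by fun_prop) fun t ht => ht
  rw [← this]
  exact hs.hasSum

/-- Numerators of the matrix elements of `n` currents at `Y` applied to an operator at `v`. The
denominators are `Pr a (z (v - y_b))` and `Pr g (z (y_b - y_c))`, `b < c`; the currents have the
matrix elements `F`. -/
structure Fam (P : Params) {S : Type} (F : ℕ → ℂ → S → S → ℂ) (χ : ℕ → ℂ) (g : ℕ → ℂ) (v : ℂ)
    (i : ℕ) (a : ℕ → ℂ) (N : ∀ n, S → (Fin n → ℂ) → ℂ) : Prop where
  summable : Summable fun k => ‖a k‖
  smooth : ∀ n s, ContDiff ℂ 1 (N n s)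
  -- `Y 0` belongs to the current next to the operator at `v`. The offset `i` counts the half
  -- currents already applied, so that variable `b` belongs to a current that acts on sector `i +
  -- b`.
  periodic : ∀ n s (b : Fin n) Y,
    N n s (Function.update Y b (Y b + P.per)) = χ (i + b) * N n s Y
  -- `R` precedes `T`: the levels at which the sums converge must be known before a contour, and
  -- with it the size of `u`, is chosen.
  bound : ∀ n s ρ, ∃ R, ∀ T : ℝ, ∃ B W : S → ℝ, (Summable fun x => W x * B x) ∧
    (∀ x Y, ‖Y‖ ≤ ρ → ‖N n x Y‖ ≤ B x) ∧
    ∀ x u, R ≤ P.lev u → ‖u‖ ≤ T → ‖F (i + n) u s x‖ ≤ W x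
  rel : ∀ n s ρ, ∃ R, ∀ Y u, ‖Y‖ ≤ ρ → R ≤ P.lev u →
    HasSum (fun x => F (i + n) u s x * N n x Y)
      (N (n + 1) s (Fin.snoc (α := fun _ => ℂ) Y u) /
        (Pr a (P.z (v - u)) * ∏ b, Pr g (P.z (Y b - u))))

section Step

variable (P : Params) {ν : ℝ} (ω v τ : ℂ)

/-- The poles in the contour integral that defines the next component: those of the current with
the operator at `v` and of the kernel with parameter `u₀` inside, those of the kernel and of the
exchange of currents outside. -/
def stepPoles (hq : P.logq.re < 0) (hν : 0 < ν) {a : ℕ → ℂ} (ha : Summable fun k => ‖a k‖) (n : ℕ) :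
    Poles (ℂ × (Fin n → ℂ)) where
  J := Bool
  I := Option (Fin n)
  β := fun j X => if j then v else X.1
  α := fun i X => i.elim X.1 X.2
  a := fun j => if j then a else geo (P.z ν) (P.z ν)
  b := fun i => i.elim (geo 1 (P.z ν)) fun _ => geo (P.z ω) (P.z ν)
  A := fun j => if j then ∑' k, ‖a k‖ else ‖P.z ν‖
  B := fun i => i.elim 1 fun _ => ‖P.z ω‖
  hβ := by rintro (_ | _) <;> simp <;> fun_prop
  hα := by rintro (_ | _) <;> simp <;> fun_prop
  ha := by
    rintro (_ | _)
    · simpa using summable_geo _ (Params.norm_z_lt_one hq hν)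
    · simpa using ha
  hb := by
    rintro (_ | _)
    · exact summable_geo _ (Params.norm_z_lt_one hq hν)
    · exact summable_geo _ (Params.norm_z_lt_one hq hν)
  hA := by
    rintro (_ | _) k
    · simpa using norm_geo_le _ (Params.norm_z_lt_one hq hν) k
    · simpa using ha.le_tsum k fun _ _ => norm_nonneg _
  hB := by
    rintro (_ | _) k
    · simpa using norm_geo_le 1 (Params.norm_z_lt_one hq hν) k
    · exact norm_geo_le _ (Params.norm_z_lt_one hq hν) k

/-- The integrand's numerator. -/
def stepNum {S : Type} (N : ∀ n, S → (Fin n → ℂ) → ℂ) (κ : ℂ → ℂ → ℂ) (n : ℕ) (s : S)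
    (X : ℂ × (ℂ × (Fin n → ℂ))) : ℂ :=
  N (n + 1) s (Fin.cons (α := fun _ => ℂ) X.1 X.2.2) * κ X.1 X.2.1

variable {P ω v}
variable (hq : P.logq.re < 0) (hν : 0 < ν) {a : ℕ → ℂ} (ha : Summable fun k => ‖a k‖)

theorem above_step {n : ℕ} {X : ℂ × (Fin n → ℂ)} {t : ℝ} :
    (stepPoles P ω v hq hν ha n).Above P X t ↔
      (∑' k, ‖a k‖) * Real.exp (P.lev v - t) < 1 ∧ ‖P.z ν‖ * Real.exp (P.lev X.1 - t) < 1 := by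
  constructor
  · exact fun h => ⟨by simpa [stepPoles] using h true, by simpa [stepPoles] using h false⟩
  · rintro ⟨h1, h2⟩ (_ | _)
    · simpa [stepPoles] using h2
    · simpa [stepPoles] using h1

theorem below_step {n : ℕ} {X : ℂ × (Fin n → ℂ)} {t : ℝ} :
    (stepPoles P ω v hq hν ha n).Below P X t ↔
      Real.exp (t - P.lev X.1) < 1 ∧ ∀ b, ‖P.z ω‖ * Real.exp (t - P.lev (X.2 b)) < 1 := by
  constructor
  · exact fun h => ⟨by simpa [stepPoles] using h none, fun b => by
      simpa [stepPoles] using h (some b)⟩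
  · rintro ⟨h1, h2⟩ (_ | b)
    · simpa [stepPoles] using h1
    · simpa [stepPoles] using h2 b

theorem din_step {n : ℕ} (X : ℂ × (ℂ × (Fin n → ℂ))) : (stepPoles P ω v hq hν ha n).din P X =
    Pr a (P.z (v - X.1)) * Pr (geo (P.z ν) (P.z ν)) (P.z (X.2.1 - X.1)) := by
  unfold Poles.din
  change ∏ j : Bool, _ = _
  rw [Fintype.prod_bool]
  simp [stepPoles]

theorem dout_step {n : ℕ} (X : ℂ × (ℂ × (Fin n → ℂ))) : (stepPoles P ω v hq hν ha n).dout P X =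
    Pr (geo 1 (P.z ν)) (P.z (X.1 - X.2.1)) *
      ∏ b, Pr (geo (P.z ω) (P.z ν)) (P.z (X.1 - X.2.2 b)) := by
  unfold Poles.dout
  change ∏ j : Option (Fin n), _ = _
  rw [Fintype.prod_option]
  rfl

/-- The pinchings are: poles at `v` with the outer poles of the kernel, the kernel with itself,
poles at `v` with a further current, the inner poles of the kernel with a further current. Once the
kernel parameter `X.1` is fixed, the first two are constants and the last two are denominators in
the variables `X.2 b`. -/
theorem res_step {n : ℕ} (X : ℂ × (Fin n → ℂ)) : (stepPoles P ω v hq hν ha n).res P X =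
    Pr (conv a (geo 1 (P.z ν))) (P.z (v - X.1)) *
        Pr (conv (geo (P.z ν) (P.z ν)) (geo 1 (P.z ν))) 1 *
      ∏ b, (Pr (conv a (geo (P.z ω) (P.z ν))) (P.z (v - X.2 b)) *
        Pr (conv (geo (P.z ν) (P.z ν)) (geo (P.z ω) (P.z ν))) (P.z (X.1 - X.2 b))) := by
  unfold Poles.res
  change ∏ j : Bool, ∏ i : Option (Fin n), _ = _
  rw [Fintype.prod_bool, Fintype.prod_option, Fintype.prod_option, Finset.prod_mul_distrib]
  simp [stepPoles]
  ring

variable {S : Type} {F : ℕ → ℂ → S → S → ℂ} {χ : ℕ → ℂ} {i : ℕ}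
  {N : ∀ n, S → (Fin n → ℂ) → ℂ} {κ : ℂ → ℂ → ℂ}

theorem contDiff_cons (n : ℕ) :
    ContDiff ℂ 1 fun X : ℂ × (Fin n → ℂ) => (Fin.cons (α := fun _ => ℂ) X.1 X.2 : Fin (n + 1) → ℂ) := by
  refine contDiff_pi.2 fun b => ?_
  refine Fin.cases ?_ (fun b => ?_) b
  · simpa using contDiff_fst
  · simp only [Fin.cons_succ]; fun_prop

theorem contDiff_snoc (n : ℕ) (u : ℂ) :
    ContDiff ℂ 1 fun Y : Fin n → ℂ => (Fin.snoc (α := fun _ => ℂ) Y u : Fin (n + 1) → ℂ) := by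
  refine contDiff_pi.2 fun b => ?_
  refine Fin.lastCases ?_ (fun b => ?_) b
  · simpa using contDiff_const
  · simp only [Fin.snoc_castSucc]; fun_prop

theorem norm_cons_le {n : ℕ} {u : ℂ} {Y : Fin n → ℂ} {ρ : ℝ} (hρ : 0 ≤ ρ) (hu : ‖u‖ ≤ ρ)
    (hY : ‖Y‖ ≤ ρ) : ‖(Fin.cons (α := fun _ => ℂ) u Y : Fin (n + 1) → ℂ)‖ ≤ ρ := by
  refine (pi_norm_le_iff_of_nonneg hρ).2 fun b => ?_
  refine Fin.cases ?_ (fun b => ?_) b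
  · simpa using hu
  · simpa using (norm_le_pi_norm Y b).trans hY

/-- The integration variable takes the place of `Y 0`, whose multiplier is `χ i`; the kernel carries
the inverse multiplier. -/
theorem good_stepNum (hN : Fam P F χ (geo (P.z ω) (P.z ν)) v i a N)
    (hκ : ContDiff ℂ 1 (Function.uncurry κ))
    (hκp : ∀ u u₀, χ i * κ (u + P.per) u₀ = κ u u₀) (n : ℕ) (s : S) :
    Poles.Good P (stepNum N κ n s) := by
  constructor
  · refine ContDiff.mul ?_ ?_
    · exact (hN.smooth (n + 1) s).comp ((contDiff_cons n).comp
        (contDiff_fst.prodMk (contDiff_snd.comp contDiff_snd)))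
    · exact hκ.comp (contDiff_fst.prodMk (contDiff_fst.comp contDiff_snd))
  · rintro u ⟨u₀, Y⟩
    have := hN.periodic (n + 1) s 0 (Fin.cons (α := fun _ => ℂ) u Y)
    simp only [Fin.cons_zero, Fin.update_cons_zero, Fin.val_zero, add_zero] at this
    simp only [stepNum]
    rw [this, ← hκp u u₀]
    ring

/-- The numerators for the next component. -/
def stepFam (P : Params) {ν : ℝ} (ω v τ : ℂ) (hq : P.logq.re < 0) (hν : 0 < ν) {a : ℕ → ℂ}
    (ha : Summable fun k => ‖a k‖) {S : Type} (N : ∀ n, S → (Fin n → ℂ) → ℂ) (κ : ℂ → ℂ → ℂ)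
    (n : ℕ) (s : S) (Y : Fin n → ℂ) : ℂ :=
  (Pr (conv a (geo 1 (P.z ν))) (P.z (-τ)) *
      Pr (conv (geo (P.z ν) (P.z ν)) (geo 1 (P.z ν))) 1)⁻¹ *
    (stepPoles P ω v hq hν ha n).cont P hq (stepNum N κ n s) (v + τ, Y)

/-- The zeros of the denominators for the next component. -/
def stepSeq (P : Params) (ν : ℝ) (ω τ : ℂ) (a : ℕ → ℂ) : ℕ → ℂ :=
  merge a (merge (conv a (geo (P.z ω) (P.z ν)))
    fun k => P.z τ * conv (geo (P.z ν) (P.z ν)) (geo (P.z ω) (P.z ν)) k)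

include hq hν ha in
theorem summable_stepSeq : Summable fun k => ‖stepSeq P ν ω τ a k‖ := by
  have hg := summable_geo (P.z ω) (Params.norm_z_lt_one hq hν)
  refine summable_merge ha (summable_merge (summable_conv ha hg) ?_)
  simp only [norm_mul]
  exact (summable_conv (summable_geo _ (Params.norm_z_lt_one hq hν)) hg).mul_left _

include hq hν ha in
theorem Pr_stepSeq (x : ℂ) : Pr (stepSeq P ν ω τ a) x = Pr a x *
    (Pr (conv a (geo (P.z ω) (P.z ν))) x *
      Pr (conv (geo (P.z ν) (P.z ν)) (geo (P.z ω) (P.z ν))) (P.z τ * x)) := by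
  have hg := summable_geo (P.z ω) (Params.norm_z_lt_one hq hν)
  have h3 : Summable fun k =>
      ‖P.z τ * conv (geo (P.z ν) (P.z ν)) (geo (P.z ω) (P.z ν)) k‖ := by
    simp only [norm_mul]
    exact (summable_conv (summable_geo _ (Params.norm_z_lt_one hq hν)) hg).mul_left _
  rw [stepSeq, Pr_merge ha (summable_merge (summable_conv ha hg) h3),
    Pr_merge (summable_conv ha hg) h3, Pr_smul]

include ha in
/-- A configuration in which the contour is not pinched. -/
theorem exists_base (n : ℕ) : ∃ (X : ℂ × (Fin n → ℂ)) (c : ℂ),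
    (stepPoles P ω v hq hν ha n).Above P X (P.lev c) ∧
      (stepPoles P ω v hq hν ha n).Below P X (P.lev c) := by
  set A := ∑' k, ‖a k‖ with hA
  have hA0 : 0 ≤ A := tsum_nonneg fun _ => norm_nonneg _
  have key : ∀ A : ℝ, A * Real.exp (-A) < 1 := fun A => by
    have e2 : A < Real.exp A := by linarith [Real.add_one_le_exp A]
    calc A * Real.exp (-A) < Real.exp A * Real.exp (-A) := by gcongr
      _ = 1 := by rw [← Real.exp_add]; simp
  have hr := P.lev_real
  have e : ∀ t : ℝ, ∃ c : ℂ, P.lev c = t := fun t => ⟨_, Poles.lev_ofReal_div P hq t⟩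
  -- The levels ascend: `c` lies by `A` above `v`; with kernel parameter `c - ν / 2` the contour
  -- through `c` is in the middle, on the logarithmic scale, of the annulus `|p z₀| < |z| < |z₀|`;
  -- the other variables lie by `‖z ω‖` above `c`.
  obtain ⟨c, hc⟩ := e (P.lev v + A)
  obtain ⟨y, hy⟩ := e (P.lev c + ‖P.z ω‖)
  have hν' : P.lev ((ν / 2 : ℝ) : ℂ) < 0 := by rw [hr]; nlinarith
  have hν2 : P.lev (ν : ℂ) = 2 * P.lev ((ν / 2 : ℝ) : ℂ) := by rw [hr, hr]; ring
  refine ⟨(c - ((ν / 2 : ℝ) : ℂ), fun _ => y), c, (above_step hq hν ha).2 ⟨?_, ?_⟩,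
    (below_step hq hν ha).2 ⟨?_, fun b => ?_⟩⟩
  · rw [hc, show P.lev v - (P.lev v + A) = -A by ring]; exact key A
  · rw [P.norm_z, ← Real.exp_add, P.lev_sub, hν2, Real.exp_lt_one_iff]
    linarith
  · rw [P.lev_sub, Real.exp_lt_one_iff]; linarith
  · simp only [hy]
    rw [show P.lev c - (P.lev c + ‖P.z ω‖) = -‖P.z ω‖ by ring]; exact key _

theorem prod_cons {n : ℕ} (f : ℂ → ℂ) (u : ℂ) (Y : Fin n → ℂ) :
    ∏ b, f ((Fin.cons (α := fun _ => ℂ) u Y : Fin (n + 1) → ℂ) b) = f u * ∏ b, f (Y b) := by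
  rw [Fin.prod_univ_succ]
  simp

/-- A further current at `u` adds only outer poles. The new factor of `dout` is the denominator of
its contraction with the integrated current, and the new factors of `res` are denominators in the
continued relation. -/
theorem din_snoc {n : ℕ} (u' x u : ℂ) (Y : Fin n → ℂ) :
    (stepPoles P ω v hq hν ha (n + 1)).din P (u', x, Fin.snoc (α := fun _ => ℂ) Y u) =
      (stepPoles P ω v hq hν ha n).din P (u', x, Y) := by
  rw [din_step, din_step]

theorem dout_snoc {n : ℕ} (u' x u : ℂ) (Y : Fin n → ℂ) :
    (stepPoles P ω v hq hν ha (n + 1)).dout P (u', x, Fin.snoc (α := fun _ => ℂ) Y u) =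
      (stepPoles P ω v hq hν ha n).dout P (u', x, Y) * Pr (geo (P.z ω) (P.z ν)) (P.z (u' - u)) := by
  rw [dout_step, dout_step, Fin.prod_univ_castSucc, mul_assoc]
  simp

theorem res_snoc {n : ℕ} (x u : ℂ) (Y : Fin n → ℂ) :
    (stepPoles P ω v hq hν ha (n + 1)).res P (x, Fin.snoc (α := fun _ => ℂ) Y u) =
      (stepPoles P ω v hq hν ha n).res P (x, Y) *
        (Pr (conv a (geo (P.z ω) (P.z ν))) (P.z (v - u)) *
          Pr (conv (geo (P.z ν) (P.z ν)) (geo (P.z ω) (P.z ν))) (P.z (x - u))) := by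
  rw [res_step, res_step, Fin.prod_univ_castSucc, mul_assoc]
  simp [mul_assoc]

theorem norm_stepNum_le {n : ℕ} {x : S} {M B K : ℝ} (hM : 0 ≤ M)
    (hB : ∀ Y, ‖Y‖ ≤ M → ‖N (n + 1) x Y‖ ≤ B)
    (hK : ∀ X ∈ Metric.closedBall (0 : ℂ × ℂ) M, ‖Function.uncurry κ X‖ ≤ K)
    {X : ℂ × (ℂ × (Fin n → ℂ))} (hX : ‖X‖ ≤ M) : ‖stepNum N κ n x X‖ ≤ B * K := by
  rw [stepNum, norm_mul]
  have hB0 := (norm_nonneg _).trans (hB (0 : Fin (n + 1) → ℂ) (by simpa using hM))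
  refine mul_le_mul (hB _ (norm_cons_le hM ?_ ?_)) (hK (X.1, X.2.1) ?_) (norm_nonneg _) hB0
  · exact (norm_fst_le X).trans hX
  · exact (norm_snd_le X.2).trans ((norm_snd_le X).trans hX)
  · rw [mem_closedBall_zero_iff, Prod.norm_def]
    exact max_le ((norm_fst_le X).trans hX) ((norm_fst_le X.2).trans ((norm_snd_le X).trans hX))

set_option maxHeartbeats 1000000 in
/-- The relation between the continued integrals with `n` and `n + 1` further currents. -/
theorem hasSum_cont [Countable S] (hN : Fam P F χ (geo (P.z ω) (P.z ν)) v i a N)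
    (hκ : ContDiff ℂ 1 (Function.uncurry κ))
    (hκp : ∀ u u₀, χ i * κ (u + P.per) u₀ = κ u u₀) (n : ℕ) (s : S) (ρ : ℝ) :
    ∃ R, ∀ (X : ℂ × (Fin n → ℂ)) (u : ℂ), ‖X‖ ≤ ρ → R ≤ P.lev u →
      HasSum (fun x => F (i + (n + 1)) u s x *
          (stepPoles P ω v hq hν hN.summable n).cont P hq (stepNum N κ n x) X)
        ((stepPoles P ω v hq hν hN.summable (n + 1)).cont P hq (stepNum N κ (n + 1) s)
            (X.1, Fin.snoc (α := fun _ => ℂ) X.2 u) /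
          (Pr a (P.z (v - u)) * (Pr (conv a (geo (P.z ω) (P.z ν))) (P.z (v - u)) *
            Pr (conv (geo (P.z ν) (P.z ν)) (geo (P.z ω) (P.z ν))) (P.z (X.1 - u))) *
            ∏ b, Pr (geo (P.z ω) (P.z ν)) (P.z (X.2 b - u)))) := by
  have ha := hN.summable
  have hg := summable_geo (P.z ω) (Params.norm_z_lt_one hq hν)
  have hgp := summable_geo (P.z ν) (Params.norm_z_lt_one hq hν)
  obtain ⟨X₀, c, hXa, hXb⟩ := exists_base (ω := ω) (v := v) hq hν ha n
  set ρ₁ := max ρ ‖X₀‖ + 1 with hρ₁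
  obtain ⟨M', C, hC0, hC⟩ := (stepPoles P ω v hq hν hN.summable n).cont_bound hq ρ₁
  set ρ₂ := max (max M' 0) (‖c‖ + ‖P.per‖ + ρ₁) with hρ₂
  have hρ₁0 : 0 ≤ ρ₁ := by
    have := norm_nonneg X₀; have := le_max_right ρ ‖X₀‖; linarith
  have hρ₂0 : 0 ≤ ρ₂ := (le_max_right _ _).trans (le_max_left _ _)
  have hρ₁₂ : ρ₁ ≤ ρ₂ := by
    have := le_max_right (max M' 0) (‖c‖ + ‖P.per‖ + ρ₁)
    have := norm_nonneg c; have := norm_nonneg P.per; linarith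
  obtain ⟨R₁, hR₁⟩ := hN.bound (n + 1) s ρ₂
  obtain ⟨R₂, hR₂⟩ := hN.rel (n + 1) s ρ₂
  obtain ⟨R₃, hR₃⟩ := exists_far P ha ‖v‖
  obtain ⟨R₄, hR₄⟩ := exists_far P (summable_conv ha hg) ‖v‖
  obtain ⟨R₅, hR₅⟩ := exists_far P (summable_conv hgp hg) ρ₁
  obtain ⟨R₆, hR₆⟩ := exists_far P hg ρ₂
  refine ⟨max R₁ (max R₂ (max R₃ (max R₄ (max R₅ R₆)))), fun X u hX hu => ?_⟩
  simp only [max_le_iff] at hu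
  obtain ⟨hu₁, hu₂, hu₃, hu₄, hu₅, hu₆⟩ := hu
  obtain ⟨B, W, hs, hB, hW⟩ := hR₁ ‖u‖
  obtain ⟨K, hK⟩ := (isCompact_closedBall (0 : ℂ × ℂ) ρ₂).exists_bound_of_continuousOn
    hκ.continuous.continuousOn
  have hFW : ∀ x, ‖F (i + (n + 1)) u s x‖ ≤ W x := fun x => hW x u hu₁ le_rfl
  have hW0 : ∀ x, 0 ≤ W x := fun x => (norm_nonneg _).trans (hFW x)
  have hne₃ : Pr a (P.z (v - u)) ≠ 0 := (hR₃ u hu₃ v le_rfl).2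
  have hne₄ := (hR₄ u hu₄ v le_rfl).2
  have hmemball : ∀ Y ∈ Metric.ball (0 : ℂ × (Fin n → ℂ)) ρ₁, ‖Y‖ ≤ ρ₁ := fun Y hY =>
    (mem_ball_zero_iff.1 hY).le
  have hne₅ : ∀ Y ∈ Metric.ball (0 : ℂ × (Fin n → ℂ)) ρ₁,
      Pr (conv (geo (P.z ν) (P.z ν)) (geo (P.z ω) (P.z ν))) (P.z (Y.1 - u)) ≠ 0 := fun Y hY =>
    (hR₅ u hu₅ _ ((norm_fst_le Y).trans (hmemball Y hY))).2
  have hne₆ : ∀ Y ∈ Metric.ball (0 : ℂ × (Fin n → ℂ)) ρ₁, ∀ b,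
      Pr (geo (P.z ω) (P.z ν)) (P.z (Y.2 b - u)) ≠ 0 := fun Y hY b =>
    (hR₆ u hu₆ _ ((norm_le_pi_norm Y.2 b).trans ((norm_snd_le Y).trans
      ((hmemball Y hY).trans hρ₁₂)))).2
  -- Both sides are holomorphic in the parameters on a ball. Near `X₀` the contour is not pinched,
  -- so the sum can be taken under the integral and `rel` applies to the integrand. The identity
  -- theorem extends the relation to the ball.
  refine hasSum_of_eventually (M := ρ₁) (X := X₀) (b := fun x => W x * (C * (B x * K)))
    (f := fun x X => F (i + (n + 1)) u s x *
      (stepPoles P ω v hq hν hN.summable n).cont P hq (stepNum N κ n x) X)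
    (g := fun X => (stepPoles P ω v hq hν hN.summable (n + 1)).cont P hq (stepNum N κ (n + 1) s)
            (X.1, Fin.snoc (α := fun _ => ℂ) X.2 u) /
          (Pr a (P.z (v - u)) * (Pr (conv a (geo (P.z ω) (P.z ν))) (P.z (v - u)) *
            Pr (conv (geo (P.z ν) (P.z ν)) (geo (P.z ω) (P.z ν))) (P.z (X.1 - u))) *
            ∏ b, Pr (geo (P.z ω) (P.z ν)) (P.z (X.2 b - u)))) ?_ ?_ ?_ ?_ ?_ ?_ ?_
  · refine (hs.mul_left (C * K)).congr fun x => ?_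
    ring
  · intro x
    have := Poles.contDiff_cont (D := stepPoles P ω v hq hν ha n) hq (good_stepNum hN hκ hκp n x)
    exact (Differentiable.const_mul (this.differentiable one_ne_zero) _).differentiableOn
  · refine ContDiffOn.differentiableOn (n := 1) (ContDiffOn.div ?_ ?_ fun Y hY => ?_) one_ne_zero
    · exact ((Poles.contDiff_cont hq (good_stepNum hN hκ hκp (n + 1) s)).comp
        (contDiff_fst.prodMk ((contDiff_snoc n u).comp contDiff_snd))).contDiffOn
    · refine ContDiff.contDiffOn ?_
      refine (contDiff_const.mul (contDiff_const.mul ?_)).mul (contDiff_prod fun b _ => ?_)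
      · exact (contDiff_Pr (summable_conv hgp hg)).comp
          (P.contDiff_z.comp (contDiff_fst.sub contDiff_const))
      · exact (contDiff_Pr hg).comp (P.contDiff_z.comp (by fun_prop))
    · exact mul_ne_zero (mul_ne_zero hne₃ (mul_ne_zero hne₄ (hne₅ Y hY)))
        (Finset.prod_ne_zero_iff.2 fun b _ => hne₆ Y hY b)
  · intro x Y hY
    rw [norm_mul]
    refine mul_le_mul (hFW x) (hC _ (good_stepNum hN hκ hκp n x) _ (fun X hX => ?_) _
      (hmemball Y hY)) (norm_nonneg _) (hW0 x)
    exact norm_stepNum_le hρ₂0 (hB x) hK (hX.trans ((le_max_left _ _).trans (le_max_left _ _)))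
  · rw [mem_ball_zero_iff]
    have := le_max_right ρ ‖X₀‖; linarith
  · filter_upwards [Poles.eventually_above _ P hXa, Poles.eventually_below _ P hXb,
      Metric.isOpen_ball.mem_nhds (show X₀ ∈ Metric.ball 0 ρ₁ by
        rw [mem_ball_zero_iff]; have := le_max_right ρ ‖X₀‖; linarith)] with Y hYa hYb hY
    have hcu : ∀ t ∈ Set.Icc (0 : ℝ) 1, ‖c + t * P.per‖ ≤ ‖c‖ + ‖P.per‖ := fun t ht => by
      refine (norm_add_le _ _).trans (add_le_add le_rfl ?_)
      rw [norm_mul, Complex.norm_real, Real.norm_eq_abs, abs_of_nonneg ht.1]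
      exact mul_le_of_le_one_left (norm_nonneg _) ht.2
    have hcρ : ‖c‖ + ‖P.per‖ ≤ ρ₂ := by
      have := le_max_right (max M' 0) (‖c‖ + ‖P.per‖ + ρ₁); linarith
    -- The appended variable lies so far out that the contour stays inside of its poles.
    have hYb' : (stepPoles P ω v hq hν ha (n + 1)).Below P
        (Y.1, Fin.snoc (α := fun _ => ℂ) Y.2 u) (P.lev c) := by
      rw [below_step] at hYb ⊢
      refine ⟨hYb.1, fun b => ?_⟩
      refine Fin.lastCases ?_ (fun b => ?_) b
      · simp only [Fin.snoc_last]
        refine lt_of_le_of_lt ?_ (hR₆ u hu₆ c ((by linarith [norm_nonneg P.per] :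
          ‖c‖ ≤ ‖c‖ + ‖P.per‖).trans hcρ)).1
        refine mul_le_mul_of_nonneg_right ?_ (Real.exp_pos _).le
        simpa [geo] using hg.le_tsum 0 fun _ _ => norm_nonneg _
      · simpa only [Fin.snoc_castSucc] using hYb.2 b
    have hYa' : (stepPoles P ω v hq hν ha (n + 1)).Above P
        (Y.1, Fin.snoc (α := fun _ => ℂ) Y.2 u) (P.lev c) := by
      rw [above_step] at hYa ⊢
      exact hYa
    simp only [Poles.cont_eq hq (good_stepNum hN hκ hκp n _) hYa hYb,
      Poles.cont_eq hq (good_stepNum hN hκ hκp (n + 1) s) hYa' hYb']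
    -- The denominator for `n` currents is the same for all intermediate states; for `n + 1`
    -- currents the additional factor comes from `rel`.
    set den : ℂ → ℂ := fun u' => (stepPoles P ω v hq hν ha n).din P (u', Y) *
      (stepPoles P ω v hq hν ha n).dout P (u', Y) with hden
    have hdc : Continuous den := by
      have e : Continuous fun u' : ℂ => (u', Y) := by fun_prop
      exact (((stepPoles P ω v hq hν ha n).contDiff_din P).continuous.comp e).mul
        (((stepPoles P ω v hq hν ha n).contDiff_dout P).continuous.comp e)
    have hdne : ∀ t : ℝ, den (c + t * P.per) ≠ 0 := fun t => mul_ne_zero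
      (Poles.din_ne_zero (by rwa [Params.lev_line hq]))
      (Poles.dout_ne_zero (by rwa [Params.lev_line hq]))
    have hlc : Continuous fun t : ℝ => c + t * P.per := by fun_prop
    have hdlc : Continuous fun t : ℝ => (den (c + t * P.per))⁻¹ :=
      (hdc.comp hlc).inv₀ hdne
    obtain ⟨D, hD⟩ := (isCompact_Icc (a := (0 : ℝ)) (b := 1)).exists_bound_of_continuousOn
      hdlc.continuousOn
    have hcons : ∀ t ∈ Set.Icc (0 : ℝ) 1,
        ‖(Fin.cons (α := fun _ => ℂ) (c + t * P.per) Y.2 : Fin (n + 1) → ℂ)‖ ≤ ρ₂ := fun t ht =>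
      norm_cons_le hρ₂0 ((hcu t ht).trans hcρ)
        ((norm_snd_le Y).trans ((hmemball Y hY).trans hρ₁₂))
    have key := continuousOn_hasSum_perInt (δ := P.per) (c := c)
      (f := fun x u' => F (i + (n + 1)) u s x * (stepNum N κ n x (u', Y) / den u'))
      (g := fun u' => (N (n + 1 + 1) s (Fin.snoc (α := fun _ => ℂ)
          (Fin.cons (α := fun _ => ℂ) u' Y.2) u) /
        (Pr a (P.z (v - u)) * ∏ b, Pr (geo (P.z ω) (P.z ν))
          (P.z ((Fin.cons (α := fun _ => ℂ) u' Y.2 : Fin (n + 1) → ℂ) b - u)))) *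
            (κ u' Y.1 / den u'))
      (b := fun x => W x * (B x * K * D)) ?_ ?_ ?_ ?_
    · have e1 : ∀ x, perInt P.per c (fun u' => F (i + (n + 1)) u s x *
          (stepNum N κ n x (u', Y) / den u')) = F (i + (n + 1)) u s x *
          perInt P.per c (fun u' => stepNum N κ n x (u', Y) / den u') := fun x => by
        simp only [perInt, intervalIntegral.integral_const_mul]
      simp only [e1] at key
      refine hasSum_of_eq (key.mul_left ((stepPoles P ω v hq hν ha n).res P Y)) (fun x => ?_) ?_
      · ring
      · simp only [perInt]
        rw [res_snoc, mul_div_right_comm, ← intervalIntegral.integral_const_mul,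
          ← intervalIntegral.integral_const_mul]
        refine intervalIntegral.integral_congr fun t _ => ?_
        have h5 := hne₅ Y hY
        have h6 : ∏ b, Pr (geo (P.z ω) (P.z ν)) (P.z (Y.2 b - u)) ≠ 0 :=
          Finset.prod_ne_zero_iff.2 fun b _ => hne₆ Y hY b
        have h10 := din_snoc (ω := ω) (v := v) hq hν ha (c + t * P.per) Y.1 u Y.2
        simp only [hden, h10, dout_snoc,
          prod_cons fun w => Pr (geo (P.z ω) (P.z ν)) (P.z (w - u)), stepNum,
          Fin.cons_snoc_eq_snoc_cons]
        have h7 := hdne t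
        simp only [hden] at h7
        have h8 := left_ne_zero_of_mul h7
        have h9 := right_ne_zero_of_mul h7
        generalize (stepPoles P ω v hq hν ha n).din P _ = x₁ at *
        generalize (stepPoles P ω v hq hν ha n).dout P _ = x₂ at *
        generalize Pr (conv (geo (P.z ν) (P.z ν)) (geo (P.z ω) (P.z ν))) _ = x₃ at *
        generalize Pr (conv a (geo (P.z ω) (P.z ν))) _ = x₄ at *
        generalize Pr (geo (P.z ω) (P.z ν)) _ = x₅ at *
        generalize (∏ b : Fin n, Pr (geo (P.z ω) (P.z ν)) (P.z (Y.2 b - u))) = x₆ at *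
        generalize (stepPoles P ω v hq hν ha n).res P Y = x₇ at *
        field_simp
    · refine (hs.mul_left (K * D)).congr fun x => ?_
      ring
    · intro x
      have e : Continuous fun t : ℝ => ((c + t * P.per, Y) : ℂ × ℂ × (Fin n → ℂ)) := by fun_prop
      exact (continuous_const.mul (((good_stepNum hN hκ hκp n x).1.continuous.comp e).mul
        hdlc)).continuousOn
    · intro x t ht
      have h1 : ‖stepNum N κ n x (c + t * P.per, Y)‖ ≤ B x * K := by
        refine norm_stepNum_le hρ₂0 (hB x) hK ?_
        rw [Prod.norm_def]
        exact max_le ((hcu t ht).trans hcρ) ((hmemball Y hY).trans hρ₁₂)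
      rw [norm_mul, div_eq_mul_inv, norm_mul]
      exact mul_le_mul (hFW x) (mul_le_mul h1 (hD t ht) (norm_nonneg _)
        ((norm_nonneg _).trans h1)) (mul_nonneg (norm_nonneg _) (norm_nonneg _)) (hW0 x)
    · intro t ht
      have := (hR₂ _ u (hcons t ht) hu₂).mul_right (κ (c + t * P.per) Y.1 / den (c + t * P.per))
      refine this.congr_fun ?_
      intro x
      simp only [stepNum]
      ring
  · rw [mem_ball_zero_iff]
    have := le_max_left ρ ‖X₀‖; linarith

/-- Near an unpinched configuration the shift changes only the numerator under the integral; the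
rest is continuation. Variable `b` is number `b + 1` in the numerator, which explains the
multiplier. -/
theorem cont_update_per (hN : Fam P F χ (geo (P.z ω) (P.z ν)) v i a N)
    (hκ : ContDiff ℂ 1 (Function.uncurry κ))
    (hκp : ∀ u u₀, χ i * κ (u + P.per) u₀ = κ u u₀) (n : ℕ) (s : S) (b : Fin n)
    (X : ℂ × (Fin n → ℂ)) :
    (stepPoles P ω v hq hν hN.summable n).cont P hq (stepNum N κ n s)
        (X.1, Function.update X.2 b (X.2 b + P.per)) =
      χ (i + 1 + b) * (stepPoles P ω v hq hν hN.summable n).cont P hq (stepNum N κ n s) X := by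
  have ha := hN.summable
  have hgood := good_stepNum hN hκ hκp n s
  obtain ⟨X₀, c, hXa, hXb⟩ := exists_base (ω := ω) (v := v) hq hν ha n
  have hlev : ∀ (Y : Fin n → ℂ) b', P.lev (Function.update Y b (Y b + P.per) b') = P.lev (Y b') := by
    intro Y b'
    by_cases h : b' = b
    · subst h
      simpa using Params.lev_line hq (Y b') 1
    · rw [Function.update_of_ne h]
  have hz : ∀ (Y : Fin n → ℂ) b', P.z (Function.update Y b (Y b + P.per) b') = P.z (Y b') := by
    intro Y b'
    by_cases h : b' = b
    · subst h
      simpa using Params.z_add_per hq (Y b')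
    · rw [Function.update_of_ne h]
  have hup : ContDiff ℂ 1 fun X : ℂ × (Fin n → ℂ) =>
      ((X.1, Function.update X.2 b (X.2 b + P.per)) : ℂ × (Fin n → ℂ)) := by
    refine contDiff_fst.prodMk (contDiff_pi.2 fun b' => ?_)
    by_cases h : b' = b
    · subst h
      simp only [Function.update_self]; fun_prop
    · simp only [Function.update_of_ne h]; fun_prop
  refine eq_on_ball (M := max ‖X‖ ‖X₀‖ + 1) (X := X₀)
    (f := fun X => (stepPoles P ω v hq hν hN.summable n).cont P hq (stepNum N κ n s)
        (X.1, Function.update X.2 b (X.2 b + P.per)))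
    (g := fun X => χ (i + 1 + b) *
      (stepPoles P ω v hq hν hN.summable n).cont P hq (stepNum N κ n s) X) ?_ ?_ ?_ ?_ ?_
  · exact (((Poles.contDiff_cont (D := stepPoles P ω v hq hν ha n) hq hgood).comp
      hup).differentiable (by norm_num)).differentiableOn
  · have := Poles.contDiff_cont (D := stepPoles P ω v hq hν ha n) hq hgood
    exact (Differentiable.const_mul (this.differentiable one_ne_zero) _).differentiableOn
  · rw [mem_ball_zero_iff]; linarith [le_max_right ‖X‖ ‖X₀‖]
  · filter_upwards [Poles.eventually_above _ P hXa, Poles.eventually_below _ P hXb] with Y hYa hYb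
    have hYa' : (stepPoles P ω v hq hν ha n).Above P
        (Y.1, Function.update Y.2 b (Y.2 b + P.per)) (P.lev c) := by
      rw [above_step] at hYa ⊢
      exact hYa
    have hYb' : (stepPoles P ω v hq hν ha n).Below P
        (Y.1, Function.update Y.2 b (Y.2 b + P.per)) (P.lev c) := by
      rw [below_step] at hYb ⊢
      refine ⟨hYb.1, fun b' => ?_⟩
      rw [hlev]
      exact hYb.2 b'
    rw [Poles.cont_eq hq hgood hYa hYb, Poles.cont_eq hq hgood hYa' hYb', mul_left_comm]
    simp only [res_step, din_step, dout_step, P.z_sub, hz, stepNum, Fin.cons_update, perInt]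
    refine congrArg₂ (· * ·) rfl ?_
    rw [← intervalIntegral.integral_const_mul]
    refine intervalIntegral.integral_congr fun t _ => ?_
    have := hN.periodic (n + 1) s b.succ (Fin.cons (α := fun _ => ℂ) (c + t * P.per) Y.2)
    simp only [Fin.cons_succ, Fin.val_succ] at this
    simp only [this, show i + (b.val + 1) = i + 1 + b.val by ring]
    ring
  · rw [mem_ball_zero_iff]; linarith [le_max_left ‖X‖ ‖X₀‖]

/-- The continued integral at kernel parameter `v + τ` is a family of the same kind. The constant
factors of `res` are divided out by `stepFam`; those that contain further variables are collected in
`stepSeq`, where the factor `z τ` rewrites `z (v + τ - u)` in terms of `z (v - u)`. -/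
theorem fam_step [Countable S] (hN : Fam P F χ (geo (P.z ω) (P.z ν)) v i a N)
    (hκ : ContDiff ℂ 1 (Function.uncurry κ))
    (hκp : ∀ u u₀, χ i * κ (u + P.per) u₀ = κ u u₀) :
    Fam P F χ (geo (P.z ω) (P.z ν)) v (i + 1) (stepSeq P ν ω τ a)
      (stepFam P ω v τ hq hν hN.summable N κ) where
  summable := summable_stepSeq τ hq hν hN.summable
  smooth n s := contDiff_const.mul ((Poles.contDiff_cont hq (good_stepNum hN hκ hκp n s)).comp
    (contDiff_const.prodMk contDiff_id))
  periodic n s b Y := by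
    simp only [stepFam]
    rw [cont_update_per hq hν hN hκ hκp n s b (v + τ, Y)]
    ring
  bound n s ρ := by
    obtain ⟨M', C, hC0, hC⟩ := (stepPoles P ω v hq hν hN.summable n).cont_bound hq
      (max ‖v + τ‖ ρ)
    obtain ⟨R, hR⟩ := hN.bound (n + 1) s (max M' 0)
    refine ⟨R, fun T => ?_⟩
    obtain ⟨B, W, hs, hB, hW⟩ := hR T
    obtain ⟨L, hL⟩ := (isCompact_closedBall (0 : ℂ × ℂ) (max M' 0)).exists_bound_of_continuousOn
      hκ.continuous.continuousOn
    set K := ‖(Pr (conv a (geo 1 (P.z ν))) (P.z (-τ)) *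
      Pr (conv (geo (P.z ν) (P.z ν)) (geo 1 (P.z ν))) 1)⁻¹‖ with hK
    refine ⟨fun x => K * (C * (B x * L)), W, ?_, fun x Y hY => ?_, fun x u h1 h2 => ?_⟩
    · refine (hs.mul_left (K * C * L)).congr fun x => ?_
      ring
    · rw [stepFam, norm_mul]
      refine mul_le_mul_of_nonneg_left ?_ (norm_nonneg _)
      refine hC _ (good_stepNum hN hκ hκp n x) _ (fun X hX => norm_stepNum_le (le_max_right M' 0)
        (hB x) hL (hX.trans (le_max_left _ _))) _ ?_
      rw [Prod.norm_def]
      exact max_le (le_max_left _ _) (hY.trans (le_max_right _ _))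
    · rw [show i + 1 + n = i + (n + 1) by ring]
      exact hW x u h1 h2
  rel n s ρ := by
    obtain ⟨R, hR⟩ := hasSum_cont hq hν hN hκ hκp n s (max ‖v + τ‖ ρ)
    refine ⟨R, fun Y u hY hu => ?_⟩
    have h := (hR (v + τ, Y) u (by
      rw [Prod.norm_def]; exact max_le (le_max_left _ _) (hY.trans (le_max_right _ _))) hu).mul_left
      (Pr (conv a (geo 1 (P.z ν))) (P.z (-τ)) *
        Pr (conv (geo (P.z ν) (P.z ν)) (geo 1 (P.z ν))) 1)⁻¹
    rw [show i + 1 + n = i + (n + 1) by ring, Pr_stepSeq τ hq hν hN.summable]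
    rw [show P.z τ * P.z (v - u) = P.z (v + τ - u) by rw [← P.z_add]; congr 1; ring]
    simp only [stepFam]
    rw [mul_div_assoc]
    refine h.congr_fun fun x => ?_
    ring

end Step
end EllipticVO
end

/-! ### Iteration of the half currents -/

open Filter Topology
noncomputable section
namespace EllipticVO

section Ladder

variable {P : Params} {ν : ℝ} {ω v τ : ℂ} (hq : P.logq.re < 0) (hν : 0 < ν) {S : Type}
  {F : ℕ → ℂ → S → S → ℂ} {χ : ℕ → ℂ} {i : ℕ} {a : ℕ → ℂ} {N : ∀ n, S → (Fin n → ℂ) → ℂ}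
  {κ : ℂ → ℂ → ℂ}

include hq hν in
-- The inner poles `z₀ p^{m+1}` and the outer poles `z₀ p^{-n}` of the kernel never coincide.
theorem Pr_conv_kernel_ne_zero :
    Pr (conv (geo (P.z ν) (P.z ν)) (geo 1 (P.z ν))) 1 ≠ 0 := by
  have h := Params.norm_z_lt_one hq hν
  refine Pr_ne_zero_of_norm (summable_conv (summable_geo _ h) (summable_geo _ h))
    (norm_conv_le (norm_geo_le _ h) (norm_geo_le _ h)) ?_
  simpa using h

/-- The product of a half current with an operator. -/
theorem exists_product [Countable S] (hN : Fam P F χ (geo (P.z ω) (P.z ν)) v i a N)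
    (hF : ∀ s x, Continuous fun u => F i u s x) (hκ : ContDiff ℂ 1 (Function.uncurry κ))
    (hκp : ∀ u u₀, χ i * κ (u + P.per) u₀ = κ u u₀)
    (hτ : Pr (conv a (geo 1 (P.z ν))) (P.z (-τ)) ≠ 0) (s : S) :
    ∃ G : ℂ → ℂ, MeromorphicOn G Set.univ ∧ AnalyticAt ℂ G (v + τ) ∧
      G (v + τ) = stepFam P ω v τ hq hν hN.summable N κ 0 s ![] ∧
      ∃ R : ℝ, ∀ u₀ c : ℂ, R ≤ P.lev u₀ → ‖P.z ν‖ * Real.exp (P.lev u₀ - P.lev c) < 1 →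
        Real.exp (P.lev c - P.lev u₀) < 1 →
        HasSum (fun x => perInt P.per c (fun u' => F i u' s x * κ u' u₀ /
          (Pr (geo (P.z ν) (P.z ν)) (P.z (u₀ - u')) * Pr (geo 1 (P.z ν)) (P.z (u' - u₀)))) *
            N 0 x ![]) (G u₀) := by
  have ha := hN.summable
  have hp := Params.norm_z_lt_one hq hν
  have hg0 := summable_geo 1 hp
  have hgp := summable_geo (P.z ν) hp
  have hgood := good_stepNum hN hκ hκp 0 s
  have hK := Pr_conv_kernel_ne_zero hq hν
  set D := stepPoles P ω v hq hν ha 0 with hD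
  have hup : ContDiff ℂ 1 fun u : ℂ => ((u, ![]) : ℂ × (Fin 0 → ℂ)) :=
    contDiff_id.prodMk contDiff_const
  set H : ℂ → ℂ := fun u => D.cont P hq (stepNum N κ 0 s) (u, ![]) with hH
  set r : ℂ → ℂ := fun u => D.res P (u, ![]) with hr
  have hres : ∀ u, r u = Pr (conv a (geo 1 (P.z ν))) (P.z (v - u)) *
      Pr (conv (geo (P.z ν) (P.z ν)) (geo 1 (P.z ν))) 1 := fun u => by
    simp only [hr, hD, res_step]
    simp
  have hHd : Differentiable ℂ H :=
    ((Poles.contDiff_cont hq hgood).comp hup).differentiable one_ne_zero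
  have hrd : Differentiable ℂ r := ((D.contDiff_res P).comp hup).differentiable one_ne_zero
  have hHa : ∀ u, AnalyticAt ℂ H u := fun u => hHd.analyticAt u
  have hra : ∀ u, AnalyticAt ℂ r u := fun u => hrd.analyticAt u
  have hrτ : r (v + τ) = Pr (conv a (geo 1 (P.z ν))) (P.z (-τ)) *
      Pr (conv (geo (P.z ν) (P.z ν)) (geo 1 (P.z ν))) 1 := by
    rw [hres, show v - (v + τ) = -τ by ring]
  have hrτ0 : r (v + τ) ≠ 0 := by rw [hrτ]; exact mul_ne_zero hτ hK
  refine ⟨fun u => H u / r u, fun u _ => (hHa u).meromorphicAt.div (hra u).meromorphicAt,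
    (hHa _).div (hra _) hrτ0, ?_, ?_⟩
  · simp only [hrτ, hH, stepFam, hD]
    rw [div_eq_inv_mul]
  obtain ⟨R₁, hR₁⟩ := hN.bound 0 s 0
  obtain ⟨R₂, hR₂⟩ := hN.rel 0 s 0
  obtain ⟨R₃, hR₃⟩ := exists_far P ha ‖v‖
  obtain ⟨R₄, hR₄⟩ := exists_far P (summable_conv ha hg0) ‖v‖
  -- The contour may lie lower than `u₀` by up to `-lev ν`, and must still be in the region where
  -- the sums converge.
  refine ⟨max R₄ (max R₁ (max R₂ R₃) - P.lev ν), fun u₀ c hu h1 h2 => ?_⟩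
  have hu₄ : R₄ ≤ P.lev u₀ := (le_max_left _ _).trans hu
  have hc : max R₁ (max R₂ R₃) ≤ P.lev c := by
    have e := (le_max_right _ _).trans hu
    rw [P.norm_z, ← Real.exp_add, Real.exp_lt_one_iff] at h1
    linarith
  simp only [max_le_iff] at hc
  obtain ⟨hc₁, hc₂, hc₃⟩ := hc
  have hru : r u₀ ≠ 0 := by
    rw [hres]; exact mul_ne_zero (hR₄ u₀ hu₄ v le_rfl).2 hK
  have habove : D.Above P (u₀, ![]) (P.lev c) :=
    (above_step hq hν ha).2 ⟨(hR₃ c hc₃ v le_rfl).1, h1⟩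
  have hbelow : D.Below P (u₀, ![]) (P.lev c) :=
    (below_step hq hν ha).2 ⟨h2, fun b => b.elim0⟩
  have hHr : H u₀ / r u₀ = perInt P.per c fun u' => stepNum N κ 0 s (u', u₀, ![]) /
      (D.din P (u', u₀, ![]) * D.dout P (u', u₀, ![])) := by
    simp only [hH, hr]
    rw [Poles.cont_eq hq hgood habove hbelow]
    exact mul_div_cancel_left₀ _ hru
  simp only [hHr]
  obtain ⟨B, W, hs, hB, hW⟩ := hR₁ (‖c‖ + ‖P.per‖)
  set den : ℂ → ℂ := fun u' => Pr (geo (P.z ν) (P.z ν)) (P.z (u₀ - u')) *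
    Pr (geo 1 (P.z ν)) (P.z (u' - u₀)) with hden
  have hdc : Continuous den := by
    have hz : Continuous P.z := (P.contDiff_z (n := 1)).continuous
    exact (((differentiable_Pr hgp).continuous.comp (hz.comp (by fun_prop)))).mul
      ((differentiable_Pr hg0).continuous.comp (hz.comp (by fun_prop)))
  have hdne : ∀ t : ℝ, den (c + t * P.per) ≠ 0 := fun t => by
    refine mul_ne_zero (Pr_ne_zero_of_norm hgp (norm_geo_le _ hp) ?_)
      (Pr_ne_zero_of_norm hg0 (norm_geo_le _ hp) ?_)
    · rw [P.norm_z (u₀ - _), P.lev_sub, Params.lev_line hq]; exact h1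
    · rw [P.norm_z (_ - u₀), P.lev_sub, Params.lev_line hq]; simpa using h2
  have hcu : ∀ t ∈ Set.Icc (0 : ℝ) 1, ‖c + t * P.per‖ ≤ ‖c‖ + ‖P.per‖ := fun t ht => by
    refine (norm_add_le _ _).trans (add_le_add le_rfl ?_)
    rw [norm_mul, Complex.norm_real, Real.norm_eq_abs, abs_of_nonneg ht.1]
    exact mul_le_of_le_one_left (norm_nonneg _) ht.2
  have hlc : Continuous fun t : ℝ => c + t * P.per := by fun_prop
  have hκc : Continuous fun u' => κ u' u₀ :=
    hκ.continuous.comp (f := fun u' : ℂ => (u', u₀)) (by fun_prop)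
  have hdlc : Continuous fun t : ℝ => κ (c + t * P.per) u₀ / den (c + t * P.per) :=
    (hκc.comp hlc).div (hdc.comp hlc) hdne
  obtain ⟨L, hL⟩ := (isCompact_Icc (a := (0 : ℝ)) (b := 1)).exists_bound_of_continuousOn
    hdlc.continuousOn
  have hlevt : ∀ t : ℝ, P.lev (c + t * P.per) = P.lev c := fun t => Params.lev_line hq c t
  have key := continuousOn_hasSum_perInt (δ := P.per) (c := c)
    (f := fun x u' => F i u' s x * κ u' u₀ / den u' * N 0 x ![])
    (g := fun u' => stepNum N κ 0 s (u', u₀, ![]) /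
      (D.din P (u', u₀, ![]) * D.dout P (u', u₀, ![])))
    (b := fun x => W x * L * B x) ?_ ?_ ?_ ?_
  · refine hasSum_of_eq key (fun x => ?_) rfl
    simp only [perInt, intervalIntegral.integral_mul_const, hden]
  · refine (hs.mul_left L).congr fun x => ?_
    ring
  · intro x
    have : Continuous fun t : ℝ => F i (c + t * P.per) s x *
        (κ (c + t * P.per) u₀ / den (c + t * P.per)) * N 0 x ![] :=
      (((hF s x).comp hlc).mul hdlc).mul continuous_const
    simpa only [mul_div_assoc] using this.continuousOn
  · intro x t ht
    rw [mul_div_assoc, norm_mul, norm_mul]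
    have e1 := hW x (c + t * P.per) (by rw [hlevt]; exact hc₁) (hcu t ht)
    have e2 := hL t ht
    have e3 := hB x ![] (by simp)
    have e4 := (norm_nonneg _).trans e1
    have e5 := (norm_nonneg _).trans e2
    exact mul_le_mul (mul_le_mul e1 e2 (norm_nonneg _) e4) e3 (norm_nonneg _) (mul_nonneg e4 e5)
  · intro t ht
    have := (hR₂ ![] (c + t * P.per) (by simp) (by rw [hlevt]; exact hc₂)).mul_right
      (κ (c + t * P.per) u₀ / den (c + t * P.per))
    refine hasSum_of_eq this (fun x => by simp only [Nat.add_zero]; ring) ?_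
    have e : (Fin.snoc (α := fun _ => ℂ) ![] (c + t * P.per) : Fin 1 → ℂ) =
        Fin.cons (α := fun _ => ℂ) (c + t * P.per) ![] := by
      funext b
      obtain rfl : b = 0 := Subsingleton.elim (α := Fin 1) _ _
      rfl
    simp only [stepNum, hD, din_step, dout_step, hden]
    rw [e]
    simp only [Finset.univ_eq_empty, Finset.prod_empty, mul_one]
    rw [div_mul_div_comm]
    congr 1
    ring_nf

/-- The zeros of the denominators for the `i`th component. -/
def PoleSet (P : Params) (ν : ℝ) (ω μ τ : ℂ) (i : ℕ) (a : ℕ → ℂ) : Prop :=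
  ∀ k, (∃ j n : ℕ, j ≤ i ∧ a k = P.z (μ + j * ω) * P.z ν ^ n) ∨
    ∃ j n : ℕ, 1 ≤ j ∧ j ≤ i ∧ a k = P.z (τ + j * ω) * P.z ν ^ (n + 1)

/-- A new zero is an old one shifted by `ω`, from the contraction with a further current, or an
inner pole of the kernel at `v + τ` shifted by `ω`. The inner poles of the kernel begin with `p`,
not with 1, hence the exponent `n + 1` in the second kind. -/
theorem PoleSet.step {μ : ℂ} (h : PoleSet P ν ω μ τ i a) :
    PoleSet P ν ω μ τ (i + 1) (stepSeq P ν ω τ a) := by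
  intro k
  unfold stepSeq
  rcases merge_mem a _ k with ⟨m, hm⟩ | ⟨m, hm⟩
  · rw [hm]
    rcases h m with ⟨j, n, hj, e⟩ | ⟨j, n, hj1, hj, e⟩
    · exact Or.inl ⟨j, n, by omega, e⟩
    · exact Or.inr ⟨j, n, hj1, by omega, e⟩
  rw [hm]
  rcases merge_mem (conv a (geo (P.z ω) (P.z ν)))
    (fun k => P.z τ * conv (geo (P.z ν) (P.z ν)) (geo (P.z ω) (P.z ν)) k) m with ⟨m', hm'⟩ | ⟨m', hm'⟩
  · rw [hm']
    simp only [conv, geo]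
    rcases h m'.unpair.1 with ⟨j, n, hj, e⟩ | ⟨j, n, hj1, hj, e⟩
    · refine Or.inl ⟨j + 1, n + m'.unpair.2, by omega, ?_⟩
      rw [e, pow_add, show μ + ((j + 1 : ℕ) : ℂ) * ω = μ + j * ω + ω by push_cast; ring,
        P.z_add (μ + j * ω)]
      ring
    · refine Or.inr ⟨j + 1, n + m'.unpair.2, by omega, by omega, ?_⟩
      rw [e, show τ + ((j + 1 : ℕ) : ℂ) * ω = τ + j * ω + ω by push_cast; ring,
        P.z_add (τ + j * ω)]
      ring
  · rw [hm']
    simp only [conv, geo]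
    refine Or.inr ⟨1, m'.unpair.1 + m'.unpair.2, le_rfl, by omega, ?_⟩
    rw [Nat.cast_one, one_mul, P.z_add]
    ring

/-- This is regularity at `u₀ = v + τ`: no pole at `v` meets an outer pole of the kernel. For zeros
of the second kind `τ` cancels, and the condition contains only `j * ω`. -/
theorem PoleSet.ne_zero {μ : ℂ} (h : PoleSet P ν ω μ τ i a) (hq : P.logq.re < 0) (hν : 0 < ν)
    (ha : Summable fun k => ‖a k‖)
    (h₁ : ∀ j n : ℕ, j ≤ i → P.z (μ - τ + j * ω) * P.z ν ^ n ≠ 1)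
    (h₂ : ∀ j n : ℕ, 1 ≤ j → j ≤ i → P.z (j * ω) * P.z ν ^ (n + 1) ≠ 1) :
    Pr (conv a (geo 1 (P.z ν))) (P.z (-τ)) ≠ 0 := by
  have hp := Params.norm_z_lt_one hq hν
  refine Pr_ne_zero (summable_conv ha (summable_geo _ hp)) fun k => ?_
  simp only [conv, geo, one_mul]
  rcases h k.unpair.1 with ⟨j, n, hj, e⟩ | ⟨j, n, hj1, hj, e⟩
  · rw [e]
    convert h₁ j (n + k.unpair.2) hj using 1
    rw [show μ - τ + j * ω = μ + j * ω + -τ by ring, P.z_add (μ + j * ω), pow_add]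
    ring
  · rw [e]
    convert h₂ j (n + k.unpair.2) hj1 hj using 1
    rw [show (j : ℂ) * ω = τ + j * ω + -τ by ring, P.z_add (τ + j * ω),
      show n + k.unpair.2 + 1 = n + 1 + k.unpair.2 by ring, pow_add _ (n + 1)]
    ring

include hq hν in
/-- The components obtained by repeated application of half currents. -/
theorem exists_ladder [Countable S] {μ : ℂ} {l : ℕ} {κ : ℕ → ℂ → ℂ → ℂ}
    (hN : Fam P F χ (geo (P.z ω) (P.z ν)) v 0 a N) (ha : PoleSet P ν ω μ τ 0 a)
    (hF : ∀ i s x, Continuous fun u => F i u s x)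
    (hκ : ∀ i, ContDiff ℂ 1 (Function.uncurry (κ i)))
    (hκp : ∀ i u u₀, χ i * κ i (u + P.per) u₀ = κ i u u₀)
    (h₁ : ∀ j n : ℕ, j < l → P.z (μ - τ + j * ω) * P.z ν ^ n ≠ 1)
    (h₂ : ∀ j n : ℕ, 1 ≤ j → j < l → P.z (j * ω) * P.z ν ^ (n + 1) ≠ 1) :
    ∃ φ : ℕ → S → ℂ, (∀ s, φ 0 s = N 0 s ![]) ∧ ∀ i < l, ∀ s,
      ∃ G : ℂ → ℂ, MeromorphicOn G Set.univ ∧ AnalyticAt ℂ G (v + τ) ∧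
        G (v + τ) = φ (i + 1) s ∧
        ∃ R : ℝ, ∀ u₀ c : ℂ, R ≤ P.lev u₀ → ‖P.z ν‖ * Real.exp (P.lev u₀ - P.lev c) < 1 →
          Real.exp (P.lev c - P.lev u₀) < 1 →
          HasSum (fun x => perInt P.per c (fun u' => F i u' s x * κ i u' u₀ /
            (Pr (geo (P.z ν) (P.z ν)) (P.z (u₀ - u')) * Pr (geo 1 (P.z ν)) (P.z (u' - u₀)))) *
              φ i x) (G u₀) := by
  -- Sequence, family and their properties are built together, because the next family is defined
  -- only with the summability of the present sequence.
  let T : ℕ → Type := fun i => {q : (ℕ → ℂ) × (∀ n, S → (Fin n → ℂ) → ℂ) //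
    Fam P F χ (geo (P.z ω) (P.z ν)) v i q.1 q.2 ∧ PoleSet P ν ω μ τ i q.1}
  let seq : ∀ i, T i := fun i => Nat.rec (motive := T) ⟨(a, N), hN, ha⟩ (fun i q =>
    ⟨(stepSeq P ν ω τ q.1.1, stepFam P ω v τ hq hν q.2.1.summable q.1.2 (κ i)),
      fam_step τ hq hν q.2.1 (hκ i) (hκp i), q.2.2.step⟩) i
  refine ⟨fun i s => (seq i).1.2 0 s ![], fun s => rfl, fun i hi s => ?_⟩
  exact exists_product hq hν (seq i).2.1 (hF i) (hκ i) (hκp i)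
    ((seq i).2.2.ne_zero hq hν (seq i).2.1.summable (fun j n hj => h₁ j n (by omega))
      fun j n h1 hj => h₂ j n h1 (by omega)) s

end Ladder
end EllipticVO
end

open Filter Topology
noncomputable section
namespace EllipticVO

/-! ### Products of normal ordered exponentials -/

open Finsupp in
theorem occ_induction {p : Occ → Prop} (h0 : p 0) (hs : ∀ d i, p d → p (d + single i 1)) (d : Occ) :
    p d := by
  induction d using Finsupp.induction with
  | zero => exact h0
  | single_add a b f _ _ ih =>
    clear * - ih hs
    induction b with
    | zero => simpa using ih
    | succ b hb =>
      rw [single_add, add_right_comm]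
      exact hs _ _ hb

/-- The coefficients of `expCre`. -/
def expCoeff (x : Mode → ℂ) (d : Occ) : ℂ := d.prod fun i n => x i ^ n / (n.factorial : ℂ)

theorem coeff_expCre (x : Mode → ℂ) (d : Occ) :
    MvPowerSeries.coeff d (Params.expCre x) = expCoeff x d := rfl

@[simp] theorem expCoeff_zero (x : Mode → ℂ) : expCoeff x 0 = 1 := Finsupp.prod_zero_index

theorem expCoeff_of_subset {x : Mode → ℂ} {d : Occ} {T : Finset Mode} (h : d.support ⊆ T) :
    expCoeff x d = ∏ i ∈ T, x i ^ d i / ((d i).factorial : ℂ) :=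
  Finsupp.prod_of_support_subset _ h _ fun _ _ => by simp

theorem expCoeff_add_single (x : Mode → ℂ) (d : Occ) (i : Mode) :
    expCoeff x (d + Finsupp.single i 1) * ((d i : ℂ) + 1) = x i * expCoeff x d := by
  classical
  have h1 : (d + Finsupp.single i 1).support ⊆ insert i d.support := by
    intro j hj
    by_cases h : j = i
    · simp [h]
    · simp_all
  rw [expCoeff_of_subset h1, expCoeff_of_subset (Finset.subset_insert i d.support),
    ← Finset.mul_prod_erase _ _ (Finset.mem_insert_self i d.support),
    ← Finset.mul_prod_erase (insert i d.support) _ (Finset.mem_insert_self i d.support)]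
  have h2 : ∏ j ∈ (insert i d.support).erase i, x j ^ (d + Finsupp.single i 1 : Occ) j /
      (((d + Finsupp.single i 1 : Occ) j).factorial : ℂ) =
      ∏ j ∈ (insert i d.support).erase i, x j ^ d j / ((d j).factorial : ℂ) := by
    refine Finset.prod_congr rfl fun j hj => ?_
    have : j ≠ i := (Finset.mem_erase.1 hj).1
    simp [this.symm]
  rw [h2]
  simp only [Finsupp.add_apply, Finsupp.single_eq_same, Nat.factorial_succ]
  have h3 : ((d i).factorial : ℂ) ≠ 0 := by exact_mod_cast Nat.factorial_ne_zero _
  have h4 : (d i : ℂ) + 1 ≠ 0 := by exact_mod_cast Nat.succ_ne_zero (d i)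
  push_cast
  field_simp
  ring

theorem pderiv_expCre (x : Mode → ℂ) (i : Mode) :
    MvPowerSeries.pderiv ℂ i (Params.expCre x) = MvPowerSeries.C (x i) * Params.expCre x := by
  ext d
  rw [MvPowerSeries.coeff_pderiv, MvPowerSeries.coeff_C_mul, coeff_expCre, coeff_expCre,
    expCoeff_add_single]

/-- Both sides have constant term 1 and satisfy `∂_i f = (x i + y i) f` for every mode `i`, and this
determines all coefficients. -/
theorem expCre_mul (x y : Mode → ℂ) :
    Params.expCre x * Params.expCre y = Params.expCre (x + y) := by
  ext d
  induction d using occ_induction with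
  | h0 =>
    rw [MvPowerSeries.coeff_zero_eq_constantCoeff_apply, map_mul,
      ← MvPowerSeries.coeff_zero_eq_constantCoeff_apply,
      ← MvPowerSeries.coeff_zero_eq_constantCoeff_apply]
    simp [coeff_expCre]
  | hs d i ih =>
    have h4 : (d i : ℂ) + 1 ≠ 0 := by exact_mod_cast Nat.succ_ne_zero (d i)
    refine mul_right_cancel₀ h4 ?_
    rw [← MvPowerSeries.coeff_pderiv, ← MvPowerSeries.coeff_pderiv, pderiv_expCre,
      Derivation.leibniz, pderiv_expCre, pderiv_expCre, MvPowerSeries.coeff_C_mul, ← ih]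
    rw [map_add, smul_eq_mul, smul_eq_mul, mul_left_comm, MvPowerSeries.coeff_C_mul,
      mul_left_comm, MvPowerSeries.coeff_C_mul, mul_comm (Params.expCre y), Pi.add_apply]
    ring

theorem expCoeff_mul_expCoeff (x y : Mode → ℂ) (d : Occ) (T : Finset Mode) (h : d.support ⊆ T) :
    expCoeff x d * ∏ i ∈ T, y i ^ d i = expCoeff (fun i => x i * y i) d := by
  rw [expCoeff_of_subset h, expCoeff_of_subset h, ← Finset.prod_mul_distrib]
  refine Finset.prod_congr rfl fun i _ => ?_
  rw [mul_pow]; ring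

/-- The part of the exponential series that involves the modes in `T`. -/
def expPart (r : Mode → ℂ) (T : Finset Mode) (d : Occ) : ℂ :=
  open Classical in if d.support ⊆ T then expCoeff r d else 0

/-- Occupation numbers supported in `insert i T` are pairs of a number for `i` and occupation
numbers supported in `T`, so the sum factors. The assertion on norms makes the product of the two
series absolutely convergent. -/
theorem hasSum_expPart (r : Mode → ℂ) (T : Finset Mode) :
    HasSum (fun d => ‖expPart r T d‖) (∏ i ∈ T, Real.exp ‖r i‖) ∧
      HasSum (expPart r T) (∏ i ∈ T, Complex.exp (r i)) := by
  classical
  induction T using Finset.induction with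
  | empty =>
    have h : ∀ d : Occ, d ≠ 0 → expPart r ∅ d = 0 := fun d hd => by simp [expPart, hd]
    constructor
    · simpa [expPart] using hasSum_single (f := fun d => ‖expPart r ∅ d‖) 0
        fun d hd => by simp [h d hd]
    · simpa [expPart] using hasSum_single (f := expPart r ∅) 0 h
  | insert i T hi ih =>
    have e1 : HasSum (fun n : ℕ => r i ^ n / (n.factorial : ℂ)) (Complex.exp (r i)) := by
      rw [Complex.exp_eq_exp_ℂ]; exact NormedSpace.expSeries_div_hasSum_exp (r i)
    have e2 : HasSum (fun n : ℕ => ‖r i ^ n / (n.factorial : ℂ)‖) (Real.exp ‖r i‖) := by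
      simp only [norm_div, norm_pow, Complex.norm_natCast]
      rw [Real.exp_eq_exp_ℝ]; exact NormedSpace.expSeries_div_hasSum_exp ‖r i‖
    have m0 : Summable fun x : ℕ × Occ => ‖r i ^ x.1 / (x.1.factorial : ℂ)‖ * ‖expPart r T x.2‖ :=
      Summable.mul_of_nonneg (f := fun n : ℕ => ‖r i ^ n / (n.factorial : ℂ)‖)
        (g := fun d => ‖expPart r T d‖) e2.summable ih.1.summable
        (fun _ => norm_nonneg _) fun _ => norm_nonneg _
    have m1 : HasSum (fun x : ℕ × Occ => ‖r i ^ x.1 / (x.1.factorial : ℂ)‖ * ‖expPart r T x.2‖)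
        (Real.exp ‖r i‖ * ∏ i ∈ T, Real.exp ‖r i‖) :=
      HasSum.mul (f := fun n : ℕ => ‖r i ^ n / (n.factorial : ℂ)‖)
        (g := fun d => ‖expPart r T d‖) e2 ih.1 m0
    have m2 : HasSum (fun x : ℕ × Occ => r i ^ x.1 / (x.1.factorial : ℂ) * expPart r T x.2)
        (Complex.exp (r i) * ∏ i ∈ T, Complex.exp (r i)) := 
      HasSum.mul (f := fun n : ℕ => r i ^ n / (n.factorial : ℂ)) (g := expPart r T) e1 ih.2
        (summable_mul_of_summable_norm (f := fun n : ℕ => r i ^ n / (n.factorial : ℂ))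
          (g := expPart r T) e2.summable ih.1.summable)
    set ψ : Occ → ℕ × Occ := fun d => (d i, d.erase i) with hψ
    have hinj : Function.Injective ψ := by
      intro d d' h
      simp only [hψ, Prod.mk.injEq] at h
      rw [← Finsupp.single_add_erase i d, ← Finsupp.single_add_erase i d', h.1, h.2]
    have hval : ∀ d, r i ^ (ψ d).1 / ((ψ d).1.factorial : ℂ) * expPart r T (ψ d).2 =
        expPart r (insert i T) d := by
      intro d
      have hs : (d.erase i).support ⊆ T ↔ d.support ⊆ insert i T := by
        rw [Finsupp.support_erase, Finset.subset_insert_iff]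
      simp only [hψ, expPart, hs]
      split_ifs with h
      · rw [expCoeff_of_subset h, expCoeff_of_subset (hs.2 h), Finset.prod_insert hi]
        congr 1
        refine Finset.prod_congr rfl fun j hj => ?_
        rw [Finsupp.erase_ne (fun hji : j = i => hi (hji ▸ hj))]
      · simp
    have hrange : ∀ x, x ∉ Set.range ψ → expPart r T x.2 = 0 := by
      rintro ⟨n, d⟩ hx
      by_contra hne
      apply hx
      have hd : d.support ⊆ T := by
        by_contra hd
        simp [expPart, hd] at hne
      have hdi : d i = 0 := by
        by_contra hdi
        exact hi (hd (Finsupp.mem_support_iff.2 hdi))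
      refine ⟨Finsupp.single i n + d, ?_⟩
      simp only [hψ, Finsupp.add_apply, Finsupp.single_eq_same, hdi, add_zero, Finsupp.erase_add,
        Finsupp.erase_single, zero_add, Prod.mk.injEq, true_and]
      exact Finsupp.erase_of_notMem_support (by simpa using hdi)
    rw [Finset.prod_insert hi, Finset.prod_insert hi]
    constructor
    · rw [← hinj.hasSum_iff (fun x hx => by rw [hrange x hx]; simp)] at m1
      convert m1 using 1
      funext d
      simp only [Function.comp_apply, ← hval d, norm_mul]
    · rw [← hinj.hasSum_iff (fun x hx => by rw [hrange x hx]; simp)] at m2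
      convert m2 using 1
      funext d
      simp only [Function.comp_apply, ← hval d]

/-- The exponential series in infinitely many variables. -/
theorem hasSum_expCoeff {r : Mode → ℂ} (hr : Summable fun i => ‖r i‖) :
    HasSum (expCoeff r) (Complex.exp (∑' i, r i)) := by
  classical
  have hsum : Summable fun d => ‖expCoeff r d‖ := by
    refine summable_of_sum_le (c := Real.exp (∑' i, ‖r i‖)) (fun _ => norm_nonneg _) fun s => ?_
    set T := s.biUnion fun d => d.support with hT
    calc ∑ d ∈ s, ‖expCoeff r d‖ = ∑ d ∈ s, ‖expPart r T d‖ := by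
          refine Finset.sum_congr rfl fun d hd => ?_
          rw [expPart, if_pos (Finset.subset_biUnion_of_mem (fun d : Occ => d.support) hd)]
      _ ≤ ∏ i ∈ T, Real.exp ‖r i‖ :=
          sum_le_hasSum s (fun _ _ => norm_nonneg _) (hasSum_expPart r T).1
      _ = Real.exp (∑ i ∈ T, ‖r i‖) := (Real.exp_sum T _).symm
      _ ≤ _ := Real.exp_le_exp.2 (hr.sum_le_tsum T fun _ _ => norm_nonneg _)
  have h1 : Tendsto (fun T => ∑' d, expPart r T d) atTop (𝓝 (∑' d, expCoeff r d)) := by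
    refine tendsto_tsum_of_dominated_convergence hsum (fun d => ?_) ?_
    · refine tendsto_const_nhds.congr' ?_
      filter_upwards [eventually_ge_atTop d.support] with T hT
      rw [expPart, if_pos hT]
    · refine Eventually.of_forall fun T d => ?_
      unfold expPart
      split_ifs
      · exact le_rfl
      · simp
  have h2 : Tendsto (fun T => ∑' d, expPart r T d) atTop (𝓝 (Complex.exp (∑' i, r i))) := by
    have : (fun T => ∑' d, expPart r T d) = fun T => Complex.exp (∑ i ∈ T, r i) := by
      funext T
      rw [(hasSum_expPart r T).2.tsum_eq, Complex.exp_sum]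
    rw [this]
    exact (Complex.continuous_exp.tendsto _).comp hr.of_norm.hasSum
  rw [← tendsto_nhds_unique h1 h2]
  exact hsum.of_norm.hasSum

/-- Translation of the variables of a polynomial. -/
def shift (β : Mode → ℂ) : MvPolynomial Mode ℂ →ₐ[ℂ] MvPolynomial Mode ℂ :=
  MvPolynomial.aeval fun i => MvPolynomial.X i + MvPolynomial.C (β i)

theorem shift_X (β : Mode → ℂ) (i : Mode) :
    shift β (MvPolynomial.X i) = MvPolynomial.X i + MvPolynomial.C (β i) :=
  MvPolynomial.aeval_X _ _

theorem pderiv_shift (β : Mode → ℂ) (i : Mode) (f : MvPolynomial Mode ℂ) :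
    MvPolynomial.pderiv i (shift β f) = shift β (MvPolynomial.pderiv i f) := by
  classical
  induction f using MvPolynomial.induction_on with
  | C c => simp [shift]
  | add f g hf hg => simp only [map_add, hf, hg]
  | mul_X f j hf =>
    rw [map_mul, Derivation.leibniz, Derivation.leibniz, hf, shift_X, map_add, MvPolynomial.pderiv_C,
      MvPolynomial.pderiv_X]
    simp only [smul_eq_mul, map_add, map_mul, shift_X, add_zero]
    by_cases h : j = i
    · subst h; simp
    · simp [h]

/-- Formally, translating `exp (∑ y_i X_i)` by `β` multiplies it by `exp (∑ y_i β_i)`. Infinitely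
many `d` contribute to each coefficient. The constant coefficient is the exponential series, and a
partial derivative, which commutes with the translation, raises `w` by one mode. -/
theorem hasSum_expCoeff_mul_shift {y β : Mode → ℂ} (h : Summable fun i => ‖y i * β i‖) (w : Occ) :
    HasSum (fun d => expCoeff y d * MvPolynomial.coeff w (shift β (MvPolynomial.monomial d 1)))
      (Complex.exp (∑' i, y i * β i) * expCoeff y w) := by
  induction w using occ_induction with
  | h0 =>
    rw [expCoeff_zero, mul_one]
    refine hasSum_of_eq (hasSum_expCoeff h) (fun d => ?_) rfl
    rw [← expCoeff_mul_expCoeff y β d d.support subset_rfl]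
    congr 1
    rw [← MvPolynomial.constantCoeff_eq, shift, MvPolynomial.aeval_monomial, map_mul]
    simp [Finsupp.prod, map_prod]
  | hs w i ih =>
    have h4 : (w i : ℂ) + 1 ≠ 0 := by exact_mod_cast Nat.succ_ne_zero (w i)
    have hinj : Function.Injective fun d : Occ => d + Finsupp.single i 1 := add_left_injective _
    have key : HasSum (fun d => expCoeff y d *
        MvPolynomial.coeff (w + Finsupp.single i 1) (shift β (MvPolynomial.monomial d 1)) *
          ((w i : ℂ) + 1)) (y i * (Complex.exp (∑' i, y i * β i) * expCoeff y w)) := by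
      have hc : ∀ d : Occ, MvPolynomial.coeff (w + Finsupp.single i 1)
          (shift β (MvPolynomial.monomial d 1)) * ((w i : ℂ) + 1) =
          (d i : ℂ) * MvPolynomial.coeff w
            (shift β (MvPolynomial.monomial (d - Finsupp.single i 1) 1)) := by
        intro d
        rw [← MvPolynomial.coeff_pderiv, pderiv_shift, MvPolynomial.pderiv_monomial, one_mul,
          ← mul_one ((d i : ℕ) : ℂ), ← MvPolynomial.C_mul_monomial, map_mul]
        simp only [shift, MvPolynomial.algHom_C, MvPolynomial.algebraMap_eq, mul_one,
          MvPolynomial.coeff_C_mul]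
      rw [← hinj.hasSum_iff]
      · refine hasSum_of_eq (ih.mul_left (y i)) (fun d => ?_) rfl
        simp only [Function.comp_apply]
        rw [mul_assoc, hc, add_tsub_cancel_right, ← mul_assoc (y i), ← expCoeff_add_single]
        simp only [Finsupp.add_apply, Finsupp.single_eq_same]
        push_cast
        ring
      · intro d hd
        rw [mul_assoc, hc]
        have : d i = 0 := by
          by_contra hne
          refine hd ⟨d - Finsupp.single i 1, ?_⟩
          refine tsub_add_cancel_of_le ?_
          rw [Finsupp.single_le_iff]; omega
        rw [this]; simp
    refine hasSum_of_eq (key.mul_right (((w i : ℂ) + 1)⁻¹)) (fun d => ?_) ?_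
    · field_simp
    · rw [mul_left_comm, ← expCoeff_add_single]
      field_simp

/-- The same with a polynomial factor: multiplication of `p` by `X i` becomes multiplication by `X i
+ β i` after the translation. -/
theorem hasSum_coeff_mul_shift {y β : Mode → ℂ} (h : Summable fun i => ‖y i * β i‖)
    (p : MvPolynomial Mode ℂ) (w : Occ) :
    HasSum (fun d => MvPowerSeries.coeff d (Params.expCre y * (p : MvPowerSeries Mode ℂ)) *
        MvPolynomial.coeff w (shift β (MvPolynomial.monomial d 1)))
      (Complex.exp (∑' i, y i * β i) *
        MvPowerSeries.coeff w (Params.expCre y * (shift β p : MvPowerSeries Mode ℂ))) := by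
  classical
  induction p using MvPolynomial.induction_on generalizing w with
  | C c =>
    refine hasSum_of_eq ((hasSum_expCoeff_mul_shift h w).mul_right c) (fun d => ?_) ?_
    · rw [MvPolynomial.coe_C, mul_comm (Params.expCre y), MvPowerSeries.coeff_C_mul, coeff_expCre]
      ring
    · rw [shift, MvPolynomial.algHom_C, MvPolynomial.algebraMap_eq, MvPolynomial.coe_C,
        mul_comm (Params.expCre y), MvPowerSeries.coeff_C_mul, coeff_expCre]
      ring
  | add f g hf hg =>
    refine hasSum_of_eq ((hf w).add (hg w)) (fun d => ?_) ?_
    · rw [MvPolynomial.coe_add, mul_add, map_add, add_mul]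
    · rw [map_add, MvPolynomial.coe_add, mul_add, map_add, mul_add]
  | mul_X f i hf =>
    have hinj : Function.Injective fun d : Occ => d + Finsupp.single i 1 := add_left_injective _
    have hmX : ∀ (g : MvPowerSeries Mode ℂ) (d : Occ), MvPowerSeries.coeff d
        (g * MvPowerSeries.X i) = if Finsupp.single i 1 ≤ d then
          MvPowerSeries.coeff (d - Finsupp.single i 1) g else 0 := fun g d => by
      rw [MvPowerSeries.X, MvPowerSeries.coeff_mul_monomial]; simp
    rw [← hinj.hasSum_iff]
    · have hsh : ∀ d : Occ, MvPolynomial.coeff w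
          (shift β (MvPolynomial.monomial (d + Finsupp.single i 1) 1)) =
          (if Finsupp.single i 1 ≤ w then MvPolynomial.coeff (w - Finsupp.single i 1)
            (shift β (MvPolynomial.monomial d 1)) else 0) +
            β i * MvPolynomial.coeff w (shift β (MvPolynomial.monomial d 1)) := by
        intro d
        rw [show (MvPolynomial.monomial (d + Finsupp.single i 1) 1 : MvPolynomial Mode ℂ) =
          MvPolynomial.monomial d 1 * MvPolynomial.X i by
            rw [MvPolynomial.X, MvPolynomial.monomial_mul, one_mul], map_mul, shift_X, mul_add, MvPolynomial.coeff_add,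
          mul_comm _ (MvPolynomial.C _), MvPolynomial.coeff_C_mul]
        congr 1
        rw [← MvPolynomial.coeff_coe, MvPolynomial.coe_mul, MvPolynomial.coe_X, hmX]
        simp only [MvPolynomial.coeff_coe]
      have hval : MvPowerSeries.coeff w (Params.expCre y *
          (shift β (f * MvPolynomial.X i) : MvPowerSeries Mode ℂ)) =
          (if Finsupp.single i 1 ≤ w then MvPowerSeries.coeff (w - Finsupp.single i 1)
            (Params.expCre y * (shift β f : MvPowerSeries Mode ℂ)) else 0) +
            β i * MvPowerSeries.coeff w (Params.expCre y * (shift β f : MvPowerSeries Mode ℂ)) := by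
        rw [map_mul (shift β), shift_X, mul_add, MvPolynomial.coe_add, MvPolynomial.coe_mul,
          MvPolynomial.coe_mul, MvPolynomial.coe_X, MvPolynomial.coe_C, mul_add, ← mul_assoc,
          map_add, hmX, ← mul_assoc, mul_comm _ (MvPowerSeries.C _), MvPowerSeries.coeff_C_mul]
      rw [hval]
      by_cases hw : Finsupp.single i 1 ≤ w
      · refine hasSum_of_eq ((hf (w - Finsupp.single i 1)).add ((hf w).mul_left (β i)))
          (fun d => ?_) ?_
        · simp only [Function.comp_apply, hsh, if_pos hw, MvPolynomial.coe_mul, MvPolynomial.coe_X,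
            ← mul_assoc, hmX, le_add_iff_nonneg_left, zero_le, if_true, add_tsub_cancel_right]
          ring
        · rw [if_pos hw]; ring
      · refine hasSum_of_eq ((hf w).mul_left (β i)) (fun d => ?_) ?_
        · simp only [Function.comp_apply, hsh, if_neg hw, MvPolynomial.coe_mul, MvPolynomial.coe_X,
            ← mul_assoc, hmX, le_add_iff_nonneg_left, zero_le, if_true, add_tsub_cancel_right]
          ring
        · rw [if_neg hw]; ring
    · intro d hd
      rw [MvPolynomial.coe_mul, MvPolynomial.coe_X, ← mul_assoc, hmX, if_neg, zero_mul]
      exact fun hle => hd ⟨d - Finsupp.single i 1, tsub_add_cancel_of_le hle⟩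

/-- Matrix elements of `exp (∑ x_i X_i)` times a translation by `β`. -/
def mel (x β : Mode → ℂ) (s t : Occ) : ℂ := MvPowerSeries.coeff s
  (Params.expCre x * (shift β (MvPolynomial.monomial t 1) : MvPowerSeries Mode ℂ))

theorem shift_shift (β β' : Mode → ℂ) (f : MvPolynomial Mode ℂ) :
    shift β (shift β' f) = shift (β + β') f := by
  have : (shift β).comp (shift β') = shift (β + β') := by
    apply MvPolynomial.algHom_ext
    intro i
    simp only [AlgHom.comp_apply, shift_X, map_add, Pi.add_apply]
    simp [shift, add_assoc]
  rw [← this]; rfl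

/-- The scalar appears when the translation of the left factor moves past the exponential of the
right factor. Multiplication by the exponential of the left factor involves finitely many terms for
each coefficient and can be split off. -/
theorem hasSum_mel_mul {x y β β' : Mode → ℂ} (h : Summable fun i => ‖β i * y i‖) (s t : Occ) :
    HasSum (fun d => mel x β s d * mel y β' d t)
      (Complex.exp (∑' i, β i * y i) * mel (x + y) (β + β') s t) := by
  classical
  have h' : Summable fun i => ‖y i * β i‖ := by simpa only [mul_comm] using h
  have hx : ∀ g : MvPowerSeries Mode ℂ, MvPowerSeries.coeff s (Params.expCre x * g) =
      ∑ u ∈ Finset.HasAntidiagonal.antidiagonal s, expCoeff x u.1 * MvPowerSeries.coeff u.2 g := fun g => by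
    rw [MvPowerSeries.coeff_mul]; rfl
  have := hasSum_sum (s := Finset.HasAntidiagonal.antidiagonal s) fun u _ =>
    (hasSum_coeff_mul_shift h' (shift β' (MvPolynomial.monomial t 1)) u.2).mul_left (expCoeff x u.1)
  refine hasSum_of_eq this (fun d => ?_) ?_
  · rw [mel, hx, Finset.sum_mul]
    refine Finset.sum_congr rfl fun u _ => ?_
    rw [MvPolynomial.coeff_coe, mel]; ring
  · rw [mel, ← expCre_mul, mul_assoc, hx, Finset.mul_sum, ← shift_shift]
    refine Finset.sum_congr rfl fun u _ => ?_
    simp only [mul_comm (β _)]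
    ring

end EllipticVO
end

open Filter Topology
noncomputable section
namespace EllipticVO

/-! ### Majorants and smoothness of matrix elements -/

/-- `g` has real coefficients that bound those of `f`. -/
def Maj (f g : MvPowerSeries Mode ℂ) : Prop :=
  ∀ d, ∃ r : ℝ, MvPowerSeries.coeff d g = r ∧ ‖MvPowerSeries.coeff d f‖ ≤ r

theorem Maj.mul {f f' g g' : MvPowerSeries Mode ℂ} (h : Maj f g) (h' : Maj f' g') :
    Maj (f * f') (g * g') := by
  classical
  intro d
  choose r hr hr' using h
  choose s hs hs' using h'
  refine ⟨∑ u ∈ Finset.HasAntidiagonal.antidiagonal d, r u.1 * s u.2, ?_, ?_⟩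
  · rw [MvPowerSeries.coeff_mul]
    push_cast
    exact Finset.sum_congr rfl fun u _ => by rw [hr, hs]
  · rw [MvPowerSeries.coeff_mul]
    refine (norm_sum_le _ _).trans (Finset.sum_le_sum fun u _ => ?_)
    rw [norm_mul]
    exact mul_le_mul (hr' _) (hs' _) (norm_nonneg _) ((norm_nonneg _).trans (hr' _))

theorem Maj.one : Maj 1 1 := by
  classical
  intro d
  rw [MvPowerSeries.coeff_one]
  split_ifs
  · exact ⟨1, by simp, by simp⟩
  · exact ⟨0, by simp, by simp⟩

theorem Maj.pow {f g : MvPowerSeries Mode ℂ} (h : Maj f g) (n : ℕ) : Maj (f ^ n) (g ^ n) := by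
  induction n with
  | zero => simpa using Maj.one
  | succ n ih => rw [pow_succ, pow_succ]; exact ih.mul h

theorem Maj.prod {ι : Type*} {f g : ι → MvPowerSeries Mode ℂ} (T : Finset ι)
    (h : ∀ i ∈ T, Maj (f i) (g i)) : Maj (∏ i ∈ T, f i) (∏ i ∈ T, g i) := by
  classical
  induction T using Finset.induction with
  | empty => simpa using Maj.one
  | insert i T hi ih =>
    rw [Finset.prod_insert hi, Finset.prod_insert hi]
    exact (h i (Finset.mem_insert_self i T)).mul
      (ih fun j hj => h j (Finset.mem_insert_of_mem hj))

theorem coe_shift_monomial (β : Mode → ℂ) (t : Occ) :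
    ((shift β (MvPolynomial.monomial t 1) : MvPolynomial Mode ℂ) : MvPowerSeries Mode ℂ) =
      ∏ i ∈ t.support, (MvPowerSeries.X i + MvPowerSeries.C (β i)) ^ t i := by
  rw [shift, MvPolynomial.aeval_monomial, map_one, one_mul, Finsupp.prod,
    ← MvPolynomial.coeToMvPowerSeries.ringHom_apply, map_prod]
  refine Finset.prod_congr rfl fun i _ => ?_
  rw [map_pow, map_add]
  simp

theorem maj_expCre {x : Mode → ℂ} {x' : Mode → ℝ} (h : ∀ i, ‖x i‖ ≤ x' i) :
    Maj (Params.expCre x) (Params.expCre fun i => (x' i : ℂ)) := by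
  intro d
  refine ⟨∏ i ∈ d.support, x' i ^ d i / ((d i).factorial : ℝ), ?_, ?_⟩
  · rw [coeff_expCre, expCoeff_of_subset subset_rfl]
    push_cast
    rfl
  · rw [coeff_expCre, expCoeff_of_subset subset_rfl, norm_prod]
    refine Finset.prod_le_prod (fun _ _ => norm_nonneg _) fun i _ => ?_
    rw [norm_div, norm_pow, Complex.norm_natCast]
    gcongr
    exact h i

theorem maj_X_add {b : ℂ} {b' : ℝ} (h : ‖b‖ ≤ b') (i : Mode) :
    Maj (MvPowerSeries.X i + MvPowerSeries.C b) (MvPowerSeries.X i + MvPowerSeries.C (b' : ℂ)) := by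
  classical
  intro d
  simp only [map_add, MvPowerSeries.coeff_X, MvPowerSeries.coeff_C]
  refine ⟨(if d = Finsupp.single i 1 then 1 else 0) + (if d = 0 then b' else 0), ?_, ?_⟩
  · push_cast
    split_ifs <;> simp
  · refine (norm_add_le _ _).trans (add_le_add ?_ ?_)
    · split_ifs <;> simp
    · split_ifs <;> simp [h]

/-- Monotonicity of the matrix elements. -/
theorem norm_mel_le {x β : Mode → ℂ} {x' β' : Mode → ℝ} (hx : ∀ i, ‖x i‖ ≤ x' i)
    (hβ : ∀ i, ‖β i‖ ≤ β' i) (s t : Occ) :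
    ‖mel x β s t‖ ≤ ‖mel (fun i => (x' i : ℂ)) (fun i => (β' i : ℂ)) s t‖ := by
  unfold mel
  rw [coe_shift_monomial, coe_shift_monomial]
  obtain ⟨r, h1, h2⟩ := ((maj_expCre hx).mul
    (Maj.prod t.support fun i _ => (maj_X_add (hβ i) i).pow (t i))) s
  rw [h1, Complex.norm_real, Real.norm_eq_abs]
  exact h2.trans (le_abs_self r)

section Smooth

variable {E : Type*} [NormedAddCommGroup E] [NormedSpace ℂ E]

/-- All coefficients depend smoothly on the parameter. -/
def SmoothSeries (f : E → MvPowerSeries Mode ℂ) : Prop :=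
  ∀ d, ContDiff ℂ 1 fun Y => MvPowerSeries.coeff d (f Y)

theorem SmoothSeries.mul {f g : E → MvPowerSeries Mode ℂ} (hf : SmoothSeries f)
    (hg : SmoothSeries g) : SmoothSeries fun Y => f Y * g Y := by
  classical
  intro d
  simp only [MvPowerSeries.coeff_mul]
  exact ContDiff.sum fun u _ => (hf _).mul (hg _)

theorem SmoothSeries.pow {f : E → MvPowerSeries Mode ℂ} (hf : SmoothSeries f) (n : ℕ) :
    SmoothSeries fun Y => f Y ^ n := by
  induction n with
  | zero => intro d; simpa using contDiff_const
  | succ n ih => simp only [pow_succ]; exact ih.mul hf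

theorem SmoothSeries.prod {ι : Type*} {f : ι → E → MvPowerSeries Mode ℂ} (T : Finset ι)
    (h : ∀ i, SmoothSeries (f i)) : SmoothSeries fun Y => ∏ i ∈ T, f i Y := by
  classical
  induction T using Finset.induction with
  | empty => intro d; simpa using contDiff_const
  | insert i T hi ih => simp only [Finset.prod_insert hi]; exact (h i).mul ih

/-- Each coefficient of a product depends on finitely many coefficients of the factors, so
smoothness is a matter of coefficients. -/
theorem contDiff_mel {x β : E → Mode → ℂ} (hx : ∀ i, ContDiff ℂ 1 fun Y => x Y i)
    (hβ : ∀ i, ContDiff ℂ 1 fun Y => β Y i) (s t : Occ) :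
    ContDiff ℂ 1 fun Y => mel (x Y) (β Y) s t := by
  classical
  have h1 : SmoothSeries fun Y => Params.expCre (x Y) := fun d => by
    simp only [coeff_expCre, expCoeff, Finsupp.prod]
    exact contDiff_prod fun i _ => ((hx i).pow _).div_const _
  have h2 : SmoothSeries fun Y => ∏ i ∈ t.support,
      (MvPowerSeries.X i + MvPowerSeries.C (β Y i)) ^ t i := by
    refine SmoothSeries.prod (f := fun i Y => (MvPowerSeries.X i + MvPowerSeries.C (β Y i)) ^ t i)
      _ fun i => SmoothSeries.pow ?_ _
    intro d
    simp only [map_add, MvPowerSeries.coeff_C]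
    refine contDiff_const.add ?_
    split_ifs
    · exact hβ i
    · exact contDiff_const
  simp only [mel, coe_shift_monomial]
  exact (h1.mul h2) s

end Smooth

/-! ### Normal ordered exponentials -/

namespace Expo

@[simp] theorem add_cre (X Y : Expo) : (X + Y).cre = X.cre + Y.cre := rfl
@[simp] theorem add_ann (X Y : Expo) : (X + Y).ann = X.ann + Y.ann := rfl
@[simp] theorem add_Q (X Y : Expo) : (X + Y).Q = X.Q + Y.Q := rfl
@[simp] theorem add_P (X Y : Expo) : (X + Y).P = X.P + Y.P := rfl
@[simp] theorem add_K (X Y : Expo) : (X + Y).K = X.K + Y.K := rfl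
@[simp] theorem sub_cre (X Y : Expo) : (X - Y).cre = X.cre - Y.cre := rfl
@[simp] theorem sub_ann (X Y : Expo) : (X - Y).ann = X.ann - Y.ann := rfl
@[simp] theorem sub_Q (X Y : Expo) : (X - Y).Q = X.Q - Y.Q := rfl
@[simp] theorem sub_P (X Y : Expo) : (X - Y).P = X.P - Y.P := rfl
@[simp] theorem sub_K (X Y : Expo) : (X - Y).K = X.K - Y.K := rfl
@[simp] theorem neg_cre (X : Expo) : (-X).cre = -X.cre := rfl
@[simp] theorem neg_ann (X : Expo) : (-X).ann = -X.ann := rfl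
@[simp] theorem neg_Q (X : Expo) : (-X).Q = -X.Q := rfl
@[simp] theorem neg_P (X : Expo) : (-X).P = -X.P := rfl
@[simp] theorem neg_K (X : Expo) : (-X).K = -X.K := rfl

/-- The eigenvalue of the zero mode part on a sector. -/
def lin (X : Expo) (c : Charge) : ℂ :=
  X.P .a * c .a + X.P .b * c .b + X.P .c * c .c + X.P .hat * c .hat + X.K

theorem lin_add (X Y : Expo) (c : Charge) : (X + Y).lin c = X.lin c + Y.lin c := by
  simp only [lin, add_P, add_K, Pi.add_apply]; ring

theorem lin_charge_add (X : Expo) (c c' : Charge) : X.lin (c + c') = X.lin c +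
    (X.P .a * c' .a + X.P .b * c' .b + X.P .c * c' .c + X.P .hat * c' .hat) := by
  simp only [lin, Pi.add_apply]; ring

end Expo

namespace Params

variable (P : Params)

/-- The change of the charges under `:exp X:`. -/
def dq (X : Expo) : Charge := fun i => P.zcomm i * X.Q i

/-- The coefficients of the annihilation operators times the commutators. -/
def bt (X : Expo) : Mode → ℂ := fun i => P.comm i * X.ann i

theorem vop_of_eq {X : Expo} {s t : State} (h : s.1 = t.1 + P.dq X) :
    P.vop X s t = Complex.exp (X.lin t.1) * mel X.cre (P.bt X) s.2 t.2 := if_pos h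

theorem vop_of_ne {X : Expo} {s t : State} (h : s.1 ≠ t.1 + P.dq X) : P.vop X s t = 0 := if_neg h

theorem dq_add (X Y : Expo) : P.dq (X + Y) = P.dq X + P.dq Y := by
  funext i; simp [dq, mul_add]

theorem bt_add (X Y : Expo) : P.bt (X + Y) = P.bt X + P.bt Y := by
  funext i; simp [bt, mul_add]

/-- The contribution of the zero modes to the contraction of two exponentials. -/
def zpair (X Y : Expo) : ℂ := X.P .a * P.dq Y .a + X.P .b * P.dq Y .b + X.P .c * P.dq Y .c +
  X.P .hat * P.dq Y .hat

/-- A normal ordered exponential shifts the charge by a fixed vector, so only intermediate states of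
one charge contribute and the sum runs over occupation numbers. -/
theorem hasSum_state {f : State → ℂ} {c : Charge} (h : ∀ x, x.1 ≠ c → f x = 0) {a : ℂ} :
    HasSum f a ↔ HasSum (fun d : Occ => f (c, d)) a := by
  have hinj : Function.Injective fun d : Occ => ((c, d) : State) := fun d d' h => by
    simpa using h
  rw [← hinj.hasSum_iff]
  · rfl
  · rintro ⟨c', d⟩ hx
    refine h _ fun hc => hx ⟨d, ?_⟩
    simp only at hc
    rw [hc]

/-- Wick's theorem for two normal ordered exponentials. -/
theorem hasSum_vop_mul {X Y : Expo} (h : Summable fun i => ‖P.bt X i * Y.cre i‖) (s t : State) :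
    HasSum (fun x : State => P.vop X s x * P.vop Y x t)
      (Complex.exp (P.zpair X Y) * Complex.exp (∑' i, P.bt X i * Y.cre i) * P.vop (X + Y) s t) := by
  have h0 : ∀ x : State, x.1 ≠ t.1 + P.dq Y → P.vop X s x * P.vop Y x t = 0 := fun x hx => by
    rw [P.vop_of_ne hx, mul_zero]
  rw [hasSum_state h0]
  -- If the charges do not match, both sides vanish termwise.
  by_cases hs : s.1 = t.1 + P.dq Y + P.dq X
  · have hs' : s.1 = t.1 + P.dq (X + Y) := by rw [hs, dq_add, add_assoc, add_comm (P.dq X)]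
    have := (hasSum_mel_mul (x := X.cre) (y := Y.cre) (β := P.bt X) (β' := P.bt Y) h s.2 t.2).mul_left
      (Complex.exp (X.lin (t.1 + P.dq Y)) * Complex.exp (Y.lin t.1))
    refine hasSum_of_eq this (fun d => ?_) ?_
    · rw [P.vop_of_eq (s := s) hs, P.vop_of_eq (s := (t.1 + P.dq Y, d)) rfl]
      ring
    · rw [P.vop_of_eq hs', Expo.lin_charge_add, Complex.exp_add, Expo.lin_add, Complex.exp_add,
        bt_add, Expo.add_cre, zpair]
      ring
  · have hs' : s.1 ≠ t.1 + P.dq (X + Y) := fun h => hs (by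
      rw [h, dq_add, add_assoc, add_comm (P.dq X)])
    rw [P.vop_of_ne hs', mul_zero]
    refine hasSum_of_eq hasSum_zero (fun d => ?_) rfl
    rw [P.vop_of_ne (s := s) hs, zero_mul]

end Params
end EllipticVO
end

open Filter Topology
noncomputable section
namespace EllipticVO
namespace Params

set_option linter.unusedSimpArgs false
set_option linter.unusedTactic false
set_option linter.unreachableTactic false

variable (P : Params)

/-! ### Coefficients of the currents and vertex operators -/

/-- `q ^ n`. -/
def qn (n : ℕ+) : ℂ := P.qpow n

/-- `q ^ (k n / 2)`. -/
def kn (n : ℕ+) : ℂ := P.qpow (P.k / 2 * n)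

/-- `q ^ (r n)`. -/
def rn (n : ℕ+) : ℂ := P.qpow (P.r * n)

/-- `q ^ (l n)`. -/
def ln (l : ℕ) (n : ℕ+) : ℂ := P.qpow (l * n)

/-- `q - q⁻¹`. -/
def dd : ℂ := P.qpow 1 - P.qpow (-1)

theorem qn_ne (n : ℕ+) : P.qn n ≠ 0 := Complex.exp_ne_zero _
theorem kn_ne (n : ℕ+) : P.kn n ≠ 0 := Complex.exp_ne_zero _
theorem rn_ne (n : ℕ+) : P.rn n ≠ 0 := Complex.exp_ne_zero _
theorem ln_ne (l : ℕ) (n : ℕ+) : P.ln l n ≠ 0 := Complex.exp_ne_zero _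

/-- Shifts of the spectral variable contribute monomials in `qn`, `kn`, `rn`, `ln`. Treating these
as atoms turns all later identities between coefficients into identities of rational functions; `q ^
(k n / 2)` is the smallest power of `q ^ k` that occurs. -/
theorem z_pow_k_quarter (n : ℕ+) : P.z (P.k / 4) ^ (n : ℕ) = P.kn n := by
  simp only [z, qpow, qn, kn, rn, ln, ← Complex.exp_nat_mul, ← Complex.exp_neg, ← Complex.exp_add]
  congr 1
  push_cast [rs]
  ring

theorem z_pow_rs_add_half_k_sub_one (n : ℕ+) : P.z ((P.rs + P.k / 2 - 1) / 2) ^ (n : ℕ) = P.rn n * (P.kn n)⁻¹ * (P.qn n)⁻¹ := by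
  simp only [z, qpow, qn, kn, rn, ln, ← Complex.exp_nat_mul, ← Complex.exp_neg, ← Complex.exp_add]
  congr 1
  push_cast [rs]
  ring

theorem z_pow_rs_half (n : ℕ+) : P.z (P.rs / 2) ^ (n : ℕ) = P.rn n * (P.kn n ^ 2)⁻¹ := by
  simp only [z, qpow, qn, kn, rn, ln, ← Complex.exp_nat_mul, ← Complex.exp_neg, ← Complex.exp_add]
  congr 1
  push_cast [rs]
  ring

theorem z_pow_rs_sub_two (n : ℕ+) : P.z ((P.rs - 2) / 2) ^ (n : ℕ) = P.rn n * (P.kn n ^ 2)⁻¹ * (P.qn n ^ 2)⁻¹ := by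
  simp only [z, qpow, qn, kn, rn, ln, ← Complex.exp_nat_mul, ← Complex.exp_neg, ← Complex.exp_add]
  congr 1
  push_cast [rs]
  ring

theorem z_pow_r_sub_half_k_sub_one (n : ℕ+) : P.z ((P.r - P.k / 2 - 1) / 2) ^ (n : ℕ) = P.rn n * (P.kn n)⁻¹ * (P.qn n)⁻¹ := by
  simp only [z, qpow, qn, kn, rn, ln, ← Complex.exp_nat_mul, ← Complex.exp_neg, ← Complex.exp_add]
  congr 1
  push_cast [rs]
  ring

theorem z_pow_r_sub_k_sub_two (n : ℕ+) : P.z ((P.r - P.k - 2) / 2) ^ (n : ℕ) = P.rn n * (P.kn n ^ 2)⁻¹ * (P.qn n ^ 2)⁻¹ := by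
  simp only [z, qpow, qn, kn, rn, ln, ← Complex.exp_nat_mul, ← Complex.exp_neg, ← Complex.exp_add]
  congr 1
  push_cast [rs]
  ring

theorem z_pow_r_sub_k (n : ℕ+) : P.z ((P.r - P.k) / 2) ^ (n : ℕ) = P.rn n * (P.kn n ^ 2)⁻¹ := by
  simp only [z, qpow, qn, kn, rn, ln, ← Complex.exp_nat_mul, ← Complex.exp_neg, ← Complex.exp_add]
  congr 1
  push_cast [rs]
  ring

theorem z_pow_half (n : ℕ+) : P.z (1 / 2) ^ (n : ℕ) = P.qn n := by
  simp only [z, qpow, qn, kn, rn, ln, ← Complex.exp_nat_mul, ← Complex.exp_neg, ← Complex.exp_add]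
  congr 1
  push_cast [rs]
  ring

theorem z_pow_k_add_one (n : ℕ+) : P.z ((P.k + 1) / 2) ^ (n : ℕ) = P.kn n ^ 2 * P.qn n := by
  simp only [z, qpow, qn, kn, rn, ln, ← Complex.exp_nat_mul, ← Complex.exp_neg, ← Complex.exp_add]
  congr 1
  push_cast [rs]
  ring

theorem z_pow_k_add_two_quarter (n : ℕ+) : P.z ((P.k + 2) / 4) ^ (n : ℕ) = P.kn n * P.qn n := by
  simp only [z, qpow, qn, kn, rn, ln, ← Complex.exp_nat_mul, ← Complex.exp_neg, ← Complex.exp_add]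
  congr 1
  push_cast [rs]
  ring

theorem z_pow_k_add_two (n : ℕ+) : P.z ((P.k + 2) / 2) ^ (n : ℕ) = P.kn n ^ 2 * P.qn n ^ 2 := by
  simp only [z, qpow, qn, kn, rn, ln, ← Complex.exp_nat_mul, ← Complex.exp_neg, ← Complex.exp_add]
  congr 1
  push_cast [rs]
  ring

theorem z_pow_half_k_add_two (n : ℕ+) : P.z ((P.k / 2 + 2) / 2) ^ (n : ℕ) = P.kn n * P.qn n ^ 2 := by
  simp only [z, qpow, qn, kn, rn, ln, ← Complex.exp_nat_mul, ← Complex.exp_neg, ← Complex.exp_add]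
  congr 1
  push_cast [rs]
  ring

theorem z_pow_half_k_add_two_half (n : ℕ+) : P.z ((P.k + 2) / 2 / 2) ^ (n : ℕ) = P.kn n * P.qn n := by
  simp only [z, qpow, qn, kn, rn, ln, ← Complex.exp_nat_mul, ← Complex.exp_neg, ← Complex.exp_add]
  congr 1
  push_cast [rs]
  ring

theorem z_pow_neg_half_k_add_two (n : ℕ+) : P.z (-((P.k + 2) / 2) / 2) ^ (n : ℕ) = (P.kn n)⁻¹ * (P.qn n)⁻¹ := by
  simp only [z, qpow, qn, kn, rn, ln, ← Complex.exp_nat_mul, ← Complex.exp_neg, ← Complex.exp_add]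
  congr 1
  push_cast [rs]
  ring

theorem z_pow_neg_half (n : ℕ+) : P.z (-1 / 2) ^ (n : ℕ) = (P.qn n)⁻¹ := by
  simp only [z, qpow, qn, kn, rn, ln, ← Complex.exp_nat_mul, ← Complex.exp_neg, ← Complex.exp_add]
  congr 1
  push_cast [rs]
  ring

theorem z_pow_half_k_sub_two (n : ℕ+) : P.z ((P.k - 2) / 2 / 2) ^ (n : ℕ) = P.kn n * (P.qn n)⁻¹ := by
  simp only [z, qpow, qn, kn, rn, ln, ← Complex.exp_nat_mul, ← Complex.exp_neg, ← Complex.exp_add]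
  congr 1
  push_cast [rs]
  ring

theorem z_pow_l_add_one (l : ℕ) (n : ℕ+) : P.z ((l + 1) / 2) ^ (n : ℕ) = P.ln l n * P.qn n := by
  simp only [z, qpow, qn, kn, rn, ln, ← Complex.exp_nat_mul, ← Complex.exp_neg, ← Complex.exp_add]
  congr 1
  push_cast [rs]
  ring

@[simp] theorem creSum_cre (x y : Boson) (f : ℕ+ → ℂ) (n : ℕ+) :
    (Expo.creSum x f).cre (y, n) = if y = x then f n else 0 := rfl
@[simp] theorem annSum_ann (x y : Boson) (f : ℕ+ → ℂ) (n : ℕ+) :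
    (Expo.annSum x f).ann (y, n) = if y = x then f n else 0 := rfl
@[simp] theorem creSum_ann (x : Boson) (f : ℕ+ → ℂ) : (Expo.creSum x f).ann = 0 := rfl
@[simp] theorem annSum_cre (x : Boson) (f : ℕ+ → ℂ) : (Expo.annSum x f).cre = 0 := rfl
@[simp] theorem q_cre (x : ZeroMode) (c : ℂ) : (Expo.q x c).cre = 0 := rfl
@[simp] theorem q_ann (x : ZeroMode) (c : ℂ) : (Expo.q x c).ann = 0 := rfl
@[simp] theorem p_cre (x : ZeroMode) (c : ℂ) : (Expo.p x c).cre = 0 := rfl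
@[simp] theorem p_ann (x : ZeroMode) (c : ℂ) : (Expo.p x c).ann = 0 := rfl
@[simp] theorem const_cre (c : ℂ) : (Expo.const c).cre = 0 := rfl
@[simp] theorem const_ann (c : ℂ) : (Expo.const c).ann = 0 := rfl

/-- The exponents of the two terms of `E(u)`. -/
def xE (ε : Bool) (u : ℂ) : Expo :=
  P.expoUp u + cond ε (P.expoE2 u) (P.expoE1 u) + Expo.q .hat 2 + phat1 (-(P.lnz u / P.rs))

/-- The exponents of the two terms of `F(u)`. -/
def xF (ε : Bool) (u : ℂ) : Expo :=
  cond ε (P.expoF2 u) (P.expoF1 u) + P.expoUm u + ph (P.lnz u / P.r) + phat1 (P.lnz u / P.r)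

/-- The exponents of `H^±(u)`. -/
def xH (ε : Bool) (u : ℂ) : Expo := cond ε
  (P.expoUp (u - P.k / 4) + P.expoPsiM u + P.expoUm (u + P.k / 4) + Expo.q .hat 2 +
    ph (P.lnz (u + P.k / 4) / P.r) +
    (phat1 (P.lnz (u - (P.r - P.k / 2) / 2) / P.r) -
      phat1 (P.lnz (u - (P.r - P.k / 2) / 2) / P.rs)))
  (P.expoUp (u + P.k / 4) + P.expoPsiP u + P.expoUm (u - P.k / 4) + Expo.q .hat 2 +
    ph (P.lnz (u - P.k / 4) / P.r) +
    (phat1 (P.lnz (u + (P.r - P.k / 2) / 2) / P.r) -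
      phat1 (P.lnz (u + (P.r - P.k / 2) / 2) / P.rs)))

/-- The exponent of `Φ_{l,l}(v)`. -/
def xPhi (l : ℕ) (v : ℂ) : Expo :=
  P.expoVp l v +
    (P.bigM .a [l] [2, P.k + 2] v ((P.k + 2) / 2) +
      P.bigM .a [P.k - l + 1] [1, P.k + 2] v (-((P.k + 2) / 2)) +
      P.bigM .b [P.k - l + 1] [1, 1] v (-1) -
      P.bigP .a [P.k - l, P.k + 1] [1, P.k, P.k + 2] v ((P.k + 2) / 2) -
      P.bigP .b [P.k - l, P.k + 1] [1, 1, P.k] v 1 +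
      P.bigM .c [P.k - l] [1, 1] v 0 -
      P.bigP .c [P.k - l] [1, 1] v 0) +
    (Expo.q .a ((P.k - l) / (2 * (P.k + 2))) + Expo.q .b (P.k - l) + Expo.q .c (P.k - l) +
      Expo.q .hat P.rs + Expo.p .c ((l - P.r) / P.r * P.lnz v) -
      Expo.p .hat (l / (2 * P.r) * P.lnz v))

/-- The exponent of `Ψ*_{l,l}(v)`. -/
def xPsi (l : ℕ) (v : ℂ) : Expo :=
  P.expoVm l v +
    (P.bigM .a [-(P.k - l)] [P.k, P.k + 2] v (-((P.k + 2) / 2)) +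
      P.bigM .b [-(P.k - l)] [1, P.k] v (-1) +
      P.bigP .a [l + 2] [2, P.k + 2] v ((P.k + 2) / 2) +
      P.bigP .b [] [1] v (l + 1)) +
    (Expo.q .a ((P.k - l) / (2 * (P.k + 2))) - Expo.q .hat (l + P.rs) -
      Expo.p .b (P.lnz v) + Expo.p .hat (l / (2 * P.rs) * P.lnz v))

theorem PhiTop_eq (l : ℕ) (v : ℂ) : P.PhiTop l v = P.vop (P.xPhi l v) := rfl

theorem PsiTop_eq (l : ℕ) (v : ℂ) : P.PsiTop l v = P.vop (P.xPsi l v) := rfl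

theorem Hplus_eq (u : ℂ) : P.Hplus u = P.vop (P.xH false u) := rfl

theorem Hminus_eq (u : ℂ) : P.Hminus u = P.vop (P.xH true u) := rfl

/-- The prefactors of the two terms of the currents. -/
def pref (ε : Bool) (u : ℂ) : ℂ := cond ε (-1) 1 * (-1 / (P.dd * P.z u))

theorem E_eq (u : ℂ) (s t : State) : P.E u s t =
    P.pref false u * P.vop (P.xE false u) s t + P.pref true u * P.vop (P.xE true u) s t := by
  simp only [E, xE, pref, dd, cond]
  ring

theorem F_eq (u : ℂ) (s t : State) : P.F u s t =
    P.pref false u * P.vop (P.xF false u) s t + P.pref true u * P.vop (P.xF true u) s t := by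
  simp only [F, xF, pref, dd, cond]
  ring

/-- Creation coefficients of `E`. -/
def cE : Bool → Mode → ℂ
  | _, (.a, n) => P.rn n * (P.kn n)⁻¹ * (P.qn n)⁻¹ / P.br (P.rs * n)
  | false, (.b, n) => (P.rn n * (P.kn n ^ 2)⁻¹ + P.rn n * (P.kn n ^ 2)⁻¹ * (P.qn n ^ 2)⁻¹) /
      P.br (P.rs * n) - P.qn n / P.br n
  | true, (.b, n) => (P.rn n * (P.kn n ^ 2)⁻¹ + P.rn n * (P.kn n ^ 2)⁻¹ * (P.qn n ^ 2)⁻¹) /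
      P.br (P.rs * n) - P.dd - (P.qn n)⁻¹ / P.br n
  | false, (.c, n) => -(P.qn n / P.br n)
  | true, (.c, n) => -((P.qn n)⁻¹ / P.br n)

/-- Annihilation coefficients of `E`. -/
def aE : Bool → Mode → ℂ
  | _, (.a, _) => 0
  | false, (.b, n) => P.dd + (P.qn n)⁻¹ / P.br n
  | true, (.b, n) => P.qn n / P.br n
  | false, (.c, n) => (P.qn n)⁻¹ / P.br n
  | true, (.c, n) => P.qn n / P.br n

/-- Creation coefficients of `F`. -/
def cF : Bool → Mode → ℂ
  | false, (.a, n) => -(P.dd * ((P.kn n)⁻¹ * (P.qn n)⁻¹))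
  | true, (.a, _) => 0
  | false, (.b, n) => (P.kn n ^ 2)⁻¹ * (P.qn n)⁻¹ / P.br n -
      P.dd * ((P.kn n ^ 2)⁻¹ * (P.qn n ^ 2)⁻¹)
  | true, (.b, n) => P.kn n ^ 2 * P.qn n / P.br n
  | false, (.c, n) => (P.kn n ^ 2)⁻¹ * (P.qn n)⁻¹ / P.br n
  | true, (.c, n) => P.kn n ^ 2 * P.qn n / P.br n

/-- Annihilation coefficients of `F`. -/
def aF : Bool → Mode → ℂ
  | false, (.a, n) => -(P.rn n * (P.kn n)⁻¹ * (P.qn n)⁻¹ / P.br (P.r * n))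
  | true, (.a, n) => -(P.rn n * (P.kn n)⁻¹ * (P.qn n)⁻¹ / P.br (P.r * n)) +
      P.dd * ((P.kn n)⁻¹ * (P.qn n)⁻¹)
  | false, (.b, n) => -((P.rn n * (P.kn n ^ 2)⁻¹ * (P.qn n ^ 2)⁻¹ + P.rn n * (P.kn n ^ 2)⁻¹) /
      P.br (P.r * n)) - P.kn n ^ 2 * P.qn n / P.br n
  | true, (.b, n) => -((P.rn n * (P.kn n ^ 2)⁻¹ * (P.qn n ^ 2)⁻¹ + P.rn n * (P.kn n ^ 2)⁻¹) /
      P.br (P.r * n)) - (P.kn n ^ 2)⁻¹ * (P.qn n)⁻¹ / P.br n +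
      P.dd * ((P.kn n ^ 2)⁻¹ * (P.qn n ^ 2)⁻¹)
  | false, (.c, n) => -(P.kn n ^ 2 * P.qn n / P.br n)
  | true, (.c, n) => -((P.kn n ^ 2)⁻¹ * (P.qn n)⁻¹ / P.br n)

/-- Creation coefficients of `H^±`. -/
def cH : Bool → Mode → ℂ
  | false, (.a, n) => P.rn n * (P.qn n)⁻¹ / P.br (P.rs * n)
  | true, (.a, n) => P.rn n * (P.kn n ^ 2)⁻¹ * (P.qn n)⁻¹ / P.br (P.rs * n) - P.dd * (P.qn n)⁻¹
  | false, (.b, n) => (P.rn n * (P.kn n)⁻¹ + P.rn n * (P.kn n)⁻¹ * (P.qn n ^ 2)⁻¹) /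
      P.br (P.rs * n)
  | true, (.b, n) => (P.rn n * (P.kn n ^ 3)⁻¹ + P.rn n * (P.kn n ^ 3)⁻¹ * (P.qn n ^ 2)⁻¹) /
      P.br (P.rs * n) - P.dd * ((P.kn n)⁻¹ + (P.kn n)⁻¹ * (P.qn n ^ 2)⁻¹)
  | _, (.c, _) => 0

/-- Annihilation coefficients of `H^±`. -/
def aH : Bool → Mode → ℂ
  | false, (.a, n) => -(P.rn n * (P.qn n)⁻¹ / P.br (P.r * n)) + P.dd * (P.qn n)⁻¹
  | true, (.a, n) => -(P.rn n * (P.kn n ^ 2)⁻¹ * (P.qn n)⁻¹ / P.br (P.r * n))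
  | false, (.b, n) => -((P.rn n * (P.kn n)⁻¹ * (P.qn n ^ 2)⁻¹ + P.rn n * (P.kn n)⁻¹) /
      P.br (P.r * n)) + P.dd * ((P.kn n)⁻¹ + (P.kn n)⁻¹ * (P.qn n ^ 2)⁻¹)
  | true, (.b, n) => -((P.rn n * (P.kn n ^ 3)⁻¹ * (P.qn n ^ 2)⁻¹ + P.rn n * (P.kn n ^ 3)⁻¹) /
      P.br (P.r * n))
  | _, (.c, _) => 0

/-- Creation coefficients of `Φ_{l,l}`. -/
def cPhi (l : ℕ) : Mode → ℂ
  | (.a, n) => P.br (l * n) / (P.br (2 * n) * P.br ((P.k + 2) * n)) * (P.kn n * P.qn n) +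
      P.br ((P.k - l + 1) * n) / (P.br n * P.br ((P.k + 2) * n)) * ((P.kn n)⁻¹ * (P.qn n)⁻¹)
  | (.b, n) => P.br ((P.k - l + 1) * n) / (P.br n * P.br n) * (P.qn n)⁻¹
  | (.c, n) => P.br ((P.k - l) * n) / (P.br n * P.br n)

/-- Annihilation coefficients of `Φ_{l,l}`. -/
def aPhi (l : ℕ) : Mode → ℂ
  | (.a, n) => -(P.br (l * n) * P.br (P.rs * n) / (P.br (2 * n) * (P.br (P.k * n) * P.br (P.r * n))) *
        ((P.kn n)⁻¹ * (P.qn n)⁻¹)) -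
      P.br ((P.k - l) * n) * P.br ((P.k + 1) * n) /
        (P.br n * (P.br (P.k * n) * P.br ((P.k + 2) * n))) * ((P.kn n)⁻¹ * (P.qn n)⁻¹)
  | (.b, n) => -(P.br (l * n) * P.br (P.rs * n) / (P.br n * (P.br (P.k * n) * P.br (P.r * n))) *
        ((P.kn n ^ 2)⁻¹ * (P.qn n)⁻¹)) -
      P.br ((P.k - l) * n) * P.br ((P.k + 1) * n) /
        (P.br n * (P.br n * P.br (P.k * n))) * (P.qn n)⁻¹
  | (.c, n) => -(P.br ((P.k - l) * n) / (P.br n * P.br n))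

/-- Creation coefficients of `Ψ*_{l,l}`. -/
def cPsi (l : ℕ) : Mode → ℂ
  | (.a, n) => P.br (-l * n) * P.br (P.r * n) / (P.br (2 * n) * (P.br (P.k * n) * P.br (P.rs * n))) *
        (P.kn n * (P.qn n)⁻¹) +
      P.br (-(P.k - l) * n) / (P.br (P.k * n) * P.br ((P.k + 2) * n)) * ((P.kn n)⁻¹ * (P.qn n)⁻¹)
  | (.b, n) => P.br (-l * n) * P.br (P.r * n) / (P.br n * (P.br (P.k * n) * P.br (P.rs * n))) *
        (P.qn n)⁻¹ + P.br (-(P.k - l) * n) / (P.br n * P.br (P.k * n)) * (P.qn n)⁻¹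
  | (.c, _) => 0

/-- Annihilation coefficients of `Ψ*_{l,l}`. -/
def aPsi (l : ℕ) : Mode → ℂ
  | (.a, n) => P.br ((l + 2) * n) / (P.br (2 * n) * P.br ((P.k + 2) * n)) *
      ((P.kn n)⁻¹ * (P.qn n)⁻¹)
  | (.b, n) => 1 / P.br n * ((P.ln l n)⁻¹ * (P.qn n)⁻¹)
  | (.c, _) => 0

/-- Mode `n` always comes with `z ^ n` or `z ^ (-n)`, so a contraction depends only on the quotient
of the two spectral variables. -/
theorem homogeneous_coefficients (ε : Bool) (l : ℕ) (u : ℂ) (i : Mode) :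
    (P.xE ε u).cre i = P.cE ε i * P.z u ^ (i.2 : ℕ) ∧
    (P.xE ε u).ann i = P.aE ε i * (P.z u ^ (i.2 : ℕ))⁻¹ ∧
    (P.xF ε u).cre i = P.cF ε i * P.z u ^ (i.2 : ℕ) ∧
    (P.xF ε u).ann i = P.aF ε i * (P.z u ^ (i.2 : ℕ))⁻¹ ∧
    (P.xH ε u).cre i = P.cH ε i * P.z u ^ (i.2 : ℕ) ∧
    (P.xH ε u).ann i = P.aH ε i * (P.z u ^ (i.2 : ℕ))⁻¹ ∧
    (P.xPhi l u).cre i = P.cPhi l i * P.z u ^ (i.2 : ℕ) ∧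
    (P.xPhi l u).ann i = P.aPhi l i * (P.z u ^ (i.2 : ℕ))⁻¹ ∧
    (P.xPsi l u).cre i = P.cPsi l i * P.z u ^ (i.2 : ℕ) ∧
    (P.xPsi l u).ann i = P.aPsi l i * (P.z u ^ (i.2 : ℕ))⁻¹ := by
  obtain ⟨x, n⟩ := i
  have hu : P.z u ≠ 0 := P.z_ne_zero u
  have hq := P.qn_ne n
  have hk := P.kn_ne n
  have hr := P.rn_ne n
  have hl := P.ln_ne l n
  refine ⟨?_, ?_, ?_, ?_, ?_, ?_, ?_, ?_, ?_, ?_⟩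
  all_goals rcases x with _ | _ | _
  all_goals try rcases ε with _ | _
  all_goals
    simp only [xE, cE, aE, xF, cF, aF, xH, cH, aH, xPhi, cPhi, aPhi, xPsi, cPsi, aPsi, cond,
      expoUp, expoUm, expoPsiP, expoPsiM, expoE1, expoE2, expoF1, expoF2, expoVp, expoVm,
      phat1, ph, field, fieldP, fieldM, starP, starM, bigP, bigM, brRatio, Expo.add_cre,
      Expo.sub_cre, Expo.neg_cre, Expo.add_ann, Expo.sub_ann, Expo.neg_ann, Pi.add_apply,
      Pi.sub_apply, Pi.neg_apply, Pi.zero_apply, creSum_cre, annSum_ann, creSum_ann,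
      annSum_cre, q_cre, q_ann, p_cre, p_ann, const_cre, const_ann, Boson.zero, reduceCtorEq,
      if_true, if_false, eq_self, List.map_cons, List.map_nil, List.prod_cons, List.prod_nil,
      add_zero, zero_add, sub_zero, zero_sub, neg_zero, mul_one, one_mul, z_add, z_sub,
      mul_pow, div_pow, zero_div, z_zero, one_pow, z_pow_k_quarter, z_pow_rs_add_half_k_sub_one, z_pow_rs_half, z_pow_rs_sub_two,
      z_pow_r_sub_half_k_sub_one, z_pow_r_sub_k_sub_two, z_pow_r_sub_k, z_pow_half, z_pow_k_add_one, z_pow_k_add_two_quarter, z_pow_k_add_two, z_pow_half_k_add_two, z_pow_half_k_add_two_half,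
      z_pow_neg_half_k_add_two, z_pow_neg_half, z_pow_half_k_sub_two, z_pow_l_add_one]
    try simp only [dd]
    try field_simp
    try ring

theorem xE_cre (ε : Bool) (u : ℂ) :
    (P.xE ε u).cre = fun i => P.cE ε i * P.z u ^ (i.2 : ℕ) :=
  funext fun i => (P.homogeneous_coefficients ε 0 u i).1

theorem xE_ann (ε : Bool) (u : ℂ) :
    (P.xE ε u).ann = fun i => P.aE ε i * (P.z u ^ (i.2 : ℕ))⁻¹ :=
  funext fun i => (P.homogeneous_coefficients ε 0 u i).2.1

theorem xF_cre (ε : Bool) (u : ℂ) :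
    (P.xF ε u).cre = fun i => P.cF ε i * P.z u ^ (i.2 : ℕ) :=
  funext fun i => (P.homogeneous_coefficients ε 0 u i).2.2.1

theorem xF_ann (ε : Bool) (u : ℂ) :
    (P.xF ε u).ann = fun i => P.aF ε i * (P.z u ^ (i.2 : ℕ))⁻¹ :=
  funext fun i => (P.homogeneous_coefficients ε 0 u i).2.2.2.1

theorem xH_cre (ε : Bool) (u : ℂ) :
    (P.xH ε u).cre = fun i => P.cH ε i * P.z u ^ (i.2 : ℕ) :=
  funext fun i => (P.homogeneous_coefficients ε 0 u i).2.2.2.2.1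

theorem xH_ann (ε : Bool) (u : ℂ) :
    (P.xH ε u).ann = fun i => P.aH ε i * (P.z u ^ (i.2 : ℕ))⁻¹ :=
  funext fun i => (P.homogeneous_coefficients ε 0 u i).2.2.2.2.2.1

theorem xPhi_cre (l : ℕ) (u : ℂ) :
    (P.xPhi l u).cre = fun i => P.cPhi l i * P.z u ^ (i.2 : ℕ) :=
  funext fun i => (P.homogeneous_coefficients true l u i).2.2.2.2.2.2.1

theorem xPhi_ann (l : ℕ) (u : ℂ) :
    (P.xPhi l u).ann = fun i => P.aPhi l i * (P.z u ^ (i.2 : ℕ))⁻¹ :=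
  funext fun i => (P.homogeneous_coefficients true l u i).2.2.2.2.2.2.2.1

theorem xPsi_cre (l : ℕ) (u : ℂ) :
    (P.xPsi l u).cre = fun i => P.cPsi l i * P.z u ^ (i.2 : ℕ) :=
  funext fun i => (P.homogeneous_coefficients true l u i).2.2.2.2.2.2.2.2.1

theorem xPsi_ann (l : ℕ) (u : ℂ) :
    (P.xPsi l u).ann = fun i => P.aPsi l i * (P.z u ^ (i.2 : ℕ))⁻¹ :=
  funext fun i => (P.homogeneous_coefficients true l u i).2.2.2.2.2.2.2.2.2

end Params
end EllipticVO
end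

open Filter Topology
noncomputable section
namespace EllipticVO

/-! ### Growth of coefficients -/

/-- At most geometric growth. -/
def Tame (f : ℕ+ → ℂ) : Prop := ∃ C ρ : ℝ, 0 ≤ C ∧ 0 ≤ ρ ∧ ∀ n : ℕ+, ‖f n‖ ≤ C * ρ ^ (n : ℕ)

theorem Tame.mul {f g : ℕ+ → ℂ} (hf : Tame f) (hg : Tame g) : Tame fun n => f n * g n := by
  obtain ⟨C, ρ, hC, hρ, h⟩ := hf
  obtain ⟨C', ρ', hC', hρ', h'⟩ := hg
  refine ⟨C * C', ρ * ρ', by positivity, by positivity, fun n => ?_⟩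
  rw [norm_mul, mul_pow, mul_mul_mul_comm]
  exact mul_le_mul (h n) (h' n) (norm_nonneg _) (by positivity)

theorem Tame.add {f g : ℕ+ → ℂ} (hf : Tame f) (hg : Tame g) : Tame fun n => f n + g n := by
  obtain ⟨C, ρ, hC, hρ, h⟩ := hf
  obtain ⟨C', ρ', hC', hρ', h'⟩ := hg
  refine ⟨C + C', ρ + ρ', by positivity, by positivity, fun n => (norm_add_le _ _).trans ?_⟩
  rw [add_mul]
  refine add_le_add ((h n).trans ?_) ((h' n).trans ?_) <;> gcongr <;> linarith

theorem Tame.const (c : ℂ) : Tame fun _ => c := ⟨‖c‖, 1, norm_nonneg _, zero_le_one, by simp⟩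

theorem Tame.neg {f : ℕ+ → ℂ} (hf : Tame f) : Tame fun n => -f n := by
  simpa [Tame] using hf

theorem Tame.sub {f g : ℕ+ → ℂ} (hf : Tame f) (hg : Tame g) : Tame fun n => f n - g n := by
  simpa only [sub_eq_add_neg] using hf.add hg.neg

theorem Tame.pow {f : ℕ+ → ℂ} (hf : Tame f) (m : ℕ) : Tame fun n => f n ^ m := by
  induction m with
  | zero => simpa using Tame.const 1
  | succ m ih => simpa only [pow_succ] using ih.mul hf

namespace Params

variable {P : Params}

theorem norm_qpow (x : ℂ) : ‖P.qpow x‖ = Real.exp (x * P.logq).re := by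
  rw [qpow, Complex.norm_exp]

theorem tame_qpow (c : ℂ) : Tame fun n : ℕ+ => P.qpow (c * n) := by
  refine ⟨1, Real.exp (c * P.logq).re, zero_le_one, (Real.exp_pos _).le, fun n => ?_⟩
  rw [norm_qpow, one_mul, ← Real.exp_nat_mul]
  refine (congrArg Real.exp ?_).le
  rw [show c * n * P.logq = ((n : ℕ) : ℂ) * (c * P.logq) by ring, ← Complex.ofReal_natCast, Complex.re_ofReal_mul]

theorem qpow_neg (x : ℂ) : P.qpow (-x) = (P.qpow x)⁻¹ := by
  rw [qpow, qpow, neg_mul, Complex.exp_neg]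

theorem qpow_add (x y : ℂ) : P.qpow (x + y) = P.qpow x * P.qpow y := by
  rw [qpow, qpow, qpow, add_mul, Complex.exp_add]

theorem tame_qpow_inv (c : ℂ) : Tame fun n : ℕ+ => (P.qpow (c * n))⁻¹ := by
  simpa only [← qpow_neg, neg_mul] using P.tame_qpow (-c)

theorem tame_qn : Tame P.qn := by simpa [Tame, qn] using P.tame_qpow 1
theorem tame_kn : Tame P.kn := P.tame_qpow _
theorem tame_rn : Tame P.rn := P.tame_qpow _
theorem tame_qn_inv : Tame fun n => (P.qn n)⁻¹ := by
  simpa [qn] using P.tame_qpow_inv 1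
theorem tame_kn_inv : Tame fun n => (P.kn n)⁻¹ := P.tame_qpow_inv _
theorem tame_ln_inv (l : ℕ) : Tame fun n => (P.ln l n)⁻¹ := P.tame_qpow_inv _

theorem tame_br {x : ℕ+ → ℂ} (c : ℂ) (h : ∀ n : ℕ+, x n = c * n) : Tame fun n => P.br (x n) := by
  simp only [h, br, qpow_neg, div_eq_mul_inv]
  exact ((tame_qpow c).sub (tame_qpow_inv c)).mul (Tame.const _)

theorem norm_qpow_ne_one (hq : P.logq.re < 0) {x : ℝ} (hx : x ≠ 0) : ‖P.qpow x‖ ≠ 1 := by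
  rw [norm_qpow, Ne, Real.exp_eq_one_iff, Complex.re_ofReal_mul]
  exact mul_ne_zero hx hq.ne

theorem dd_ne_zero (hq : P.logq.re < 0) : P.dd ≠ 0 := by
  intro h
  rw [dd, sub_eq_zero] at h
  have h2 : P.qpow (2 : ℝ) = 1 := by
    rw [show (((2 : ℝ) : ℝ) : ℂ) = 1 + 1 by norm_num, qpow_add]
    nth_rewrite 2 [h]
    rw [qpow_neg]
    exact mul_inv_cancel₀ (Complex.exp_ne_zero _)
  exact norm_qpow_ne_one hq two_ne_zero (by rw [h2, norm_one])

theorem one_le_norm_sub_inv {w : ℂ} {t : ℝ} (ht : 1 < t) (hw : t ≤ ‖w‖) :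
    t - 1 ≤ ‖w - w⁻¹‖ := by
  have h1 : ‖w⁻¹‖ ≤ 1 := by rw [norm_inv]; exact inv_le_one_of_one_le₀ (ht.le.trans hw)
  have h2 := norm_sub_norm_le w w⁻¹
  linarith

/-- Of `q ^ (c n)` and its inverse one has norm at least `exp |c Re (log q)| > 1`, so the numerator
of `[c n]` is bounded below uniformly in `n`. -/
theorem tame_br_inv (hq : P.logq.re < 0) {x : ℕ+ → ℂ} (c : ℝ) (hc : c ≠ 0)
    (h : ∀ n : ℕ+, x n = c * n) : Tame fun n => (P.br (x n))⁻¹ := by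
  have hD := dd_ne_zero hq
  set t : ℝ := Real.exp |c * P.logq.re| with ht
  have ht1 : 1 < t := Real.one_lt_exp_iff.2 (abs_pos.2 (mul_ne_zero hc hq.ne))
  refine ⟨‖P.dd‖ / (t - 1), 1, div_nonneg (norm_nonneg _) (by linarith), zero_le_one, fun n => ?_⟩
  have key : t - 1 ≤ ‖P.qpow (x n) - P.qpow (-(x n))‖ := by
    have hn : (1 : ℝ) ≤ (n : ℕ) := by exact_mod_cast n.one_le
    have e : (x n * P.logq).re = (n : ℕ) * (c * P.logq.re) := by
      rw [h, show (c : ℂ) * n * P.logq = ((c * (n : ℕ) : ℝ) : ℂ) * P.logq by push_cast; ring,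
        Complex.re_ofReal_mul]
      ring
    rcases le_total 0 (c * P.logq.re) with h0 | h0
    · rw [qpow_neg]
      refine one_le_norm_sub_inv ht1 ?_
      rw [norm_qpow, e, ht, abs_of_nonneg h0]
      exact Real.exp_le_exp.2 (by nlinarith)
    · rw [← neg_neg (x n), qpow_neg (-x n), neg_neg, ← norm_neg, neg_sub]
      refine one_le_norm_sub_inv ht1 ?_
      rw [norm_qpow, neg_mul, Complex.neg_re, e, ht, abs_of_nonpos h0]
      exact Real.exp_le_exp.2 (by nlinarith)
  simp only [br, inv_div, norm_div, one_pow, mul_one]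
  exact div_le_div_of_nonneg_left (norm_nonneg _) (by linarith) key

end Params

/-! ### Contractions -/

instance : Fintype Boson := ⟨{.a, .b, .c}, fun x => by cases x <;> simp⟩

theorem sum_boson (f : Boson → ℂ) : ∑ x, f x = f .a + f .b + f .c := by
  rw [show (Finset.univ : Finset Boson) = {.a, .b, .c} from rfl]
  simp [add_assoc]

theorem Tame.uniform {f : Mode → ℂ} (hf : ∀ x, Tame fun n => f (x, n)) :
    ∃ C ρ : ℝ, 0 ≤ C ∧ 0 ≤ ρ ∧ ∀ i : Mode, ‖f i‖ ≤ C * ρ ^ (i.2 : ℕ) := by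
  choose C ρ hC hρ h using hf
  refine ⟨∑ x, C x, ∑ x, ρ x, Finset.sum_nonneg fun x _ => hC x,
    Finset.sum_nonneg fun x _ => hρ x, fun i => (h i.1 i.2).trans ?_⟩
  have h1 := Finset.single_le_sum (f := C) (fun x _ => hC x) (Finset.mem_univ i.1)
  have h2 := Finset.single_le_sum (f := ρ) (fun x _ => hρ x) (Finset.mem_univ i.1)
  have h3 := hρ i.1
  have h4 := hC i.1
  have h5 := h4.trans h1
  gcongr

theorem summable_geometric_mode {C ρ : ℝ} (hρ : 0 ≤ ρ) (h1 : ρ < 1) :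
    Summable fun i : Mode => C * ρ ^ (i.2 : ℕ) := by
  have h : Summable fun n : ℕ+ => C * ρ ^ (n : ℕ) :=
    ((summable_geometric_of_lt_one hρ h1).mul_left C).comp_injective PNat.coe_injective
  rw [← (Equiv.sigmaEquivProd Boson ℕ+).summable_iff]
  refine Summable.of_abs ?_
  rw [summable_sigma_of_nonneg fun _ => abs_nonneg _]
  exact ⟨fun x => h.abs, Summable.of_finite⟩

/-- The contraction of two operators with annihilation coefficients `b` and creation coefficients
`c` is `(y ζ; p)_∞ (1 - e ζ) / (y' ζ; p)_∞`, where `ζ` is the quotient of the spectral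
variables. -/
def Contr (p : ℂ) (b c : Mode → ℂ) (y' y e : ℂ) : Prop :=
  ∃ r : ℝ, 0 < r ∧ ∀ ζ : ℂ, ‖ζ‖ ≤ r → (Summable fun i : Mode => ‖b i * c i * ζ ^ (i.2 : ℕ)‖) ∧
    Pr (geo y' p) ζ ≠ 0 ∧
    Complex.exp (∑' i : Mode, b i * c i * ζ ^ (i.2 : ℕ)) =
      Pr (geo y p) ζ * (1 - e * ζ) / Pr (geo y' p) ζ

theorem poch_zero_right (y : ℂ) : Params.poch y 0 = 1 - y := by
  rw [poch_succ (by simp), zero_mul]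
  simp [Params.poch]

/-- `∑ (yζ)^n / (n (1 - p^n))` is `-log (yζ; p)_∞`, and the term with `e^n / n` is its case `p = 0`,
which leaves a single factor. -/
theorem contr_of_eq {p : ℂ} (hp : ‖p‖ < 1) {b c : Mode → ℂ} (hb : ∀ x, Tame fun n => b (x, n))
    (hc : ∀ x, Tame fun n => c (x, n)) {y' y e : ℂ}
    (h : ∀ n : ℕ+, b (.a, n) * c (.a, n) + b (.b, n) * c (.b, n) + b (.c, n) * c (.c, n) =
      (y' ^ (n : ℕ) - y ^ (n : ℕ)) / ((n : ℕ) * (1 - p ^ (n : ℕ))) - e ^ (n : ℕ) / (n : ℕ)) :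
    Contr p b c y' y e := by
  obtain ⟨C, ρ, hC, hρ, hbc⟩ := Tame.uniform (f := fun i => b i * c i) fun x => (hb x).mul (hc x)
  -- For `‖ζ‖ ≤ 1 / (2M)` the geometric majorant and all three logarithmic series converge.
  set M := ρ + ‖y'‖ + ‖y‖ + ‖e‖ + 1 with hM
  have hM0 : 0 < M := by positivity
  refine ⟨1 / (2 * M), by positivity, fun ζ hζ => ?_⟩
  have hsmall : ∀ t : ℝ, 0 ≤ t → t ≤ M → t * ‖ζ‖ < 1 := fun t h0 ht => by
    have : t * ‖ζ‖ ≤ M * (1 / (2 * M)) := by gcongr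
    have e2 : M * (1 / (2 * M)) = 1 / 2 := by field_simp
    linarith
  have n1 := norm_nonneg y'
  have n2 := norm_nonneg y
  have n3 := norm_nonneg e
  have h1 : ‖y' * ζ‖ < 1 := by rw [norm_mul]; exact hsmall _ n1 (by linarith)
  have h2 : ‖y * ζ‖ < 1 := by rw [norm_mul]; exact hsmall _ n2 (by linarith)
  have h3 : ‖e * ζ‖ < 1 := by rw [norm_mul]; exact hsmall _ n3 (by linarith)
  have hs : Summable fun i : Mode => ‖b i * c i * ζ ^ (i.2 : ℕ)‖ := by
    refine Summable.of_nonneg_of_le (fun _ => norm_nonneg _) (fun i => ?_)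
      (summable_geometric_mode (C := C) (mul_nonneg hρ (norm_nonneg ζ))
        (hsmall ρ hρ (by linarith)))
    rw [norm_mul, norm_pow, mul_pow, ← mul_assoc]
    exact mul_le_mul_of_nonneg_right (hbc i) (by positivity)
  refine ⟨hs, by rw [Pr_geo]; exact poch_ne_zero hp h1, ?_⟩
  obtain ⟨S₁, a1, b1⟩ := hasSum_log_poch hp h1
  obtain ⟨S₂, a2, b2⟩ := hasSum_log_poch hp h2
  obtain ⟨S₃, a3, b3⟩ := hasSum_log_poch (t := 0) (by simp) h3
  have hs' := hs.of_norm
  have hx : ∀ x, Summable fun n : ℕ+ => b (x, n) * c (x, n) * ζ ^ (n : ℕ) := fun x =>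
    hs'.comp_injective (i := fun n : ℕ+ => ((x, n) : Mode)) fun n m h => (Prod.ext_iff.1 h).2
  have hsum : ∑' i : Mode, b i * c i * ζ ^ (i.2 : ℕ) = S₁ - S₂ - S₃ := by
    rw [hs'.tsum_prod, tsum_fintype, ← Summable.tsum_finsetSum fun x _ => hx x]
    refine HasSum.tsum_eq (hasSum_of_eq ((a1.sub a2).sub a3) (fun n => ?_) rfl)
    rw [sum_boson, ← add_mul, ← add_mul, h, zero_pow n.ne_zero, sub_zero, mul_one, mul_pow, mul_pow,
      mul_pow]
    ring
  rw [hsum, sub_sub, sub_eq_add_neg, neg_add, Complex.exp_add, Complex.exp_add, b2, b3, Pr_geo,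
    Pr_geo, ← b1, Complex.exp_neg, poch_zero_right, div_inv_eq_mul]
  ring

end EllipticVO
end

open Filter Topology
noncomputable section
namespace EllipticVO
namespace Params

variable {P : Params}

/-! ### Growth of the coefficients of the currents and vertex operators -/

section Growth

variable (hP : P.Admissible)
include hP

theorem tame_br_inv_one : Tame fun n : ℕ+ => (P.br n)⁻¹ :=
  tame_br_inv hP.q_lt_one 1 one_ne_zero fun n => by simp

theorem tame_br_inv_two : Tame fun n : ℕ+ => (P.br (2 * n))⁻¹ :=
  tame_br_inv hP.q_lt_one 2 two_ne_zero fun n => by simp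

theorem tame_br_inv_k : Tame fun n : ℕ+ => (P.br (P.k * n))⁻¹ :=
  tame_br_inv hP.q_lt_one P.k hP.k_ne_zero fun _ => rfl

theorem tame_br_inv_k_add_two : Tame fun n : ℕ+ => (P.br ((P.k + 2) * n))⁻¹ :=
  tame_br_inv hP.q_lt_one (P.k + 2) (fun h => hP.k_ne_neg_two (by linarith)) fun n => by
    push_cast; ring

theorem tame_br_inv_r : Tame fun n : ℕ+ => (P.br (P.r * n))⁻¹ :=
  tame_br_inv hP.q_lt_one P.r hP.r_pos.ne' fun _ => rfl

theorem tame_br_inv_rs : Tame fun n : ℕ+ => (P.br (P.rs * n))⁻¹ :=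
  tame_br_inv hP.q_lt_one P.rs hP.rs_pos.ne' fun _ => rfl

theorem tame_currents (ε : Bool) (l : ℕ) (x : Boson) :
    (Tame fun n => P.cE ε (x, n)) ∧ (Tame fun n => P.aE ε (x, n)) ∧
    (Tame fun n => P.cF ε (x, n)) ∧ (Tame fun n => P.aF ε (x, n)) ∧
    (Tame fun n => P.cH ε (x, n)) ∧ (Tame fun n => P.aH ε (x, n)) ∧
    (Tame fun n => P.cPhi l (x, n)) ∧ (Tame fun n => P.aPhi l (x, n)) ∧
    (Tame fun n => P.cPsi l (x, n)) ∧ (Tame fun n => P.aPsi l (x, n)) ∧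
    Tame fun n => P.comm (x, n) := by
  have h1 := tame_br_inv_one hP
  have h2 := tame_br_inv_two hP
  have h3 := tame_br_inv_k hP
  have h4 := tame_br_inv_k_add_two hP
  have h5 := tame_br_inv_r hP
  have h6 := tame_br_inv_rs hP
  have hn : Tame fun n : ℕ+ => ((n : ℕ) : ℂ)⁻¹ := ⟨1, 1, zero_le_one, zero_le_one, fun n => by
    rw [norm_inv, Complex.norm_natCast, one_pow, mul_one]
    exact inv_le_one_of_one_le₀ (by exact_mod_cast n.one_le)⟩
  have b1 : Tame fun n : ℕ+ => P.br n := tame_br 1 fun n => by simp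
  have hb : ∀ c : ℂ, Tame fun n : ℕ+ => P.br (c * n) := fun c => tame_br c fun _ => rfl
  have m1 := P.tame_qn
  have m2 := P.tame_kn
  have m3 := P.tame_rn
  have m4 := P.tame_qn_inv
  have m5 := P.tame_kn_inv
  have m6 := P.tame_ln_inv l
  refine ⟨?_, ?_, ?_, ?_, ?_, ?_, ?_, ?_, ?_, ?_, ?_⟩
  all_goals cases x
  all_goals try cases ε
  all_goals simp only [cE, aE, cF, aF, cH, aH, cPhi, aPhi, cPsi, aPsi, comm, div_eq_mul_inv, mul_inv,
    ← inv_pow]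
  all_goals repeat' with_reducible first
    | exact Tame.const _ | assumption | exact hb _ | refine Tame.pow ?_ _ | refine Tame.neg ?_
    | refine Tame.mul ?_ ?_ | refine Tame.sub ?_ ?_ | refine Tame.add ?_ ?_

theorem tame_cE (ε : Bool) (x : Boson) : Tame fun n => P.cE ε (x, n) := (tame_currents hP ε 0 x).1
theorem tame_aE (ε : Bool) (x : Boson) : Tame fun n => P.comm (x, n) * P.aE ε (x, n) :=
  (tame_currents hP ε 0 x).2.2.2.2.2.2.2.2.2.2.mul (tame_currents hP ε 0 x).2.1
theorem tame_cF (ε : Bool) (x : Boson) : Tame fun n => P.cF ε (x, n) :=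
  (tame_currents hP ε 0 x).2.2.1
theorem tame_aF (ε : Bool) (x : Boson) : Tame fun n => P.comm (x, n) * P.aF ε (x, n) :=
  (tame_currents hP ε 0 x).2.2.2.2.2.2.2.2.2.2.mul (tame_currents hP ε 0 x).2.2.2.1
theorem tame_cH (ε : Bool) (x : Boson) : Tame fun n => P.cH ε (x, n) :=
  (tame_currents hP ε 0 x).2.2.2.2.1
theorem tame_aH (ε : Bool) (x : Boson) : Tame fun n => P.comm (x, n) * P.aH ε (x, n) :=
  (tame_currents hP ε 0 x).2.2.2.2.2.2.2.2.2.2.mul (tame_currents hP ε 0 x).2.2.2.2.2.1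
theorem tame_cPhi (l : ℕ) (x : Boson) : Tame fun n => P.cPhi l (x, n) :=
  (tame_currents hP true l x).2.2.2.2.2.2.1
theorem tame_aPhi (l : ℕ) (x : Boson) : Tame fun n => P.comm (x, n) * P.aPhi l (x, n) :=
  (tame_currents hP true l x).2.2.2.2.2.2.2.2.2.2.mul (tame_currents hP true l x).2.2.2.2.2.2.2.1
theorem tame_cPsi (l : ℕ) (x : Boson) : Tame fun n => P.cPsi l (x, n) :=
  (tame_currents hP true l x).2.2.2.2.2.2.2.2.1
theorem tame_aPsi (l : ℕ) (x : Boson) : Tame fun n => P.comm (x, n) * P.aPsi l (x, n) :=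
  (tame_currents hP true l x).2.2.2.2.2.2.2.2.2.2.mul (tame_currents hP true l x).2.2.2.2.2.2.2.2.2.1

end Growth

/-! ### Contractions of the currents and vertex operators -/

section Brackets

variable (P) (l : ℕ) (n : ℕ+)

theorem br_eq_of_qpow {x m : ℂ} (h : P.qpow x = m) : P.br x = (m - m⁻¹) / P.dd := by
  rw [br, qpow_neg, h, dd]

/-- The symbols `[c n]` as rational functions of `q ^ n`, `q ^ (k n / 2)`, `q ^ (r n)`,
`q ^ (l n)`. -/
theorem bracket_values :
    P.br n = (P.qn n ^ 2 - 1) / (P.qn n * P.dd) ∧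
    P.br (2 * n) = (P.qn n ^ 2 - 1) * (P.qn n ^ 2 + 1) / (P.qn n ^ 2 * P.dd) ∧
    P.br (P.k * n) = (P.kn n ^ 4 - 1) / (P.kn n ^ 2 * P.dd) ∧
    P.br ((P.k + 2) * n) = (P.kn n ^ 4 * P.qn n ^ 4 - 1) / (P.kn n ^ 2 * P.qn n ^ 2 * P.dd) ∧
    P.br ((P.k + 1) * n) = (P.kn n ^ 4 * P.qn n ^ 2 - 1) / (P.kn n ^ 2 * P.qn n * P.dd) ∧
    P.br (P.r * n) = (P.rn n ^ 2 - 1) / (P.rn n * P.dd) ∧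
    P.br (P.rs * n) = (P.rn n ^ 2 - P.kn n ^ 4) / (P.rn n * P.kn n ^ 2 * P.dd) ∧
    P.br (l * n) = (P.ln l n ^ 2 - 1) / (P.ln l n * P.dd) ∧
    P.br (-l * n) = -(P.ln l n ^ 2 - 1) / (P.ln l n * P.dd) ∧
    P.br ((l + 2) * n) = (P.ln l n ^ 2 * P.qn n ^ 4 - 1) / (P.ln l n * P.qn n ^ 2 * P.dd) ∧
    P.br ((P.k - l) * n) = (P.kn n ^ 4 - P.ln l n ^ 2) / (P.kn n ^ 2 * P.ln l n * P.dd) ∧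
    P.br (-(P.k - l) * n) = -(P.kn n ^ 4 - P.ln l n ^ 2) / (P.kn n ^ 2 * P.ln l n * P.dd) ∧
    P.br ((P.k - l + 1) * n) = (P.kn n ^ 4 * P.qn n ^ 2 - P.ln l n ^ 2) /
      (P.kn n ^ 2 * P.qn n * P.ln l n * P.dd) := by
  have hQ := P.qn_ne n
  have hK := P.kn_ne n
  have hR := P.rn_ne n
  have hL := P.ln_ne l n
  have e : ∀ x y : ℂ, P.qpow (x - y) = P.qpow x / P.qpow y := fun x y => by
    rw [sub_eq_add_neg, qpow_add, qpow_neg, div_eq_mul_inv]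
  have q1 : P.qpow n = P.qn n := rfl
  have r1 : P.qpow (P.r * n) = P.rn n := rfl
  have l1 : P.qpow (l * n) = P.ln l n := rfl
  have q2 : P.qpow (2 * n) = P.qn n ^ 2 := by rw [two_mul, qpow_add, q1, sq]
  have k2 : P.qpow (P.k * n) = P.kn n ^ 2 := by
    rw [show (P.k : ℂ) * n = P.k / 2 * n + P.k / 2 * n by ring, qpow_add, sq]; rfl
  refine ⟨?_, ?_, ?_, ?_, ?_, ?_, ?_, ?_, ?_, ?_, ?_, ?_, ?_⟩
  all_goals
    rw [br_eq_of_qpow P rfl, ← div_div]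
    congr 1
    simp only [rs, Complex.ofReal_sub, add_mul, sub_mul, neg_mul, neg_sub, one_mul, qpow_add, e,
      qpow_neg, q1, q2, k2, r1, l1]
    field_simp
    try ring

end Brackets

section Values

variable (P)

theorem z_pow_eq (α : ℂ) (n : ℕ+) : P.z α ^ (n : ℕ) = P.qpow (2 * α * n) := by
  rw [z, qpow, ← Complex.exp_nat_mul, qpow]; congr 1; ring

end Values

end Params
end EllipticVO
end

open Filter Topology
noncomputable section
namespace EllipticVO
namespace Params

section Contractions

variable {P : Params} (hP : P.Admissible)

theorem z_values (P : Params) (l : ℕ) (n : ℕ+) :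
    P.z P.r ^ (n : ℕ) = P.rn n ^ 2 ∧ P.z P.rs ^ (n : ℕ) = P.rn n ^ 2 / P.kn n ^ 4 ∧
    P.z (l / 2) ^ (n : ℕ) = P.ln l n ∧ P.z (P.k / 2) ^ (n : ℕ) = P.kn n ^ 2 ∧
    P.z (P.k / 4) ^ (n : ℕ) = P.kn n ∧ P.z 1 ^ (n : ℕ) = P.qn n ^ 2 := by
  refine ⟨?_, ?_, ?_, ?_, ?_, ?_⟩
  all_goals
    simp only [z, qpow, qn, kn, rn, ln, div_eq_mul_inv, ← Complex.exp_nat_mul, ← Complex.exp_neg,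
      ← Complex.exp_add]
    congr 1
    push_cast [rs]
    ring

/-- The factors in the contractions of two currents `F`. -/
def numF (P : Params) : Bool → Bool → ℂ
  | true, false => P.z 1
  | _, _ => P.z (1 + P.r)

/-- The factors in the contractions of two currents `F`. -/
def facF (P : Params) : Bool → Bool → ℂ
  | true, false => 0
  | false, true => P.z (-1)
  | _, _ => 1

/-- The factors in the contractions of two currents `E`. -/
def numE (P : Params) : Bool → Bool → ℂ
  | false, true => P.z (-1)
  | _, _ => P.z (P.rs - 1)

/-- The factors in the contractions of two currents `E`. -/
def facE (P : Params) : Bool → Bool → ℂ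
  | false, true => 0
  | true, false => P.z 1
  | _, _ => 1

theorem qpow_mul_nat_ne_one (hq : P.logq.re < 0) {c : ℝ} (hc : c ≠ 0) (n : ℕ+) :
    P.qpow ((c * (n : ℕ) : ℝ) : ℂ) ≠ 1 := fun h =>
  norm_qpow_ne_one hq (mul_ne_zero hc (Nat.cast_ne_zero.2 n.ne_zero)) (by rw [h, norm_one])

include hP

/-- Up to units, each expression is or divides `q ^ x - 1` with a real `x ≠ 0`, and `‖q ^ x‖ ≠ 1`.
This uses `k ≠ 0`, `k ≠ -2`, `r ≠ 0`, `r* ≠ 0`. -/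
theorem bracket_denominators (n : ℕ+) : P.qn n ^ 2 - 1 ≠ 0 ∧ P.qn n ^ 2 + 1 ≠ 0 ∧
    P.kn n ^ 4 - 1 ≠ 0 ∧ P.kn n ^ 4 * P.qn n ^ 4 - 1 ≠ 0 ∧ P.rn n ^ 2 - 1 ≠ 0 ∧
    P.rn n ^ 2 - P.kn n ^ 4 ≠ 0 := by
  have key := fun {c : ℝ} (hc : c ≠ 0) => qpow_mul_nat_ne_one hP.q_lt_one hc n
  have e : ∀ {x : ℂ} {c : ℝ}, c ≠ 0 → P.qpow ((c * (n : ℕ) : ℝ) : ℂ) = x → x - 1 ≠ 0 :=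
    fun hc h h' => key hc (h.trans (sub_eq_zero.1 h'))
  have q4 : P.qn n ^ 4 - 1 ≠ 0 := e (c := 4) (by norm_num) (by
    simp only [qpow, qn, ← Complex.exp_nat_mul]; congr 1; push_cast; ring)
  refine ⟨fun h => q4 (by linear_combination (P.qn n ^ 2 + 1) * h),
    fun h => q4 (by linear_combination (P.qn n ^ 2 - 1) * h),
    e (c := 2 * P.k) (mul_ne_zero two_ne_zero hP.k_ne_zero) ?_,
    e (c := 2 * (P.k + 2)) (mul_ne_zero two_ne_zero fun h => hP.k_ne_neg_two (by linarith)) ?_,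
    e (c := 2 * P.r) (mul_ne_zero two_ne_zero hP.r_pos.ne') ?_, fun h => ?_⟩
  rotate_right
  · refine e (x := P.rn n ^ 2 / P.kn n ^ 4) (c := 2 * P.rs) (mul_ne_zero two_ne_zero hP.rs_pos.ne')
      ?_ (by rw [div_sub_one (pow_ne_zero _ (P.kn_ne n)), h, zero_div])
    rw [← (z_values P 0 n).2.1, z_pow_eq]
    push_cast
    rfl
  all_goals
    simp only [qpow, qn, kn, rn, ← Complex.exp_nat_mul, ← Complex.exp_add]
    congr 1
    push_cast
    ring

/-- Here and in the contractions below, inserting the values of the brackets leaves a rational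
identity in the four atoms. The contractions with `Φ` have the base `p = q^{2r}`, those with `Ψ*`
the base `p* = q^{2r*}`. For `F` and `Φ` both orders give the same function of the quotient of the
variables, the same for both terms of `F`. -/
theorem contr_F_Phi (l : ℕ) (ε : Bool) :
    Contr (P.z P.r) (fun i => P.comm i * P.aF ε i) (P.cPhi l)
      (P.z (l / 2)) (P.z (P.r - l / 2)) 0 := by
  refine contr_of_eq (norm_z_lt_one hP.q_lt_one hP.r_pos) (tame_aF hP ε) (tame_cPhi hP l) fun n => ?_
  have hn : ((n : ℕ) : ℂ) ≠ 0 := by exact_mod_cast n.ne_zero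
  have hD := dd_ne_zero hP.q_lt_one
  have hQ := P.qn_ne n
  have hK := P.kn_ne n
  have hR := P.rn_ne n
  have hL := P.ln_ne l n
  obtain ⟨d1, d2, d3, d4, d5, d6⟩ := bracket_denominators hP n
  obtain ⟨b1, b2, b3, b4, b5, b6, b7, b8, b9, b10, b11, b12, b13⟩ := P.bracket_values l n
  obtain ⟨z1, z2, z3, z4, z5, z6⟩ := P.z_values l n
  cases ε
  all_goals
    simp only [comm, aF, cPhi, b1, b2, b3, b4, b5, b6, b7, b8, b9, b10, b11, b12, b13, cond,
      z_add, z_sub, z_neg, mul_pow, div_pow, inv_pow, z1, z2, z3, z4, z5, z6, zero_pow n.ne_zero,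
      one_pow]
    -- The sign is changed so that `field_simp` meets the denominator that `d5` asserts to be
    -- nonzero.
    try rw [show 1 - P.rn n ^ 2 = -(P.rn n ^ 2 - 1) from by ring]
    field_simp
    try ring

theorem contr_Phi_F (l : ℕ) (ε : Bool) :
    Contr (P.z P.r) (fun i => P.comm i * P.aPhi l i) (P.cF ε)
      (P.z (l / 2)) (P.z (P.r - l / 2)) 0 := by
  refine contr_of_eq (norm_z_lt_one hP.q_lt_one hP.r_pos) (tame_aPhi hP l) (tame_cF hP ε) fun n => ?_
  have hn : ((n : ℕ) : ℂ) ≠ 0 := by exact_mod_cast n.ne_zero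
  have hD := dd_ne_zero hP.q_lt_one
  have hQ := P.qn_ne n
  have hK := P.kn_ne n
  have hR := P.rn_ne n
  have hL := P.ln_ne l n
  obtain ⟨d1, d2, d3, d4, d5, d6⟩ := bracket_denominators hP n
  obtain ⟨b1, b2, b3, b4, b5, b6, b7, b8, b9, b10, b11, b12, b13⟩ := P.bracket_values l n
  obtain ⟨z1, z2, z3, z4, z5, z6⟩ := P.z_values l n
  cases ε
  all_goals
    simp only [comm, aPhi, cF, b1, b2, b3, b4, b5, b6, b7, b8, b9, b10, b11, b12, b13, cond,
      z_add, z_sub, z_neg, mul_pow, div_pow, inv_pow, z1, z2, z3, z4, z5, z6, zero_pow n.ne_zero,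
      one_pow]
    try rw [show 1 - P.rn n ^ 2 = -(P.rn n ^ 2 - 1) from by ring]
    field_simp
    try ring

/-- With `y' = y = 0` no infinite product is left: the contraction is the linear factor `1 - eζ`,
which is why the exchange of `E` and `Φ` costs only a sign. -/
theorem contr_E_Phi (l : ℕ) (ε : Bool) :
    Contr (P.z P.r) (fun i => P.comm i * P.aE ε i) (P.cPhi l)
      0 0 (P.z (cond ε (l / 2 - P.k / 2) (P.k / 2 - l / 2))) := by
  refine contr_of_eq (norm_z_lt_one hP.q_lt_one hP.r_pos) (tame_aE hP ε) (tame_cPhi hP l) fun n => ?_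
  have hn : ((n : ℕ) : ℂ) ≠ 0 := by exact_mod_cast n.ne_zero
  have hD := dd_ne_zero hP.q_lt_one
  have hQ := P.qn_ne n
  have hK := P.kn_ne n
  have hR := P.rn_ne n
  have hL := P.ln_ne l n
  obtain ⟨d1, d2, d3, d4, d5, d6⟩ := bracket_denominators hP n
  obtain ⟨b1, b2, b3, b4, b5, b6, b7, b8, b9, b10, b11, b12, b13⟩ := P.bracket_values l n
  obtain ⟨z1, z2, z3, z4, z5, z6⟩ := P.z_values l n
  cases ε
  all_goals
    simp only [comm, aE, cPhi, b1, b2, b3, b4, b5, b6, b7, b8, b9, b10, b11, b12, b13, cond,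
      z_add, z_sub, z_neg, mul_pow, div_pow, inv_pow, z1, z2, z3, z4, z5, z6, zero_pow n.ne_zero,
      one_pow]
    try rw [show 1 - P.rn n ^ 2 = -(P.rn n ^ 2 - 1) from by ring]
    field_simp
    try ring

theorem contr_Phi_E (l : ℕ) (ε : Bool) :
    Contr (P.z P.r) (fun i => P.comm i * P.aPhi l i) (P.cE ε)
      0 0 (P.z (cond ε (P.k / 2 - l / 2) (l / 2 - P.k / 2))) := by
  refine contr_of_eq (norm_z_lt_one hP.q_lt_one hP.r_pos) (tame_aPhi hP l) (tame_cE hP ε) fun n => ?_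
  have hn : ((n : ℕ) : ℂ) ≠ 0 := by exact_mod_cast n.ne_zero
  have hD := dd_ne_zero hP.q_lt_one
  have hQ := P.qn_ne n
  have hK := P.kn_ne n
  have hR := P.rn_ne n
  have hL := P.ln_ne l n
  obtain ⟨d1, d2, d3, d4, d5, d6⟩ := bracket_denominators hP n
  obtain ⟨b1, b2, b3, b4, b5, b6, b7, b8, b9, b10, b11, b12, b13⟩ := P.bracket_values l n
  obtain ⟨z1, z2, z3, z4, z5, z6⟩ := P.z_values l n
  cases ε
  all_goals
    simp only [comm, aPhi, cE, b1, b2, b3, b4, b5, b6, b7, b8, b9, b10, b11, b12, b13, cond,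
      z_add, z_sub, z_neg, mul_pow, div_pow, inv_pow, z1, z2, z3, z4, z5, z6, zero_pow n.ne_zero,
      one_pow]
    try rw [show 1 - P.rn n ^ 2 = -(P.rn n ^ 2 - 1) from by ring]
    field_simp
    try ring

/-- Unlike for `F`, the two orders differ: for `H^+` both products acquire an additional `p` when
`Φ` stands on the left, for `H^-` when it stands on the right. -/
theorem contr_Hplus_Phi (l : ℕ) :
    Contr (P.z P.r) (fun i => P.comm i * P.aH false i) (P.cPhi l)
      (P.z (P.k / 4 + l / 2)) (P.z (P.k / 4 - l / 2)) 0 := by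
  refine contr_of_eq (norm_z_lt_one hP.q_lt_one hP.r_pos) (tame_aH hP false) (tame_cPhi hP l) fun n => ?_
  have hn : ((n : ℕ) : ℂ) ≠ 0 := by exact_mod_cast n.ne_zero
  have hD := dd_ne_zero hP.q_lt_one
  have hQ := P.qn_ne n
  have hK := P.kn_ne n
  have hR := P.rn_ne n
  have hL := P.ln_ne l n
  obtain ⟨d1, d2, d3, d4, d5, d6⟩ := bracket_denominators hP n
  obtain ⟨b1, b2, b3, b4, b5, b6, b7, b8, b9, b10, b11, b12, b13⟩ := P.bracket_values l n
  obtain ⟨z1, z2, z3, z4, z5, z6⟩ := P.z_values l n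
  simp only [comm, aH, cPhi, b1, b2, b3, b4, b5, b6, b7, b8, b9, b10, b11, b12, b13, cond, z_add,
    z_sub, z_neg, mul_pow, div_pow, inv_pow, z1, z2, z3, z4, z5, z6, zero_pow n.ne_zero, one_pow]
  try rw [show 1 - P.rn n ^ 2 = -(P.rn n ^ 2 - 1) from by ring]
  field_simp
  try ring

theorem contr_Phi_Hplus (l : ℕ) :
    Contr (P.z P.r) (fun i => P.comm i * P.aPhi l i) (P.cH false)
      (P.z (P.r - P.k / 4 + l / 2)) (P.z (P.r - P.k / 4 - l / 2)) 0 := by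
  refine contr_of_eq (norm_z_lt_one hP.q_lt_one hP.r_pos) (tame_aPhi hP l) (tame_cH hP false) fun n => ?_
  have hn : ((n : ℕ) : ℂ) ≠ 0 := by exact_mod_cast n.ne_zero
  have hD := dd_ne_zero hP.q_lt_one
  have hQ := P.qn_ne n
  have hK := P.kn_ne n
  have hR := P.rn_ne n
  have hL := P.ln_ne l n
  obtain ⟨d1, d2, d3, d4, d5, d6⟩ := bracket_denominators hP n
  obtain ⟨b1, b2, b3, b4, b5, b6, b7, b8, b9, b10, b11, b12, b13⟩ := P.bracket_values l n
  obtain ⟨z1, z2, z3, z4, z5, z6⟩ := P.z_values l n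
  simp only [comm, aPhi, cH, b1, b2, b3, b4, b5, b6, b7, b8, b9, b10, b11, b12, b13, cond, z_add,
    z_sub, z_neg, mul_pow, div_pow, inv_pow, z1, z2, z3, z4, z5, z6, zero_pow n.ne_zero, one_pow]
  try rw [show 1 - P.rn n ^ 2 = -(P.rn n ^ 2 - 1) from by ring]
  field_simp
  try ring

theorem contr_Hminus_Phi (l : ℕ) :
    Contr (P.z P.r) (fun i => P.comm i * P.aH true i) (P.cPhi l)
      (P.z (P.r - P.k / 4 + l / 2)) (P.z (P.r - P.k / 4 - l / 2)) 0 := by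
  refine contr_of_eq (norm_z_lt_one hP.q_lt_one hP.r_pos) (tame_aH hP true) (tame_cPhi hP l) fun n => ?_
  have hn : ((n : ℕ) : ℂ) ≠ 0 := by exact_mod_cast n.ne_zero
  have hD := dd_ne_zero hP.q_lt_one
  have hQ := P.qn_ne n
  have hK := P.kn_ne n
  have hR := P.rn_ne n
  have hL := P.ln_ne l n
  obtain ⟨d1, d2, d3, d4, d5, d6⟩ := bracket_denominators hP n
  obtain ⟨b1, b2, b3, b4, b5, b6, b7, b8, b9, b10, b11, b12, b13⟩ := P.bracket_values l n
  obtain ⟨z1, z2, z3, z4, z5, z6⟩ := P.z_values l n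
  simp only [comm, aH, cPhi, b1, b2, b3, b4, b5, b6, b7, b8, b9, b10, b11, b12, b13, cond, z_add,
    z_sub, z_neg, mul_pow, div_pow, inv_pow, z1, z2, z3, z4, z5, z6, zero_pow n.ne_zero, one_pow]
  try rw [show 1 - P.rn n ^ 2 = -(P.rn n ^ 2 - 1) from by ring]
  field_simp
  try ring

theorem contr_Phi_Hminus (l : ℕ) :
    Contr (P.z P.r) (fun i => P.comm i * P.aPhi l i) (P.cH true)
      (P.z (P.k / 4 + l / 2)) (P.z (P.k / 4 - l / 2)) 0 := by
  refine contr_of_eq (norm_z_lt_one hP.q_lt_one hP.r_pos) (tame_aPhi hP l) (tame_cH hP true) fun n => ?_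
  have hn : ((n : ℕ) : ℂ) ≠ 0 := by exact_mod_cast n.ne_zero
  have hD := dd_ne_zero hP.q_lt_one
  have hQ := P.qn_ne n
  have hK := P.kn_ne n
  have hR := P.rn_ne n
  have hL := P.ln_ne l n
  obtain ⟨d1, d2, d3, d4, d5, d6⟩ := bracket_denominators hP n
  obtain ⟨b1, b2, b3, b4, b5, b6, b7, b8, b9, b10, b11, b12, b13⟩ := P.bracket_values l n
  obtain ⟨z1, z2, z3, z4, z5, z6⟩ := P.z_values l n
  simp only [comm, aPhi, cH, b1, b2, b3, b4, b5, b6, b7, b8, b9, b10, b11, b12, b13, cond, z_add,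
    z_sub, z_neg, mul_pow, div_pow, inv_pow, z1, z2, z3, z4, z5, z6, zero_pow n.ne_zero, one_pow]
  try rw [show 1 - P.rn n ^ 2 = -(P.rn n ^ 2 - 1) from by ring]
  field_simp
  try ring

theorem contr_E_Psi (l : ℕ) (ε : Bool) :
    Contr (P.z P.rs) (fun i => P.comm i * P.aE ε i) (P.cPsi l)
      (P.z (-(l / 2))) (P.z (P.rs + l / 2)) 0 := by
  refine contr_of_eq (norm_z_lt_one hP.q_lt_one hP.rs_pos) (tame_aE hP ε) (tame_cPsi hP l) fun n => ?_
  have hn : ((n : ℕ) : ℂ) ≠ 0 := by exact_mod_cast n.ne_zero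
  have hD := dd_ne_zero hP.q_lt_one
  have hQ := P.qn_ne n
  have hK := P.kn_ne n
  have hR := P.rn_ne n
  have hL := P.ln_ne l n
  obtain ⟨d1, d2, d3, d4, d5, d6⟩ := bracket_denominators hP n
  obtain ⟨b1, b2, b3, b4, b5, b6, b7, b8, b9, b10, b11, b12, b13⟩ := P.bracket_values l n
  obtain ⟨z1, z2, z3, z4, z5, z6⟩ := P.z_values l n
  cases ε
  all_goals
    simp only [comm, aE, cPsi, b1, b2, b3, b4, b5, b6, b7, b8, b9, b10, b11, b12, b13, cond,
      z_add, z_sub, z_neg, mul_pow, div_pow, inv_pow, z1, z2, z3, z4, z5, z6, zero_pow n.ne_zero,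
      one_pow]
    try rw [show 1 - P.rn n ^ 2 / P.kn n ^ 4 = -((P.rn n ^ 2 - P.kn n ^ 4) / P.kn n ^ 4) from by field_simp; ring]
    field_simp
    try ring

theorem contr_Psi_E (l : ℕ) (ε : Bool) :
    Contr (P.z P.rs) (fun i => P.comm i * P.aPsi l i) (P.cE ε)
      (P.z (-(l / 2))) (P.z (P.rs + l / 2)) 0 := by
  refine contr_of_eq (norm_z_lt_one hP.q_lt_one hP.rs_pos) (tame_aPsi hP l) (tame_cE hP ε) fun n => ?_
  have hn : ((n : ℕ) : ℂ) ≠ 0 := by exact_mod_cast n.ne_zero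
  have hD := dd_ne_zero hP.q_lt_one
  have hQ := P.qn_ne n
  have hK := P.kn_ne n
  have hR := P.rn_ne n
  have hL := P.ln_ne l n
  obtain ⟨d1, d2, d3, d4, d5, d6⟩ := bracket_denominators hP n
  obtain ⟨b1, b2, b3, b4, b5, b6, b7, b8, b9, b10, b11, b12, b13⟩ := P.bracket_values l n
  obtain ⟨z1, z2, z3, z4, z5, z6⟩ := P.z_values l n
  cases ε
  all_goals
    simp only [comm, aPsi, cE, b1, b2, b3, b4, b5, b6, b7, b8, b9, b10, b11, b12, b13, cond,
      z_add, z_sub, z_neg, mul_pow, div_pow, inv_pow, z1, z2, z3, z4, z5, z6, zero_pow n.ne_zero,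
      one_pow]
    try rw [show 1 - P.rn n ^ 2 / P.kn n ^ 4 = -((P.rn n ^ 2 - P.kn n ^ 4) / P.kn n ^ 4) from by field_simp; ring]
    field_simp
    try ring

theorem contr_F_Psi (l : ℕ) (ε : Bool) :
    Contr (P.z P.rs) (fun i => P.comm i * P.aF ε i) (P.cPsi l)
      0 0 (P.z (cond ε (l / 2 - P.k / 2) (P.k / 2 - l / 2))) := by
  refine contr_of_eq (norm_z_lt_one hP.q_lt_one hP.rs_pos) (tame_aF hP ε) (tame_cPsi hP l) fun n => ?_
  have hn : ((n : ℕ) : ℂ) ≠ 0 := by exact_mod_cast n.ne_zero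
  have hD := dd_ne_zero hP.q_lt_one
  have hQ := P.qn_ne n
  have hK := P.kn_ne n
  have hR := P.rn_ne n
  have hL := P.ln_ne l n
  obtain ⟨d1, d2, d3, d4, d5, d6⟩ := bracket_denominators hP n
  obtain ⟨b1, b2, b3, b4, b5, b6, b7, b8, b9, b10, b11, b12, b13⟩ := P.bracket_values l n
  obtain ⟨z1, z2, z3, z4, z5, z6⟩ := P.z_values l n
  cases ε
  all_goals
    simp only [comm, aF, cPsi, b1, b2, b3, b4, b5, b6, b7, b8, b9, b10, b11, b12, b13, cond,
      z_add, z_sub, z_neg, mul_pow, div_pow, inv_pow, z1, z2, z3, z4, z5, z6, zero_pow n.ne_zero,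
      one_pow]
    try rw [show 1 - P.rn n ^ 2 / P.kn n ^ 4 = -((P.rn n ^ 2 - P.kn n ^ 4) / P.kn n ^ 4) from by field_simp; ring]
    field_simp
    try ring

theorem contr_Psi_F (l : ℕ) (ε : Bool) :
    Contr (P.z P.rs) (fun i => P.comm i * P.aPsi l i) (P.cF ε)
      0 0 (P.z (cond ε (P.k / 2 - l / 2) (l / 2 - P.k / 2))) := by
  refine contr_of_eq (norm_z_lt_one hP.q_lt_one hP.rs_pos) (tame_aPsi hP l) (tame_cF hP ε) fun n => ?_
  have hn : ((n : ℕ) : ℂ) ≠ 0 := by exact_mod_cast n.ne_zero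
  have hD := dd_ne_zero hP.q_lt_one
  have hQ := P.qn_ne n
  have hK := P.kn_ne n
  have hR := P.rn_ne n
  have hL := P.ln_ne l n
  obtain ⟨d1, d2, d3, d4, d5, d6⟩ := bracket_denominators hP n
  obtain ⟨b1, b2, b3, b4, b5, b6, b7, b8, b9, b10, b11, b12, b13⟩ := P.bracket_values l n
  obtain ⟨z1, z2, z3, z4, z5, z6⟩ := P.z_values l n
  cases ε
  all_goals
    simp only [comm, aPsi, cF, b1, b2, b3, b4, b5, b6, b7, b8, b9, b10, b11, b12, b13, cond,
      z_add, z_sub, z_neg, mul_pow, div_pow, inv_pow, z1, z2, z3, z4, z5, z6, zero_pow n.ne_zero,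
      one_pow]
    try rw [show 1 - P.rn n ^ 2 / P.kn n ^ 4 = -((P.rn n ^ 2 - P.kn n ^ 4) / P.kn n ^ 4) from by field_simp; ring]
    field_simp
    try ring

theorem contr_Hplus_Psi (l : ℕ) :
    Contr (P.z P.rs) (fun i => P.comm i * P.aH false i) (P.cPsi l)
      (P.z (-(P.k / 4) - l / 2)) (P.z (-(P.k / 4) + l / 2)) 0 := by
  refine contr_of_eq (norm_z_lt_one hP.q_lt_one hP.rs_pos) (tame_aH hP false) (tame_cPsi hP l) fun n => ?_
  have hn : ((n : ℕ) : ℂ) ≠ 0 := by exact_mod_cast n.ne_zero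
  have hD := dd_ne_zero hP.q_lt_one
  have hQ := P.qn_ne n
  have hK := P.kn_ne n
  have hR := P.rn_ne n
  have hL := P.ln_ne l n
  obtain ⟨d1, d2, d3, d4, d5, d6⟩ := bracket_denominators hP n
  obtain ⟨b1, b2, b3, b4, b5, b6, b7, b8, b9, b10, b11, b12, b13⟩ := P.bracket_values l n
  obtain ⟨z1, z2, z3, z4, z5, z6⟩ := P.z_values l n
  simp only [comm, aH, cPsi, b1, b2, b3, b4, b5, b6, b7, b8, b9, b10, b11, b12, b13, cond, z_add,
    z_sub, z_neg, mul_pow, div_pow, inv_pow, z1, z2, z3, z4, z5, z6, zero_pow n.ne_zero, one_pow]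
  try rw [show 1 - P.rn n ^ 2 / P.kn n ^ 4 = -((P.rn n ^ 2 - P.kn n ^ 4) / P.kn n ^ 4) from by field_simp; ring]
  field_simp
  try ring

theorem contr_Psi_Hplus (l : ℕ) :
    Contr (P.z P.rs) (fun i => P.comm i * P.aPsi l i) (P.cH false)
      (P.z (P.rs + P.k / 4 - l / 2)) (P.z (P.rs + P.k / 4 + l / 2)) 0 := by
  refine contr_of_eq (norm_z_lt_one hP.q_lt_one hP.rs_pos) (tame_aPsi hP l) (tame_cH hP false) fun n => ?_
  have hn : ((n : ℕ) : ℂ) ≠ 0 := by exact_mod_cast n.ne_zero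
  have hD := dd_ne_zero hP.q_lt_one
  have hQ := P.qn_ne n
  have hK := P.kn_ne n
  have hR := P.rn_ne n
  have hL := P.ln_ne l n
  obtain ⟨d1, d2, d3, d4, d5, d6⟩ := bracket_denominators hP n
  obtain ⟨b1, b2, b3, b4, b5, b6, b7, b8, b9, b10, b11, b12, b13⟩ := P.bracket_values l n
  obtain ⟨z1, z2, z3, z4, z5, z6⟩ := P.z_values l n
  simp only [comm, aPsi, cH, b1, b2, b3, b4, b5, b6, b7, b8, b9, b10, b11, b12, b13, cond, z_add,
    z_sub, z_neg, mul_pow, div_pow, inv_pow, z1, z2, z3, z4, z5, z6, zero_pow n.ne_zero, one_pow]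
  try rw [show 1 - P.rn n ^ 2 / P.kn n ^ 4 = -((P.rn n ^ 2 - P.kn n ^ 4) / P.kn n ^ 4) from by field_simp; ring]
  field_simp
  try ring

theorem contr_Hminus_Psi (l : ℕ) :
    Contr (P.z P.rs) (fun i => P.comm i * P.aH true i) (P.cPsi l)
      (P.z (P.rs + P.k / 4 - l / 2)) (P.z (P.rs + P.k / 4 + l / 2)) 0 := by
  refine contr_of_eq (norm_z_lt_one hP.q_lt_one hP.rs_pos) (tame_aH hP true) (tame_cPsi hP l) fun n => ?_
  have hn : ((n : ℕ) : ℂ) ≠ 0 := by exact_mod_cast n.ne_zero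
  have hD := dd_ne_zero hP.q_lt_one
  have hQ := P.qn_ne n
  have hK := P.kn_ne n
  have hR := P.rn_ne n
  have hL := P.ln_ne l n
  obtain ⟨d1, d2, d3, d4, d5, d6⟩ := bracket_denominators hP n
  obtain ⟨b1, b2, b3, b4, b5, b6, b7, b8, b9, b10, b11, b12, b13⟩ := P.bracket_values l n
  obtain ⟨z1, z2, z3, z4, z5, z6⟩ := P.z_values l n
  simp only [comm, aH, cPsi, b1, b2, b3, b4, b5, b6, b7, b8, b9, b10, b11, b12, b13, cond, z_add,
    z_sub, z_neg, mul_pow, div_pow, inv_pow, z1, z2, z3, z4, z5, z6, zero_pow n.ne_zero, one_pow]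
  try rw [show 1 - P.rn n ^ 2 / P.kn n ^ 4 = -((P.rn n ^ 2 - P.kn n ^ 4) / P.kn n ^ 4) from by field_simp; ring]
  field_simp
  try ring

theorem contr_Psi_Hminus (l : ℕ) :
    Contr (P.z P.rs) (fun i => P.comm i * P.aPsi l i) (P.cH true)
      (P.z (-(P.k / 4) - l / 2)) (P.z (-(P.k / 4) + l / 2)) 0 := by
  refine contr_of_eq (norm_z_lt_one hP.q_lt_one hP.rs_pos) (tame_aPsi hP l) (tame_cH hP true) fun n => ?_
  have hn : ((n : ℕ) : ℂ) ≠ 0 := by exact_mod_cast n.ne_zero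
  have hD := dd_ne_zero hP.q_lt_one
  have hQ := P.qn_ne n
  have hK := P.kn_ne n
  have hR := P.rn_ne n
  have hL := P.ln_ne l n
  obtain ⟨d1, d2, d3, d4, d5, d6⟩ := bracket_denominators hP n
  obtain ⟨b1, b2, b3, b4, b5, b6, b7, b8, b9, b10, b11, b12, b13⟩ := P.bracket_values l n
  obtain ⟨z1, z2, z3, z4, z5, z6⟩ := P.z_values l n
  simp only [comm, aPsi, cH, b1, b2, b3, b4, b5, b6, b7, b8, b9, b10, b11, b12, b13, cond, z_add,
    z_sub, z_neg, mul_pow, div_pow, inv_pow, z1, z2, z3, z4, z5, z6, zero_pow n.ne_zero, one_pow]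
  try rw [show 1 - P.rn n ^ 2 / P.kn n ^ 4 = -((P.rn n ^ 2 - P.kn n ^ 4) / P.kn n ^ 4) from by field_simp; ring]
  field_simp
  try ring

/-- For products of several currents. All pairs of terms share the denominator `(q^{-2} ζ; p)_∞`;
what distinguishes them is entire and goes into the numerators. For `E` the denominator is `(q^2 ζ;
p*)_∞`. -/
theorem contr_F_F (ε ε' : Bool) :
    Contr (P.z P.r) (fun i => P.comm i * P.aF ε i) (P.cF ε')
      (P.z (-1)) (numF P ε ε') (facF P ε ε') := by
  refine contr_of_eq (norm_z_lt_one hP.q_lt_one hP.r_pos) (tame_aF hP ε) (tame_cF hP ε') fun n => ?_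
  have hn : ((n : ℕ) : ℂ) ≠ 0 := by exact_mod_cast n.ne_zero
  have hD := dd_ne_zero hP.q_lt_one
  have hQ := P.qn_ne n
  have hK := P.kn_ne n
  have hR := P.rn_ne n
  have hL := P.ln_ne 0 n
  obtain ⟨d1, d2, d3, d4, d5, d6⟩ := bracket_denominators hP n
  obtain ⟨b1, b2, b3, b4, b5, b6, b7, b8, b9, b10, b11, b12, b13⟩ := P.bracket_values 0 n
  obtain ⟨z1, z2, z3, z4, z5, z6⟩ := P.z_values 0 n
  cases ε <;> cases ε'
  all_goals
    simp only [comm, aF, cF, numF, facF, b1, b2, b3, b4, b5, b6, b7, b8, b9, b10, b11, b12, b13,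
      cond, z_add, z_sub, z_neg, mul_pow, div_pow, inv_pow, z1, z2, z3, z4, z5, z6, zero_pow
      n.ne_zero, one_pow]
    try rw [show 1 - P.rn n ^ 2 = -(P.rn n ^ 2 - 1) from by ring]
    field_simp
    try ring

theorem contr_E_E (ε ε' : Bool) :
    Contr (P.z P.rs) (fun i => P.comm i * P.aE ε i) (P.cE ε')
      (P.z 1) (numE P ε ε') (facE P ε ε') := by
  refine contr_of_eq (norm_z_lt_one hP.q_lt_one hP.rs_pos) (tame_aE hP ε) (tame_cE hP ε') fun n => ?_
  have hn : ((n : ℕ) : ℂ) ≠ 0 := by exact_mod_cast n.ne_zero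
  have hD := dd_ne_zero hP.q_lt_one
  have hQ := P.qn_ne n
  have hK := P.kn_ne n
  have hR := P.rn_ne n
  have hL := P.ln_ne 0 n
  obtain ⟨d1, d2, d3, d4, d5, d6⟩ := bracket_denominators hP n
  obtain ⟨b1, b2, b3, b4, b5, b6, b7, b8, b9, b10, b11, b12, b13⟩ := P.bracket_values 0 n
  obtain ⟨z1, z2, z3, z4, z5, z6⟩ := P.z_values 0 n
  cases ε <;> cases ε'
  all_goals
    simp only [comm, aE, cE, numE, facE, b1, b2, b3, b4, b5, b6, b7, b8, b9, b10, b11, b12, b13,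
      cond, z_add, z_sub, z_neg, mul_pow, div_pow, inv_pow, z1, z2, z3, z4, z5, z6, zero_pow
      n.ne_zero, one_pow]
    try rw [show 1 - P.rn n ^ 2 / P.kn n ^ 4 = -((P.rn n ^ 2 - P.kn n ^ 4) / P.kn n ^ 4) from by field_simp; ring]
    field_simp
    try ring

end Contractions

end Params
end EllipticVO
end

open Filter Topology
noncomputable section
namespace EllipticVO

/-! ### Zero modes -/

namespace Expo

theorem q_Q (x y : ZeroMode) (c : ℂ) : (q x c).Q y = if y = x then c else 0 := by
  simp [q, Pi.single_apply]
theorem p_P (x y : ZeroMode) (c : ℂ) : (p x c).P y = if y = x then c else 0 := by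
  simp [p, Pi.single_apply]
theorem q_P (x : ZeroMode) (c : ℂ) : (q x c).P = 0 := rfl
theorem p_Q (x : ZeroMode) (c : ℂ) : (p x c).Q = 0 := rfl
theorem creSum_Q (x : Boson) (f : ℕ+ → ℂ) : (creSum x f).Q = 0 := rfl
theorem creSum_P (x : Boson) (f : ℕ+ → ℂ) : (creSum x f).P = 0 := rfl
theorem annSum_Q (x : Boson) (f : ℕ+ → ℂ) : (annSum x f).Q = 0 := rfl
theorem annSum_P (x : Boson) (f : ℕ+ → ℂ) : (annSum x f).P = 0 := rfl
theorem const_Q (c : ℂ) : (const c).Q = 0 := rfl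
theorem const_P (c : ℂ) : (const c).P = 0 := rfl
theorem q_K (x : ZeroMode) (c : ℂ) : (q x c).K = 0 := rfl
theorem p_K (x : ZeroMode) (c : ℂ) : (p x c).K = 0 := rfl
theorem creSum_K (x : Boson) (f : ℕ+ → ℂ) : (creSum x f).K = 0 := rfl
theorem annSum_K (x : Boson) (f : ℕ+ → ℂ) : (annSum x f).K = 0 := rfl
theorem const_K (c : ℂ) : (const c).K = c := rfl

end Expo

namespace Params

variable (P : Params)

/-- The charges of `e^X` for the exponents in `F`. -/
def dqF : Charge
  | .a => 0
  | .b => -1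
  | .c => 1
  | .hat => 0

/-- The charges of `e^X` for the exponents in `E`. -/
def dqE : Charge
  | .a => 0
  | .b => 1
  | .c => -1
  | .hat => -2

/-- The charges of `e^X` for the exponents in `H^±`. -/
def dqH : Charge
  | .hat => -2
  | _ => 0

/-- The charges of `Φ_{l,l}`. -/
def dqPhi (l : ℕ) : Charge
  | .a => P.k - l
  | .b => -(P.k - l)
  | .c => P.k - l
  | .hat => -P.rs

/-- The charges of `Ψ*_{l,l}`. -/
def dqPsi (l : ℕ) : Charge
  | .a => P.k - l
  | .b => 0
  | .c => 0
  | .hat => l + P.rs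

/-- Both terms of a current shift the charges alike, so a current maps each sector into one sector.
-/
theorem dq_eq (hk : P.k ≠ -2) (ε : Bool) (l : ℕ) (u : ℂ) :
    P.dq (P.xF ε u) = dqF ∧ P.dq (P.xE ε u) = dqE ∧ P.dq (P.xH ε u) = dqH ∧
    P.dq (P.xPhi l u) = P.dqPhi l ∧ P.dq (P.xPsi l u) = P.dqPsi l := by
  have hk' : (P.k : ℂ) + 2 ≠ 0 := by
    intro h
    apply hk
    have : ((P.k + 2 : ℝ) : ℂ) = 0 := by push_cast; exact h
    linarith [Complex.ofReal_eq_zero.1 this]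
  refine ⟨?_, ?_, ?_, ?_, ?_⟩ <;> funext i <;> cases i
  all_goals try cases ε
  all_goals
    simp only [dq, dqF, dqE, dqH, dqPhi, dqPsi, zcomm, xF, xE, xH, xPhi, xPsi, cond, expoUp,
      expoUm, expoPsiP, expoPsiM, expoE1, expoE2, expoF1, expoF2, expoVp, expoVm, phat1, ph, field,
      fieldP, fieldM, starP, starM, bigP, bigM, Expo.add_Q, Expo.sub_Q, Expo.neg_Q, Pi.add_apply,
      Pi.sub_apply, Pi.neg_apply, Pi.zero_apply, Expo.q_Q, Expo.p_Q, Expo.creSum_Q, Expo.annSum_Q,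
      Expo.const_Q, Boson.zero, reduceCtorEq, if_true, if_false]
    try field_simp
    try ring

theorem lnz_add (u v : ℂ) : P.lnz (u + v) = P.lnz u + 2 * v * P.logq := by
  unfold lnz; ring

theorem lnz_sub (u v : ℂ) : P.lnz (u - v) = P.lnz u - 2 * v * P.logq := by
  unfold lnz; ring

/-- A sign for the two terms of the currents. -/
def sg (ε : Bool) : ℂ := cond ε (-1) 1

theorem zero_modes (ε : Bool) (l : ℕ) (u : ℂ) :
    ((P.xF ε u).P .a = P.lnz u / P.r - sg ε * P.logq ∧
      (P.xF ε u).P .b = P.lnz u + 2 * P.lnz u / P.r - sg ε * (P.k + 2) * P.logq ∧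
      (P.xF ε u).P .c = P.lnz u - sg ε * (P.k + 1) * P.logq ∧
      (P.xF ε u).P .hat = P.lnz u / P.r ∧ (P.xF ε u).K = -(P.lnz u / P.r)) ∧
    ((P.xE ε u).P .a = 0 ∧ (P.xE ε u).P .b = -P.lnz u ∧
      (P.xE ε u).P .c = -P.lnz u - sg ε * P.logq ∧
      (P.xE ε u).P .hat = -(P.lnz u / P.rs) ∧ (P.xE ε u).K = P.lnz u / P.rs) ∧
    ((P.xH ε u).P .a = (P.lnz u - sg ε * (P.k / 2) * P.logq) / P.r + sg ε * P.logq ∧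
      (P.xH ε u).P .b = 2 * ((P.lnz u - sg ε * (P.k / 2) * P.logq) / P.r) + 2 * sg ε * P.logq ∧
      (P.xH ε u).P .c = 0 ∧
      (P.xH ε u).P .hat = (P.lnz u + sg ε * (P.r - P.k / 2) * P.logq) / P.r -
        (P.lnz u + sg ε * (P.r - P.k / 2) * P.logq) / P.rs ∧
      (P.xH ε u).K = -((P.lnz u + sg ε * (P.r - P.k / 2) * P.logq) / P.r -
        (P.lnz u + sg ε * (P.r - P.k / 2) * P.logq) / P.rs)) ∧
    ((P.xPhi l u).P .a = 0 ∧ (P.xPhi l u).P .b = 0 ∧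
      (P.xPhi l u).P .c = (l - P.r) / P.r * P.lnz u ∧
      (P.xPhi l u).P .hat = -(l / (2 * P.r) * P.lnz u) ∧ (P.xPhi l u).K = 0) ∧
    ((P.xPsi l u).P .a = 0 ∧ (P.xPsi l u).P .b = -P.lnz u ∧ (P.xPsi l u).P .c = 0 ∧
      (P.xPsi l u).P .hat = l / (2 * P.rs) * P.lnz u ∧ (P.xPsi l u).K = 0) := by
  refine ⟨⟨?_, ?_, ?_, ?_, ?_⟩, ⟨?_, ?_, ?_, ?_, ?_⟩, ⟨?_, ?_, ?_, ?_, ?_⟩, ⟨?_, ?_, ?_, ?_, ?_⟩,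
    ⟨?_, ?_, ?_, ?_, ?_⟩⟩
  all_goals try cases ε
  all_goals
    simp only [sg, xF, xE, xH, xPhi, xPsi, cond, expoUp,
      expoUm, expoPsiP, expoPsiM, expoE1, expoE2, expoF1, expoF2, expoVp, expoVm, phat1, ph, field,
      fieldP, fieldM, starP, starM, bigP, bigM, Expo.add_P, Expo.sub_P, Expo.neg_P, Expo.add_K,
      Expo.sub_K, Expo.neg_K, Pi.add_apply, Pi.sub_apply, Pi.neg_apply, Pi.zero_apply, Expo.q_P,
      Expo.p_P, Expo.creSum_P, Expo.annSum_P, Expo.const_P, Expo.q_K, Expo.p_K, Expo.creSum_K,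
      Expo.annSum_K, Expo.const_K, Boson.zero, reduceCtorEq, if_true, if_false, lnz_add, lnz_sub]
    try ring

/-- These are the powers of `z`, `w` and `q` that arise when the `p`'s of the left factor pass the
`q`'s of the right one. They supply the prefactors that turn infinite products into theta functions.
-/
theorem zpair_currents (hk : P.k ≠ -2) (hr : (P.r : ℂ) ≠ 0) (hrs : (P.rs : ℂ) ≠ 0) (ε : Bool) (l : ℕ)
    (u v : ℂ) :
    (P.zpair (P.xF ε u) (P.xPhi l v) = (l / P.r - 1) * P.lnz u ∧
      P.zpair (P.xPhi l v) (P.xF ε u) = (l / P.r - 1) * P.lnz v) ∧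
    (P.zpair (P.xE ε u) (P.xPhi l v) = P.lnz u - sg ε * (P.k - l) * P.logq ∧
      P.zpair (P.xPhi l v) (P.xE ε u) = P.lnz v) ∧
    (P.zpair (P.xH ε u) (P.xPhi l v) = l * P.lnz u / P.r + sg ε * (l - l * P.k / (2 * P.r)) * P.logq ∧
      P.zpair (P.xPhi l v) (P.xH ε u) = l / P.r * P.lnz v) ∧
    (P.zpair (P.xE ε u) (P.xPsi l v) = -(l / P.rs + 1) * P.lnz u ∧
      P.zpair (P.xPsi l v) (P.xE ε u) = -(l / P.rs + 1) * P.lnz v) ∧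
    (P.zpair (P.xF ε u) (P.xPsi l v) = P.lnz u - sg ε * (P.k - l) * P.logq ∧
      P.zpair (P.xPsi l v) (P.xF ε u) = P.lnz v) ∧
    (P.zpair (P.xH ε u) (P.xPsi l v) =
        -(l * P.lnz u / P.rs) - sg ε * (l + l * P.k / (2 * P.rs)) * P.logq ∧
      P.zpair (P.xPsi l v) (P.xH ε u) = -(l / P.rs) * P.lnz v) := by
  obtain ⟨f1, f2, f3, f4, f5⟩ := P.dq_eq hk ε l u
  obtain ⟨-, -, -, g4, g5⟩ := P.dq_eq hk ε l v
  obtain ⟨⟨a1, a2, a3, a4, -⟩, ⟨b1, b2, b3, b4, -⟩, ⟨c1, c2, c3, c4, -⟩, -, -⟩ := P.zero_modes ε l u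
  obtain ⟨-, -, -, ⟨d1, d2, d3, d4, -⟩, e1, e2, e3, e4, -⟩ := P.zero_modes ε l v
  have hk' : (P.k : ℂ) = P.r - P.rs := by simp [rs]
  refine ⟨⟨?_, ?_⟩, ⟨?_, ?_⟩, ⟨?_, ?_⟩, ⟨?_, ?_⟩, ⟨?_, ?_⟩, ?_, ?_⟩
  all_goals
    simp only [zpair, f1, f2, f3, g4, g5, dqF, dqE, dqH, dqPhi, dqPsi, a1, a2, a3, a4, b1, b2, b3,
      b4, c1, c2, c3, c4, d1, d2, d3, d4, e1, e2, e3, e4, hk']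
    field_simp
    ring

end Params
end EllipticVO
end

/-! ### From contractions to exchange relations -/

open Filter Topology
noncomputable section
namespace EllipticVO

theorem Expo.add_comm (X Y : Expo) : X + Y = Y + X := by
  change Expo.mk _ _ _ _ _ = Expo.mk _ _ _ _ _
  congr 1 <;> exact _root_.add_comm _ _

theorem eventually_codiscrete_ne_zero {f : ℂ → ℂ} (hf : Differentiable ℂ f) {x : ℂ} (hx : f x ≠ 0) :
    ∀ᶠ u in codiscrete ℂ, f u ≠ 0 := by
  refine (AnalyticOnNhd.eqOn_zero_or_eventually_ne_zero_of_preconnected (f := f)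
    (fun u _ => hf.analyticAt u) isPreconnected_univ).resolve_left fun h => hx ?_
  simpa using h (Set.mem_univ x)

namespace Params

variable {P : Params}

theorem differentiable_z : Differentiable ℂ P.z := P.contDiff_z.differentiable (n := 1) one_ne_zero

theorem differentiable_lnz : Differentiable ℂ P.lnz := by unfold lnz; fun_prop

/-- The contraction of exponentials with homogeneous coefficients. -/
theorem exp_tsum_eq {p : ℂ} {a c : Mode → ℂ} {y' y e : ℂ}
    (h : Contr p (fun i => P.comm i * a i) c y' y e) : ∃ R : ℝ, 0 < R ∧
    ∀ (X Y : Expo) (u v : ℂ), X.ann = (fun i => a i * (P.z u ^ (i.2 : ℕ))⁻¹) →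
      Y.cre = (fun i => c i * P.z v ^ (i.2 : ℕ)) → R * ‖P.z v‖ < ‖P.z u‖ →
      (Summable fun i => ‖P.bt X i * Y.cre i‖) ∧
        Complex.exp (∑' i, P.bt X i * Y.cre i) = Pr (geo y p) (P.z (v - u)) *
          (1 - e * P.z (v - u)) / Pr (geo y' p) (P.z (v - u)) := by
  obtain ⟨r, hr, h⟩ := h
  refine ⟨1 / r, by positivity, fun X Y u v hX hY hR => ?_⟩
  have hu : P.z u ≠ 0 := P.z_ne_zero u
  have hsmall : ‖P.z (v - u)‖ ≤ r := by
    rw [P.z_sub, norm_div, div_le_iff₀ (norm_pos_iff.2 hu)]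
    rw [one_div, inv_mul_lt_iff₀ hr] at hR
    exact hR.le
  obtain ⟨h1, -, h2⟩ := h _ hsmall
  have e : ∀ i, P.bt X i * Y.cre i = P.comm i * a i * c i * P.z (v - u) ^ (i.2 : ℕ) := by
    intro i
    rw [bt, hX, hY, P.z_sub, div_pow]
    field_simp
  simp only [e]
  exact ⟨h1, h2⟩

/-- The matrix elements of the normal ordered product are entire in `u`, so all poles of an operator
product come from the contraction. -/
theorem differentiable_vop {X : ℂ → Expo} {c a : Mode → ℂ} {d : Charge}
    (hc : ∀ u, (X u).cre = fun i => c i * P.z u ^ (i.2 : ℕ))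
    (ha : ∀ u, (X u).ann = fun i => a i * (P.z u ^ (i.2 : ℕ))⁻¹) (hd : ∀ u, P.dq (X u) = d)
    (hlin : ∀ t, Differentiable ℂ fun u => (X u).lin t) (Y : Expo) (s t : State) :
    Differentiable ℂ fun u => P.vop (X u + Y) s t := by
  by_cases h : s.1 = t.1 + (d + P.dq Y)
  · have h' : ∀ u, s.1 = t.1 + P.dq (X u + Y) := fun u => by rw [dq_add, hd, h]
    simp only [fun u => P.vop_of_eq (h' u), Expo.lin_add, bt_add, Expo.add_cre, hc]
    refine ((hlin _).add_const _).cexp.mul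
      ((contDiff_mel (fun i => ?_) (fun i => ?_) _ _).differentiable one_ne_zero)
    · simp only [Pi.add_apply]
      exact (contDiff_const.mul (P.contDiff_z.pow _)).add contDiff_const
    · simp only [Pi.add_apply, bt, ha]
      exact (contDiff_const.mul (contDiff_const.mul ((P.contDiff_z.pow _).inv fun u =>
        pow_ne_zero _ (P.z_ne_zero u)))).add contDiff_const
  · have h' : ∀ u, s.1 ≠ t.1 + P.dq (X u + Y) := fun u => by rwa [dq_add, hd]
    simp only [fun u => P.vop_of_ne (h' u)]
    exact differentiable_const _

/-- Exchange relations from contractions. -/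
theorem exchange_of_contr {ι : Type} [Fintype ι] {p : ℂ} (hp : ‖p‖ < 1) {A B : ℂ → Op}
    {ρ : ℂ → ℂ} {k : ι → ℂ → ℂ} {X : ι → ℂ → Expo} {Y : ℂ → Expo} {cX aX : ι → Mode → ℂ}
    {cY aY : Mode → ℂ} {d : Charge} {y₁' y₁ e₁ y₂' y₂ e₂ : ι → ℂ}
    (hA : ∀ u s t, A u s t = ∑ i, k i u * P.vop (X i u) s t) (hB : ∀ v, B v = P.vop (Y v))
    (hcX : ∀ i u, (X i u).cre = fun j => cX i j * P.z u ^ (j.2 : ℕ))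
    (haX : ∀ i u, (X i u).ann = fun j => aX i j * (P.z u ^ (j.2 : ℕ))⁻¹)
    (hcY : ∀ v, (Y v).cre = fun j => cY j * P.z v ^ (j.2 : ℕ))
    (haY : ∀ v, (Y v).ann = fun j => aY j * (P.z v ^ (j.2 : ℕ))⁻¹)
    (hk : ∀ i, Differentiable ℂ (k i)) (hd : ∀ i u, P.dq (X i u) = d)
    (hlin : ∀ i t, Differentiable ℂ fun u => (X i u).lin t)
    (h₁ : ∀ i, Contr p (fun j => P.comm j * aX i j) cY (y₁' i) (y₁ i) (e₁ i))
    (h₂ : ∀ i, Contr p (fun j => P.comm j * aY j) (cX i) (y₂' i) (y₂ i) (e₂ i))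
    (hz₁ : ∀ i v, Differentiable ℂ fun u => P.zpair (X i u) (Y v))
    (hz₂ : ∀ i v, Differentiable ℂ fun u => P.zpair (Y v) (X i u))
    (hρ : ∀ i v, ∀ᶠ u in codiscrete ℂ,
      Complex.exp (P.zpair (X i u) (Y v)) * (Pr (geo (y₁ i) p) (P.z (v - u)) *
          (1 - e₁ i * P.z (v - u)) / Pr (geo (y₁' i) p) (P.z (v - u))) =
        ρ (u - v) * (Complex.exp (P.zpair (Y v) (X i u)) * (Pr (geo (y₂ i) p) (P.z (u - v)) *
          (1 - e₂ i * P.z (u - v)) / Pr (geo (y₂' i) p) (P.z (u - v))))) :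
    P.Exchange A B ρ := by
  choose R₁ hR₁ H₁ using fun i => exp_tsum_eq (h₁ i)
  choose R₂ hR₂ H₂ using fun i => exp_tsum_eq (h₂ i)
  have hR : ∀ i, R₁ i ≤ 1 + ∑ i, (R₁ i + R₂ i) ∧ R₂ i ≤ 1 + ∑ i, (R₁ i + R₂ i) := fun i => by
    have := Finset.single_le_sum (f := fun i => R₁ i + R₂ i)
      (fun i _ => (add_pos (hR₁ i) (hR₂ i)).le) (Finset.mem_univ i)
    have h1 := hR₁ i
    have h2 := hR₂ i
    constructor <;> linarith
  have hR0 : 0 < 1 + ∑ i, (R₁ i + R₂ i) :=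
    add_pos_of_pos_of_nonneg one_pos (Finset.sum_nonneg fun i _ => (add_pos (hR₁ i) (hR₂ i)).le)
  -- Both continuations are sums of contractions times matrix elements of the same `:exp (X i u + Y
  -- v):`, so `hρ`, which compares the scalars term by term, suffices.
  refine ⟨_, hR0, fun s t v => ⟨fun u => ∑ i, k i u * (Complex.exp (P.zpair (X i u) (Y v)) *
      (Pr (geo (y₁ i) p) (P.z (v - u)) * (1 - e₁ i * P.z (v - u)) /
        Pr (geo (y₁' i) p) (P.z (v - u))) * P.vop (X i u + Y v) s t),
    fun u => ∑ i, k i u * (Complex.exp (P.zpair (Y v) (X i u)) *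
      (Pr (geo (y₂ i) p) (P.z (u - v)) * (1 - e₂ i * P.z (u - v)) /
        Pr (geo (y₂' i) p) (P.z (u - v))) * P.vop (X i u + Y v) s t), ?_, ?_, ?_, ?_, ?_⟩⟩
  · intro u _
    refine MeromorphicAt.fun_sum fun i _ => ((hk i).analyticAt u).meromorphicAt.mul
      ((((hz₁ i v).cexp.analyticAt u).meromorphicAt.mul (((((differentiable_Pr (summable_geo _ hp)).comp
        (differentiable_z.comp (differentiable_id.const_sub v))).mul ((differentiable_const _).sub
          ((differentiable_const _).mul (differentiable_z.comp
            (differentiable_id.const_sub v))))).analyticAt u).meromorphicAt.div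
        (((differentiable_Pr (summable_geo _ hp)).comp
          (differentiable_z.comp (differentiable_id.const_sub v))).analyticAt u).meromorphicAt)).mul
      ((differentiable_vop (hcX i) (haX i) (hd i) (hlin i) (Y v) s t).analyticAt u).meromorphicAt)
  · intro u _
    refine MeromorphicAt.fun_sum fun i _ => ((hk i).analyticAt u).meromorphicAt.mul
      ((((hz₂ i v).cexp.analyticAt u).meromorphicAt.mul (((((differentiable_Pr (summable_geo _ hp)).comp
        (differentiable_z.comp (differentiable_id.sub_const v))).mul ((differentiable_const _).sub
          ((differentiable_const _).mul (differentiable_z.comp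
            (differentiable_id.sub_const v))))).analyticAt u).meromorphicAt.div
        (((differentiable_Pr (summable_geo _ hp)).comp
          (differentiable_z.comp (differentiable_id.sub_const v))).analyticAt u).meromorphicAt)).mul
      ((differentiable_vop (hcX i) (haX i) (hd i) (hlin i) (Y v) s t).analyticAt u).meromorphicAt)
  · intro u hu
    refine hasSum_of_eq (hasSum_sum (s := Finset.univ) fun i _ => ?_)
      (fun x => by rw [hA, hB, Finset.sum_mul]) rfl
    have hu' : R₁ i * ‖P.z v‖ < ‖P.z u‖ := lt_of_le_of_lt (by gcongr; exact (hR i).1) hu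
    obtain ⟨s1, s2⟩ := H₁ i (X i u) (Y v) u v (haX i u) (hcY v) hu'
    have := (P.hasSum_vop_mul s1 s t).mul_left (k i u)
    rw [s2] at this
    exact hasSum_of_eq this (fun x => by ring) rfl
  · intro u hu
    refine hasSum_of_eq (hasSum_sum (s := Finset.univ) fun i _ => ?_)
      (fun x => by rw [hA, hB, Finset.mul_sum]) rfl
    have hu' : R₂ i * ‖P.z u‖ < ‖P.z v‖ := lt_of_le_of_lt (by gcongr; exact (hR i).2) hu
    obtain ⟨s1, s2⟩ := H₂ i (Y v) (X i u) v u (haY v) (hcX i u) hu'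
    have := (P.hasSum_vop_mul s1 s t).mul_left (k i u)
    rw [s2, Expo.add_comm] at this
    exact hasSum_of_eq this (fun x => by ring) rfl
  · filter_upwards [eventually_all.2 fun i => hρ i v] with u hu
    rw [Finset.mul_sum]
    refine Finset.sum_congr rfl fun i _ => ?_
    rw [hu i]
    ring

/-! ### Theta functions -/

/-- `(z; p)_∞` as a function of `u`, where `z = q^{2u}` and `p = q^{2ν}`. -/
def pz (P : Params) (ν : ℝ) (u : ℂ) : ℂ := Pr (geo 1 (P.z ν)) (P.z u)

theorem Pr_geo_z (ν : ℝ) (α u : ℂ) : Pr (geo (P.z α) (P.z ν)) (P.z u) = P.pz ν (α + u) := by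
  rw [pz, Pr_geo, Pr_geo, z_add, one_mul]

section Theta

variable {ν : ℝ} (hq : P.logq.re < 0) (hν : 0 < ν)
include hq hν

theorem pz_succ (u : ℂ) : P.pz ν u = (1 - P.z u) * P.pz ν (ν + u) := by
  rw [pz, Pr_geo, one_mul, poch_succ (norm_z_lt_one hq hν), pz, Pr_geo, one_mul, z_add]

theorem differentiable_pz : Differentiable ℂ (P.pz ν) :=
  (differentiable_Pr (summable_geo _ (norm_z_lt_one hq hν))).comp differentiable_z

theorem pz_one_ne_zero : P.pz ν 1 ≠ 0 := by
  rw [pz, Pr_geo, one_mul]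
  exact poch_ne_zero (norm_z_lt_one hq hν) (by simpa using norm_z_lt_one (P := P) hq one_pos)

theorem eventually_pz_add_ne_zero (α : ℂ) : ∀ᶠ u in codiscrete ℂ, P.pz ν (α + u) ≠ 0 :=
  eventually_codiscrete_ne_zero (f := fun u => P.pz ν (α + u))
    ((differentiable_pz hq hν).comp (differentiable_id.const_add α)) (x := 1 - α)
    (by simpa using pz_one_ne_zero hq hν)

theorem eventually_pz_sub_ne_zero (α : ℂ) : ∀ᶠ u in codiscrete ℂ, P.pz ν (α - u) ≠ 0 :=
  eventually_codiscrete_ne_zero (f := fun u => P.pz ν (α - u))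
    ((differentiable_pz hq hν).comp (differentiable_id.const_sub α)) (x := α - 1)
    (by simpa using pz_one_ne_zero hq hν)

theorem poch_self_ne_zero : poch (P.z ν) (P.z ν) ≠ 0 :=
  poch_ne_zero (norm_z_lt_one hq hν) (norm_z_lt_one hq hν)

theorem thetaNu_eq (x : ℂ) : P.thetaNu ν x =
    P.qpow (x ^ 2 / ν - x) * (P.pz ν x * P.pz ν (ν - x)) / poch (P.z ν) (P.z ν) ^ 2 := by
  have h := poch_self_ne_zero hq hν
  rw [thetaNu, bigTheta, pz, pz, Pr_geo, Pr_geo, one_mul, one_mul, z_sub, div_eq_mul_inv (P.z ν)]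
  change P.qpow _ * (poch (P.z x) (P.z ν) * poch (P.z ν * (P.z x)⁻¹) (P.z ν) *
    poch (P.z ν) (P.z ν)) / poch (P.z ν) (P.z ν) ^ 3 = _
  field_simp

/-- The quotients of theta functions in the exchange relations. -/
theorem thetaNu_div_mul (α : ℂ) {x : ℂ} (h₁ : P.pz ν (ν - α + x) ≠ 0) (h₂ : P.pz ν (α + x) ≠ 0)
    (h₃ : P.pz ν (ν + α - x) ≠ 0) (h₄ : P.pz ν (-α + x) ≠ 0) (h₅ : P.pz ν (α - x) ≠ 0) :
    P.thetaNu ν (x + α) / P.thetaNu ν (x - α) * (P.pz ν (ν - α + x) / P.pz ν (α + x)) =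
      -(P.qpow (4 * x * α / ν) * P.z (-x) * (P.pz ν (ν - α - x) / P.pz ν (α - x))) := by
  have hC := poch_self_ne_zero hq hν
  have hν' : (ν : ℂ) ≠ 0 := by exact_mod_cast hν.ne'
  have e1 : P.qpow ((x + α) ^ 2 / ν - (x + α)) =
      P.qpow (4 * x * α / ν) * (P.z α)⁻¹ * P.qpow ((x - α) ^ 2 / ν - (x - α)) := by
    rw [z, ← qpow_neg, ← qpow_add, ← qpow_add]
    congr 1
    field_simp
    ring
  -- After the products in the denominator are shifted by `p`, the factors `1 - z (x - α)` and `1 -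
  -- z (α - x)` remain, and their quotient is a monomial up to sign.
  have e2 := pz_succ hq hν (-α + x)
  have e3 := pz_succ hq hν (α - x)
  have e4 : P.z (α - x) * P.z (-α + x) = 1 := by
    rw [← z_add, show α - x + (-α + x) = 0 by ring, z_zero]
  have e5 : P.z (-x) = (P.z α)⁻¹ * P.z (α - x) := by
    rw [← z_neg, ← z_add]; congr 1; ring
  rw [show (ν : ℂ) + (-α + x) = ν - α + x by ring] at e2
  rw [show (ν : ℂ) + (α - x) = ν + α - x by ring] at e3
  rw [thetaNu_eq hq hν, thetaNu_eq hq hν, e1, e5, show x + α = α + x by ring,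
    show (ν : ℂ) - (α + x) = ν - α - x by ring, show x - α = -α + x by ring,
    show (ν : ℂ) - (-α + x) = ν + α - x by ring]
  have h6 : P.qpow ((-α + x) ^ 2 / ν - (-α + x)) ≠ 0 := Complex.exp_ne_zero _
  have hz := P.z_ne_zero α
  rw [e2] at h₄ ⊢
  rw [e3] at h₅ ⊢
  have h7 := left_ne_zero_of_mul h₄
  have h8 := left_ne_zero_of_mul h₅
  generalize P.qpow ((-α + x) ^ 2 / ν - (-α + x)) = a at h6 ⊢
  generalize P.qpow (4 * x * α / ν) = b
  field_simp
  linear_combination -(b * P.pz ν (ν - α - x)) * e4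

/-- `thetaNu_div_mul` with one linear factor moved on each side. This is the shape of the
contractions of `H^+`; the next variant is that of `H^-`. -/
theorem thetaNu_div_mul_left (α : ℂ) {x : ℂ} (h₁ : P.pz ν (ν - α + x) ≠ 0)
    (h₂ : P.pz ν (α + x) ≠ 0) (h₃ : P.pz ν (ν + α - x) ≠ 0) (h₄ : P.pz ν (-α + x) ≠ 0)
    (h₅ : P.pz ν (α - x) ≠ 0) :
    P.thetaNu ν (x + α) / P.thetaNu ν (x - α) * (P.pz ν (ν - α + x) / P.pz ν (ν + α + x)) =
      P.qpow (4 * x * α / ν) * P.z α * (P.pz ν (-α - x) / P.pz ν (α - x)) := by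
  have key := thetaNu_div_mul hq hν α h₁ h₂ h₃ h₄ h₅
  have e2 := pz_succ hq hν (α + x)
  have e3 := pz_succ hq hν (-α - x)
  rw [show (ν : ℂ) + (α + x) = ν + α + x by ring] at e2
  rw [show (ν : ℂ) + (-α - x) = ν - α - x by ring] at e3
  have e4 : P.z (-x) * P.z (α + x) = P.z α := by rw [← z_add]; congr 1; ring
  have e5 : P.z α * P.z (-α - x) = P.z (-x) := by rw [← z_add]; congr 1; ring
  have h₂' := h₂
  rw [e2] at h₂'
  have h7 := left_ne_zero_of_mul h₂'
  have h8 := right_ne_zero_of_mul h₂'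
  have e6 : P.pz ν (ν - α + x) / P.pz ν (ν + α + x) =
      P.pz ν (ν - α + x) / P.pz ν (α + x) * (1 - P.z (α + x)) := by
    rw [e2]; field_simp
  rw [e6, ← mul_assoc, key, e3]
  linear_combination P.qpow (4 * x * α / ν) * P.pz ν (ν - α - x) / P.pz ν (α - x) * (e4 + e5)

theorem thetaNu_div_mul_right (α : ℂ) {x : ℂ} (h₁ : P.pz ν (ν - α + x) ≠ 0)
    (h₂ : P.pz ν (α + x) ≠ 0) (h₃ : P.pz ν (ν + α - x) ≠ 0) (h₄ : P.pz ν (-α + x) ≠ 0)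
    (h₅ : P.pz ν (α - x) ≠ 0) :
    P.thetaNu ν (x + α) / P.thetaNu ν (x - α) * (P.pz ν (-α + x) / P.pz ν (α + x)) =
      P.qpow (4 * x * α / ν) * P.z (-α) * (P.pz ν (ν - α - x) / P.pz ν (ν + α - x)) := by
  have key := thetaNu_div_mul hq hν α h₁ h₂ h₃ h₄ h₅
  have e2 := pz_succ hq hν (-α + x)
  have e3 := pz_succ hq hν (α - x)
  rw [show (ν : ℂ) + (-α + x) = ν - α + x by ring] at e2
  rw [show (ν : ℂ) + (α - x) = ν + α - x by ring] at e3
  have e4 : P.z (-x) * P.z (-α + x) = P.z (-α) := by rw [← z_add]; congr 1; ring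
  have e5 : P.z (-α) * P.z (α - x) = P.z (-x) := by rw [← z_add]; congr 1; ring
  rw [e3] at h₅
  have h7 := left_ne_zero_of_mul h₅
  have h8 := right_ne_zero_of_mul h₅
  have e6 : P.pz ν (-α + x) / P.pz ν (α + x) =
      P.pz ν (ν - α + x) / P.pz ν (α + x) * (1 - P.z (-α + x)) := by
    rw [e2]; ring
  have e7 : P.pz ν (ν - α - x) / P.pz ν (ν + α - x) =
      P.pz ν (ν - α - x) / P.pz ν (α - x) * (1 - P.z (α - x)) := by
    rw [e3]; field_simp
  rw [e6, ← mul_assoc, key, e7]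
  linear_combination P.qpow (4 * x * α / ν) * P.pz ν (ν - α - x) / P.pz ν (α - x) * (e4 + e5)

/-- The zeros of the infinite products that enter are discrete. -/
theorem eventually_pz_ne_zero (α β v : ℂ) : ∀ᶠ u in codiscrete ℂ,
    P.pz ν (ν - α + (u - v + β)) ≠ 0 ∧ P.pz ν (α + (u - v + β)) ≠ 0 ∧
    P.pz ν (ν + α - (u - v + β)) ≠ 0 ∧ P.pz ν (-α + (u - v + β)) ≠ 0 ∧
    P.pz ν (α - (u - v + β)) ≠ 0 := by
  filter_upwards [eventually_pz_add_ne_zero hq hν (ν - α - v + β),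
    eventually_pz_add_ne_zero hq hν (α - v + β), eventually_pz_sub_ne_zero hq hν (ν + α + v - β),
    eventually_pz_add_ne_zero hq hν (-α - v + β), eventually_pz_sub_ne_zero hq hν (α + v - β)]
    with u h1 h2 h3 h4 h5
  refine ⟨?_, ?_, ?_, ?_, ?_⟩
  · rwa [show (ν : ℂ) - α + (u - v + β) = ν - α - v + β + u by ring]
  · rwa [show α + (u - v + β) = α - v + β + u by ring]
  · rwa [show (ν : ℂ) + α - (u - v + β) = ν + α + v - β - u by ring]
  · rwa [show -α + (u - v + β) = -α - v + β + u by ring]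
  · rwa [show α - (u - v + β) = α + v - β - u by ring]

end Theta

end Params
end EllipticVO
end

open Filter Topology
noncomputable section
namespace EllipticVO
namespace Params

variable {P : Params}

/-! ### The exchange relations -/

theorem differentiable_pref (hq : P.logq.re < 0) (ε : Bool) : Differentiable ℂ (P.pref ε) := by
  unfold pref
  exact (differentiable_const _).mul ((differentiable_const _).div
    ((differentiable_const _).mul differentiable_z)
    fun u => mul_ne_zero (dd_ne_zero hq) (P.z_ne_zero u))

theorem differentiable_lin (ε : Bool) (t : Charge) :
    (Differentiable ℂ fun u => (P.xF ε u).lin t) ∧ (Differentiable ℂ fun u => (P.xE ε u).lin t) ∧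
      Differentiable ℂ fun u => (P.xH ε u).lin t := by
  have h := P.differentiable_lnz
  obtain ⟨h1, h2, h3⟩ : (∀ u, _) ∧ (∀ u, _) ∧ ∀ u, _ :=
    ⟨fun u => (P.zero_modes ε 0 u).1, fun u => (P.zero_modes ε 0 u).2.1,
      fun u => (P.zero_modes ε 0 u).2.2.1⟩
  refine ⟨?_, ?_, ?_⟩
  · simp only [Expo.lin, (h1 _).1, (h1 _).2.1, (h1 _).2.2.1, (h1 _).2.2.2.1, (h1 _).2.2.2.2]
    fun_prop
  · simp only [Expo.lin, (h2 _).1, (h2 _).2.1, (h2 _).2.2.1, (h2 _).2.2.2.1, (h2 _).2.2.2.2]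
    fun_prop
  · simp only [Expo.lin, (h3 _).1, (h3 _).2.1, (h3 _).2.2.1, (h3 _).2.2.2.1, (h3 _).2.2.2.2]
    fun_prop

theorem Pr_geo_zero (t x : ℂ) : Pr (geo 0 t) x = 1 := by simp [Pr, geo]

section Exchange

variable (hP : P.Admissible) (l : ℕ)
include hP

/-- The contractions and zero mode factors with `Φ` do not depend on the term of `F`, so the common
factor is `thetaNu_div_mul` at `α = l / 2`. For `E` and `Ψ*` the same holds with `r*` and `α = -l /
2`. -/
theorem exchange_F_Phi : P.Exchange P.F (P.PhiTop l)
    fun x => -(P.theta (x + l / 2) / P.theta (x - l / 2)) := by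
  have hr : (P.r : ℂ) ≠ 0 := by exact_mod_cast hP.r_pos.ne'
  have hrs : (P.rs : ℂ) ≠ 0 := by exact_mod_cast hP.rs_pos.ne'
  have hz₁ : ∀ ε u v, P.zpair (P.xF ε u) (P.xPhi l v) = (l / P.r - 1) * P.lnz u :=
    fun ε u v => (P.zpair_currents hP.k_ne_neg_two hr hrs ε l u v).1.1
  have hz₂ : ∀ ε u v, P.zpair (P.xPhi l v) (P.xF ε u) = (l / P.r - 1) * P.lnz v :=
    fun ε u v => (P.zpair_currents hP.k_ne_neg_two hr hrs ε l u v).1.2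
  have hl := P.differentiable_lnz
  refine exchange_of_contr (ι := Bool) (norm_z_lt_one hP.q_lt_one hP.r_pos)
    (fun u s t => by rw [P.F_eq, Fintype.sum_bool, add_comm]) (P.PhiTop_eq l) P.xF_cre P.xF_ann
    (P.xPhi_cre l) (P.xPhi_ann l) (differentiable_pref hP.q_lt_one)
    (fun ε u => (P.dq_eq hP.k_ne_neg_two ε l u).1) (fun ε t => (differentiable_lin ε t).1)
    (contr_F_Phi hP l) (contr_Phi_F hP l) (fun ε v => ?_) (fun ε v => ?_) fun ε v => ?_
  · simp only [hz₁]; fun_prop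
  · simp only [hz₂]; fun_prop
  filter_upwards [eventually_pz_ne_zero hP.q_lt_one hP.r_pos (l / 2) (0) v] with u ⟨h1, h2, h3, h4, h5⟩
  have key := thetaNu_div_mul hP.q_lt_one hP.r_pos (l / 2) h1 h2 h3 h4 h5
  simp only [hz₁, hz₂, zero_mul, sub_zero, mul_one, Pr_geo_z]
  rw [theta, theta]
  -- The zero modes of the two orders differ by `(z / w) ^ (l / r - 1)`, which is the prefactor
  -- produced by the theta functions.
  have e : Complex.exp ((l / P.r - 1) * P.lnz u) = Complex.exp ((l / P.r - 1) * P.lnz v) *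
      (P.qpow (4 * (u - v + (0)) * (l / 2) / P.r) * P.z (-(u - v + 0))) := by
    simp only [z, qpow, ← Complex.exp_add]
    congr 1
    simp only [lnz, sg, cond]
    field_simp
    ring
  rw [e,
    show (P.r : ℂ) - l / 2 + (v - u) = P.r - l / 2 - (u - v + 0) by ring,
    show (l : ℂ) / 2 + (v - u) = l / 2 - (u - v + 0) by ring,
    show u - v + l / 2 = u - v + 0 + l / 2 by ring,
    show u - v - l / 2 = u - v + 0 - l / 2 by ring,
    show (P.r : ℂ) - l / 2 + (u - v) = P.r - l / 2 + (u - v + 0) by ring,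
    show (l : ℂ) / 2 + (u - v) = l / 2 + (u - v + 0) by ring]
  linear_combination Complex.exp ((l / P.r - 1) * P.lnz v) * key


theorem exchange_E_Psi : P.Exchange P.E (P.PsiTop l)
    fun x => -(P.thetaS (x - l / 2) / P.thetaS (x + l / 2)) := by
  have hr : (P.r : ℂ) ≠ 0 := by exact_mod_cast hP.r_pos.ne'
  have hrs : (P.rs : ℂ) ≠ 0 := by exact_mod_cast hP.rs_pos.ne'
  have hz₁ : ∀ ε u v, P.zpair (P.xE ε u) (P.xPsi l v) = -(l / P.rs + 1) * P.lnz u :=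
    fun ε u v => (P.zpair_currents hP.k_ne_neg_two hr hrs ε l u v).2.2.2.1.1
  have hz₂ : ∀ ε u v, P.zpair (P.xPsi l v) (P.xE ε u) = -(l / P.rs + 1) * P.lnz v :=
    fun ε u v => (P.zpair_currents hP.k_ne_neg_two hr hrs ε l u v).2.2.2.1.2
  have hl := P.differentiable_lnz
  refine exchange_of_contr (ι := Bool) (norm_z_lt_one hP.q_lt_one hP.rs_pos)
    (fun u s t => by rw [P.E_eq, Fintype.sum_bool, add_comm]) (P.PsiTop_eq l) P.xE_cre P.xE_ann
    (P.xPsi_cre l) (P.xPsi_ann l) (differentiable_pref hP.q_lt_one)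
    (fun ε u => (P.dq_eq hP.k_ne_neg_two ε l u).2.1) (fun ε t => (differentiable_lin ε t).2.1)
    (contr_E_Psi hP l) (contr_Psi_E hP l) (fun ε v => ?_) (fun ε v => ?_) fun ε v => ?_
  · simp only [hz₁]; fun_prop
  · simp only [hz₂]; fun_prop
  filter_upwards [eventually_pz_ne_zero hP.q_lt_one hP.rs_pos (-(l / 2)) (0) v] with u ⟨h1, h2, h3, h4, h5⟩
  have key := thetaNu_div_mul hP.q_lt_one hP.rs_pos (-(l / 2)) h1 h2 h3 h4 h5
  simp only [hz₁, hz₂, zero_mul, sub_zero, mul_one, Pr_geo_z]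
  rw [thetaS, thetaS]
  have e : Complex.exp (-(l / P.rs + 1) * P.lnz u) = Complex.exp (-(l / P.rs + 1) * P.lnz v) *
      (P.qpow (4 * (u - v + (0)) * (-(l / 2)) / P.rs) * P.z (-(u - v + 0))) := by
    simp only [z, qpow, ← Complex.exp_add]
    congr 1
    simp only [lnz, sg, cond]
    field_simp
    ring
  rw [e,
    show (P.rs : ℂ) + l / 2 + (v - u) = P.rs - -(l / 2) - (u - v + 0) by ring,
    show -((l : ℂ) / 2) + (v - u) = -(l / 2) - (u - v + 0) by ring,
    show u - v - l / 2 = u - v + 0 + -(l / 2) by ring,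
    show u - v + l / 2 = u - v + 0 - -(l / 2) by ring,
    show (P.rs : ℂ) + l / 2 + (u - v) = P.rs - -(l / 2) + (u - v + 0) by ring,
    show -((l : ℂ) / 2) + (u - v) = -(l / 2) + (u - v + 0) by ring]
  linear_combination Complex.exp (-(l / P.rs + 1) * P.lnz v) * key


/-- For each term of `E`, contraction and zero modes combine to the linear form `q ^ (-(k - l)) z -
w` or `q ^ (k - l) z - w`, and the opposite order gives its negative. -/
theorem exchange_E_Phi : P.Exchange P.E (P.PhiTop l)
    fun x => -1 := by
  have hr : (P.r : ℂ) ≠ 0 := by exact_mod_cast hP.r_pos.ne'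
  have hrs : (P.rs : ℂ) ≠ 0 := by exact_mod_cast hP.rs_pos.ne'
  have hz₁ : ∀ ε u v, P.zpair (P.xE ε u) (P.xPhi l v) = P.lnz u - sg ε * (P.k - l) * P.logq :=
    fun ε u v => (P.zpair_currents hP.k_ne_neg_two hr hrs ε l u v).2.1.1
  have hz₂ : ∀ ε u v, P.zpair (P.xPhi l v) (P.xE ε u) = P.lnz v :=
    fun ε u v => (P.zpair_currents hP.k_ne_neg_two hr hrs ε l u v).2.1.2
  have hl := P.differentiable_lnz
  refine exchange_of_contr (ι := Bool) (norm_z_lt_one hP.q_lt_one hP.r_pos)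
    (fun u s t => by rw [P.E_eq, Fintype.sum_bool, add_comm]) (P.PhiTop_eq l) P.xE_cre P.xE_ann
    (P.xPhi_cre l) (P.xPhi_ann l) (differentiable_pref hP.q_lt_one)
    (fun ε u => (P.dq_eq hP.k_ne_neg_two ε l u).2.1) (fun ε t => (differentiable_lin ε t).2.1)
    (contr_E_Phi hP l) (contr_Phi_E hP l) (fun ε v => ?_) (fun ε v => ?_) fun ε v => ?_
  · simp only [hz₁]; fun_prop
  · simp only [hz₂]; fun_prop
  refine Eventually.of_forall fun u => ?_
  simp only [hz₁, hz₂, Pr_geo_zero, one_mul, div_one, ← z_add]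
  have e : ∀ w, Complex.exp (P.lnz w) = P.z w := fun w => rfl
  have e' : Complex.exp (P.lnz u - sg ε * (P.k - l) * P.logq) =
      P.z (u - sg ε * (P.k - l) / 2) := by
    simp only [z, qpow, lnz]; congr 1; ring
  rw [e, e']
  cases ε
  all_goals
    simp only [sg, cond, mul_one_sub, ← z_add]
    ring_nf

theorem exchange_F_Psi : P.Exchange P.F (P.PsiTop l)
    fun x => -1 := by
  have hr : (P.r : ℂ) ≠ 0 := by exact_mod_cast hP.r_pos.ne'
  have hrs : (P.rs : ℂ) ≠ 0 := by exact_mod_cast hP.rs_pos.ne'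
  have hz₁ : ∀ ε u v, P.zpair (P.xF ε u) (P.xPsi l v) = P.lnz u - sg ε * (P.k - l) * P.logq :=
    fun ε u v => (P.zpair_currents hP.k_ne_neg_two hr hrs ε l u v).2.2.2.2.1.1
  have hz₂ : ∀ ε u v, P.zpair (P.xPsi l v) (P.xF ε u) = P.lnz v :=
    fun ε u v => (P.zpair_currents hP.k_ne_neg_two hr hrs ε l u v).2.2.2.2.1.2
  have hl := P.differentiable_lnz
  refine exchange_of_contr (ι := Bool) (norm_z_lt_one hP.q_lt_one hP.rs_pos)
    (fun u s t => by rw [P.F_eq, Fintype.sum_bool, add_comm]) (P.PsiTop_eq l) P.xF_cre P.xF_ann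
    (P.xPsi_cre l) (P.xPsi_ann l) (differentiable_pref hP.q_lt_one)
    (fun ε u => (P.dq_eq hP.k_ne_neg_two ε l u).1) (fun ε t => (differentiable_lin ε t).1)
    (contr_F_Psi hP l) (contr_Psi_F hP l) (fun ε v => ?_) (fun ε v => ?_) fun ε v => ?_
  · simp only [hz₁]; fun_prop
  · simp only [hz₂]; fun_prop
  refine Eventually.of_forall fun u => ?_
  simp only [hz₁, hz₂, Pr_geo_zero, one_mul, div_one, ← z_add]
  have e : ∀ w, Complex.exp (P.lnz w) = P.z w := fun w => rfl
  have e' : Complex.exp (P.lnz u - sg ε * (P.k - l) * P.logq) =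
      P.z (u - sg ε * (P.k - l) / 2) := by
    simp only [z, qpow, lnz]; congr 1; ring
  rw [e, e']
  cases ε
  all_goals
    simp only [sg, cond, mul_one_sub, ← z_add]
    ring_nf

theorem exchange_Hplus_Phi : P.Exchange P.Hplus (P.PhiTop l)
    fun x => P.theta (x + l / 2 - P.k / 4) / P.theta (x - l / 2 - P.k / 4) := by
  have hr : (P.r : ℂ) ≠ 0 := by exact_mod_cast hP.r_pos.ne'
  have hrs : (P.rs : ℂ) ≠ 0 := by exact_mod_cast hP.rs_pos.ne'
  have hz₁ : ∀ u v, P.zpair (P.xH false u) (P.xPhi l v) = l * P.lnz u / P.r + sg false * (l - l * P.k / (2 * P.r)) * P.logq :=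
    fun u v => (P.zpair_currents hP.k_ne_neg_two hr hrs false l u v).2.2.1.1
  have hz₂ : ∀ u v, P.zpair (P.xPhi l v) (P.xH false u) = l / P.r * P.lnz v :=
    fun u v => (P.zpair_currents hP.k_ne_neg_two hr hrs false l u v).2.2.1.2
  have hl := P.differentiable_lnz
  refine exchange_of_contr (ι := Unit) (k := fun _ _ => 1) (norm_z_lt_one hP.q_lt_one hP.r_pos)
    (fun u s t => by rw [P.Hplus_eq, Fintype.sum_unique, one_mul]) (P.PhiTop_eq l)
    (fun _ => P.xH_cre false) (fun _ => P.xH_ann false) (P.xPhi_cre l) (P.xPhi_ann l)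
    (fun _ => differentiable_const _) (fun _ u => (P.dq_eq hP.k_ne_neg_two false l u).2.2.1)
    (fun _ t => (differentiable_lin false t).2.2) (fun _ => contr_Hplus_Phi hP l)
    (fun _ => contr_Phi_Hplus hP l) (fun _ v => ?_) (fun _ v => ?_) fun _ v => ?_
  · simp only [hz₁]; fun_prop
  · simp only [hz₂]; fun_prop
  filter_upwards [eventually_pz_ne_zero hP.q_lt_one hP.r_pos (l / 2) (-(P.k / 4)) v] with u ⟨h1, h2, h3, h4, h5⟩
  have key := thetaNu_div_mul_left hP.q_lt_one hP.r_pos (l / 2) h1 h2 h3 h4 h5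
  simp only [hz₁, hz₂, zero_mul, sub_zero, mul_one, Pr_geo_z]
  rw [theta, theta]
  have e : Complex.exp (l * P.lnz u / P.r + sg false * (l - l * P.k / (2 * P.r)) * P.logq) = Complex.exp (l / P.r * P.lnz v) *
      (P.qpow (4 * (u - v + (-(P.k / 4))) * (l / 2) / P.r) * P.z (l / 2)) := by
    simp only [z, qpow, ← Complex.exp_add]
    congr 1
    simp only [lnz, sg, cond]
    field_simp
    ring
  rw [e,
    show (P.k / 4 - l / 2 + (v - u) : ℂ) = -(l / 2) - (u - v + -(P.k / 4)) by ring,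
    show (P.k / 4 + l / 2 + (v - u) : ℂ) = l / 2 - (u - v + -(P.k / 4)) by ring,
    show (P.r - P.k / 4 - l / 2 + (u - v) : ℂ) = P.r - l / 2 + (u - v + -(P.k / 4)) by ring,
    show (P.r - P.k / 4 + l / 2 + (u - v) : ℂ) = P.r + l / 2 + (u - v + -(P.k / 4)) by ring,
    show u - v + l / 2 - P.k / 4 = (u - v + -(P.k / 4)) + l / 2 by ring,
    show u - v - l / 2 - P.k / 4 = (u - v + -(P.k / 4)) - l / 2 by ring]
  linear_combination -Complex.exp (l / P.r * P.lnz v) * key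


theorem exchange_Hminus_Phi : P.Exchange P.Hminus (P.PhiTop l)
    fun x => P.theta (x + l / 2 + P.k / 4) / P.theta (x - l / 2 + P.k / 4) := by
  have hr : (P.r : ℂ) ≠ 0 := by exact_mod_cast hP.r_pos.ne'
  have hrs : (P.rs : ℂ) ≠ 0 := by exact_mod_cast hP.rs_pos.ne'
  have hz₁ : ∀ u v, P.zpair (P.xH true u) (P.xPhi l v) = l * P.lnz u / P.r + sg true * (l - l * P.k / (2 * P.r)) * P.logq :=
    fun u v => (P.zpair_currents hP.k_ne_neg_two hr hrs true l u v).2.2.1.1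
  have hz₂ : ∀ u v, P.zpair (P.xPhi l v) (P.xH true u) = l / P.r * P.lnz v :=
    fun u v => (P.zpair_currents hP.k_ne_neg_two hr hrs true l u v).2.2.1.2
  have hl := P.differentiable_lnz
  refine exchange_of_contr (ι := Unit) (k := fun _ _ => 1) (norm_z_lt_one hP.q_lt_one hP.r_pos)
    (fun u s t => by rw [P.Hminus_eq, Fintype.sum_unique, one_mul]) (P.PhiTop_eq l)
    (fun _ => P.xH_cre true) (fun _ => P.xH_ann true) (P.xPhi_cre l) (P.xPhi_ann l)
    (fun _ => differentiable_const _) (fun _ u => (P.dq_eq hP.k_ne_neg_two true l u).2.2.1)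
    (fun _ t => (differentiable_lin true t).2.2) (fun _ => contr_Hminus_Phi hP l)
    (fun _ => contr_Phi_Hminus hP l) (fun _ v => ?_) (fun _ v => ?_) fun _ v => ?_
  · simp only [hz₁]; fun_prop
  · simp only [hz₂]; fun_prop
  filter_upwards [eventually_pz_ne_zero hP.q_lt_one hP.r_pos (l / 2) (P.k / 4) v] with u ⟨h1, h2, h3, h4, h5⟩
  have key := thetaNu_div_mul_right hP.q_lt_one hP.r_pos (l / 2) h1 h2 h3 h4 h5
  simp only [hz₁, hz₂, zero_mul, sub_zero, mul_one, Pr_geo_z]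
  rw [theta, theta]
  have e : Complex.exp (l * P.lnz u / P.r + sg true * (l - l * P.k / (2 * P.r)) * P.logq) = Complex.exp (l / P.r * P.lnz v) *
      (P.qpow (4 * (u - v + (P.k / 4)) * (l / 2) / P.r) * P.z (-(l / 2))) := by
    simp only [z, qpow, ← Complex.exp_add]
    congr 1
    simp only [lnz, sg, cond]
    field_simp
    ring
  rw [e,
    show (P.r - P.k / 4 - l / 2 + (v - u) : ℂ) = P.r - l / 2 - (u - v + P.k / 4) by ring,
    show (P.r - P.k / 4 + l / 2 + (v - u) : ℂ) = P.r + l / 2 - (u - v + P.k / 4) by ring,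
    show (P.k / 4 - l / 2 + (u - v) : ℂ) = -(l / 2) + (u - v + P.k / 4) by ring,
    show (P.k / 4 + l / 2 + (u - v) : ℂ) = l / 2 + (u - v + P.k / 4) by ring,
    show u - v + l / 2 + P.k / 4 = (u - v + P.k / 4) + l / 2 by ring,
    show u - v - l / 2 + P.k / 4 = (u - v + P.k / 4) - l / 2 by ring]
  linear_combination -Complex.exp (l / P.r * P.lnz v) * key


theorem exchange_Hplus_Psi : P.Exchange P.Hplus (P.PsiTop l)
    fun x => P.thetaS (x - l / 2 + P.k / 4) / P.thetaS (x + l / 2 + P.k / 4) := by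
  have hr : (P.r : ℂ) ≠ 0 := by exact_mod_cast hP.r_pos.ne'
  have hrs : (P.rs : ℂ) ≠ 0 := by exact_mod_cast hP.rs_pos.ne'
  have hz₁ : ∀ u v, P.zpair (P.xH false u) (P.xPsi l v) = -(l * P.lnz u / P.rs) - sg false * (l + l * P.k / (2 * P.rs)) * P.logq :=
    fun u v => (P.zpair_currents hP.k_ne_neg_two hr hrs false l u v).2.2.2.2.2.1
  have hz₂ : ∀ u v, P.zpair (P.xPsi l v) (P.xH false u) = -(l / P.rs) * P.lnz v :=
    fun u v => (P.zpair_currents hP.k_ne_neg_two hr hrs false l u v).2.2.2.2.2.2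
  have hl := P.differentiable_lnz
  refine exchange_of_contr (ι := Unit) (k := fun _ _ => 1) (norm_z_lt_one hP.q_lt_one hP.rs_pos)
    (fun u s t => by rw [P.Hplus_eq, Fintype.sum_unique, one_mul]) (P.PsiTop_eq l)
    (fun _ => P.xH_cre false) (fun _ => P.xH_ann false) (P.xPsi_cre l) (P.xPsi_ann l)
    (fun _ => differentiable_const _) (fun _ u => (P.dq_eq hP.k_ne_neg_two false l u).2.2.1)
    (fun _ t => (differentiable_lin false t).2.2) (fun _ => contr_Hplus_Psi hP l)
    (fun _ => contr_Psi_Hplus hP l) (fun _ v => ?_) (fun _ v => ?_) fun _ v => ?_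
  · simp only [hz₁]; fun_prop
  · simp only [hz₂]; fun_prop
  filter_upwards [eventually_pz_ne_zero hP.q_lt_one hP.rs_pos (-(l / 2)) (P.k / 4) v] with u ⟨h1, h2, h3, h4, h5⟩
  have key := thetaNu_div_mul_left hP.q_lt_one hP.rs_pos (-(l / 2)) h1 h2 h3 h4 h5
  simp only [hz₁, hz₂, zero_mul, sub_zero, mul_one, Pr_geo_z]
  rw [thetaS, thetaS]
  have e : Complex.exp (-(l * P.lnz u / P.rs) - sg false * (l + l * P.k / (2 * P.rs)) * P.logq) = Complex.exp (-(l / P.rs) * P.lnz v) *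
      (P.qpow (4 * (u - v + (P.k / 4)) * (-(l / 2)) / P.rs) * P.z (-(l / 2))) := by
    simp only [z, qpow, ← Complex.exp_add]
    congr 1
    simp only [lnz, sg, cond]
    field_simp
    ring
  rw [e,
    show (-(P.k / 4) + l / 2 + (v - u) : ℂ) = -(-(l / 2)) - (u - v + P.k / 4) by ring,
    show (-(P.k / 4) - l / 2 + (v - u) : ℂ) = -(l / 2) - (u - v + P.k / 4) by ring,
    show (P.rs + P.k / 4 + l / 2 + (u - v) : ℂ) = P.rs - -(l / 2) + (u - v + P.k / 4) by ring,
    show (P.rs + P.k / 4 - l / 2 + (u - v) : ℂ) = P.rs + -(l / 2) + (u - v + P.k / 4) by ring,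
    show u - v - l / 2 + P.k / 4 = (u - v + P.k / 4) + -(l / 2) by ring,
    show u - v + l / 2 + P.k / 4 = (u - v + P.k / 4) - -(l / 2) by ring]
  linear_combination -Complex.exp (-(l / P.rs) * P.lnz v) * key


theorem exchange_Hminus_Psi : P.Exchange P.Hminus (P.PsiTop l)
    fun x => P.thetaS (x - l / 2 - P.k / 4) / P.thetaS (x + l / 2 - P.k / 4) := by
  have hr : (P.r : ℂ) ≠ 0 := by exact_mod_cast hP.r_pos.ne'
  have hrs : (P.rs : ℂ) ≠ 0 := by exact_mod_cast hP.rs_pos.ne'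
  have hz₁ : ∀ u v, P.zpair (P.xH true u) (P.xPsi l v) = -(l * P.lnz u / P.rs) - sg true * (l + l * P.k / (2 * P.rs)) * P.logq :=
    fun u v => (P.zpair_currents hP.k_ne_neg_two hr hrs true l u v).2.2.2.2.2.1
  have hz₂ : ∀ u v, P.zpair (P.xPsi l v) (P.xH true u) = -(l / P.rs) * P.lnz v :=
    fun u v => (P.zpair_currents hP.k_ne_neg_two hr hrs true l u v).2.2.2.2.2.2
  have hl := P.differentiable_lnz
  refine exchange_of_contr (ι := Unit) (k := fun _ _ => 1) (norm_z_lt_one hP.q_lt_one hP.rs_pos)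
    (fun u s t => by rw [P.Hminus_eq, Fintype.sum_unique, one_mul]) (P.PsiTop_eq l)
    (fun _ => P.xH_cre true) (fun _ => P.xH_ann true) (P.xPsi_cre l) (P.xPsi_ann l)
    (fun _ => differentiable_const _) (fun _ u => (P.dq_eq hP.k_ne_neg_two true l u).2.2.1)
    (fun _ t => (differentiable_lin true t).2.2) (fun _ => contr_Hminus_Psi hP l)
    (fun _ => contr_Psi_Hminus hP l) (fun _ v => ?_) (fun _ v => ?_) fun _ v => ?_
  · simp only [hz₁]; fun_prop
  · simp only [hz₂]; fun_prop
  filter_upwards [eventually_pz_ne_zero hP.q_lt_one hP.rs_pos (-(l / 2)) (-(P.k / 4)) v] with u ⟨h1, h2, h3, h4, h5⟩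
  have key := thetaNu_div_mul_right hP.q_lt_one hP.rs_pos (-(l / 2)) h1 h2 h3 h4 h5
  simp only [hz₁, hz₂, zero_mul, sub_zero, mul_one, Pr_geo_z]
  rw [thetaS, thetaS]
  have e : Complex.exp (-(l * P.lnz u / P.rs) - sg true * (l + l * P.k / (2 * P.rs)) * P.logq) = Complex.exp (-(l / P.rs) * P.lnz v) *
      (P.qpow (4 * (u - v + (-(P.k / 4))) * (-(l / 2)) / P.rs) * P.z (-(-(l / 2)))) := by
    simp only [z, qpow, ← Complex.exp_add]
    congr 1
    simp only [lnz, sg, cond]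
    field_simp
    ring
  rw [e,
    show (P.rs + P.k / 4 + l / 2 + (v - u) : ℂ) = P.rs - -(l / 2) - (u - v + -(P.k / 4)) by ring,
    show (P.rs + P.k / 4 - l / 2 + (v - u) : ℂ) = P.rs + -(l / 2) - (u - v + -(P.k / 4)) by ring,
    show (-(P.k / 4) + l / 2 + (u - v) : ℂ) = -(-(l / 2)) + (u - v + -(P.k / 4)) by ring,
    show (-(P.k / 4) - l / 2 + (u - v) : ℂ) = -(l / 2) + (u - v + -(P.k / 4)) by ring,
    show u - v - l / 2 - P.k / 4 = (u - v + -(P.k / 4)) + -(l / 2) by ring,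
    show u - v + l / 2 - P.k / 4 = (u - v + -(P.k / 4)) - -(l / 2) by ring]
  linear_combination -Complex.exp (-(l / P.rs) * P.lnz v) * key


end Exchange

end Params
end EllipticVO
end

/-! ### Products of several currents with a vertex operator -/

open Filter Topology
noncomputable section
namespace EllipticVO

/-- Matrix elements of normal ordered exponentials or of their transposes, as functions of the
coefficients of the two exponentials. -/
structure WickKernel (M : (Mode → ℂ) → (Mode → ℂ) → Occ → Occ → ℂ) : Prop where
  mul : ∀ {x y β β' : Mode → ℂ}, (Summable fun i => ‖β i * y i‖) → ∀ s t,
    HasSum (fun d => M x β s d * M y β' d t)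
      (Complex.exp (∑' i, β i * y i) * M (x + y) (β + β') s t)
  norm_le : ∀ {x β : Mode → ℂ} {x' β' : Mode → ℝ}, (∀ i, ‖x i‖ ≤ x' i) → (∀ i, ‖β i‖ ≤ β' i) →
    ∀ s t, ‖M x β s t‖ ≤ ‖M (fun i => (x' i : ℂ)) (fun i => (β' i : ℂ)) s t‖
  smooth : ∀ {E : Type} [NormedAddCommGroup E] [NormedSpace ℂ E] {x β : E → Mode → ℂ},
    (∀ i, ContDiff ℂ 1 fun Y => x Y i) → (∀ i, ContDiff ℂ 1 fun Y => β Y i) →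
    ∀ s t, ContDiff ℂ 1 fun Y => M (x Y) (β Y) s t

theorem wickKernel_mel : WickKernel mel := ⟨hasSum_mel_mul, norm_mel_le, contDiff_mel⟩

/-- Transposition interchanges creation and annihilation coefficients and reverses products. It
allows a current that acts from the right to be treated as one that acts from the left. -/
theorem wickKernel_mel_transpose : WickKernel fun x β s t => mel β x t s where
  mul {x y β β'} h s t := by
    have h' : Summable fun i => ‖y i * β i‖ := by simpa only [mul_comm] using h
    refine hasSum_of_eq (hasSum_mel_mul (x := β') (β' := x) h' t s) (fun d => mul_comm _ _) ?_
    rw [add_comm x, add_comm β]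
    simp only [mul_comm]
  norm_le hx hβ s t := norm_mel_le hβ hx t s
  smooth hx hβ s t := contDiff_mel hβ hx t s

namespace Params

variable (P : Params)

/-- Creation coefficients of an operator at `u`. -/
def up (X : Mode → ℂ) (u : ℂ) : Mode → ℂ := fun i => X i * P.z u ^ (i.2 : ℕ)

/-- Annihilation coefficients of an operator at `u`. -/
def dn (b : Mode → ℂ) (u : ℂ) : Mode → ℂ := fun i => b i * (P.z u ^ (i.2 : ℕ))⁻¹

theorem up_add_per {P : Params} (hq : P.logq.re < 0) (X : Mode → ℂ) (u : ℂ) :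
    P.up X (u + P.per) = P.up X u := by
  funext i; simp only [up, z_add_per hq]

theorem dn_add_per {P : Params} (hq : P.logq.re < 0) (X : Mode → ℂ) (u : ℂ) :
    P.dn X (u + P.per) = P.dn X u := by
  funext i; simp only [dn, z_add_per hq]

end Params

/-- The data of a current, which is a sum of two exponentials, and a vertex operator, in terms of
the coefficients of the creation and annihilation operators, the scalar factors of the current on
a sequence of sectors, and the contractions. -/
structure CurrentData (P : Params) where
  ν : ℝ
  X : Bool → Mode → ℂ
  b : Bool → Mode → ℂ
  X₀ : Mode → ℂ
  b₀ : Mode → ℂ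
  A : ℕ → Bool → ℂ → ℂ
  A₀ : ℂ
  χ : ℕ → ℂ
  v : ℂ
  M : (Mode → ℂ) → (Mode → ℂ) → Occ → Occ → ℂ
  t : Occ
  α : ℂ
  ω : ℂ
  y₀ : Bool → ℂ
  y : Bool → Bool → ℂ
  e : Bool → Bool → ℂ
  hq : P.logq.re < 0
  hν : 0 < ν
  tame_X : ∀ ε x, Tame fun n => X ε (x, n)
  tame_b : ∀ ε x, Tame fun n => b ε (x, n)
  tame_X₀ : ∀ x, Tame fun n => X₀ (x, n)
  tame_b₀ : ∀ x, Tame fun n => b₀ (x, n)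
  smooth_A : ∀ n ε, ContDiff ℂ 1 (A n ε)
  per_A : ∀ n ε u, A n ε (u + P.per) = χ n * A n ε u
  kernel : WickKernel M
  contr₀ : ∀ ε, Contr (P.z ν) (b ε) X₀ (P.z α) (y₀ ε) 0
  contr : ∀ ε ε', Contr (P.z ν) (b ε) (X ε') (P.z ω) (y ε ε') (e ε ε')

namespace CurrentData

variable {P : Params} (D : CurrentData P)

/-- The current. -/
def F (n : ℕ) (u : ℂ) (s x : Occ) : ℂ :=
  ∑ ε, D.A n ε u * D.M (P.up (D.X ε) u) (P.dn (D.b ε) u) s x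

/-- The numerator of the contraction of the current and the vertex operator. -/
def num₀ (ε : Bool) (x : ℂ) : ℂ := Pr (geo (D.y₀ ε) (P.z D.ν)) (P.z x)

/-- The numerator of the contraction of two currents. -/
def num (ε ε' : Bool) (x : ℂ) : ℂ :=
  Pr (geo (D.y ε ε') (P.z D.ν)) (P.z x) * (1 - D.e ε ε' * P.z x)

/-- The scalar factor in the product of `n` currents and the vertex operator. -/
def coef : ∀ n : ℕ, (Fin n → Bool) → (Fin n → ℂ) → ℂ
  | 0, _, _ => D.A₀
  | n + 1, ε, Y => coef n (fun b => ε b.castSucc) (fun b => Y b.castSucc) *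
      (D.A n (ε (Fin.last n)) (Y (Fin.last n)) *
        D.num₀ (ε (Fin.last n)) (D.v - Y (Fin.last n)) *
        ∏ b : Fin n, D.num (ε (Fin.last n)) (ε b.castSucc) (Y b.castSucc - Y (Fin.last n)))

/-- The creation coefficients of the product. -/
def xs (n : ℕ) (ε : Fin n → Bool) (Y : Fin n → ℂ) : Mode → ℂ :=
  P.up D.X₀ D.v + ∑ b, P.up (D.X (ε b)) (Y b)

/-- The annihilation coefficients of the product. -/
def bs (n : ℕ) (ε : Fin n → Bool) (Y : Fin n → ℂ) : Mode → ℂ :=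
  P.dn D.b₀ D.v + ∑ b, P.dn (D.b (ε b)) (Y b)

/-- The product of `n` currents and the vertex operator, without denominators. -/
def N (n : ℕ) (s : Occ) (Y : Fin n → ℂ) : ℂ :=
  ∑ ε : Fin n → Bool, D.coef n ε Y * D.M (D.xs n ε Y) (D.bs n ε Y) s D.t

theorem norm_p : ‖P.z D.ν‖ < 1 := Params.norm_z_lt_one D.hq D.hν

theorem contDiff_num₀ (ε : Bool) : ContDiff ℂ 1 (D.num₀ ε) :=
  (contDiff_Pr (summable_geo _ D.norm_p)).comp P.contDiff_z

theorem contDiff_num (ε ε' : Bool) : ContDiff ℂ 1 (D.num ε ε') :=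
  ((contDiff_Pr (summable_geo _ D.norm_p)).comp P.contDiff_z).mul
    (contDiff_const.sub (contDiff_const.mul P.contDiff_z))

theorem contDiff_coef (n : ℕ) (ε : Fin n → Bool) : ContDiff ℂ 1 (D.coef n ε) := by
  induction n with
  | zero => exact contDiff_const
  | succ n ih =>
    have hY : ∀ b : Fin (n + 1), ContDiff ℂ 1 fun Y : Fin (n + 1) → ℂ => Y b :=
      fun b => contDiff_apply ℂ ℂ b
    change ContDiff ℂ 1 fun Y => D.coef (n + 1) ε Y
    simp only [coef]
    refine ((ih _).comp (contDiff_pi.2 fun b => hY _)).mul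
      ((((D.smooth_A _ _).comp (hY _)).mul
        ((D.contDiff_num₀ _).comp (contDiff_const.sub (hY _)))).mul
        (contDiff_prod fun b _ => (D.contDiff_num _ _).comp ((hY _).sub (hY _))))

theorem contDiff_up (X : Mode → ℂ) (i : Mode) : ContDiff ℂ 1 fun u => P.up X u i :=
  contDiff_const.mul (P.contDiff_z.pow _)

theorem contDiff_dn (X : Mode → ℂ) (i : Mode) : ContDiff ℂ 1 fun u => P.dn X u i :=
  contDiff_const.mul ((P.contDiff_z.pow _).inv fun u => pow_ne_zero _ (P.z_ne_zero u))

theorem contDiff_N (n : ℕ) (s : Occ) : ContDiff ℂ 1 (D.N n s) := by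
  have hY : ∀ b : Fin n, ContDiff ℂ 1 fun Y : Fin n → ℂ => Y b := fun b => contDiff_apply ℂ ℂ b
  refine ContDiff.sum fun ε _ => (D.contDiff_coef n ε).mul (D.kernel.smooth (fun i => ?_)
    (fun i => ?_) _ _)
  · simp only [xs, Pi.add_apply, Finset.sum_apply]
    exact contDiff_const.add (ContDiff.sum fun b _ => (contDiff_up _ i).comp (hY b))
  · simp only [bs, Pi.add_apply, Finset.sum_apply]
    exact contDiff_const.add (ContDiff.sum fun b _ => (contDiff_dn _ i).comp (hY b))

theorem num_add_per (ε ε' : Bool) (x : ℂ) : D.num ε ε' (x + P.per) = D.num ε ε' x := by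
  simp only [num, Params.z_add_per D.hq]

theorem num_sub_per (ε ε' : Bool) (x : ℂ) : D.num ε ε' (x - P.per) = D.num ε ε' x := by
  rw [← D.num_add_per, sub_add_cancel]

theorem num₀_sub_per (ε : Bool) (x : ℂ) : D.num₀ ε (x - P.per) = D.num₀ ε x := by
  rw [num₀, num₀, ← Params.z_add_per D.hq (x - P.per), sub_add_cancel]

/-- The contractions are functions of `z` and hence periodic; only the scalar factor `A` of the
shifted current changes. -/
theorem coef_update (n : ℕ) (ε : Fin n → Bool) (c : Fin n) (Y : Fin n → ℂ) :
    D.coef n ε (Function.update Y c (Y c + P.per)) = D.χ c * D.coef n ε Y := by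
  induction n with
  | zero => exact c.elim0
  | succ n ih =>
    unfold coef
    refine Fin.lastCases ?_ (fun c => ?_) c
    · have h : ∀ b : Fin n, Function.update Y (Fin.last n) (Y (Fin.last n) + P.per) b.castSucc =
          Y b.castSucc := fun b => Function.update_of_ne (Fin.castSucc_lt_last b).ne _ _
      simp only [h, Function.update_self, D.per_A, ← sub_sub, D.num₀_sub_per, D.num_sub_per,
        Fin.val_last]
      ring
    · have hl : Function.update Y c.castSucc (Y c.castSucc + P.per) (Fin.last n) = Y (Fin.last n) :=
        Function.update_of_ne (Fin.castSucc_lt_last c).ne' _ _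
      have hi : (fun b : Fin n => Function.update Y c.castSucc (Y c.castSucc + P.per) b.castSucc) =
          Function.update (fun b : Fin n => Y b.castSucc) c (Y c.castSucc + P.per) := by
        funext b
        by_cases hb : b = c
        · subst hb; simp
        · rw [Function.update_of_ne hb, Function.update_of_ne fun h => hb (Fin.castSucc_injective _ h)]
      have hp : ∀ b : Fin n, D.num (ε (Fin.last n)) (ε b.castSucc)
          (Function.update Y c.castSucc (Y c.castSucc + P.per) b.castSucc - Y (Fin.last n)) =
          D.num (ε (Fin.last n)) (ε b.castSucc) (Y b.castSucc - Y (Fin.last n)) := by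
        intro b
        rw [congrFun hi b]
        by_cases hb : b = c
        · subst hb
          rw [Function.update_self, add_sub_right_comm, D.num_add_per]
        · rw [Function.update_of_ne hb]
      simp only [hl, hp, hi]
      have := ih (fun b => ε b.castSucc) c (fun b => Y b.castSucc)
      rw [this, Fin.val_castSucc]
      ring

theorem sum_update {n : ℕ} {f : Fin n → ℂ → Mode → ℂ} (hf : ∀ b u, f b (u + P.per) = f b u)
    (c : Fin n) (Y : Fin n → ℂ) :
    ∑ b, f b (Function.update Y c (Y c + P.per) b) = ∑ b, f b (Y b) := by
  refine Finset.sum_congr rfl fun b _ => ?_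
  by_cases hb : b = c
  · subst hb; rw [Function.update_self, hf]
  · rw [Function.update_of_ne hb]

theorem N_update (n : ℕ) (s : Occ) (c : Fin n) (Y : Fin n → ℂ) :
    D.N n s (Function.update Y c (Y c + P.per)) = D.χ c * D.N n s Y := by
  unfold N
  rw [Finset.mul_sum]
  refine Finset.sum_congr rfl fun ε _ => ?_
  rw [coef_update, xs, bs, sum_update (f := fun b => P.up (D.X (ε b)))
    (fun b u => Params.up_add_per D.hq _ u), sum_update (f := fun b => P.dn (D.b (ε b)))
    (fun b u => Params.dn_add_per D.hq _ u), mul_assoc]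
  rfl

theorem norm_up_le {X : Mode → ℂ} {C ρ r : ℝ} (hC : 0 ≤ C) (hρ : 0 ≤ ρ)
    (h : ∀ i, ‖X i‖ ≤ C * ρ ^ (i.2 : ℕ)) {u : ℂ} (hu : ‖P.z u‖ ≤ r) (i : Mode) :
    ‖P.up X u i‖ ≤ C * (ρ * r) ^ (i.2 : ℕ) := by
  rw [Params.up, norm_mul, norm_pow, mul_pow, ← mul_assoc]
  exact mul_le_mul (h i) (pow_le_pow_left₀ (norm_nonneg _) hu _) (by positivity) (by positivity)

theorem norm_dn_le {X : Mode → ℂ} {C ρ r : ℝ} (hC : 0 ≤ C) (hρ : 0 ≤ ρ)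
    (h : ∀ i, ‖X i‖ ≤ C * ρ ^ (i.2 : ℕ)) {u : ℂ} (hu : ‖P.z (-u)‖ ≤ r) (i : Mode) :
    ‖P.dn X u i‖ ≤ C * (ρ * r) ^ (i.2 : ℕ) := by
  have : P.dn X u = P.up X (-u) := by
    funext i; rw [Params.dn, Params.up, Params.z_neg, inv_pow]
  rw [this]
  exact norm_up_le hC hρ h hu i

theorem norm_z_le {ρ : ℝ} {u : ℂ} (hu : ‖u‖ ≤ ρ) : ‖P.z u‖ ≤ Real.exp (2 * ‖P.logq‖ * ρ) := by
  rw [P.norm_z, Real.exp_le_exp]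
  have := (le_abs_self _).trans (P.abs_lev_le u)
  exact this.trans (by gcongr)

/-- For bounded `Y` all coefficients have a common geometric majorant, so `WickKernel.norm_le`
bounds all matrix elements by fixed ones. -/
theorem exists_data_bound (n : ℕ) (ρ : ℝ) : ∃ C r : ℝ, 0 ≤ C ∧ 0 ≤ r ∧ ∀ (ε : Fin n → Bool) Y,
    ‖Y‖ ≤ ρ → ∀ i : Mode, ‖D.xs n ε Y i‖ ≤ C * r ^ (i.2 : ℕ) ∧ ‖D.bs n ε Y i‖ ≤ C * r ^ (i.2 : ℕ) := by
  obtain ⟨C₁, r₁, hC₁, hr₁, h₁⟩ := Tame.uniform (f := fun i => P.up D.X₀ D.v i) fun x => by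
    obtain ⟨C, r, hC, hr, h⟩ := D.tame_X₀ x
    exact ⟨C, r * ‖P.z D.v‖, hC, by positivity, fun n => by
      simp only [Params.up]
      rw [norm_mul, norm_pow, mul_pow, ← mul_assoc]
      exact mul_le_mul_of_nonneg_right (h n) (by positivity)⟩
  obtain ⟨C₂, r₂, hC₂, hr₂, h₂⟩ := Tame.uniform (f := fun i => P.dn D.b₀ D.v i) fun x => by
    obtain ⟨C, r, hC, hr, h⟩ := D.tame_b₀ x
    exact ⟨C, r * ‖(P.z D.v)⁻¹‖, hC, by positivity, fun n => by
      simp only [Params.dn]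
      rw [norm_mul, ← inv_pow, norm_pow, mul_pow, ← mul_assoc]
      exact mul_le_mul_of_nonneg_right (h n) (by positivity)⟩
  choose C₃ r₃ hC₃ hr₃ h₃ using fun ε => Tame.uniform (D.tame_X ε)
  choose C₄ r₄ hC₄ hr₄ h₄ using fun ε => Tame.uniform (D.tame_b ε)
  set ζ := Real.exp (2 * ‖P.logq‖ * ρ) with hζ
  have hζ0 : 0 < ζ := Real.exp_pos _
  set C := C₃ true + C₃ false + C₄ true + C₄ false
  set r := r₃ true + r₃ false + r₄ true + r₄ false
  have e1 := hC₃ true; have e2 := hC₃ false; have e3 := hC₄ true; have e4 := hC₄ false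
  have f1 := hr₃ true; have f2 := hr₃ false; have f3 := hr₄ true; have f4 := hr₄ false
  have hC : 0 ≤ C := by positivity
  have hr : 0 ≤ r := by positivity
  have hle : ∀ {c a : ℝ} (m : ℕ), 0 ≤ c → 0 ≤ a → c ≤ C → a ≤ r → c * a ^ m ≤ C * r ^ m :=
    fun m h0 h1 h2 h3 => mul_le_mul h2 (pow_le_pow_left₀ h1 h3 m) (by positivity) hC
  have k₃ : ∀ ε i, ‖D.X ε i‖ ≤ C * r ^ (i.2 : ℕ) := fun ε i => (h₃ ε i).trans
    (hle _ (hC₃ ε) (hr₃ ε) (by cases ε <;> simp only [C] <;> linarith)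
      (by cases ε <;> simp only [r] <;> linarith))
  have k₄ : ∀ ε i, ‖D.b ε i‖ ≤ C * r ^ (i.2 : ℕ) := fun ε i => (h₄ ε i).trans
    (hle _ (hC₄ ε) (hr₄ ε) (by cases ε <;> simp only [C] <;> linarith)
      (by cases ε <;> simp only [r] <;> linarith))
  have add : ∀ {c a : ℝ} {w : ℂ} {f : Fin n → ℂ} (m : ℕ), 0 ≤ c → 0 ≤ a → c ≤ C₁ + C₂ → a ≤ r₁ + r₂ →
      ‖w‖ ≤ c * a ^ m → (∀ b, ‖f b‖ ≤ C * (r * ζ) ^ m) →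
      ‖w + ∑ b, f b‖ ≤ (C₁ + C₂ + n * C) * (r₁ + r₂ + r * ζ) ^ m := by
    intro c a w f m hc0 ha0 hc ha hw hf
    have s1 : ‖∑ b, f b‖ ≤ n * (C * (r * ζ) ^ m) := by
      refine (norm_sum_le _ _).trans ((Finset.sum_le_sum fun b _ => hf b).trans ?_)
      simp
    have s2 : c * a ^ m ≤ (C₁ + C₂) * (r₁ + r₂ + r * ζ) ^ m := by
      have : 0 ≤ r * ζ := by positivity
      exact mul_le_mul hc (pow_le_pow_left₀ ha0 (by linarith) m) (by positivity) (by positivity)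
    have s3 : n * (C * (r * ζ) ^ m) ≤ n * C * (r₁ + r₂ + r * ζ) ^ m := by
      rw [mul_assoc]
      gcongr
      linarith
    refine (norm_add_le _ _).trans ?_
    rw [add_mul]
    linarith
  refine ⟨C₁ + C₂ + n * C, r₁ + r₂ + r * ζ, by positivity, by positivity, fun ε Y hY i => ⟨?_, ?_⟩⟩
  · simp only [xs, Pi.add_apply, Finset.sum_apply]
    exact add _ hC₁ hr₁ (by linarith) (by linarith) (h₁ i) fun b =>
      norm_up_le hC hr (k₃ _) (norm_z_le ((norm_le_pi_norm Y b).trans hY)) i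
  · simp only [bs, Pi.add_apply, Finset.sum_apply]
    exact add _ hC₂ hr₂ (by linarith) (by linarith) (h₂ i) fun b =>
      norm_dn_le hC hr (k₄ _) (norm_z_le ((norm_neg (Y b)).le.trans ((norm_le_pi_norm Y b).trans hY))) i

end CurrentData
end EllipticVO
end

open Filter Topology
noncomputable section
namespace EllipticVO
namespace CurrentData

variable {P : Params} (D : CurrentData P)

theorem norm_F_le {C c r rb T R : ℝ} (hC : 0 ≤ C) (hr : 0 ≤ r) (hrb : 0 ≤ rb)
    (hX : ∀ ε i, ‖D.X ε i‖ ≤ C * r ^ (i.2 : ℕ)) (hb : ∀ ε i, ‖D.b ε i‖ ≤ C * rb ^ (i.2 : ℕ)) {n : ℕ}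
    {u : ℂ} (hA : ∀ ε, ‖D.A n ε u‖ ≤ c) (hu : ‖u‖ ≤ T) (hR : R ≤ P.lev u) (s x : Occ) :
    ‖D.F n u s x‖ ≤ 2 * (c * ‖D.M
      (fun i => ((C * (r * Real.exp (2 * ‖P.logq‖ * T)) ^ (i.2 : ℕ) : ℝ) : ℂ))
      (fun i => ((C * (rb * Real.exp (-R)) ^ (i.2 : ℕ) : ℝ) : ℂ)) s x‖) := by
  have hc : 0 ≤ c := (norm_nonneg _).trans (hA true)
  have key : ∀ ε, ‖D.A n ε u * D.M (P.up (D.X ε) u) (P.dn (D.b ε) u) s x‖ ≤ c * ‖D.M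
      (fun i => ((C * (r * Real.exp (2 * ‖P.logq‖ * T)) ^ (i.2 : ℕ) : ℝ) : ℂ))
      (fun i => ((C * (rb * Real.exp (-R)) ^ (i.2 : ℕ) : ℝ) : ℂ)) s x‖ := fun ε => by
    rw [norm_mul]
    refine mul_le_mul (hA ε) (D.kernel.norm_le (fun i => norm_up_le hC hr (hX ε) (norm_z_le hu) i)
      (fun i => norm_dn_le hC hrb (hb ε) ?_ i) s x) (norm_nonneg _) hc
    rw [P.norm_z, Real.exp_le_exp, ← zero_sub, P.lev_sub, show P.lev 0 = 0 by simp [Params.lev]]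
    linarith
  rw [F, Fintype.sum_bool, two_mul]
  exact (norm_add_le _ _).trans (add_le_add (key _) (key _))

/-- Matrix elements are dominated by those with nonnegative coefficients, and Wick's theorem for
these majorants gives the summability over intermediate states as soon as their contraction
converges. -/
theorem exists_bound (n : ℕ) (s : Occ) (ρ : ℝ) : ∃ R, ∀ T : ℝ, ∃ B W : Occ → ℝ,
    (Summable fun x => W x * B x) ∧ (∀ x Y, ‖Y‖ ≤ ρ → ‖D.N n x Y‖ ≤ B x) ∧
    ∀ x u, R ≤ P.lev u → ‖u‖ ≤ T → ‖D.F n u s x‖ ≤ W x := by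
  obtain ⟨C, r, hC, hr, hdata⟩ := D.exists_data_bound n ρ
  choose C₃ r₃ hC₃ hr₃ h₃ using fun ε => Tame.uniform (D.tame_X ε)
  choose C₄ r₄ hC₄ hr₄ h₄ using fun ε => Tame.uniform (D.tame_b ε)
  have k : ∀ {C r : Bool → ℝ} {f : Bool → Mode → ℂ}, (∀ ε, 0 ≤ C ε) → (∀ ε, 0 ≤ r ε) →
      (∀ ε i, ‖f ε i‖ ≤ C ε * r ε ^ (i.2 : ℕ)) → ∀ c, C true + C false ≤ c → ∀ ε i,
      ‖f ε i‖ ≤ c * (r true + r false) ^ (i.2 : ℕ) := by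
    intro C r f hC hr h c hc ε i
    have e1 := hC true; have e2 := hC false
    have f1 := hr true; have f2 := hr false
    refine (h ε i).trans (mul_le_mul ?_ (pow_le_pow_left₀ (hr ε) ?_ _) (pow_nonneg (hr ε) _) ?_)
    · cases ε <;> linarith
    · cases ε <;> linarith
    · linarith
  set c := C₃ true + C₃ false + (C₄ true + C₄ false) with hc
  have e1 := hC₃ true; have e2 := hC₃ false; have e3 := hC₄ true; have e4 := hC₄ false
  have hc0 : 0 ≤ c := by positivity
  have hX := k hC₃ hr₃ h₃ c (by linarith)
  have hb := k hC₄ hr₄ h₄ c (by linarith)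
  set rx := r₃ true + r₃ false
  set rb := r₄ true + r₄ false
  have hrx : 0 ≤ rx := add_nonneg (hr₃ _) (hr₃ _)
  have hrb : 0 ≤ rb := add_nonneg (hr₄ _) (hr₄ _)
  have hK : ∀ ε : Fin n → Bool, ∃ K : ℝ, ∀ Y, ‖Y‖ ≤ ρ → ‖D.coef n ε Y‖ ≤ K := fun ε => by
    obtain ⟨K, hK⟩ := (isCompact_closedBall (0 : Fin n → ℂ) ρ).exists_bound_of_continuousOn
      (D.contDiff_coef n ε).continuous.continuousOn
    exact ⟨K, fun Y hY => hK Y (by simpa using hY)⟩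
  choose K hK using hK
  -- Beyond this level `rb * exp (-R) * r < 1`, which is the convergence of the contraction of the
  -- majorants.
  refine ⟨Real.log (2 * (rb * r + 1)), fun T => ?_⟩
  set R := Real.log (2 * (rb * r + 1))
  have hpos : 0 < rb * r + 1 := by positivity
  have hexp : Real.exp (-R) = (2 * (rb * r + 1))⁻¹ := by
    rw [Real.exp_neg, Real.exp_log (by positivity)]
  have hA : ∀ ε, ∃ a : ℝ, ∀ u, ‖u‖ ≤ T → ‖D.A n ε u‖ ≤ a := fun ε => by
    obtain ⟨a, ha⟩ := (isCompact_closedBall (0 : ℂ) T).exists_bound_of_continuousOn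
      (D.smooth_A n ε).continuous.continuousOn
    exact ⟨a, fun u hu => ha u (by simpa using hu)⟩
  choose a ha using hA
  set x₁ : Mode → ℝ := fun i => c * (rx * Real.exp (2 * ‖P.logq‖ * T)) ^ (i.2 : ℕ)
  set b₁ : Mode → ℝ := fun i => c * (rb * Real.exp (-R)) ^ (i.2 : ℕ)
  set x₂ : Mode → ℝ := fun i => C * r ^ (i.2 : ℕ)
  have hsum : Summable fun i : Mode => ‖(b₁ i : ℂ) * (x₂ i : ℂ)‖ := by
    have hlt : rb * Real.exp (-R) * r < 1 := by
      rw [hexp, mul_right_comm, ← div_eq_mul_inv, div_lt_one (by positivity)]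
      linarith [mul_nonneg hrb hr]
    refine (summable_geometric_mode (C := c * C) (ρ := rb * Real.exp (-R) * r) (by positivity)
      hlt).congr fun i => ?_
    rw [← Complex.ofReal_mul, Complex.norm_real, Real.norm_of_nonneg (by positivity)]
    simp only [b₁, x₂, mul_pow]
    ring
  have hM := (D.kernel.mul (x := fun i => (x₁ i : ℂ)) (β := fun i => (b₁ i : ℂ))
    (y := fun i => (x₂ i : ℂ)) (β' := fun i => (x₂ i : ℂ)) hsum s D.t).summable.norm
  refine ⟨fun x => (∑ ε, |K ε|) * ‖D.M (fun i => (x₂ i : ℂ)) (fun i => (x₂ i : ℂ)) x D.t‖,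
    fun x => 2 * (max (a true) (a false) *
      ‖D.M (fun i => (x₁ i : ℂ)) (fun i => (b₁ i : ℂ)) s x‖), ?_, fun x Y hY => ?_, fun x u hR hu => ?_⟩
  · refine (hM.mul_left (2 * max (a true) (a false) * ∑ ε, |K ε|)).congr fun x => ?_
    rw [norm_mul]
    ring
  · simp only [N, Finset.sum_mul]
    refine (norm_sum_le _ _).trans (Finset.sum_le_sum fun ε _ => ?_)
    rw [norm_mul]
    exact mul_le_mul ((hK ε Y hY).trans (le_abs_self _)) (D.kernel.norm_le
      (fun i => (hdata ε Y hY i).1) (fun i => (hdata ε Y hY i).2) _ _) (norm_nonneg _) (abs_nonneg _)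
  · exact D.norm_F_le hc0 hrx hrb hX hb (fun ε => (ha ε u hu).trans (by
      cases ε
      · exact le_max_right _ _
      · exact le_max_left _ _)) hu hR s x

/-- The exponent is additive in the creation coefficients, so the contraction of a current with a
product is the product of the contractions. -/
theorem exists_contraction (n : ℕ) (ρ : ℝ) : ∃ R, ∀ (ε : Bool) (ε' : Fin n → Bool) Y u,
    ‖Y‖ ≤ ρ → R ≤ P.lev u →
      (Summable fun i => ‖P.dn (D.b ε) u i * D.xs n ε' Y i‖) ∧
      Complex.exp (∑' i, P.dn (D.b ε) u i * D.xs n ε' Y i) =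
        (D.num₀ ε (D.v - u) * ∏ b, D.num ε (ε' b) (Y b - u)) /
          (Pr (geo (P.z D.α) (P.z D.ν)) (P.z (D.v - u)) *
            ∏ b, Pr (geo (P.z D.ω) (P.z D.ν)) (P.z (Y b - u))) := by
  choose r₀ hr₀ h₀ using D.contr₀
  choose r hr h using D.contr
  have hmin : ∃ m : ℝ, 0 < m ∧ (∀ ε, m ≤ r₀ ε) ∧ ∀ ε ε', m ≤ r ε ε' := by
    refine ⟨min (min (r₀ true) (r₀ false)) (min (min (r true true) (r true false))
      (min (r false true) (r false false))), by simp [hr, hr₀], ?_, ?_⟩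
    · rintro (_ | _) <;> simp
    · rintro (_ | _) (_ | _) <;> simp
  obtain ⟨m, hm, hm₀, hm₁⟩ := hmin
  refine ⟨2 * ‖P.logq‖ * max ρ ‖D.v‖ - Real.log m, fun ε ε' Y u hY hu => ?_⟩
  have hz : ∀ w, ‖w‖ ≤ max ρ ‖D.v‖ → ‖P.z (w - u)‖ ≤ m := fun w hw => by
    rw [P.norm_z, P.lev_sub, ← Real.exp_log hm, Real.exp_le_exp]
    have h1 := (le_abs_self _).trans (P.abs_lev_le w)
    have h2 : 2 * ‖P.logq‖ * ‖w‖ ≤ 2 * ‖P.logq‖ * max ρ ‖D.v‖ := by gcongr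
    linarith
  have hmul : ∀ (b X : Mode → ℂ) w i, P.dn b u i * P.up X w i =
      b i * X i * P.z (w - u) ^ (i.2 : ℕ) := fun b X w i => by
    have := P.z_ne_zero u
    rw [Params.dn, Params.up, P.z_sub, div_pow]
    field_simp
  obtain ⟨s0, -, c0⟩ := h₀ ε (P.z (D.v - u)) ((hz _ (le_max_right _ _)).trans (hm₀ ε))
  have hb := fun b => h ε (ε' b) (P.z (Y b - u))
    ((hz _ ((norm_le_pi_norm Y b).trans (hY.trans (le_max_left _ _)))).trans (hm₁ _ _))
  have split : ∀ i, P.dn (D.b ε) u i * D.xs n ε' Y i =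
      D.b ε i * D.X₀ i * P.z (D.v - u) ^ (i.2 : ℕ) +
        ∑ b, D.b ε i * D.X (ε' b) i * P.z (Y b - u) ^ (i.2 : ℕ) := fun i => by
    simp only [xs, Pi.add_apply, Finset.sum_apply, mul_add, Finset.mul_sum, hmul]
  have sb : ∀ b, Summable fun i : Mode => D.b ε i * D.X (ε' b) i * P.z (Y b - u) ^ (i.2 : ℕ) :=
    fun b => (hb b).1.of_norm
  simp only [split]
  refine ⟨?_, ?_⟩
  · refine Summable.norm (s0.of_norm.add (summable_sum fun b _ => sb b))
  · rw [s0.of_norm.tsum_add (summable_sum fun b _ => sb b), Summable.tsum_finsetSum fun b _ => sb b,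
      Complex.exp_add, Complex.exp_sum, c0, Finset.prod_congr rfl fun b _ => (hb b).2.2,
      Finset.prod_div_distrib, div_mul_div_comm]
    simp only [num₀, num, zero_mul, sub_zero, mul_one]

/-- Wick's theorem for every choice of one exponential from each current. Appending the choice for
the new current identifies the pairs of choices with those for `n + 1` currents, and the
denominators are independent of the choice. -/
theorem hasSum_F_mul_N (n : ℕ) (s : Occ) (ρ : ℝ) : ∃ R, ∀ Y u, ‖Y‖ ≤ ρ → R ≤ P.lev u →
    HasSum (fun x => D.F n u s x * D.N n x Y)
      (D.N (n + 1) s (Fin.snoc (α := fun _ => ℂ) Y u) /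
        (Pr (geo (P.z D.α) (P.z D.ν)) (P.z (D.v - u)) *
          ∏ b, Pr (geo (P.z D.ω) (P.z D.ν)) (P.z (Y b - u)))) := by
  obtain ⟨R, hR⟩ := D.exists_contraction n ρ
  refine ⟨R, fun Y u hY hu => ?_⟩
  have key : ∀ q : Bool × (Fin n → Bool), HasSum (fun x =>
      D.A n q.1 u * D.M (P.up (D.X q.1) u) (P.dn (D.b q.1) u) s x *
        (D.coef n q.2 Y * D.M (D.xs n q.2 Y) (D.bs n q.2 Y) x D.t)) _ := fun q =>
    hasSum_of_eq ((D.kernel.mul (hR q.1 q.2 Y u hY hu).1 s D.t).mul_left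
      (D.A n q.1 u * D.coef n q.2 Y)) (fun x => by ring) rfl
  refine hasSum_of_eq (hasSum_sum (s := Finset.univ) fun q _ => key q) (fun x => ?_) ?_
  · rw [F, N, Finset.sum_mul_sum, ← Finset.sum_product']
    rfl
  · rw [N, Finset.sum_div]
    refine (Fintype.sum_equiv (Fin.snocEquiv fun _ => Bool) _ _ fun q => ?_).symm
    rw [(hR q.1 q.2 Y u hY hu).2]
    have hx : D.xs (n + 1) (Fin.snocEquiv (fun _ => Bool) q) (Fin.snoc (α := fun _ => ℂ) Y u) =
        P.up (D.X q.1) u + D.xs n q.2 Y := by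
      simp only [xs, Fin.sum_univ_castSucc, Fin.snocEquiv_apply, Fin.snoc_castSucc, Fin.snoc_last]
      abel
    have hb : D.bs (n + 1) (Fin.snocEquiv (fun _ => Bool) q) (Fin.snoc (α := fun _ => ℂ) Y u) =
        P.dn (D.b q.1) u + D.bs n q.2 Y := by
      simp only [bs, Fin.sum_univ_castSucc, Fin.snocEquiv_apply, Fin.snoc_castSucc, Fin.snoc_last]
      abel
    rw [hx, hb, coef]
    simp only [Fin.snocEquiv_apply, Fin.snoc_castSucc, Fin.snoc_last]
    ring

theorem fam : Fam P D.F D.χ (geo (P.z D.ω) (P.z D.ν)) D.v 0 (geo (P.z D.α) (P.z D.ν)) D.N where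
  summable := summable_geo _ D.norm_p
  smooth := D.contDiff_N
  periodic n s c Y := by rw [zero_add]; exact D.N_update n s c Y
  bound n s ρ := by simpa only [zero_add] using D.exists_bound n s ρ
  rel n s ρ := by simpa only [zero_add] using D.hasSum_F_mul_N n s ρ

theorem continuous_F (n : ℕ) (s x : Occ) : Continuous fun u => D.F n u s x := by
  unfold F
  exact continuous_finsetSum _ fun ε _ => (D.smooth_A n ε).continuous.mul
    (D.kernel.smooth (fun i => contDiff_up _ i) (fun i => contDiff_dn _ i) s x).continuous

end CurrentData
end EllipticVO
end

/-! ### The theta kernels of the half currents -/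

open Filter Topology
noncomputable section
namespace EllipticVO
namespace Params

variable {P : Params} {ν : ℝ} (hq : P.logq.re < 0) (hν : 0 < ν)
include hq hν

/-- With `y = u₀ - u` this sorts the zeros of the theta function: the first product on the right
vanishes at `z = p^{n+1} z₀`, inside of the contour, the second at `z = p^{-n} z₀`, outside of it.
-/
theorem pz_mul_pz (y : ℂ) : P.pz ν y * P.pz ν (ν - y) =
    -(P.z y * (Pr (geo (P.z ν) (P.z ν)) (P.z y) * Pr (geo 1 (P.z ν)) (P.z (-y)))) := by
  have h1 := pz_succ hq hν y
  have h2 := pz_succ hq hν (-y)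
  have h3 : P.z y * P.z (-y) = 1 := by rw [← z_add, add_neg_cancel, z_zero]
  rw [Pr_geo_z, show Pr (geo 1 (P.z ν)) (P.z (-y)) = P.pz ν (-y) from rfl, h1, h2, ← sub_eq_add_neg]
  linear_combination (-P.pz ν (ν + y) * P.pz ν (ν - y)) * h3

theorem contDiff_thetaNu : ContDiff ℂ 1 (P.thetaNu ν) := by
  have h : P.thetaNu ν = fun x => P.qpow (x ^ 2 / ν - x) * (P.pz ν x * P.pz ν (ν - x)) /
      poch (P.z ν) (P.z ν) ^ 2 := funext fun x => thetaNu_eq hq hν x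
  have hp : ContDiff ℂ 1 (P.pz ν) := (differentiable_pz hq hν).contDiff
  rw [h]
  unfold qpow
  exact (((((contDiff_id.pow 2).div_const _).sub contDiff_id).mul contDiff_const).cexp.mul
    (hp.mul (hp.comp (contDiff_const.sub contDiff_id)))).div_const _

theorem pz_sub_per (y : ℂ) : P.pz ν (y - P.per) = P.pz ν y := by
  rw [pz, pz, ← z_add_per hq (y - P.per), sub_add_cancel]

theorem pz_add_per (y : ℂ) : P.pz ν (y + P.per) = P.pz ν y := by
  rw [pz, pz, z_add_per hq]

theorem thetaNu_sub_per (y : ℂ) : P.thetaNu ν (y - P.per) =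
    P.qpow ((P.per ^ 2 - 2 * y * P.per) / ν + P.per) * P.thetaNu ν y := by
  rw [thetaNu_eq hq hν, thetaNu_eq hq hν, pz_sub_per hq hν,
    show (ν : ℂ) - (y - P.per) = ν - y + P.per by ring, pz_add_per hq hν,
    show (y - P.per) ^ 2 / ν - (y - P.per) =
      (P.per ^ 2 - 2 * y * P.per) / ν + P.per + (y ^ 2 / ν - y) by ring, qpow_add]
  ring

theorem thetaNu_neg (y : ℂ) : P.thetaNu ν (-y) = -P.thetaNu ν y := by
  have h1 := pz_succ hq hν y
  have h2 := pz_succ hq hν (-y)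
  have h3 : P.z y * P.z (-y) = 1 := by rw [← z_add, add_neg_cancel, z_zero]
  have h4 : P.qpow ((-y) ^ 2 / ν - -y) = P.z y * P.qpow (y ^ 2 / ν - y) := by
    rw [z, ← qpow_add]; congr 1; ring
  rw [thetaNu_eq hq hν, thetaNu_eq hq hν, h4, h1, h2, sub_neg_eq_add, ← sub_eq_add_neg]
  linear_combination (-P.qpow (y ^ 2 / ν - y) * P.pz ν (ν + y) * P.pz ν (ν - y) /
    poch (P.z ν) (P.z ν) ^ 2) * h3

theorem thetaNu_add (y : ℂ) : P.thetaNu ν (y + ν) = -P.thetaNu ν y := by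
  have h0 : (ν : ℂ) ≠ 0 := by exact_mod_cast hν.ne'
  have h1 := pz_succ hq hν y
  have h2 := pz_succ hq hν (-y)
  have h3 : P.z y * P.z (-y) = 1 := by rw [← z_add, add_neg_cancel, z_zero]
  have h4 : P.qpow ((y + ν) ^ 2 / ν - (y + ν)) = P.z y * P.qpow (y ^ 2 / ν - y) := by
    rw [z, ← qpow_add]
    congr 1
    field_simp
    ring
  rw [thetaNu_eq hq hν, thetaNu_eq hq hν, h4, h1, show (ν : ℂ) - (y + ν) = -y by ring, h2,
    ← sub_eq_add_neg, add_comm y]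
  linear_combination (-P.qpow (y ^ 2 / ν - y) * P.pz ν (ν + y) * P.pz ν (ν - y) /
    poch (P.z ν) (P.z ν) ^ 2) * h3

/-- The equation `q^{2m} = p^n` with `n ≥ 1` makes `m` a zero of the theta function, and for `n = 0`
it contradicts `|q^{2m}| < 1`. -/
theorem z_neg_mul_pow_ne_one {m : ℕ} (hm : 1 ≤ m) (h : P.thetaNu ν m ≠ 0) (n : ℕ) :
    P.z (-m) * P.z ν ^ n ≠ 1 := by
  intro h1
  rcases n with _ | n
  · rw [pow_zero, mul_one, z_neg, inv_eq_one] at h1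
    have := norm_z_lt_one (P := P) hq (ν := m) (by exact_mod_cast hm)
    rw [Complex.ofReal_natCast, h1, norm_one] at this
    exact lt_irrefl _ this
  · refine h ?_
    rw [thetaNu_eq hq hν, show P.pz ν (ν - m) = 0 from Pr_eq_zero n ?_, mul_zero, mul_zero, zero_div]
    rw [geo, one_mul, sub_eq_add_neg, z_add]
    linear_combination h1

theorem z_mul_pow_ne_one {m : ℕ} (hm : 1 ≤ m) (n : ℕ) : P.z m * P.z ν ^ n ≠ 1 := by
  intro h
  have h1 := norm_z_lt_one (P := P) hq (ν := m) (by exact_mod_cast hm)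
  have h2 := norm_z_lt_one (P := P) hq hν
  rw [Complex.ofReal_natCast] at h1
  have h3 := congrArg norm h
  rw [norm_mul, norm_pow, norm_one] at h3
  have h4 := pow_le_one₀ (n := n) (norm_nonneg _) h2.le
  nlinarith [norm_nonneg (P.z m)]

/-- The contour integral kernels of the half currents. -/
def kernelNum (P : Params) (ν : ℝ) (K a u u₀ : ℂ) : ℂ :=
  -(K * poch (P.z ν) (P.z ν) ^ 2 * P.thetaNu ν (u₀ - u + a) *
    P.qpow (-((u₀ - u) ^ 2 / ν - (u₀ - u))) * P.z (-(u₀ - u)))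

theorem kernelNum_div (K a u u₀ : ℂ) :
    P.kernelNum ν K a u u₀ /
      (Pr (geo (P.z ν) (P.z ν)) (P.z (u₀ - u)) * Pr (geo 1 (P.z ν)) (P.z (u - u₀))) =
    K * (P.thetaNu ν (u₀ - u + a) / P.thetaNu ν (u₀ - u)) := by
  have hC := poch_self_ne_zero hq hν
  have hz := P.z_ne_zero (u₀ - u)
  have hQ : P.qpow ((u₀ - u) ^ 2 / ν - (u₀ - u)) ≠ 0 := Complex.exp_ne_zero _
  rw [thetaNu_eq hq hν (u₀ - u), pz_mul_pz hq hν, neg_sub, kernelNum, qpow_neg, z_neg]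
  generalize P.qpow ((u₀ - u) ^ 2 / ν - (u₀ - u)) = Q at *
  generalize Pr (geo (P.z ν) (P.z ν)) (P.z (u₀ - u)) * Pr (geo 1 (P.z ν)) (P.z (u - u₀)) = d
  by_cases hd : d = 0
  · simp [hd]
  · field_simp

theorem contDiff_kernelNum (K a : ℂ) : ContDiff ℂ 1 (Function.uncurry (P.kernelNum ν K a)) := by
  have hs : ContDiff ℂ 1 fun X : ℂ × ℂ => X.2 - X.1 := contDiff_snd.sub contDiff_fst
  change ContDiff ℂ 1 fun X : ℂ × ℂ => P.kernelNum ν K a X.1 X.2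
  unfold kernelNum qpow
  exact ((((contDiff_const.mul ((contDiff_thetaNu hq hν).comp (hs.add contDiff_const))).mul
    (((((hs.pow 2).div_const _).sub hs).neg.mul contDiff_const).cexp)).mul
    (P.contDiff_z.comp hs.neg))).neg

/-- Under a period of `u`, `θ(u₀ - u + a) / θ(u₀ - u)` is multiplied by `exp (-2πi a / ν)`, which
cancels the monodromy of the current on a sector with this `a`. -/
theorem kernelNum_add_per (K a u u₀ : ℂ) :
    Complex.exp (2 * Real.pi * Complex.I * a / ν) * P.kernelNum ν K a (u + P.per) u₀ =
      P.kernelNum ν K a u u₀ := by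
  have h0 : (ν : ℂ) ≠ 0 := by exact_mod_cast hν.ne'
  have hper : Complex.exp (2 * Real.pi * Complex.I * a / ν) = P.qpow (2 * a * P.per / ν) := by
    rw [qpow, per]
    congr 1
    have := logq_ne_zero hq
    field_simp
  have hz : P.z (-(u₀ - (u + P.per))) = P.z (-(u₀ - u)) := by
    rw [show -(u₀ - (u + P.per)) = -(u₀ - u) + P.per by ring, z_add_per hq]
  have e : P.qpow (2 * a * P.per / ν) *
      (P.qpow ((P.per ^ 2 - 2 * (u₀ - u + a) * P.per) / ν + P.per) *
        P.qpow (-((u₀ - (u + P.per)) ^ 2 / ν - (u₀ - (u + P.per))))) =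
      P.qpow (-((u₀ - u) ^ 2 / ν - (u₀ - u))) := by
    rw [← qpow_add, ← qpow_add]
    congr 1
    field_simp
    ring
  rw [kernelNum, kernelNum, hz, hper, show u₀ - (u + P.per) + a = u₀ - u + a - P.per by ring,
    thetaNu_sub_per hq hν, ← e]
  ring

end Params

namespace CurrentData

variable {P : Params} (D : CurrentData P)

theorem N_zero (s : Occ) : D.N 0 s ![] =
    D.A₀ * D.M (P.up D.X₀ D.v) (P.dn D.b₀ D.v) s D.t := by
  simp [N, coef, xs, bs]

/-- The matrix elements of the lower components. -/
theorem exists_components {τ : ℂ} {l : ℕ} {a K : ℕ → ℂ}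
    (hχ : ∀ i, D.χ i = Complex.exp (2 * Real.pi * Complex.I * a i / D.ν))
    (h₁ : ∀ j n : ℕ, j < l → P.z (D.α - τ + j * D.ω) * P.z D.ν ^ n ≠ 1)
    (h₂ : ∀ j n : ℕ, 1 ≤ j → j < l → P.z (j * D.ω) * P.z D.ν ^ (n + 1) ≠ 1) :
    ∃ φ : ℕ → Occ → ℂ, (∀ s, φ 0 s = D.A₀ * D.M (P.up D.X₀ D.v) (P.dn D.b₀ D.v) s D.t) ∧
      ∀ i < l, ∀ s, ∃ G : ℂ → ℂ, MeromorphicOn G Set.univ ∧ AnalyticAt ℂ G (D.v + τ) ∧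
        G (D.v + τ) = φ (i + 1) s ∧
        ∃ R : ℝ, ∀ u₀ c : ℂ, R ≤ P.lev u₀ → ‖P.z D.ν‖ * Real.exp (P.lev u₀ - P.lev c) < 1 →
          Real.exp (P.lev c - P.lev u₀) < 1 →
          HasSum (fun x => perInt P.per c (fun u' => D.F i u' s x *
            (K i * (P.thetaNu D.ν (u₀ - u' + a i) / P.thetaNu D.ν (u₀ - u')))) * φ i x) (G u₀) := by
  have hpole : PoleSet P D.ν D.ω D.α τ 0 (geo (P.z D.α) (P.z D.ν)) := fun k =>
    Or.inl ⟨0, k, le_rfl, by simp [geo]⟩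
  obtain ⟨φ, h0, h⟩ := exists_ladder D.hq D.hν (κ := fun i => P.kernelNum D.ν (K i) (a i)) D.fam
    hpole D.continuous_F (fun i => Params.contDiff_kernelNum D.hq D.hν _ _)
    (fun i u u₀ => by rw [hχ]; exact Params.kernelNum_add_per D.hq D.hν _ _ _ _) h₁ h₂
  refine ⟨φ, fun s => by rw [h0, N_zero], fun i hi s => ?_⟩
  obtain ⟨G, hG1, hG2, hG3, R, hR⟩ := h i hi s
  refine ⟨G, hG1, hG2, hG3, R, fun u₀ c h1 h2 h3 => ?_⟩
  simpa only [mul_div_assoc, Params.kernelNum_div D.hq D.hν] using hR u₀ c h1 h2 h3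

end CurrentData
end EllipticVO
end

/-! ### Sectors, and the data for the two vertex operators -/

open Filter Topology
noncomputable section
namespace EllipticVO

theorem Contr.symm {p : ℂ} {b c : Mode → ℂ} {y' y e : ℂ} (h : Contr p b c y' y e) :
    Contr p c b y' y e := by
  simpa only [Contr, mul_comm (c _)] using h

namespace Params

variable {P : Params}

theorem exp_int_mul_eq {a b : ℂ} {ν : ℝ} {n : ℤ} (h : b = a / ν + n) :
    Complex.exp (2 * Real.pi * Complex.I * b) = Complex.exp (2 * Real.pi * Complex.I * a / ν) := by
  rw [h, show 2 * Real.pi * Complex.I * (a / ν + n) =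
    2 * Real.pi * Complex.I * a / ν + n * (2 * Real.pi * Complex.I) by ring, Complex.exp_add,
    Complex.exp_int_mul_two_pi_mul_I, mul_one]

theorem lnz_add_per (hq : P.logq.re < 0) (u : ℂ) : P.lnz (u + P.per) = P.lnz u + 2 * Real.pi * Complex.I := by
  have := logq_ne_zero hq
  rw [lnz, lnz, per]
  field_simp

theorem pref_add_per (hq : P.logq.re < 0) (ε : Bool) (u : ℂ) :
    P.pref ε (u + P.per) = P.pref ε u := by
  rw [pref, pref, z_add_per hq]

/-- This is the monodromy of `z ^ ((p̂ + h - 1) / r + p_b + p_c)`. For integral `p_b + p_c` only the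
part that the kernel compensates is left. -/
theorem lin_xF_add_per (hq : P.logq.re < 0) (ε : Bool) (u : ℂ) (c : Charge) :
    (P.xF ε (u + P.per)).lin c = (P.xF ε u).lin c +
      2 * Real.pi * Complex.I * ((c .hat + hval c - 1) / P.r + (c .b + c .c)) := by
  obtain ⟨⟨a1, a2, a3, a4, a5⟩, -⟩ := P.zero_modes ε 0 u
  obtain ⟨⟨b1, b2, b3, b4, b5⟩, -⟩ := P.zero_modes ε 0 (u + P.per)
  simp only [Expo.lin, a1, a2, a3, a4, a5, b1, b2, b3, b4, b5, lnz_add_per hq, hval]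
  ring

theorem lin_xE_add_per (hq : P.logq.re < 0) (ε : Bool) (u : ℂ) (c : Charge) :
    (P.xE ε (u + P.per)).lin c = (P.xE ε u).lin c -
      2 * Real.pi * Complex.I * ((c .hat - 1) / P.rs + (c .b + c .c)) := by
  obtain ⟨-, ⟨a1, a2, a3, a4, a5⟩, -⟩ := P.zero_modes ε 0 u
  obtain ⟨-, ⟨b1, b2, b3, b4, b5⟩, -⟩ := P.zero_modes ε 0 (u + P.per)
  simp only [Expo.lin, a1, a2, a3, a4, a5, b1, b2, b3, b4, b5, lnz_add_per hq]
  ring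

/-- The sectors of the components of `Φ_{l,m}`, `i = l - m`. -/
def chargePhi (P : Params) (l : ℕ) (c : Charge) (i : ℕ) : Charge := c + P.dqPhi l + i • dqF

theorem chargePhi_succ (l : ℕ) (c : Charge) (i : ℕ) :
    P.chargePhi l c (i + 1) = P.chargePhi l c i + dqF := by
  rw [chargePhi, chargePhi, succ_nsmul]
  abel

theorem chargePhi_add (l : ℕ) (c : Charge) (i : ℕ) :
    P.chargePhi l c i .b + P.chargePhi l c i .c = c .b + c .c := by
  simp only [chargePhi, Pi.add_apply, Pi.smul_apply]
  simp only [dqPhi, dqF, nsmul_eq_mul]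
  ring

/-- The sectors of the components of `Ψ*_{l,m}`, `i = l - m`. -/
def chargePsi (P : Params) (l : ℕ) (c : Charge) (i : ℕ) : Charge := c - P.dqPsi l - i • dqE

theorem chargePsi_succ (l : ℕ) (c : Charge) (i : ℕ) :
    P.chargePsi l c (i + 1) + dqE = P.chargePsi l c i := by
  rw [chargePsi, chargePsi, succ_nsmul]
  abel

theorem chargePsi_add (l : ℕ) (c : Charge) (i : ℕ) :
    P.chargePsi l c i .b + P.chargePsi l c i .c = c .b + c .c := by
  simp only [chargePsi, Pi.sub_apply, Pi.smul_apply]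
  simp only [dqPsi, dqE, nsmul_eq_mul]
  ring

/-- The half current `F` on the sectors reached from `Φ_{l,l}`. -/
def dataPhi (hP : P.Admissible) (l : ℕ) (v : ℂ) (t : State) {n : ℤ}
    (ht : t.1 .b + t.1 .c = n) : CurrentData P where
  ν := P.r
  X := P.cF
  b ε i := P.comm i * P.aF ε i
  X₀ := P.cPhi l
  b₀ i := P.comm i * P.aPhi l i
  A i ε u := P.pref ε u * Complex.exp ((P.xF ε u).lin (P.chargePhi l t.1 i))
  A₀ := Complex.exp ((P.xPhi l v).lin t.1)
  χ i := Complex.exp (2 * Real.pi * Complex.I *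
    (P.chargePhi l t.1 i .hat + hval (P.chargePhi l t.1 i) - 1) / P.r)
  v := v
  M := mel
  t := t.2
  α := l / 2
  ω := -1
  y₀ _ := P.z (P.r - l / 2)
  y := numF P
  e := facF P
  hq := hP.q_lt_one
  hν := hP.r_pos
  tame_X := tame_cF hP
  tame_b := tame_aF hP
  tame_X₀ := tame_cPhi hP l
  tame_b₀ := tame_aPhi hP l
  smooth_A i ε := ((differentiable_pref hP.q_lt_one ε).mul
    (differentiable_lin ε _).1.cexp).contDiff
  per_A i ε u := by
    rw [pref_add_per hP.q_lt_one, lin_xF_add_per hP.q_lt_one, Complex.exp_add,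
      exp_int_mul_eq (n := n) (by rw [chargePhi_add, ht])]
    ring
  kernel := wickKernel_mel
  contr₀ := contr_F_Phi hP l
  contr := contr_F_F hP

/-- The half current `E` on the sectors reached from `Ψ*_{l,l}`, acting to the left. -/
def dataPsi (hP : P.Admissible) (l : ℕ) (v : ℂ) (s : State) {n : ℤ}
    (hs : s.1 .b + s.1 .c = n) : CurrentData P where
  ν := P.rs
  X ε i := P.comm i * P.aE ε i
  b := P.cE
  X₀ i := P.comm i * P.aPsi l i
  b₀ := P.cPsi l
  -- `E` maps sector `i + 1` to sector `i`, so its transpose leads from `i` to `i + 1`. The argument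
  -- `-y` turns convergence for small `|z|` into convergence at high levels of `y`.
  A i ε y := P.pref ε (-y) * Complex.exp ((P.xE ε (-y)).lin (P.chargePsi l s.1 (i + 1)))
  A₀ := Complex.exp ((P.xPsi l v).lin (P.chargePsi l s.1 0))
  χ i := Complex.exp (2 * Real.pi * Complex.I * (P.chargePsi l s.1 (i + 1) .hat - 1) / P.rs)
  v := -v
  M x β s t := mel β x t s
  t := s.2
  α := -(l / 2)
  ω := 1
  y₀ _ := P.z (P.rs + l / 2)
  y ε ε' := numE P ε' ε
  e ε ε' := facE P ε' ε
  hq := hP.q_lt_one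
  hν := hP.rs_pos
  tame_X := tame_aE hP
  tame_b := tame_cE hP
  tame_X₀ := tame_aPsi hP l
  tame_b₀ := tame_cPsi hP l
  smooth_A i ε := (((differentiable_pref hP.q_lt_one ε).comp differentiable_neg).mul
    ((differentiable_lin ε _).2.1.comp differentiable_neg).cexp).contDiff
  per_A i ε u := by
    have h1 := pref_add_per hP.q_lt_one ε (-(u + P.per))
    have h2 := lin_xE_add_per hP.q_lt_one ε (-(u + P.per)) (P.chargePsi l s.1 (i + 1))
    rw [show -(u + P.per) + P.per = -u by ring] at h1 h2
    rw [← h1, eq_add_of_sub_eq h2.symm, Complex.exp_add,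
      exp_int_mul_eq (n := n) (by rw [chargePsi_add, hs])]
    ring
  kernel := wickKernel_mel_transpose
  contr₀ ε := (contr_Psi_E hP l ε).symm
  contr ε ε' := (contr_E_E hP ε' ε).symm

end Params
end EllipticVO
end

/-! ### Matrix elements between the sectors and construction of the components -/

open Filter Topology
noncomputable section
namespace EllipticVO
namespace Params

variable {P : Params}

theorem F_eq_zero (hk : P.k ≠ -2) {u : ℂ} {s t : State} (h : s.1 ≠ t.1 + dqF) : P.F u s t = 0 := by
  rw [F_eq, vop_of_ne _ (by rwa [(P.dq_eq hk false 0 u).1]),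
    vop_of_ne _ (by rwa [(P.dq_eq hk true 0 u).1]), mul_zero, mul_zero, add_zero]

theorem E_eq_zero (hk : P.k ≠ -2) {u : ℂ} {s t : State} (h : s.1 ≠ t.1 + dqE) : P.E u s t = 0 := by
  rw [E_eq, vop_of_ne _ (by rwa [(P.dq_eq hk false 0 u).2.1]),
    vop_of_ne _ (by rwa [(P.dq_eq hk true 0 u).2.1]), mul_zero, mul_zero, add_zero]

theorem Fplus_eq_zero (hk : P.k ≠ -2) {ϱ : ℂ} {σ : ℝ} {v : ℂ} {s t : State}
    (h : s.1 ≠ t.1 + dqF) : P.Fplus ϱ σ v s t = 0 := by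
  simp [Fplus, F_eq_zero hk h]

theorem Eplus_eq_zero (hk : P.k ≠ -2) {ϱs : ℂ} {σ : ℝ} {v : ℂ} {s t : State}
    (h : s.1 ≠ t.1 + dqE) : P.Eplus ϱs σ v s t = 0 := by
  simp [Eplus, E_eq_zero hk h]

theorem PhiTop_eq_zero (hk : P.k ≠ -2) {l : ℕ} {v : ℂ} {s t : State}
    (h : s.1 ≠ P.chargePhi l t.1 0) : P.PhiTop l v s t = 0 := by
  rw [PhiTop_eq, vop_of_ne]
  rwa [(P.dq_eq hk false l v).2.2.2.1, ← add_zero (t.1 + _), ← zero_nsmul dqF]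

theorem PsiTop_eq_zero (hk : P.k ≠ -2) {l : ℕ} {v : ℂ} {s t : State}
    (h : t.1 ≠ P.chargePsi l s.1 0) : P.PsiTop l v s t = 0 := by
  rw [PsiTop_eq, vop_of_ne]
  rw [(P.dq_eq hk false l v).2.2.2.2]
  rintro h'
  rw [h', chargePsi, zero_nsmul] at h
  simp at h

theorem bt_eq {X : Expo} {a : Mode → ℂ} {u : ℂ}
    (h : X.ann = fun i => a i * (P.z u ^ (i.2 : ℕ))⁻¹) :
    P.bt X = P.dn (fun i => P.comm i * a i) u := by
  funext i
  rw [bt, h, dn, mul_assoc]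

theorem dataPhi_F (hP : P.Admissible) (l : ℕ) (v : ℂ) (t : State) {n : ℤ}
    (ht : t.1 .b + t.1 .c = n) (i : ℕ) (u : ℂ) (s x : Occ) :
    (dataPhi hP l v t ht).F i u s x =
      P.F u (P.chargePhi l t.1 (i + 1), s) (P.chargePhi l t.1 i, x) := by
  have hd : ∀ ε, P.chargePhi l t.1 (i + 1) = P.chargePhi l t.1 i + P.dq (P.xF ε u) := fun ε => by
    rw [chargePhi_succ, (P.dq_eq hP.k_ne_neg_two ε l u).1]
  rw [CurrentData.F, Fintype.sum_bool, add_comm, F_eq, P.vop_of_eq (hd false),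
    P.vop_of_eq (hd true), bt_eq (P.xF_ann false u), bt_eq (P.xF_ann true u), P.xF_cre, P.xF_cre,
    ← mul_assoc, ← mul_assoc]
  rfl

theorem dataPsi_F (hP : P.Admissible) (l : ℕ) (v : ℂ) (s : State) {n : ℤ}
    (hs : s.1 .b + s.1 .c = n) (i : ℕ) (u : ℂ) (x y : Occ) :
    (dataPsi hP l v s hs).F i u x y =
      P.E (-u) (P.chargePsi l s.1 i, y) (P.chargePsi l s.1 (i + 1), x) := by
  have hd : ∀ ε, P.chargePsi l s.1 i = P.chargePsi l s.1 (i + 1) + P.dq (P.xE ε (-u)) := fun ε => by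
    rw [← chargePsi_succ, (P.dq_eq hP.k_ne_neg_two ε l (-u)).2.1]
  have hup : ∀ a : Mode → ℂ, P.dn a (-u) = P.up a u := fun a => by
    funext i; rw [up, dn, z_neg, inv_pow, inv_inv]
  have hdn : ∀ a : Mode → ℂ, P.up a (-u) = P.dn a u := fun a => by
    funext i; rw [up, dn, z_neg, inv_pow]
  have hc : ∀ ε, (P.xE ε (-u)).cre = P.up (P.cE ε) (-u) := fun ε => P.xE_cre ε (-u)
  rw [CurrentData.F, Fintype.sum_bool, add_comm, E_eq, P.vop_of_eq (hd false),
    P.vop_of_eq (hd true), bt_eq (P.xE_ann false (-u)), bt_eq (P.xE_ann true (-u)), hc, hc, hup,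
    hup, hdn, hdn, ← mul_assoc, ← mul_assoc]
  rfl

theorem dataPhi_zero (hP : P.Admissible) (l : ℕ) (v : ℂ) (t : State) (s : Occ) :
    Complex.exp ((P.xPhi l v).lin t.1) *
      mel (P.up (P.cPhi l) v) (P.dn (fun i => P.comm i * P.aPhi l i) v) s t.2 =
    P.PhiTop l v (P.chargePhi l t.1 0, s) t := by
  rw [PhiTop_eq, P.vop_of_eq, bt_eq (P.xPhi_ann l v), P.xPhi_cre]
  · rfl
  · rw [chargePhi, zero_nsmul, add_zero, (P.dq_eq hP.k_ne_neg_two false l v).2.2.2.1]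

theorem dataPsi_zero (hP : P.Admissible) (l : ℕ) (v : ℂ) (s : State) (x : Occ) :
    Complex.exp ((P.xPsi l v).lin (P.chargePsi l s.1 0)) *
      mel (P.dn (P.cPsi l) (-v)) (P.up (fun i => P.comm i * P.aPsi l i) (-v)) s.2 x =
    P.PsiTop l v s (P.chargePsi l s.1 0, x) := by
  have hup : ∀ a : Mode → ℂ, P.up a (-v) = P.dn a v := fun a => by
    funext i; rw [up, dn, z_neg, inv_pow]
  have hdn : ∀ a : Mode → ℂ, P.dn a (-v) = P.up a v := fun a => by
    funext i; rw [up, dn, z_neg, inv_pow, inv_inv]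
  rw [PsiTop_eq, P.vop_of_eq, bt_eq (P.xPsi_ann l v), P.xPsi_cre, hup, hdn]
  · rfl
  · rw [chargePsi, zero_nsmul, sub_zero, (P.dq_eq hP.k_ne_neg_two false l v).2.2.2.2, sub_add_cancel]

/-- The components of `Φ_{l,m}` on the sectors reached from a given basis state. -/
theorem exists_components_Phi (hP : P.Admissible) {l : ℕ}
    (hθ : ∀ n : ℕ, 1 ≤ n → n < l → P.theta n ≠ 0) (ϱ v : ℂ) (t : State)
    (ht : ∃ n : ℤ, t.1 .b + t.1 .c = n) :
    ∃ φ : ℕ → Occ → ℂ, (∀ d, φ 0 d = P.PhiTop l v (P.chargePhi l t.1 0, d) t) ∧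
      ∀ i < l, ∀ d, ∃ G : ℂ → ℂ, MeromorphicOn G Set.univ ∧ AnalyticAt ℂ G (v - l / 2) ∧
        (∃ R : ℝ, ∀ σ : ℝ, 0 < σ → σ < 1 → ∀ v₁ : ℂ, R * ‖P.z v‖ < ‖P.z v₁‖ →
          HasSum (fun x : Occ =>
            P.Fplus ϱ σ v₁ (P.chargePhi l t.1 (i + 1), d) (P.chargePhi l t.1 i, x) *
              (P.theta (P.chargePhi l t.1 i .hat + hval (P.chargePhi l t.1 i) + i) /
                P.theta (P.chargePhi l t.1 i .hat + hval (P.chargePhi l t.1 i))) * φ i x) (G v₁)) ∧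
        φ (i + 1) d = G (v - l / 2) := by
  obtain ⟨n, hn⟩ := ht
  have hq := hP.q_lt_one
  have hr := hP.r_pos
  set c := P.chargePhi l t.1 with hc
  -- On sector `i` the zero modes are numbers, so the kernel has the parameter `a = p̂ + h - 1`, and
  -- all other theta functions of zero modes go into the constant `K i`.
  obtain ⟨φ, h0, h⟩ := (dataPhi hP l v t hn).exists_components (τ := -(l / 2)) (l := l)
    (a := fun i => c i .hat + hval (c i) - 1)
    (K := fun i => ϱ * P.theta 1 / P.theta (c i .hat + hval (c i) - 1) *
      (P.theta (c i .hat + hval (c i) + i) / P.theta (c i .hat + hval (c i))))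
    (fun i => by simp only [dataPhi]; rfl)
    -- `q^{2(l - j)} p^m` has norm less than one.
    (fun j m hj => by
      have := z_mul_pow_ne_one hq hr (m := l - j) (by omega) m
      rw [Nat.cast_sub hj.le] at this
      change P.z (l / 2 - -(l / 2) + j * -1) * P.z P.r ^ m ≠ 1
      rwa [show (l : ℂ) / 2 - -(l / 2) + j * -1 = l - j by ring])
    -- `q^{-2j} p^{m+1} = 1` would make `j` a zero of `θ`.
    (fun j m h1 hj => by
      have := z_neg_mul_pow_ne_one hq hr h1 (hθ j h1 hj) (m + 1)
      change P.z (j * -1) * P.z P.r ^ (m + 1) ≠ 1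
      rwa [mul_neg_one])
  refine ⟨φ, fun d => by rw [h0]; exact dataPhi_zero hP l v t d, fun i hi d => ?_⟩
  obtain ⟨G, hG1, hG2, hG3, R, hR⟩ := h i hi d
  have hv : (dataPhi hP l v t hn).v + -(l / 2) = v - l / 2 := by simp only [dataPhi]; ring
  rw [hv] at hG2 hG3
  refine ⟨G, hG1, hG2, ⟨Real.exp R / ‖P.z v‖, fun σ h1 h2 v₁ hv₁ => ?_⟩, hG3.symm⟩
  have hzv : ‖P.z v‖ ≠ 0 := norm_ne_zero_iff.2 (P.z_ne_zero v)
  rw [div_mul_cancel₀ _ hzv, P.norm_z, Real.exp_lt_exp] at hv₁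
  have hlev : P.lev (v₁ + P.r * σ) = P.lev v₁ + 2 * (P.r * σ) * P.logq.re := by
    rw [P.lev_add, ← Complex.ofReal_mul, P.lev_real]
  have hrσ := mul_pos hr h1
  have hrσ' := mul_pos hr (sub_pos.2 h2)
  -- For `0 < σ < 1` the circle `|w'| = |p|^σ |w₁|` lies in the annulus between the poles of the
  -- kernel.
  refine hasSum_of_eq (hR v₁ (v₁ + P.r * σ) hv₁.le ?_ ?_) (fun x => ?_) rfl
  · change ‖P.z P.r‖ * _ < 1
    rw [P.norm_z, P.lev_real, hlev, ← Real.exp_add, Real.exp_lt_one_iff]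
    nlinarith
  · rw [hlev, Real.exp_lt_one_iff]
    nlinarith
  · congr 1
    rw [Fplus, mul_assoc, ← intervalIntegral.integral_mul_const, ← intervalIntegral.integral_const_mul,
      perInt]
    refine intervalIntegral.integral_congr fun y _ => ?_
    simp only [dataPhi_F, ← hc]
    change _ = _ * (_ * (P.theta _ / P.theta _))
    rw [← per]
    ring_nf

/-- The components of `Ψ*_{l,m}` on the sectors which reach a given basis state. -/
theorem exists_components_Psi (hP : P.Admissible) {l : ℕ}
    (hθ : ∀ n : ℕ, 1 ≤ n → n ≤ l → P.thetaS n ≠ 0) (ϱs v : ℂ) (s : State)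
    (hs : ∃ n : ℤ, s.1 .b + s.1 .c = n) :
    ∃ φ : ℕ → Occ → ℂ, (∀ d, φ 0 d = P.PsiTop l v s (P.chargePsi l s.1 0, d)) ∧
      ∀ i < l, ∀ d, ∃ G : ℂ → ℂ, MeromorphicOn G Set.univ ∧
        AnalyticAt ℂ G (v - (l + P.k) / 2 - P.rs) ∧
        (∃ R : ℝ, ∀ σ : ℝ, 0 < σ → σ < 1 → ∀ v₁ : ℂ, R * ‖P.z v₁‖ < ‖P.z v‖ →
          HasSum (fun x : Occ => φ i x *
            P.Eplus ϱs σ v₁ (P.chargePsi l s.1 i, x) (P.chargePsi l s.1 (i + 1), d) *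
              (P.thetaS (l - i) * P.thetaS (P.chargePsi l s.1 (i + 1) .hat - i - 2) /
                (P.thetaS (i + 1) * P.thetaS (P.chargePsi l s.1 (i + 1) .hat - 2)))) (G v₁)) ∧
        φ (i + 1) d = G (v - (l + P.k) / 2 - P.rs) := by
  obtain ⟨n, hn⟩ := hs
  have hq := hP.q_lt_one
  have hr := hP.rs_pos
  set c := P.chargePsi l s.1 with hc
  obtain ⟨φ, h0, h⟩ := (dataPsi hP l v s hn).exists_components (τ := l / 2) (l := l)
    (a := fun i => c (i + 1) .hat - 1)
    (K := fun i => ϱs * P.thetaS 1 / P.thetaS (c (i + 1) .hat - 1) *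
      (P.thetaS (l - i) * P.thetaS (c (i + 1) .hat - i - 2) /
        (P.thetaS (i + 1) * P.thetaS (c (i + 1) .hat - 2))))
    (fun i => by simp only [dataPsi]; rfl)
    -- Because of the reflection this condition now needs the hypothesis on `θ*`, and `l - j` runs
    -- through `1, …, l`. The other condition holds by size.
    (fun j m hj => by
      have := z_neg_mul_pow_ne_one hq hr (m := l - j) (by omega) (hθ _ (by omega) (by omega)) m
      rw [Nat.cast_sub hj.le] at this
      change P.z (-(l / 2) - l / 2 + j * 1) * P.z P.rs ^ m ≠ 1
      rwa [show -((l : ℂ) / 2) - l / 2 + j * 1 = -(l - j) by ring])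
    (fun j m h1 hj => by
      have := z_mul_pow_ne_one hq hr h1 (m + 1)
      change P.z (j * 1) * P.z P.rs ^ (m + 1) ≠ 1
      rwa [mul_one])
  refine ⟨φ, fun d => by rw [h0]; exact dataPsi_zero hP l v s d, fun i hi d => ?_⟩
  obtain ⟨G, hG1, hG2, hG3, R, hR⟩ := h i hi d
  -- In the reflected variable `u' = -v'` the kernel parameter is `-(v₁ + k/2) - r*`, because `θ*`
  -- is invariant under `w ↦ -(w + r*)`. The point `v - (l + k)/2 - r*` goes to `-v + l/2`, which is
  -- `v + τ` for the reflected data.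
  set f : ℂ → ℂ := fun v₁ => -(v₁ + P.k / 2) - P.rs with hf
  have hv : (dataPsi hP l v s hn).v + l / 2 = f (v - (l + P.k) / 2 - P.rs) := by
    simp only [dataPsi, hf]; ring
  rw [hv] at hG2 hG3
  have hfa : ∀ x, AnalyticAt ℂ f x := fun x => by
    have : Differentiable ℂ f := by fun_prop
    exact this.analyticAt x
  refine ⟨G ∘ f, fun x _ => ?_, hG2.comp (hfa _), ⟨Real.exp (R + P.lev (P.k / 2 + P.rs)) * ‖P.z v‖,
    fun σ h1 h2 v₁ hv₁ => ?_⟩, hG3.symm⟩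
  · refine (hG1 (f x) trivial).comp_analyticAt (hfa x)
  have hzv : 0 < ‖P.z v‖ := norm_pos_iff.2 (P.z_ne_zero v)
  rw [mul_right_comm, mul_lt_iff_lt_one_left hzv, P.norm_z v₁, ← Real.exp_add,
    Real.exp_lt_one_iff] at hv₁
  have hfl : P.lev (f v₁) = -P.lev v₁ - P.lev (P.k / 2 + P.rs) := by
    have h0 : P.lev 0 = 0 := by simp [lev]
    rw [show f v₁ = 0 - v₁ - (P.k / 2 + P.rs) by simp only [hf]; ring, P.lev_sub, P.lev_sub, h0,
      zero_sub]
  have hcl : P.lev (f v₁ + P.rs * (1 - σ) - P.per) = P.lev (f v₁) + 2 * (P.rs * (1 - σ)) * P.logq.re := by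
    have := lev_mul_per hq 1
    rw [Complex.ofReal_one, one_mul] at this
    rw [P.lev_sub, this, sub_zero, P.lev_add, ← Complex.ofReal_one, ← Complex.ofReal_sub,
      ← Complex.ofReal_mul, P.lev_real]
  have hrσ := mul_pos hr h1
  have hrσ' := mul_pos hr (sub_pos.2 h2)
  refine hasSum_of_eq (hR (f v₁) (f v₁ + P.rs * (1 - σ) - P.per) ?_ ?_ ?_) (fun x => ?_) rfl
  · rw [hfl]; linarith
  · change ‖P.z P.rs‖ * _ < 1
    rw [P.norm_z, P.lev_real, hcl, ← Real.exp_add, Real.exp_lt_one_iff]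
    nlinarith
  · rw [hcl, Real.exp_lt_one_iff]
    nlinarith
  · rw [mul_assoc, mul_comm (φ i x)]
    congr 1
    -- The reflection reverses the direction of the contour, hence `y ↦ 1 - y` and the base point
    -- shifted by a period.
    have hint := intervalIntegral.integral_comp_sub_left (a := 0) (b := 1) (fun y : ℝ =>
      P.E (v₁ + P.k / 2 + P.rs * σ + y * P.per) (c i, x) (c (i + 1), d) *
        (P.thetaS (v₁ - (v₁ + P.k / 2 + P.rs * σ + y * P.per) + P.k / 2 - c (i + 1) .hat + 1) *
          P.thetaS 1 / (P.thetaS (v₁ - (v₁ + P.k / 2 + P.rs * σ + y * P.per) + P.k / 2) *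
            P.thetaS (c (i + 1) .hat - 1)))) 1
    rw [sub_self, sub_zero] at hint
    rw [Eplus, ← per]
    simp only []
    rw [← hint, mul_assoc, ← intervalIntegral.integral_mul_const,
      ← intervalIntegral.integral_const_mul, perInt]
    refine intervalIntegral.integral_congr fun y _ => ?_
    simp only [dataPsi_F, ← hc]
    change _ = _ * (_ * (P.thetaS _ / P.thetaS _))
    have hθ' : ∀ w, P.thetaS (-(w + P.rs)) = P.thetaS w := fun w => by
      rw [thetaS, thetaNu_neg hq hr, thetaNu_add hq hr, neg_neg, thetaS]
    rw [← hθ' (_ + _), ← hθ' (f v₁ - _)]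
    simp only [hf]
    push_cast
    ring_nf

end Params
end EllipticVO
end

/-! ### Existence and uniqueness of the lower components -/

open Filter Topology
noncomputable section
namespace EllipticVO

/-- The identity theorem for meromorphic functions on the plane. -/
theorem eq_of_meromorphicOn {G G' : ℂ → ℂ} (hG : MeromorphicOn G Set.univ)
    (hG' : MeromorphicOn G' Set.univ) {x y : ℂ} (hx : AnalyticAt ℂ G x) (hx' : AnalyticAt ℂ G' x)
    (h : ∀ᶠ u in 𝓝 y, G u = G' u) : G x = G' x := by
  have hm := hG.sub hG'
  have hy : meromorphicOrderAt (G - G') y = ⊤ := by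
    rw [meromorphicOrderAt_eq_top_iff]
    exact (h.filter_mono nhdsWithin_le_nhds).mono fun u hu => by simp [hu]
  have htop : meromorphicOrderAt (G - G') x = ⊤ := by
    by_contra hne
    exact (hm.exists_meromorphicOrderAt_ne_top_iff_forall isConnected_univ).1
      ⟨⟨x, trivial⟩, hne⟩ ⟨y, trivial⟩ hy
  rw [meromorphicOrderAt_eq_top_iff] at htop
  have hev : ∀ᶠ u in 𝓝[≠] x, G u = G' u := htop.mono fun u hu => sub_eq_zero.1 hu
  exact tendsto_nhds_unique_of_eventuallyEq
    (hx.continuousAt.tendsto.mono_left nhdsWithin_le_nhds)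
    (hx'.continuousAt.tendsto.mono_left nhdsWithin_le_nhds) hev

namespace Params

variable {P : Params}

theorem exists_lt_norm_z (hq : P.logq.re < 0) (C : ℝ) : ∃ u, C < ‖P.z u‖ := by
  refine ⟨((C / (2 * P.logq.re) : ℝ) : ℂ), ?_⟩
  rw [P.norm_z, Poles.lev_ofReal_div P hq]
  linarith [Real.add_one_le_exp C]

theorem exists_mul_norm_z_lt (hq : P.logq.re < 0) (R : ℝ) {C : ℝ} (hC : 0 < C) :
    ∃ u, R * ‖P.z u‖ < C := by
  obtain ⟨u, hu⟩ := exists_lt_norm_z hq (R / C)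
  refine ⟨-u, ?_⟩
  have hz : 0 < ‖P.z u‖ := norm_pos_iff.2 (P.z_ne_zero u)
  rw [z_neg, norm_inv, ← div_eq_mul_inv, div_lt_iff₀ hz]
  rwa [div_lt_iff₀' hC] at hu

theorem continuous_norm_z : Continuous fun u => ‖P.z u‖ :=
  P.differentiable_z.continuous.norm

/-- `E` lowers `p̂` by 2 and raises `h` by 2. In a product with `E^+` on the right the induction
hypothesis is applied to states of the shifted charge. -/
theorem Generic.add_dqE {c : Charge} (h : P.Generic c) : P.Generic (c + dqE) := by
  obtain ⟨⟨n, hn⟩, h1, h2⟩ := h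
  refine ⟨⟨n, ?_⟩, fun m => ?_, fun m => ?_⟩
  · rw [← hn]; simp only [Pi.add_apply, dqE]; ring
  · convert h1 m using 2
    simp only [hval, Pi.add_apply, dqE]; ring
  · convert h2 (m - 2) using 2
    simp only [Pi.add_apply, dqE]; push_cast; ring

-- The components constructed for single initial states are assembled; index `m` leads from charge
-- `c` only to `chargePhi l c (l - m)`. On sectors with non-integral `p_b + p_c` no recursion is
-- required, and the values there are arbitrary.
open Classical in
theorem exists_lowerPhi (hP : P.Admissible) {l : ℕ}
    (hθ : ∀ n : ℕ, 1 ≤ n → n < l → P.theta n ≠ 0) (ϱ : ℂ) :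
    ∃ Φ : ℕ → ℂ → Op, P.LowerPhi ϱ l Φ := by
  have hk := hP.k_ne_neg_two
  have hφ : ∀ (v : ℂ) (t : State), ∃ φ : ℕ → Occ → ℂ,
      (∀ d, φ 0 d = P.PhiTop l v (P.chargePhi l t.1 0, d) t) ∧ ((∃ n : ℤ, t.1 .b + t.1 .c = n) → _) :=
    fun v t => by
      by_cases ht : ∃ n : ℤ, t.1 .b + t.1 .c = n
      · obtain ⟨φ, h0, h⟩ := exists_components_Phi hP hθ ϱ v t ht
        exact ⟨φ, h0, fun _ => h⟩
      · exact ⟨fun _ d => P.PhiTop l v (P.chargePhi l t.1 0, d) t, fun _ => rfl, fun h => absurd h ht⟩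
  choose φ h0 h using hφ
  refine ⟨fun m v s t => if s.1 = P.chargePhi l t.1 (l - m) then φ v t (l - m) s.2 else 0,
    ?_, fun m hm hml σ hσ hσ' v s t ht => ?_⟩
  · funext v s t
    simp only [Nat.sub_self]
    split_ifs with hs
    · rw [h0, ← hs]
    · rw [PhiTop_eq_zero hk hs]
  obtain ⟨i, rfl⟩ := Nat.exists_eq_add_of_le hml
  have hsub : m + i - (m - 1) = i + 1 := by omega
  simp only [Nat.add_sub_cancel_left, hsub]
  by_cases hs : s.1 = P.chargePhi (m + i) t.1 (i + 1)
  · obtain ⟨G, hG1, hG2, ⟨R, hR⟩, hG3⟩ := h v t ht.1 i (by omega) s.2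
    refine ⟨G, hG1, hG2, ⟨R, fun v₁ hv₁ => ?_⟩, by rw [if_pos hs, hG3]⟩
    rw [hasSum_state (c := P.chargePhi (m + i) t.1 i) fun x hx => by rw [if_neg hx, mul_zero]]
    refine hasSum_of_eq (hR σ hσ hσ' v₁ hv₁) (fun x => ?_) rfl
    rw [if_pos rfl, ← hs]
    simp only [Prod.mk.eta]
    push_cast
    ring_nf
  -- For any other final charge one factor of every term vanishes, so the continuation is zero.
  · refine ⟨0, fun x _ => MeromorphicAt.const 0 x, analyticAt_const, ⟨0, fun v₁ _ => ?_⟩,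
      by rw [if_neg hs]; rfl⟩
    refine hasSum_of_eq hasSum_zero (fun x => ?_) rfl
    by_cases hx : x.1 = P.chargePhi (m + i) t.1 i
    · rw [Fplus_eq_zero hk (by rwa [hx, ← chargePhi_succ]), zero_mul, zero_mul]
    · rw [if_neg hx, mul_zero]

-- Since `E^+` acts first, the construction starts from the final state `s`. Integrality of `p_b +
-- p_c` passes from `t` to `s`, as all operators preserve this sum up to the integers.
open Classical in
theorem exists_lowerPsi (hP : P.Admissible) {l : ℕ}
    (hθ : ∀ n : ℕ, 1 ≤ n → n ≤ l → P.thetaS n ≠ 0) (ϱs : ℂ) :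
    ∃ Ψ : ℕ → ℂ → Op, P.LowerPsi ϱs l Ψ := by
  have hk := hP.k_ne_neg_two
  have hφ : ∀ (v : ℂ) (s : State), ∃ φ : ℕ → Occ → ℂ,
      (∀ d, φ 0 d = P.PsiTop l v s (P.chargePsi l s.1 0, d)) ∧ ((∃ n : ℤ, s.1 .b + s.1 .c = n) → _) :=
    fun v s => by
      by_cases hs : ∃ n : ℤ, s.1 .b + s.1 .c = n
      · obtain ⟨φ, h0, h⟩ := exists_components_Psi hP hθ ϱs v s hs
        exact ⟨φ, h0, fun _ => h⟩
      · exact ⟨fun _ d => P.PsiTop l v s (P.chargePsi l s.1 0, d), fun _ => rfl, fun h => absurd h hs⟩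
  choose φ h0 h using hφ
  refine ⟨fun m v s t => if t.1 = P.chargePsi l s.1 (l - m) then φ v s (l - m) t.2 else 0,
    ?_, fun m hm hml σ hσ hσ' v s t ht => ?_⟩
  · funext v s t
    simp only [Nat.sub_self]
    split_ifs with ht
    · rw [h0, ← ht]
    · rw [PsiTop_eq_zero hk ht]
  obtain ⟨i, rfl⟩ := Nat.exists_eq_add_of_le hml
  have hsub : m + i - (m - 1) = i + 1 := by omega
  simp only [Nat.add_sub_cancel_left, hsub]
  by_cases hs : t.1 = P.chargePsi (m + i) s.1 (i + 1)
  · have hsn : ∃ n : ℤ, s.1 .b + s.1 .c = n := by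
      obtain ⟨n, hn⟩ := ht.1
      exact ⟨n, by rw [← hn, hs, chargePsi_add]⟩
    obtain ⟨G, hG1, hG2, ⟨R, hR⟩, hG3⟩ := h v s hsn i (by omega) t.2
    refine ⟨G, hG1, hG2, ⟨R, fun v₁ hv₁ => ?_⟩, by rw [if_pos hs, hG3]⟩
    rw [hasSum_state (c := P.chargePsi (m + i) s.1 i) fun x hx => by
      rw [if_neg hx, zero_mul, zero_mul]]
    refine hasSum_of_eq (hR σ hσ hσ' v₁ hv₁) (fun x => ?_) rfl
    rw [if_pos rfl, ← hs]
    simp only [Prod.mk.eta]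
    push_cast
    ring_nf
  · refine ⟨0, fun x _ => MeromorphicAt.const 0 x, analyticAt_const, ⟨0, fun v₁ _ => ?_⟩,
      by rw [if_neg hs]; rfl⟩
    refine hasSum_of_eq hasSum_zero (fun x => ?_) rfl
    by_cases hx : x.1 = P.chargePsi (m + i) s.1 i
    · rw [Eplus_eq_zero hk (fun h' => hs ?_), mul_zero, zero_mul]
      rw [hx, ← chargePsi_succ] at h'
      exact (add_right_cancel h').symm
    · rw [if_neg hx, zero_mul, zero_mul]

/-- Downward induction on `m`. If the components of index `m + 1` agree, the two continuations agree
where the sums converge and therefore at the point of evaluation. The initial state stays the same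
throughout. -/
theorem lowerPhi_unique (hP : P.Admissible) {l : ℕ} {ϱ : ℂ} {Φ Φ' : ℕ → ℂ → Op}
    (h : P.LowerPhi ϱ l Φ) (h' : P.LowerPhi ϱ l Φ') {m : ℕ} (hm : m ≤ l) (v : ℂ) (s t : State)
    (ht : P.Generic t.1) : Φ m v s t = Φ' m v s t := by
  induction hm using Nat.decreasingInduction generalizing s with
  | self => rw [h.1, h'.1]
  | of_succ m hm ih =>
    obtain ⟨G, hG1, hG2, ⟨R, hR⟩, hG3⟩ := h.2 (m + 1) (by omega) hm (1 / 2) (by norm_num)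
      (by norm_num) v s t ht
    obtain ⟨G', hG1', hG2', ⟨R', hR'⟩, hG3'⟩ := h'.2 (m + 1) (by omega) hm (1 / 2) (by norm_num)
      (by norm_num) v s t ht
    rw [Nat.add_sub_cancel] at hG3 hG3'
    rw [hG3, hG3']
    obtain ⟨y, hy⟩ := exists_lt_norm_z hP.q_lt_one (max (R * ‖P.z v‖) (R' * ‖P.z v‖))
    refine eq_of_meromorphicOn hG1 hG1' hG2 hG2' (y := y) ?_
    filter_upwards [continuous_norm_z.continuousAt.eventually (lt_mem_nhds hy)] with u hu
    refine (hR u ((le_max_left _ _).trans_lt hu)).unique ?_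
    simp only [ih]
    exact hR' u ((le_max_right _ _).trans_lt hu)

/-- As before, but the states to which the induction hypothesis is applied have the charge of `t`
shifted by `dqE`; on all others `E^+` vanishes. -/
theorem lowerPsi_unique (hP : P.Admissible) {l : ℕ} {ϱs : ℂ} {Ψ Ψ' : ℕ → ℂ → Op}
    (h : P.LowerPsi ϱs l Ψ) (h' : P.LowerPsi ϱs l Ψ') {m : ℕ} (hm : m ≤ l) (v : ℂ) (s t : State)
    (ht : P.Generic t.1) : Ψ m v s t = Ψ' m v s t := by
  induction hm using Nat.decreasingInduction generalizing t with
  | self => rw [h.1, h'.1]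
  | of_succ m hm ih =>
    obtain ⟨G, hG1, hG2, ⟨R, hR⟩, hG3⟩ := h.2 (m + 1) (by omega) hm (1 / 2) (by norm_num)
      (by norm_num) v s t ht
    obtain ⟨G', hG1', hG2', ⟨R', hR'⟩, hG3'⟩ := h'.2 (m + 1) (by omega) hm (1 / 2) (by norm_num)
      (by norm_num) v s t ht
    rw [Nat.add_sub_cancel] at hG3 hG3'
    rw [hG3, hG3']
    have hzv : 0 < ‖P.z v‖ := norm_pos_iff.2 (P.z_ne_zero v)
    obtain ⟨y, hy⟩ := exists_mul_norm_z_lt hP.q_lt_one (max R R') hzv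
    refine eq_of_meromorphicOn hG1 hG1' hG2 hG2' (y := y) ?_
    filter_upwards [(continuous_const.mul continuous_norm_z).continuousAt.eventually
      (gt_mem_nhds hy)] with u hu
    refine (hR u ((mul_le_mul_of_nonneg_right (le_max_left _ _) (norm_nonneg _)).trans_lt hu)).unique ?_
    refine hasSum_of_eq
      (hR' u ((mul_le_mul_of_nonneg_right (le_max_right _ _) (norm_nonneg _)).trans_lt hu))
      (fun x => ?_) rfl
    by_cases hx : x.1 = t.1 + dqE
    · rw [ih _ (hx ▸ ht.add_dqE)]
    · rw [Eplus_eq_zero hP.k_ne_neg_two hx, mul_zero, mul_zero]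

end Params
end EllipticVO
end

theorem theorem4 (P : EllipticVO.Params) (hP : P.Admissible) (l : ℕ) :
    -- relations of the type I operator with `H^±`, `E`, `F`
    P.Exchange P.Hplus (P.PhiTop l)
      (fun x => P.theta (x + l / 2 - P.k / 4) / P.theta (x - l / 2 - P.k / 4)) ∧
    P.Exchange P.Hminus (P.PhiTop l)
      (fun x => P.theta (x + l / 2 + P.k / 4) / P.theta (x - l / 2 + P.k / 4)) ∧
    P.Exchange P.E (P.PhiTop l) (fun _ => -1) ∧
    P.Exchange P.F (P.PhiTop l) (fun x => -(P.theta (x + l / 2) / P.theta (x - l / 2))) ∧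
    -- relations of the type II operator with `H^±`, `F`, `E`
    P.Exchange P.Hplus (P.PsiTop l)
      (fun x => P.thetaS (x - l / 2 + P.k / 4) / P.thetaS (x + l / 2 + P.k / 4)) ∧
    P.Exchange P.Hminus (P.PsiTop l)
      (fun x => P.thetaS (x - l / 2 - P.k / 4) / P.thetaS (x + l / 2 - P.k / 4)) ∧
    P.Exchange P.F (P.PsiTop l) (fun _ => -1) ∧
    P.Exchange P.E (P.PsiTop l) (fun x => -(P.thetaS (x - l / 2) / P.thetaS (x + l / 2))) ∧
    -- the lower components exist and are determined by the recursions
    ∀ ϱ ϱs : ℂ, P.Normalized ϱ ϱs →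
      ((∀ n : ℕ, 1 ≤ n → n < l → P.theta n ≠ 0) →
        (∃ Φ : ℕ → ℂ → EllipticVO.Op, P.LowerPhi ϱ l Φ) ∧
        ∀ Φ Φ' : ℕ → ℂ → EllipticVO.Op, P.LowerPhi ϱ l Φ → P.LowerPhi ϱ l Φ' →
          ∀ m ≤ l, ∀ (v : ℂ) (s t : EllipticVO.State), P.Generic t.1 → Φ m v s t = Φ' m v s t) ∧
      ((∀ n : ℕ, 1 ≤ n → n ≤ l → P.thetaS n ≠ 0) →
        (∃ Ψ : ℕ → ℂ → EllipticVO.Op, P.LowerPsi ϱs l Ψ) ∧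
        ∀ Ψ Ψ' : ℕ → ℂ → EllipticVO.Op, P.LowerPsi ϱs l Ψ → P.LowerPsi ϱs l Ψ' →
          ∀ m ≤ l, ∀ (v : ℂ) (s t : EllipticVO.State), P.Generic t.1 → Ψ m v s t = Ψ' m v s t) := by
  exact ⟨EllipticVO.Params.exchange_Hplus_Phi hP l, EllipticVO.Params.exchange_Hminus_Phi hP l,
    EllipticVO.Params.exchange_E_Phi hP l, EllipticVO.Params.exchange_F_Phi hP l,
    EllipticVO.Params.exchange_Hplus_Psi hP l, EllipticVO.Params.exchange_Hminus_Psi hP l,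
    EllipticVO.Params.exchange_F_Psi hP l, EllipticVO.Params.exchange_E_Psi hP l,
    fun ϱ ϱs _ => ⟨fun hθ => ⟨EllipticVO.Params.exists_lowerPhi hP hθ ϱ,
        fun _ _ h h' _ hm v s t ht => EllipticVO.Params.lowerPhi_unique hP h h' hm v s t ht⟩,
      fun hθ => ⟨EllipticVO.Params.exists_lowerPsi hP hθ ϱs,
        fun _ _ h h' _ hm v s t ht => EllipticVO.Params.lowerPsi_unique hP h h' hm v s t ht⟩⟩⟩
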